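/- **Setting.** Groups are Abelian. For a countable group $G$, a subgroup $B\subset G$ and an automorphism $w$ of $G$ put $L(G,B,w)=\{\#(\{w^i(g): i\in\mathbb Z\}\cap B) : g\in B\setminus\{0\}\}$. Let $E\subset\{1,2,3,\dots\}$. We consider triples $(K,H,v)$, where $K$ is a compact Polish Abelian group, $H$ a closed subgroup, $v$ a continuous automorphism of $K$, $\widehat v(\chi)=\chi\circ v$, $\widehat{K/H}=\{\chi\in\widehat K:\chi|_H=1\}$, such that (i) $E=L(\widehat K,\widehat{K/H},\widehat v)$, and (ii) the set $\mathcal K\subset K$ of $v$-periodic points is countable and dense. For $a\in\mathcal K$ let $m_a$ be its least positive period and, for $\chi\in\widehat K$, $l_\chi(a)=m_a^{-1}\sum_{i=0}^{m_a-1}\chi(v^i(a))$. We also use the condition (iii) if $\chi,\eta\in\widehat{K/H}$ lie on different $\widehat v$-orbits, then $l_\chi(a)\ne l_\eta(a)$ for some $a\in\mathcal K$. **Construction.** Given $(K,H,v)$ with (i), (ii), let $\xi_1,\xi_2>0$ be rationally independent reals, and fix a partition $\mathbb N=\mathcal W_1\sqcup\mathcal W_2\sqcup\bigsqcup_{a\in\mathcal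 K}\mathcal N_a$ into infinite sets. Let $h_0=1$ and $F_n=[0,h_n)$. Choose any finite $C_1\subset[0,\infty)$ and $h_1$ with $0\in C_1$, $F_0+C_1\subset F_1$ and the sets $F_0+c$, $c\in C_1$, disjoint, and any map $\alpha_1:C_1\to K$. For $n\ge1$: * if $n+1\in\mathcal N_a$, put $r_n=n^3m_a$, $z_{n+1}=m_anh_n$, $C_{n+1}=h_n\{0,\dots,r_n-1\}$, $h_{n+1}=r_nh_n+1$, and let $\alpha_{n+1}:C_{n+1}\to K$ be any map such that $\alpha_{n+1}(c+z_{n+1})=v(\alpha_{n+1}(c))$ whenever $c,c+z_{n+1}\in C_{n+1}$, and such that for each $0\le i<m_a$ there is $C_{n+1,i}\subset C_{n+1}$ with $C_{n+1,i}-h_n\subset C_{n+1}$, $\alpha_{n+1}(c)=\alpha_{n+1}(c-h_n)+v^i(a)$ for $c\in C_{n+1,i}$, and $\left|\frac{\#C_{n+1,i}}{\#C_{n+1}}-\frac1{m_a}\right|<\frac2{nm_a}$; * if $n+1\in\mathcal W_i$, put $C_{n+1}=\{jh_n:0\le j<n\}\sqcup\{j(h_n+\xi_i)+nh_n:0\le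 j<n\}$, $h_{n+1}=2nh_n+n\xi_i$ and $\alpha_{n+1}\equiv0$. Let $X$ be the increasing union of the spaces $X_n=F_n\times C_{n+1}\times C_{n+2}\times\cdots$, where $(f,c_{n+1},c_{n+2},\dots)\in X_n$ is identified with $(f+c_{n+1},c_{n+2},\dots)\in X_{n+1}$, with the inductive limit Borel structure. Let $\mu$ be the probability measure on $X$ whose restriction to each $X_n$ is proportional to the product of Lebesgue measure on $F_n$ and the equidistributions on the $C_k$, $k>n$. Let $T=(T_t)_{t\in\mathbb R}$ be the $(C,F)$-flow on $(X,\mu)$, defined a.e. by $T_t(f_n,c_{n+1},\dots)=(f_n+t,c_{n+1},\dots)$ for large $n$. For $x\in X$ let $n\ge0$ be least with $x=(f_n,c_{n+1},\dots)\in X_n$, and put $\pi(x)_k=0$ for $k\le n$, $\pi(x)_k=c_k$ for $k>n$. For $x,y$ on the same $T$-orbit let $\alpha(x,y)=\sum_{k\ge1}(\alpha_k(\pi(x)_k)-\alpha_k(\pi(y)_k))$ (a finite sum), and let $T^{\alpha,H}_t(x,k+H)=(T_tx,\alpha(T_tx,x)+k+H)$ on $(X\times K/H,\mu\times\lambda_{K/H})$,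 $\lambda_{K/H}$ being the normalized Haar measure. **Theorem 4.1.** (1) For every $E\subset\{1,2,3,\dots\}$ there is a triple $(K,H,v)$ with (i), (ii) and (iii). (2) For every triple $(K,H,v)$ with (i) and (ii) and all rationally independent $\xi_1,\xi_2>0$, a partition as above exists, and for every such partition the construction can be carried out. Whatever choices are made in it, $\mu\times\lambda_{K/H}$ is a probability measure and $T^{\alpha,H}$ is a measurable measure preserving flow, which is weakly mixing (its Koopman representation $U(t)f=f\circ T^{\alpha,H}_{-t}$ has no eigenvectors in $L^2_0$, the orthocomplement of the constants in $L^2(X\times K/H,\mu\times\lambda_{K/H})$). If (iii) holds as well, then the set $\mathcal M(T^{\alpha,H})$ of spectral multiplicities of $T^{\alpha,H}$ (the essential image of the spectral multiplicity function of $U$ on $L^2_0$) is $E\cup\{1\}$. -/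

import Mathlib

open MeasureTheory Filter
open scoped ENNReal

noncomputable section

namespace SpectralMult

/-! ### The algebraic data

Abelian groups are written multiplicatively. -/

/-- `L(G, B, w) = { #({w^i(h) : i ∈ ℤ} ∩ B) : h ∈ B, h ≠ 1 }`, a set of extended natural numbers. -/
def orbitCounts {G : Type*} [CommGroup G] (B : Subgroup G) (w : MulAut G) : Set ℕ∞ :=
  {n | ∃ h ∈ B, h ≠ 1 ∧ n = (Set.range (fun i : ℤ => (w ^ i) h) ∩ (B : Set G)).encard}

section Algebra

variable {K : Type*} [CommGroup K] [TopologicalSpace K] [IsTopologicalGroup K]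

/-- The automorphism `χ ↦ χ ∘ v` of the dual group of `K`. -/
def dualAut (v : K ≃ₜ* K) : MulAut (PontryaginDual K) where
  toFun := PontryaginDual.map (v : K →ₜ* K)
  invFun := PontryaginDual.map (v.symm : K →ₜ* K)
  left_inv χ := PontryaginDual.ext fun a => congrArg χ (v.apply_symm_apply a)
  right_inv χ := PontryaginDual.ext fun a => congrArg χ (v.symm_apply_apply a)
  map_mul' := map_mul _

/-- The dual group of `K / H`, viewed inside the dual of `K`: the characters that are trivial
on `H`. -/
def dualQuotient (H : Subgroup K) : Subgroup (PontryaginDual K) where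
  carrier := {χ | ∀ k ∈ H, χ k = 1}
  one_mem' := fun _ _ => rfl
  mul_mem' := fun {χ η} hχ hη k hk => by
    change χ k * η k = 1
    rw [hχ k hk, hη k hk, one_mul]
  inv_mem' := fun {χ} hχ k hk => by
    change (χ k)⁻¹ = 1
    rw [hχ k hk, inv_one]

/-- The set of points of `K` that are periodic under `v`. -/
def periodicPoints (v : K ≃ₜ* K) : Set K := Function.periodicPts v

/-- The least positive period of a periodic point (and `0` at the other points). -/
def period (v : K ≃ₜ* K) (a : K) : ℕ := Function.minimalPeriod v a

/-- `l_χ(a) = m_a⁻¹ ∑_{0 ≤ i < m_a} χ(v^i(a))`. -/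
def orbitMean (v : K ≃ₜ* K) (χ : PontryaginDual K) (a : K) : ℂ :=
  (period v a : ℂ)⁻¹ * ∑ i ∈ Finset.range (period v a), (χ (v^[i] a) : ℂ)

/-- The properties (i) and (ii) of a triple `(K, H, v)`:
`H` is closed, `E = L(K^, (K/H)^, v^)`, and the `v`-periodic points are countable and dense. -/
structure IsTriple (E : Set ℕ) (H : Subgroup K) (v : K ≃ₜ* K) : Prop where
  isClosed : IsClosed (H : Set K)
  counts : orbitCounts (dualQuotient H) (dualAut v) = (fun n : ℕ => (n : ℕ∞)) '' E
  countable : (periodicPoints v).Countable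
  dense : Dense (periodicPoints v)

/-- Characters of `K/H` on different orbits of `v^` are told apart by some `l_•(a)`, `a` periodic. -/
def SeparatesOrbits (H : Subgroup K) (v : K ≃ₜ* K) : Prop :=
  ∀ χ ∈ dualQuotient H, ∀ η ∈ dualQuotient H, (∀ i : ℤ, (dualAut v ^ i) χ ≠ η) →
    ∃ a ∈ periodicPoints v, orbitMean v χ a ≠ orbitMean v η a

end Algebra

/-! ### `(C,F)`-flows -/

/-- The data of a `(C,F)`-construction: finite sets `C_n` (`n ≥ 1`; the set `C 0` is not used)
and the intervals `F_n = [0, h_n)` (`n ≥ 0`). -/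
structure CFData where
  C : ℕ → Finset ℝ
  h : ℕ → ℝ
  h_zero : h 0 = 1
  zero_mem : ∀ n, 0 ∈ C (n + 1)
  nonneg : ∀ n, ∀ c ∈ C (n + 1), 0 ≤ c
  /-- `F_n + C_{n+1} ⊆ F_{n+1}` -/
  add_le : ∀ n, ∀ c ∈ C (n + 1), h n + c ≤ h (n + 1)
  /-- the translates `F_n + c`, `c ∈ C_{n+1}`, are pairwise disjoint -/
  disjoint : ∀ n, (C (n + 1) : Set ℝ).PairwiseDisjoint fun c => Set.Ico c (h n + c)

namespace CFData

variable (D : CFData)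

/-- `X_n = F_n × C_{n+1} × C_{n+2} × ⋯`. -/
abbrev Level (n : ℕ) : Type := Set.Ico (0 : ℝ) (D.h n) × (∀ k : ℕ, D.C (k + n + 1))

/-- The point `(f, c_{n+1}, c_{n+2}, …)` of `X_n` is sent to the germ at infinity of the sequence
`m ↦ f + c_{n+1} + ⋯ + c_m` of its positions in the towers `F_m`. Since
`(f, c_{n+1}, c_{n+2}, …) ∈ X_n` and `(f + c_{n+1}, c_{n+2}, …) ∈ X_{n+1}` have the same germ, the
inductive limit of the `X_n` is the union of the images. -/
def germ (n : ℕ) (q : D.Level n) : Germ (atTop : Filter ℕ) ℝ :=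
  ((fun m : ℕ => (q.1 : ℝ) + ∑ k ∈ Finset.range (m - n), (q.2 k : ℝ) : ℕ → ℝ) :
    Germ (atTop : Filter ℕ) ℝ)

/-- A germ that is a point of some `X_n`. -/
def IsPoint (x : Germ (atTop : Filter ℕ) ℝ) : Prop := ∃ n, ∃ q : D.Level n, D.germ n q = x

/-- The space `X`, the inductive limit (increasing union) of the spaces `X_n`. -/
@[ext]
structure X where
  val : Germ (atTop : Filter ℕ) ℝ
  isPoint : D.IsPoint val

/-- The embedding of `X_n` into `X`. -/
def emb (n : ℕ) (q : D.Level n) : D.X := ⟨D.germ n q, n, q, rfl⟩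

/-- `X_n` as a subset of `X`. -/
def levelSet (n : ℕ) : Set D.X := Set.range (D.emb n)

/-- The inductive limit Borel structure: `A` is measurable if and only if its preimages
in all the `X_n` are. -/
instance : MeasurableSpace D.X := ⨅ n, MeasurableSpace.map (D.emb n) inferInstance

instance (n k : ℕ) : Nonempty (D.C (k + n + 1)) := ⟨⟨0, D.zero_mem (k + n)⟩⟩

/-- The equidistribution on `C_{k+n+1}`. -/
def unif (n k : ℕ) : Measure (D.C (k + n + 1)) := (PMF.uniformOfFintype (D.C (k + n + 1))).toMeasure

instance (n k : ℕ) : IsProbabilityMeasure (D.unif n k) := by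
  unfold unif
  infer_instance

/-- The measure `(#C_1 ⋯ #C_n)⁻¹ (Lebesgue measure) × (equidistributions)` on `X_n`. -/
def levelMeasure (n : ℕ) : Measure (D.Level n) :=
  (∏ k ∈ Finset.range n, ((D.C (k + 1)).card : ℝ≥0∞))⁻¹ •
    (Measure.comap ((↑) : Set.Ico (0 : ℝ) (D.h n) → ℝ) volume).prod (Measure.infinitePi (D.unif n))

/-- The measure on `X` whose restriction to each `X_n` is `levelMeasure n`; it is put together from
the disjoint pieces `X_0, X_1 \ X_0, X_2 \ X_1, …`. -/
def rawMeasure : Measure D.X :=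
  Measure.sum fun n => ((D.levelMeasure n).map (D.emb n)).restrict (disjointed D.levelSet n)

/-- The probability measure `μ` on `X` that is invariant under the tail equivalence relation. -/
def measure : Measure D.X := (D.rawMeasure Set.univ)⁻¹ • D.rawMeasure

/-- The set of those points of `X` on which the partially defined translations
`(f_n, c_{n+1}, …) ↦ (t + f_n, c_{n+1}, …)` (for `n` large, depending on the point and on `t`)
are defined for all `t ∈ ℝ`. -/
def core : Set D.X := {x | ∀ t : ℝ, D.IsPoint (x.val + (t : Germ (atTop : Filter ℕ) ℝ))}

open Classical in
/-- The `(C,F)`-flow: `T_t (f_n, c_{n+1}, …) = (t + f_n, c_{n+1}, …)` for large `n`. Outside of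
`core` the flow is defined to be the identity. -/
def flow (t : ℝ) (x : D.X) : D.X :=
  if hx : x ∈ D.core then ⟨x.val + (t : Germ (atTop : Filter ℕ) ℝ), hx t⟩ else x

/-! ### `(C,F)`-cocycles -/

/-- The least `n ≥ 0` with `x ∈ X_n`. -/
def index (x : D.X) : ℕ := sInf {n | x ∈ D.levelSet n}

lemma mem_levelSet_index (x : D.X) : x ∈ D.levelSet (D.index x) := by
  refine Nat.sInf_mem (s := {n | x ∈ D.levelSet n}) ?_
  obtain ⟨y, n, q, hq⟩ := x
  exact ⟨n, q, X.ext hq⟩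

/-- The coordinates `(f_n, c_{n+1}, …)` of `x` in `X_n`, where `n = index x`. -/
def coord (x : D.X) : D.Level (D.index x) := (D.mem_levelSet_index x).choose

/-- The coordinate with index `k ≥ 1` of the point `π(x) = (0, 0, …, 0, c_{n+1}, c_{n+2}, …) ∈ X_0`,
where `n = index x`. -/
def digit (x : D.X) (k : ℕ) : ℝ :=
  if D.index x < k then ((D.coord x).2 (k - D.index x - 1) : ℝ) else 0

/-- The `(C,F)`-cocycle associated with maps `α_k : C_k → K`, `k ≥ 1` (the values of `a k` outside
of `C_k` are not used): `α(x, y) = ∏_{k ≥ 1} α_k(π(x)_k) α_k(π(y)_k)⁻¹` for tail equivalent points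
`x` and `y`, when all but finitely many factors are `1`. -/
def cocycle {K : Type*} [CommGroup K] (a : ℕ → ℝ → K) (x y : D.X) : K :=
  ∏ᶠ k : ℕ, a (k + 1) (D.digit x (k + 1)) / a (k + 1) (D.digit y (k + 1))

/-- The compact group extension `T^{α,H}_t (x, kH) = (T_t x, α(T_t x, x) kH)`. -/
def extension {K : Type*} [CommGroup K] (H : Subgroup K) (a : ℕ → ℝ → K)
    (t : ℝ) (p : D.X × (K ⧸ H)) : D.X × (K ⧸ H) :=
  (D.flow t p.1, (QuotientGroup.mk (D.cocycle a (D.flow t p.1) p.1) : K ⧸ H) * p.2)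

end CFData

/-- The normalized Haar measure of `K / H`, as the image of the one of `K`. -/
def haarQuotient {K : Type*} [CommGroup K] [TopologicalSpace K] [IsTopologicalGroup K]
    [CompactSpace K] [MeasurableSpace K] [BorelSpace K] (H : Subgroup K) : Measure (K ⧸ H) :=
  (Measure.haarMeasure (⊤ : TopologicalSpace.PositiveCompacts K)).map QuotientGroup.mk

/-- The construction. Here `κ` describes the partition of the index set into the sets
`W_i = κ⁻¹(inl i)` and `N_p = κ⁻¹(inr p)`, `p` a periodic point, and
`C_{n+1}, h_{n+1}, α_{n+1}` are obtained from `h_n` for all `n ≥ 1`. The first step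
`(C_1, h_1, α_1)` is arbitrary. -/
structure IsConstruction {K : Type*} [CommGroup K] [TopologicalSpace K] [IsTopologicalGroup K]
    (v : K ≃ₜ* K) (ξ : Fin 2 → ℝ) (κ : ℕ → Fin 2 ⊕ periodicPoints v)
    (D : CFData) (a : ℕ → ℝ → K) : Prop where
  /-- `C_{n+1} = h_n {0, 1, …, r_n - 1}` with `r_n = n³ m_p` -/
  C_inr : ∀ n, 1 ≤ n → ∀ p : periodicPoints v, κ (n + 1) = Sum.inr p →
    D.C (n + 1) = (Finset.range (n ^ 3 * period v p)).image (fun j : ℕ => (j : ℝ) * D.h n)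
  /-- `h_{n+1} = r_n h_n + 1` -/
  h_inr : ∀ n, 1 ≤ n → ∀ p : periodicPoints v, κ (n + 1) = Sum.inr p →
    D.h (n + 1) = ((n ^ 3 * period v p : ℕ) : ℝ) * D.h n + 1
  /-- (A1), with `z_{n+1} = m_p n h_n` -/
  shift : ∀ n, 1 ≤ n → ∀ p : periodicPoints v, κ (n + 1) = Sum.inr p →
    ∀ c ∈ D.C (n + 1), c + (period v p * n : ℕ) * D.h n ∈ D.C (n + 1) →
      a (n + 1) (c + (period v p * n : ℕ) * D.h n) = v (a (n + 1) c)
  /-- (A2) -/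
  increments : ∀ n, 1 ≤ n → ∀ p : periodicPoints v, κ (n + 1) = Sum.inr p →
    ∀ i < period v p, ∃ B ⊆ D.C (n + 1),
      (∀ c ∈ B, c - D.h n ∈ D.C (n + 1) ∧ a (n + 1) c = a (n + 1) (c - D.h n) * v^[i] p) ∧
      |(B.card : ℝ) / ((D.C (n + 1)).card : ℝ) - 1 / (period v p : ℝ)|
        < 2 / ((n : ℝ) * (period v p : ℝ))
  /-- `C_{n+1} = {j h_n : 0 ≤ j < n} ⊔ {j (h_n + ξ_i) + n h_n : 0 ≤ j < n}` -/
  C_inl : ∀ n, 1 ≤ n → ∀ i : Fin 2, κ (n + 1) = Sum.inl i →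
    D.C (n + 1) = (Finset.range n).image (fun j : ℕ => (j : ℝ) * D.h n) ∪
      (Finset.range n).image (fun j : ℕ => (j : ℝ) * (D.h n + ξ i) + n * D.h n)
  /-- `h_{n+1} = 2 n h_n + n ξ_i` -/
  h_inl : ∀ n, 1 ≤ n → ∀ i : Fin 2, κ (n + 1) = Sum.inl i →
    D.h (n + 1) = 2 * n * D.h n + n * ξ i
  trivial_inl : ∀ n, 1 ≤ n → ∀ i : Fin 2, κ (n + 1) = Sum.inl i →
    ∀ c ∈ D.C (n + 1), a (n + 1) c = 1

/-! ### Flows, weak mixing, spectral multiplicities -/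

section Flow

variable {Y : Type*} [MeasurableSpace Y]

/-- `T` is a (jointly measurable) measure preserving flow on `(Y, ν)`. -/
structure IsFlow (T : ℝ → Y → Y) (ν : Measure Y) : Prop where
  zero : ∀ y, T 0 y = y
  add : ∀ s t y, T (s + t) y = T s (T t y)
  measurable : Measurable fun p : ℝ × Y => T p.1 p.2
  measurePreserving : ∀ t, MeasurePreserving (T t) ν ν

/-- The Koopman representation `U_T(t) f = f ∘ T_{-t}` of `ℝ` in `L²(Y, ν)`. -/
def koopman {T : ℝ → Y → Y} {ν : Measure Y} (hT : IsFlow T ν) (t : ℝ) :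
    Lp ℂ 2 ν →ₗᵢ[ℂ] Lp ℂ 2 ν :=
  Lp.compMeasurePreservingₗᵢ ℂ (T (-t)) (hT.measurePreserving (-t))

/-- The space `L²₀(Y, ν)`, the orthocomplement of the constants in `L²(Y, ν)`. -/
def L2zero (ν : Measure Y) [IsFiniteMeasure ν] : Submodule ℂ (Lp ℂ 2 ν) :=
  (Submodule.span ℂ {Lp.const 2 ν (1 : ℂ)})ᗮ

/-- Weak mixing: `U_T` has no eigenvectors in `L²₀(Y, ν)`. -/
def WeaklyMixing {T : ℝ → Y → Y} {ν : Measure Y} [IsFiniteMeasure ν] (hT : IsFlow T ν) : Prop :=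
  ∀ (s : ℝ) (f : Lp ℂ 2 ν), f ∈ L2zero ν →
    (∀ t : ℝ, koopman hT t f = Complex.exp (s * t * Complex.I) • f) → f = 0

end Flow

section Spectral

variable {V : Type*} [NormedAddCommGroup V] [InnerProductSpace ℂ V]

/-- `τ` is the spectral measure of the vector `w` with respect to the unitary representation `U`
of `ℝ` (the dual group of `ℝ` is identified with `ℝ`). -/
def IsSpectralMeasure (U : ℝ → V →ₗᵢ[ℂ] V) (w : V) (τ : Measure ℝ) : Prop :=
  IsFiniteMeasure τ ∧
    ∀ t : ℝ, inner ℂ w (U t w) = ∫ s, Complex.exp (s * t * Complex.I) ∂τ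

/-- `σ` is a measure of maximal spectral type, and `l` is the spectral multiplicity function, of the
restriction of the unitary representation `U` to the closed invariant subspace `W`: the space `W` is
the orthogonal sum of the cyclic subspaces generated by vectors `w k`, the spectral measure of `w k`
is equivalent to the restriction of `σ` to a set `S k`, and `σ`-almost everywhere
`l(s) = #{k : s ∈ S k} ≥ 1`. -/
def IsMultiplicityFunction (U : ℝ → V →ₗᵢ[ℂ] V) (W : Submodule ℂ V)
    (σ : Measure ℝ) (l : ℝ → ℕ∞) : Prop :=
  IsFiniteMeasure σ ∧
  ∃ (w : ℕ → V) (S : ℕ → Set ℝ),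
    (∀ j k, j ≠ k → ∀ t, inner ℂ (w j) (U t (w k)) = 0) ∧
    (Submodule.span ℂ (Set.range fun p : ℕ × ℝ => U p.2 (w p.1))).topologicalClosure = W ∧
    (∀ k, MeasurableSet (S k) ∧ ∃ τ, IsSpectralMeasure U (w k) τ ∧
      τ ≪ σ.restrict (S k) ∧ σ.restrict (S k) ≪ τ) ∧
    ∀ᵐ s ∂σ, l s = {k | s ∈ S k}.encard ∧ l s ≠ 0

/-- `M` is the set of spectral multiplicities of the restriction of `U` to `W`, that is,
the essential image of its spectral multiplicity function. -/
def HasMultiplicitySet (U : ℝ → V →ₗᵢ[ℂ] V) (W : Submodule ℂ V) (M : Set ℕ∞) : Prop :=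
  ∃ (σ : Measure ℝ) (l : ℝ → ℕ∞), IsMultiplicityFunction U W σ l ∧ M = {n | σ {s | l s = n} ≠ 0}

end Spectral

end SpectralMult

end

noncomputable section

namespace SpectralMult

open scoped Topology ComplexConjugate

/-! The space `L²(X × K/H)` is the orthogonal sum, over the characters `χ` of `K/H`, of the closed
invariant subspaces of functions `f(x)χ(k)`. On each of them the Koopman representation has "rank
one" in the sense of `IsRankOne`: the space is exhausted by copies of `L²([0, h_n))` on which `U(t)`
is translation by `t` as long as nothing leaves the interval, and consecutive copies are nested by
the coefficients `χ(α_{n+1}(c))`. Everything about the spectrum is read off from these coefficients.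

Weak limits. Along the steps of type `a`, a periodic point, `C_{n+1}` is a long arithmetic
progression and the increments of `α_{n+1}` are nearly equidistributed on the orbit of `a`. Hence
`U(h_n)` converges weakly to the scalar `conj l_χ(a)` (`tendsto_coeff`, `tendsto_inner_inr`). Along
the steps of type `W_i`, half of the copies are spaced by `h_n` and half by `h_n + ξ_i`, and
`U(h_n)` converges weakly to `(1 + U(-ξ_i))/2` (`tendsto_inner_inl`).

Atoms. At an atom `s` of a spectral measure the numbers `e^{i h_n s}` converge to the value at `s`
of the weak limit. For the steps `W_i` this gives `|1 + e^{-iξ_i s}| = 2`, so `e^{-iξ_i s} = 1` for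
both `i`, and rational independence forces `s = 0`. For the steps of type `a` it then gives `l_χ(a)
= 1`, so `χ(a) = 1` for all periodic `a`, and `χ = 1` by density (`eq_zero_of_atom`). Weak mixing
follows: the components of an eigenvector vanish for `χ ≠ 1`, and for `χ = 1` they are invariant,
where the invariant vectors of a cyclic representation form at most a line, here the constants.

Simplicity. The indicator of `[0, 2δ)` in a tower, and the indicator of `[0, 1)` in the tower below,
are trigonometric polynomials in `U` applied to the indicator of `[0, δ)`, respectively of `[0, 1)`,
in the given tower. A nonzero trigonometric polynomial has countably many zeros, so without atoms at
them nothing is lost on passing to the polynomial, and by induction the indicator of the bottom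
tower is cyclic (`towerSpan_eq_cyclicSpan`). So each `χ` contributes simple spectrum.

Comparison of characters. If `l_χ(a) ≠ l_η(a)`, the same sequence `U(h_n)` has different scalar weak
limits, so the spectral types are mutually singular (`HasWeakLimit.mutuallySingular`); by (iii) this
covers different orbits. For `χ` and `χ ∘ v` the equivariance of `α_{n+1}` says that the
coefficients agree after translation by `z_{n+1}`, up to a share `1/n²` of the copies. This is
summable, so translations by `z_2 + ⋯ + z_N` carry one nesting to the other in the limit and the
spectral types are equivalent (`exists_inner_eq_of_shift`). The multiplicities are therefore the
numbers of points of `v^`-orbits inside the dual of `K/H`; the trivial character, with the constants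
removed, adds the value `1` (`hasMultiplicitySet_of_family`).

Two classical facts are proved along the way: Bochner's theorem for matrix coefficients (Fejér
densities and tightness), and the fact that characters separate the points of a compact Abelian
group (compact operators commuting with the regular representation).

Existence of the triple. Take `K = ∏_{j ∈ E} A_j × A_j`, with `A_j` cyclic of prime order having an
automorphism `z_j` of order `j!` whose powers are trivial or fixed-point free, `v = (z_j,
z_j^{1+j})_j`, and `H` the antidiagonal. A character of `K/H` lives on finitely many coordinates;
its `i`-th image is again trivial on `H` exactly when `j! ∣ ij` on the support, that is `(J-1)! ∣ i`
for the largest `J` of the support, and its orbit has length `J!`. The quotient `J!/(J-1)! = J` is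
the required count (`exists_encard_orbit_eq`). All dual orbits are finite, so (iii) follows from the
linear independence of characters. -/

/-! ### Characters of `ℝ` and trigonometric polynomials -/

/-- The character `s ↦ e^{ist}` of `ℝ`. -/
def expi (t s : ℝ) : ℂ := Complex.exp (s * t * Complex.I)

lemma norm_expi (t s : ℝ) : ‖expi t s‖ = 1 := by
  unfold expi
  rw [← Complex.ofReal_mul, Complex.norm_exp_ofReal_mul_I]

lemma expi_add (t u s : ℝ) : expi (t + u) s = expi t s * expi u s := by
  unfold expi
  rw [← Complex.exp_add]
  push_cast
  ring_nf

@[simp] lemma expi_zero (s : ℝ) : expi 0 s = 1 := by simp [expi]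

@[simp] lemma expi_zero_right (t : ℝ) : expi t 0 = 1 := by simp [expi]

lemma conj_expi (t s : ℝ) : conj (expi t s) = expi (-t) s := by
  unfold expi
  rw [← Complex.exp_conj]
  simp

@[fun_prop] lemma continuous_expi (t : ℝ) : Continuous (expi t) := by
  unfold expi
  fun_prop

lemma integrable_expi_mul {τ : Measure ℝ} {g : ℝ → ℂ} (hg : Integrable g τ) (t : ℝ) :
    Integrable (fun s => expi t s * g s) τ :=
  hg.bdd_mul (c := 1) (continuous_expi t).aestronglyMeasurable
    (Eventually.of_forall fun s => (norm_expi t s).le)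

/-- The positive and the negative part of `g` are densities of two finite measures with the same
characteristic function, hence of the same measure. -/
lemma ae_eq_zero_of_integral_expi_real {τ : Measure ℝ} [IsFiniteMeasure τ] {g : ℝ → ℝ}
    (hg : Integrable g τ) (h : ∀ t, ∫ s, expi t s * (g s : ℂ) ∂τ = 0) : g =ᵐ[τ] 0 := by
  have key : ∀ f : ℝ → ℝ, Integrable f τ → ∀ t,
      charFun (τ.withDensity fun s => ENNReal.ofReal (f s)) t
        = ∫ s, expi t s * ((max (f s) 0 : ℝ) : ℂ) ∂τ := by
    intro f hf t
    rw [charFun_apply_real, integral_withDensity_eq_integral_toReal_smul₀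
      hf.1.aemeasurable.ennreal_ofReal (by simp)]
    refine integral_congr_ae (Eventually.of_forall fun s => ?_)
    simp only [ENNReal.toReal_ofReal', expi, Complex.real_smul]
    rw [mul_comm, mul_comm (s : ℂ)]
  have hfin : ∀ f : ℝ → ℝ, Integrable f τ →
      IsFiniteMeasure (τ.withDensity fun s => ENNReal.ofReal (f s)) := fun f hf =>
    isFiniteMeasure_withDensity_ofReal hf.2
  have := hfin g hg
  have := hfin (fun s => -g s) hg.neg
  have heq : (τ.withDensity fun s => ENNReal.ofReal (g s))
      = τ.withDensity fun s => ENNReal.ofReal (-g s) := by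
    refine Measure.ext_of_charFun (funext fun t => ?_)
    rw [key g hg, show charFun (τ.withDensity fun s => ENNReal.ofReal (-g s)) t = _ from key _ hg.neg t, ← sub_eq_zero, ← integral_sub, ← h t]
    · refine integral_congr_ae (Eventually.of_forall fun s => ?_)
      simp only [Pi.neg_apply]
      rw [← mul_sub, ← Complex.ofReal_sub]
      congr 2
      rcases le_total (g s) 0 with h0 | h0
      · rw [max_eq_right h0, max_eq_left (by linarith)]; ring
      · rw [max_eq_left h0, max_eq_right (by linarith)]; ring
    · exact integrable_expi_mul hg.pos_part.ofReal t
    · exact integrable_expi_mul hg.neg.pos_part.ofReal t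
  replace heq := (withDensity_eq_iff hg.1.aemeasurable.ennreal_ofReal
    hg.neg.1.aemeasurable.ennreal_ofReal hg.lintegral_lt_top.ne).1 heq
  filter_upwards [heq] with s hs
  rw [Pi.neg_apply] at hs
  rcases le_total (g s) 0 with h0 | h0
  · rw [ENNReal.ofReal_of_nonpos h0, eq_comm, ENNReal.ofReal_eq_zero] at hs
    simp only [Pi.zero_apply]; linarith
  · rw [ENNReal.ofReal_of_nonpos (by linarith : -g s ≤ 0), ENNReal.ofReal_eq_zero] at hs
    simp only [Pi.zero_apply]; linarith

/-- Conjugating the hypothesis at `-t` gives it for `conj g`, hence for the real and the imaginary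
part. -/
lemma ae_eq_zero_of_integral_expi {τ : Measure ℝ} [IsFiniteMeasure τ] {g : ℝ → ℂ}
    (hg : Integrable g τ) (h : ∀ t, ∫ s, expi t s * g s ∂τ = 0) : g =ᵐ[τ] 0 := by
  have hc : ∀ t, ∫ s, expi t s * conj (g s) ∂τ = 0 := by
    intro t
    have h1 := congrArg conj (h (-t))
    rw [← integral_conj, map_zero] at h1
    rw [← h1]
    refine integral_congr_ae (Eventually.of_forall fun s => ?_)
    simp only [map_mul, conj_expi, neg_neg]
  have hgc : Integrable (fun s => conj (g s)) τ :=
    (LinearIsometryEquiv.integrable_comp_iff Complex.conjLIE).2 hg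
  have hre : (fun s => (g s).re) =ᵐ[τ] 0 := by
    refine ae_eq_zero_of_integral_expi_real hg.re fun t => ?_
    have : ∀ s, expi t s * ((g s).re : ℂ)
        = (1 / 2 : ℂ) * (expi t s * g s + expi t s * conj (g s)) := by
      intro s
      rw [Complex.re_eq_add_conj]; ring
    simp_rw [this]
    rw [integral_const_mul, integral_add (integrable_expi_mul hg t) (integrable_expi_mul hgc t),
      h, hc]
    simp
  have him : (fun s => (g s).im) =ᵐ[τ] 0 := by
    refine ae_eq_zero_of_integral_expi_real hg.im fun t => ?_
    have : ∀ s, expi t s * ((g s).im : ℂ)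
        = (1 / (2 * Complex.I) : ℂ) * (expi t s * g s - expi t s * conj (g s)) := by
      intro s
      rw [Complex.im_eq_sub_conj]; ring
    simp_rw [this]
    rw [integral_const_mul, integral_sub (integrable_expi_mul hg t) (integrable_expi_mul hgc t),
      h, hc]
    simp
  filter_upwards [hre, him] with s h1 h2
  exact Complex.ext h1 h2

/-! ### Multiplication by exponentials on `L²(τ)` -/

section ModelSpace

variable (τ : Measure ℝ)

lemma memLp_expi_mul (t : ℝ) (f : Lp ℂ 2 τ) : MemLp (fun s => expi t s * f s) 2 τ :=
  (Lp.memLp f).of_le_mul (c := 1)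
    ((continuous_expi t).aestronglyMeasurable.mul (Lp.aestronglyMeasurable f))
    (Eventually.of_forall fun s => by simp [norm_expi])

/-- Multiplication by `e^{ist}` on `L²(τ)`. -/
def modulate (t : ℝ) : Lp ℂ 2 τ →ₗᵢ[ℂ] Lp ℂ 2 τ where
  toFun f := (memLp_expi_mul τ t f).toLp _
  map_add' f g := by
    rw [← MemLp.toLp_add, MemLp.toLp_eq_toLp_iff]
    filter_upwards [Lp.coeFn_add f g] with s h
    rw [h, Pi.add_apply, Pi.add_apply, mul_add]
  map_smul' c f := by
    rw [RingHom.id_apply, ← MemLp.toLp_const_smul, MemLp.toLp_eq_toLp_iff]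
    filter_upwards [Lp.coeFn_smul c f] with s h
    rw [h, Pi.smul_apply, Pi.smul_apply, smul_eq_mul, smul_eq_mul]
    ring
  norm_map' f := by
    change ‖(memLp_expi_mul τ t f).toLp _‖ = _
    rw [Lp.norm_toLp, Lp.norm_def]
    congr 1
    exact eLpNorm_congr_norm_ae (Eventually.of_forall fun s => by simp [norm_expi])

lemma coeFn_modulate (t : ℝ) (f : Lp ℂ 2 τ) :
    modulate τ t f =ᵐ[τ] fun s => expi t s * f s :=
  MemLp.coeFn_toLp (memLp_expi_mul τ t f)

variable [IsFiniteMeasure τ]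

/-- The class of `s ↦ e^{ist}` in `L²(τ)`. -/
def expLp (t : ℝ) : Lp ℂ 2 τ := modulate τ t (Lp.const 2 τ (1 : ℂ))

lemma coeFn_expLp (t : ℝ) : expLp τ t =ᵐ[τ] expi t := by
  filter_upwards [coeFn_modulate τ t (Lp.const 2 τ (1 : ℂ)),
    Lp.coeFn_const (p := 2) (μ := τ) (1 : ℂ)] with s h1 h2
  unfold expLp
  rw [h1, h2]
  simp

lemma modulate_expLp (t u : ℝ) : modulate τ t (expLp τ u) = expLp τ (t + u) := by
  apply Lp.ext
  filter_upwards [coeFn_modulate τ t (expLp τ u), coeFn_expLp τ u, coeFn_expLp τ (t + u)]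
    with s h1 h2 h3
  rw [h1, h2, h3, expi_add]

lemma inner_expLp_left (t : ℝ) (f : Lp ℂ 2 τ) :
    inner ℂ (expLp τ t) f = ∫ s, expi (-t) s * f s ∂τ := by
  rw [L2.inner_def]
  refine integral_congr_ae ?_
  filter_upwards [coeFn_expLp τ t] with s h
  rw [RCLike.inner_apply, h, conj_expi, mul_comm]

lemma inner_expLp_expLp (t u : ℝ) :
    inner ℂ (expLp τ t) (expLp τ u) = ∫ s, expi (u - t) s ∂τ := by
  rw [inner_expLp_left]
  refine integral_congr_ae ?_
  filter_upwards [coeFn_expLp τ u] with s h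
  rw [h, ← expi_add]
  ring_nf

lemma integrable_of_memLp_two {g : ℝ → ℂ} (hg : MemLp g 2 τ) : Integrable g τ :=
  hg.integrable (by norm_num)

/-- A function orthogonal to all exponentials has vanishing Fourier transform. -/
lemma span_expLp_dense :
    (Submodule.span ℂ (Set.range (expLp τ))).topologicalClosure = ⊤ := by
  rw [Submodule.topologicalClosure_eq_top_iff, Submodule.eq_bot_iff]
  intro f hf
  have h0 : (f : ℝ → ℂ) =ᵐ[τ] 0 := by
    refine ae_eq_zero_of_integral_expi (integrable_of_memLp_two τ (Lp.memLp f)) fun t => ?_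
    have := (Submodule.mem_orthogonal _ _).1 hf (expLp τ (-t))
      (Submodule.subset_span ⟨_, rfl⟩)
    rwa [inner_expLp_left, neg_neg] at this
  exact (Lp.eq_zero_iff_ae_eq_zero).2 h0

end ModelSpace

/-! ### Cyclic subspaces of unitary representations of `ℝ` -/

/-- `U` is a unitary representation of `ℝ` (no continuity is assumed). -/
structure IsUnitaryRep {V : Type*} [NormedAddCommGroup V] [InnerProductSpace ℂ V]
    (U : ℝ → V →ₗᵢ[ℂ] V) : Prop where
  zero : ∀ x, U 0 x = x
  add : ∀ s t x, U (s + t) x = U s (U t x)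

section Cyclic

variable {V : Type*} [NormedAddCommGroup V] [InnerProductSpace ℂ V]

lemma IsUnitaryRep.neg_apply_self {U : ℝ → V →ₗᵢ[ℂ] V} (hU : IsUnitaryRep U) (t : ℝ) (x : V) :
    U (-t) (U t x) = x := by
  rw [← hU.add, neg_add_cancel, hU.zero]

lemma IsUnitaryRep.inner_right {U : ℝ → V →ₗᵢ[ℂ] V} (hU : IsUnitaryRep U) (t : ℝ) (x y : V) :
    inner ℂ x (U t y) = inner ℂ (U (-t) x) y := by
  rw [← (U (-t)).inner_map_map x, hU.neg_apply_self]

lemma IsUnitaryRep.inner_left {U : ℝ → V →ₗᵢ[ℂ] V} (hU : IsUnitaryRep U) (t : ℝ) (x y : V) :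
    inner ℂ (U t x) y = inner ℂ x (U (-t) y) := by
  rw [hU.inner_right, neg_neg]

/-- The closed subspace generated by the vectors `U t w`. -/
def cyclicSpan (U : ℝ → V →ₗᵢ[ℂ] V) (w : V) : Submodule ℂ V :=
  (Submodule.span ℂ (Set.range fun t => U t w)).topologicalClosure

lemma self_mem_cyclicSpan {U : ℝ → V →ₗᵢ[ℂ] V} (hU : IsUnitaryRep U) (w : V) :
    w ∈ cyclicSpan U w :=
  Submodule.le_topologicalClosure _ (Submodule.subset_span ⟨0, hU.zero w⟩)

lemma apply_mem_cyclicSpan {U : ℝ → V →ₗᵢ[ℂ] V} (hU : IsUnitaryRep U) {w y : V}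
    (hy : y ∈ cyclicSpan U w) (t : ℝ) : U t y ∈ cyclicSpan U w := by
  have h : Submodule.span ℂ (Set.range fun t => U t w) ≤
      (Submodule.span ℂ (Set.range fun t => U t w)).comap (U t).toLinearMap := by
    rw [Submodule.span_le]
    rintro _ ⟨u, rfl⟩
    exact Submodule.subset_span ⟨t + u, hU.add t u w⟩
  refine map_mem_closure (U t).continuous hy fun z hz => ?_
  exact h hz

lemma cyclicSpan_le {U : ℝ → V →ₗᵢ[ℂ] V} (hU : IsUnitaryRep U) {w y : V}
    (hy : y ∈ cyclicSpan U w) : cyclicSpan U y ≤ cyclicSpan U w := by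
  refine Submodule.topologicalClosure_minimal _ ?_ (Submodule.isClosed_topologicalClosure _)
  rw [Submodule.span_le]
  rintro _ ⟨t, rfl⟩
  exact apply_mem_cyclicSpan hU hy t

/-- If `‖A x‖ = ‖B x‖` for all `x`, then the closures of the ranges of `A` and `B` are matched. -/
lemma exists_matching_limit {M W : Type*} [AddCommGroup M] [Module ℂ M] [NormedAddCommGroup W]
    [InnerProductSpace ℂ W] [CompleteSpace W] (A : M →ₗ[ℂ] V) (B : M →ₗ[ℂ] W)
    (hAB : ∀ x, ‖A x‖ = ‖B x‖) {y : V} (hy : y ∈ closure (Set.range A)) :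
    ∃ (z : W) (x : ℕ → M), Tendsto (fun k => A (x k)) atTop (𝓝 y) ∧
      Tendsto (fun k => B (x k)) atTop (𝓝 z) := by
  obtain ⟨a, ha, hlim⟩ := mem_closure_iff_seq_limit.1 hy
  choose x hx using ha
  have hA : Tendsto (fun k => A (x k)) atTop (𝓝 y) := by simpa only [hx] using hlim
  have hC : CauchySeq fun k => B (x k) := by
    rw [Metric.cauchySeq_iff]
    intro ε hε
    obtain ⟨N, hN⟩ := Metric.cauchySeq_iff.1 hA.cauchySeq ε hε
    refine ⟨N, fun m hm n hn => ?_⟩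
    have := hN m hm n hn
    rwa [dist_eq_norm, ← map_sub, ← hAB, map_sub, ← dist_eq_norm]
  obtain ⟨z, hz⟩ := cauchySeq_tendsto_of_complete hC
  exact ⟨z, x, hA, hz⟩

/-- The vector `∑_t P(t) U(t) w`. -/
def trigOp (U : ℝ → V →ₗᵢ[ℂ] V) (w : V) : (ℝ →₀ ℂ) →ₗ[ℂ] V :=
  Finsupp.linearCombination ℂ fun t => U t w

/-- The class of the trigonometric polynomial `s ↦ ∑_t P(t) e^{ist}` in `L²(τ)`. -/
def trigFn (τ : Measure ℝ) [IsFiniteMeasure τ] : (ℝ →₀ ℂ) →ₗ[ℂ] Lp ℂ 2 τ :=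
  Finsupp.linearCombination ℂ (expLp τ)

lemma coeFn_trigFn (τ : Measure ℝ) [IsFiniteMeasure τ] (P : ℝ →₀ ℂ) :
    trigFn τ P =ᵐ[τ] fun s => P.sum fun t c => c * expi t s := by
  induction P using Finsupp.induction_linear with
  | zero =>
    rw [map_zero]
    filter_upwards [Lp.coeFn_zero ℂ 2 τ] with s h
    rw [h, Finsupp.sum_zero_index, Pi.zero_apply]
  | add P Q hP hQ =>
    rw [map_add]
    filter_upwards [hP, hQ, Lp.coeFn_add (trigFn τ P) (trigFn τ Q)] with s h1 h2 h3
    rw [h3, Pi.add_apply, h1, h2, Finsupp.sum_add_index'] <;> intros <;> ring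
  | single t c =>
    unfold trigFn
    rw [Finsupp.linearCombination_single]
    filter_upwards [Lp.coeFn_smul c (expLp τ t), coeFn_expLp τ t] with s h1 h2
    rw [h1, Pi.smul_apply, h2, Finsupp.sum_single_index] <;> simp

lemma cyclicSpan_eq_closure_range (U : ℝ → V →ₗᵢ[ℂ] V) (w : V) :
    (cyclicSpan U w : Set V) = closure (Set.range (trigOp U w)) := by
  unfold cyclicSpan trigOp
  rw [Submodule.topologicalClosure_coe, ← LinearMap.coe_range, Finsupp.range_linearCombination]

variable {U : ℝ → V →ₗᵢ[ℂ] V} {w : V} {τ : Measure ℝ} [IsFiniteMeasure τ]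

/-- This is what makes `U t w ↦ e^{ist}` an isometric model of the cyclic space in `L²(τ)`; the
remaining comparisons extend it linearly and by limits. -/
lemma IsSpectralMeasure.inner_eq (hU : IsUnitaryRep U) (h : IsSpectralMeasure U w τ) (t u : ℝ) :
    inner ℂ (U t w) (U u w) = inner ℂ (expLp τ t) (expLp τ u) := by
  rw [hU.inner_left, ← hU.add, neg_add_eq_sub, h.2, inner_expLp_expLp]
  rfl

lemma IsSpectralMeasure.inner_trigOp (hU : IsUnitaryRep U) (h : IsSpectralMeasure U w τ)
    (P Q : ℝ →₀ ℂ) : inner ℂ (trigOp U w P) (trigOp U w Q) = inner ℂ (trigFn τ P) (trigFn τ Q) := by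
  unfold trigOp trigFn
  simp only [Finsupp.linearCombination_apply, Finsupp.sum, sum_inner, inner_sum, inner_smul_left,
    inner_smul_right, h.inner_eq hU]

lemma IsSpectralMeasure.norm_trigOp (hU : IsUnitaryRep U) (h : IsSpectralMeasure U w τ)
    (P : ℝ →₀ ℂ) : ‖trigOp U w P‖ = ‖trigFn τ P‖ := by
  have := h.inner_trigOp hU P P
  rw [inner_self_eq_norm_sq_to_K, inner_self_eq_norm_sq_to_K] at this
  have h2 : ‖trigOp U w P‖ ^ 2 = ‖trigFn τ P‖ ^ 2 := by exact_mod_cast this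
  exact (sq_eq_sq₀ (norm_nonneg _) (norm_nonneg _)).1 h2

lemma apply_trigOp (hU : IsUnitaryRep U) (t : ℝ) (P : ℝ →₀ ℂ) :
    U t (trigOp U w P) = trigOp U w (P.mapDomain fun u => t + u) := by
  unfold trigOp
  rw [Finsupp.linearCombination_mapDomain, Finsupp.linearCombination_apply,
    Finsupp.linearCombination_apply, Finsupp.sum, Finsupp.sum, map_sum]
  simp [hU.add]

lemma modulate_trigFn (t : ℝ) (P : ℝ →₀ ℂ) :
    modulate τ t (trigFn τ P) = trigFn τ (P.mapDomain fun u => t + u) := by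
  unfold trigFn
  rw [Finsupp.linearCombination_mapDomain, Finsupp.linearCombination_apply,
    Finsupp.linearCombination_apply, Finsupp.sum, Finsupp.sum, map_sum]
  simp [modulate_expLp]

/-- Vectors of the cyclic space of `w` are represented by functions in `L²(τ)`, `τ` the
spectral measure of `w`. -/
lemma IsSpectralMeasure.exists_model (hU : IsUnitaryRep U) (h : IsSpectralMeasure U w τ) {y : V}
    (hy : y ∈ cyclicSpan U w) : ∃ F : Lp ℂ 2 τ,
      (∀ t P, inner ℂ (U t (trigOp U w P)) y = inner ℂ (modulate τ t (trigFn τ P)) F) ∧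
      (∀ t, inner ℂ y (U t y) = inner ℂ F (modulate τ t F)) := by
  rw [← SetLike.mem_coe, cyclicSpan_eq_closure_range] at hy
  obtain ⟨F, P, h1, h2⟩ := exists_matching_limit _ _ (h.norm_trigOp hU) hy
  refine ⟨F, fun t Q => ?_, fun t => ?_⟩
  · refine tendsto_nhds_unique (tendsto_const_nhds.inner h1) ?_
    simp only [apply_trigOp hU, h.inner_trigOp hU, modulate_trigFn]
    exact tendsto_const_nhds.inner h2
  · refine tendsto_nhds_unique (h1.inner (((U t).continuous.tendsto y).comp h1)) ?_
    refine (h2.inner (((modulate τ t).continuous.tendsto F).comp h2)).congr fun k => ?_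
    simp only [Function.comp_apply, apply_trigOp hU, h.inner_trigOp hU, modulate_trigFn]

end Cyclic

lemma isFiniteMeasure_withDensity_sq {τ : Measure ℝ} (F : Lp ℂ 2 τ) :
    IsFiniteMeasure (τ.withDensity fun s => ENNReal.ofReal (‖F s‖ ^ 2)) :=
  isFiniteMeasure_withDensity_ofReal ((memLp_two_iff_integrable_sq_norm
    (Lp.aestronglyMeasurable F)).1 (Lp.memLp F)).2

/-! ### Spectral measures of vectors in a cyclic subspace -/

section Cyclic

variable {V : Type*} [NormedAddCommGroup V] [InnerProductSpace ℂ V]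
  {U : ℝ → V →ₗᵢ[ℂ] V} {w : V} {τ : Measure ℝ} [IsFiniteMeasure τ]

/-- If `y` is represented by `F ∈ L²(τ)`, its spectral measure is `|F|² τ`. -/
lemma IsSpectralMeasure.exists_of_mem_cyclicSpan (hU : IsUnitaryRep U)
    (h : IsSpectralMeasure U w τ) {y : V} (hy : y ∈ cyclicSpan U w) :
    ∃ ρ, IsSpectralMeasure U y ρ ∧ ρ ≪ τ := by
  obtain ⟨F, -, hF⟩ := h.exists_model hU hy
  refine ⟨_, ⟨isFiniteMeasure_withDensity_sq F, fun t => ?_⟩, withDensity_absolutelyContinuous _ _⟩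
  rw [hF, L2.inner_def, integral_withDensity_eq_integral_toReal_smul₀
    ((Lp.aestronglyMeasurable F).norm.aemeasurable.pow_const 2).ennreal_ofReal (by simp)]
  refine integral_congr_ae ?_
  filter_upwards [coeFn_modulate τ t F] with s hs
  rw [RCLike.inner_apply, hs, ENNReal.toReal_ofReal (by positivity), Complex.real_smul, expi]
  push_cast
  rw [← Complex.conj_mul']
  ring

lemma IsSpectralMeasure.unique {τ' : Measure ℝ} (h : IsSpectralMeasure U w τ)
    (h' : IsSpectralMeasure U w τ') : τ = τ' := by
  have := h'.1
  refine Measure.ext_of_charFun (funext fun t => ?_)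
  have h1 := h.2 t
  rw [h'.2 t] at h1
  rw [charFun_apply_real, charFun_apply_real]
  simp only [mul_comm (t : ℂ)]
  exact h1.symm

/-- If the trigonometric polynomial `P` does not vanish `τ`-almost everywhere, then `w` lies in
the cyclic space of `P(U) w`. -/
lemma IsSpectralMeasure.mem_cyclicSpan_trigOp [CompleteSpace V] (hU : IsUnitaryRep U)
    (h : IsSpectralMeasure U w τ) (P : ℝ →₀ ℂ)
    (hP : ∀ᵐ s ∂τ, (P.sum fun t c => c * expi t s) ≠ 0) : w ∈ cyclicSpan U (trigOp U w P) := by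
  set Z := cyclicSpan U (trigOp U w P) with hZ
  have hZc : IsClosed (Z : Set V) := Submodule.isClosed_topologicalClosure _
  have : CompleteSpace Z := hZc.completeSpace_coe
  have hw := self_mem_cyclicSpan hU w
  have hZle : Z ≤ cyclicSpan U w := by
    refine cyclicSpan_le hU ?_
    rw [← SetLike.mem_coe, cyclicSpan_eq_closure_range]
    exact subset_closure ⟨P, rfl⟩
  -- The component `z` of `w` orthogonal to the cyclic space of `P(U) w` is represented by some `F`.
  -- Orthogonality to all translates of `P(U) w` says that `conj P · F` has vanishing Fourier
  -- transform, and `P ≠ 0` almost everywhere, so `F = 0`.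
  obtain ⟨y, hy, z, hz, hyz⟩ := Z.exists_add_mem_mem_orthogonal w
  have hzw : z ∈ cyclicSpan U w := by
    have : z = w - y := by rw [hyz]; abel
    rw [this]
    exact Submodule.sub_mem _ hw (hZle hy)
  obtain ⟨F, h1, h2⟩ := h.exists_model hU hzw
  have hF : (F : ℝ → ℂ) =ᵐ[τ] 0 := by
    have hint : ∀ G : Lp ℂ 2 τ, Integrable (fun s => conj (G s) * F s) τ := by
      intro G
      refine (L2.integrable_inner (𝕜 := ℂ) G F).congr (Eventually.of_forall fun s => ?_)
      simp only [RCLike.inner_apply, mul_comm]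
    have h0 := ae_eq_zero_of_integral_expi (hint (trigFn τ P)) fun t => by
      have h3 : inner ℂ (U (-t) (trigOp U w P)) z = 0 :=
        (Submodule.mem_orthogonal _ _).1 hz _
          (apply_mem_cyclicSpan hU (self_mem_cyclicSpan hU _) (-t))
      rw [h1, L2.inner_def] at h3
      rw [← h3]
      refine integral_congr_ae ?_
      filter_upwards [coeFn_modulate τ (-t) (trigFn τ P)] with s hs
      rw [RCLike.inner_apply, hs, map_mul, conj_expi, neg_neg]
      ring
    filter_upwards [h0, hP, coeFn_trigFn τ P] with s hs1 hs2 hs3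
    rw [hs3, Pi.zero_apply, mul_eq_zero, map_eq_zero] at hs1
    exact hs1.resolve_left hs2
  have hz0 : z = 0 := by
    have := h2 0
    rw [hU.zero, Lp.eq_zero_iff_ae_eq_zero.2 hF, inner_zero_left] at this
    exact inner_self_eq_zero.1 this
  rw [hyz, hz0, add_zero]
  exact hy

end Cyclic

/-! ### Existence of spectral measures (Bochner's theorem) -/

lemma integral_exp_int_mul_I (n : ℤ) :
    ∫ θ in (-Real.pi)..Real.pi, Complex.exp ((n * Complex.I) * θ)
      = if n = 0 then (2 * Real.pi : ℂ) else 0 := by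
  split_ifs with h
  · subst h
    simp
    ring
  · have hc : (n * Complex.I : ℂ) ≠ 0 := mul_ne_zero (by exact_mod_cast h) Complex.I_ne_zero
    rw [integral_exp_mul_complex hc]
    have : Complex.exp (n * Complex.I * (Real.pi : ℝ))
        = Complex.exp (n * Complex.I * ((-Real.pi : ℝ) : ℂ)) := by
      rw [Complex.exp_eq_exp_iff_exists_int]
      exact ⟨n, by push_cast; ring⟩
    rw [this, sub_self, zero_div]

lemma card_filter_add_eq {N m : ℕ} (hm : m ≤ N) :
    ((Finset.range N ×ˢ Finset.range N).filter fun p : ℕ × ℕ => p.1 + m = p.2).card = N - m := by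
  have : ((Finset.range N ×ˢ Finset.range N).filter fun p : ℕ × ℕ => p.1 + m = p.2)
      = (Finset.range (N - m)).image fun k => (k, k + m) := by
    ext ⟨a, b⟩
    simp only [Finset.mem_filter, Finset.mem_product, Finset.mem_range, Finset.mem_image,
      Prod.mk.injEq]
    constructor
    · rintro ⟨⟨h1, h2⟩, h3⟩
      exact ⟨a, by omega, rfl, h3⟩
    · rintro ⟨k, h1, h2, h3⟩
      omega
  rw [this, Finset.card_image_of_injective _ fun a b h => (Prod.mk.inj h).1, Finset.card_range]

section Bochner

variable {V : Type*} [NormedAddCommGroup V] [InnerProductSpace ℂ V]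

/-- A Fejér-type trigonometric density built from the vectors `c k`. -/
def fejerDensity (c : ℕ → V) (N : ℕ) (θ : ℝ) : ℝ :=
  (2 * Real.pi * N)⁻¹ * ‖∑ k ∈ Finset.range N, Complex.exp (-(k * θ * Complex.I)) • c k‖ ^ 2

lemma continuous_fejerDensity (c : ℕ → V) (N : ℕ) : Continuous (fejerDensity c N) := by
  unfold fejerDensity
  fun_prop

lemma fejerDensity_nonneg (c : ℕ → V) (N : ℕ) (θ : ℝ) : 0 ≤ fejerDensity c N θ := by
  unfold fejerDensity
  positivity

lemma ofReal_fejerDensity (c : ℕ → V) (N : ℕ) (θ : ℝ) :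
    (fejerDensity c N θ : ℂ) = (2 * Real.pi * N : ℂ)⁻¹ * ∑ p ∈ Finset.range N ×ˢ Finset.range N,
      inner ℂ (c p.1) (c p.2) * Complex.exp (((p.1 : ℤ) - (p.2 : ℤ) : ℤ) * Complex.I * θ) := by
  unfold fejerDensity
  push_cast
  rw [← Complex.coe_algebraMap, ← inner_self_eq_norm_sq_to_K (𝕜 := ℂ), sum_inner,
    Finset.sum_product]
  congr 1
  refine Finset.sum_congr rfl fun k _ => ?_
  rw [inner_sum]
  refine Finset.sum_congr rfl fun l _ => ?_
  rw [inner_smul_left, inner_smul_right, ← Complex.exp_conj]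
  simp only [map_neg, map_mul, Complex.conj_I, map_natCast, Complex.coe_algebraMap,
    Complex.conj_ofReal]
  rw [← mul_assoc, ← Complex.exp_add, mul_comm]
  congr 2
  ring

/-- Only the `N - m` pairs `(k, k + m)` survive the integration; divided by `N`, their number is the
damping factor `1 - m/N`. -/
lemma integral_fejerDensity (c : ℕ → V) {φ : ℕ → ℂ}
    (hφ : ∀ k m, inner ℂ (c k) (c (k + m)) = φ m) {N m : ℕ} (hN : 0 < N) (hm : m ≤ N) :
    ∫ θ in (-Real.pi)..Real.pi, Complex.exp ((m : ℤ) * Complex.I * θ) * (fejerDensity c N θ : ℂ)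
      = φ m * (1 - m / N) := by
  have h1 : ∀ θ : ℝ, Complex.exp ((m : ℤ) * Complex.I * θ) * (fejerDensity c N θ : ℂ)
      = ∑ p ∈ Finset.range N ×ˢ Finset.range N, ((2 * Real.pi * N : ℂ)⁻¹ *
        inner ℂ (c p.1) (c p.2)) *
          Complex.exp (((p.1 : ℤ) + (m : ℤ) - (p.2 : ℤ) : ℤ) * Complex.I * θ) := by
    intro θ
    rw [ofReal_fejerDensity, mul_left_comm, Finset.mul_sum, Finset.mul_sum]
    refine Finset.sum_congr rfl fun p _ => ?_
    have : Complex.exp (((p.1 : ℤ) + (m : ℤ) - (p.2 : ℤ) : ℤ) * Complex.I * θ)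
        = Complex.exp ((m : ℤ) * Complex.I * θ)
          * Complex.exp (((p.1 : ℤ) - (p.2 : ℤ) : ℤ) * Complex.I * θ) := by
      rw [← Complex.exp_add]
      congr 1
      push_cast
      ring
    rw [this]
    ring
  simp_rw [h1]
  rw [intervalIntegral.integral_finsetSum fun p _ => (by
    apply Continuous.intervalIntegrable; fun_prop)]
  simp_rw [intervalIntegral.integral_const_mul, integral_exp_int_mul_I, mul_ite, mul_zero]
  rw [← Finset.sum_filter]
  have h2 : ((Finset.range N ×ˢ Finset.range N).filter fun p : ℕ × ℕ =>
      ((p.1 : ℤ) + (m : ℤ) - (p.2 : ℤ) : ℤ) = 0)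
      = (Finset.range N ×ˢ Finset.range N).filter fun p : ℕ × ℕ => p.1 + m = p.2 := by
    refine Finset.filter_congr fun p _ => ?_
    omega
  rw [h2, Finset.sum_congr rfl (g := fun _ => (N : ℂ)⁻¹ * φ m), Finset.sum_const,
    card_filter_add_eq hm, nsmul_eq_mul, Nat.cast_sub hm]
  · have : (N : ℂ) ≠ 0 := by exact_mod_cast hN.ne'
    field_simp
  · rintro ⟨k, l⟩ hp
    have hkl : k + m = l := (Finset.mem_filter.1 hp).2
    subst hkl
    simp only
    rw [hφ]
    have : (N : ℂ) ≠ 0 := by exact_mod_cast hN.ne'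
    have : (Real.pi : ℂ) ≠ 0 := by exact_mod_cast Real.pi_ne_zero
    field_simp

/-- A probability measure on `[-π, π]` with given (damped) Fourier coefficients. -/
lemma exists_fejer_measure (c : ℕ → V) {φ : ℕ → ℂ} (hφ0 : φ 0 = 1)
    (hφ : ∀ k m, inner ℂ (c k) (c (k + m)) = φ m) {N : ℕ} (hN : 0 < N) :
    ∃ ν : Measure ℝ, IsProbabilityMeasure ν ∧ (∀ᵐ s ∂ν, |s| ≤ Real.pi) ∧
      ∀ m : ℕ, m ≤ N → charFun ν m = φ m * (1 - m / N) := by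
  set ν := (volume.restrict (Set.Ioc (-Real.pi) Real.pi)).withDensity
    fun θ => ENNReal.ofReal (fejerDensity c N θ) with hν
  have hfin : IsFiniteMeasure ν := by
    refine isFiniteMeasure_withDensity_ofReal ?_
    exact ((continuous_fejerDensity c N).integrableOn_Ioc).2
  have hchar : ∀ m : ℕ, m ≤ N → charFun ν m = φ m * (1 - m / N) := by
    intro m hm
    rw [← integral_fejerDensity c hφ hN hm, intervalIntegral.integral_of_le
      (by linarith [Real.pi_pos]), charFun_apply_real, hν,
      integral_withDensity_eq_integral_toReal_smul₀
      (continuous_fejerDensity c N).measurable.ennreal_ofReal.aemeasurable (by simp)]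
    refine integral_congr_ae (Eventually.of_forall fun θ => ?_)
    simp only [ENNReal.toReal_ofReal (fejerDensity_nonneg c N θ), Complex.real_smul]
    rw [mul_comm]
    congr 2
    push_cast
    ring
  refine ⟨ν, ⟨?_⟩, ?_, hchar⟩
  · have h0 := hchar 0 (Nat.zero_le _)
    rw [Nat.cast_zero, charFun_zero, hφ0] at h0
    have h1 : ν.real Set.univ = 1 := by
      have : ((ν.real Set.univ : ℝ) : ℂ) = ((1 : ℝ) : ℂ) := by rw [h0]; simp
      exact_mod_cast this
    rw [measureReal_def] at h1
    rw [← ENNReal.toReal_eq_one_iff, h1]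
  · refine (withDensity_absolutelyContinuous _ _).ae_le ?_
    filter_upwards [ae_restrict_mem measurableSet_Ioc] with s hs
    exact abs_le.2 ⟨hs.1.le, hs.2⟩

/-- Increments over a time at most `1` are controlled by the single value at `1`: by Jensen the left
side is at most `∫ |e^{ius} - 1|² = ∫ (2 - 2 cos us)`, and `cos s ≤ cos us` for `|s| ≤ π` and `0 ≤ u
≤ 1`. This lets values at integers determine those at real times. -/
lemma norm_charFun_sub_sq_le {ν : Measure ℝ} [IsProbabilityMeasure ν]
    (hν : ∀ᵐ s ∂ν, |s| ≤ Real.pi) {t u : ℝ} (hu0 : 0 ≤ u) (hu1 : u ≤ 1) :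
    ‖charFun ν (t + u) - charFun ν t‖ ^ 2 ≤ 2 * (1 - (charFun ν 1).re) := by
  have hi : ∀ t : ℝ, Integrable (expi t) ν := fun t =>
    (integrable_const (1 : ℝ)).mono' (continuous_expi t).aestronglyMeasurable
      (Eventually.of_forall fun s => (norm_expi t s).le)
  have hc : ∀ t : ℝ, charFun ν t = ∫ s, expi t s ∂ν := fun t => by
    rw [charFun_apply_real]
    simp only [expi, mul_comm]
  set f : ℝ → ℝ := fun s => ‖expi u s - 1‖ with hf
  have hfm : Continuous f := by
    have := continuous_expi u
    fun_prop
  have hf2 : ∀ s, f s ≤ 2 := fun s => by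
    refine (norm_sub_le _ _).trans ?_
    rw [norm_expi, norm_one]; norm_num
  have hfi : Integrable f ν := (integrable_const (2 : ℝ)).mono' hfm.aestronglyMeasurable
    (Eventually.of_forall fun s => by rw [Real.norm_of_nonneg (norm_nonneg _)]; exact hf2 s)
  have hfi2 : Integrable (fun s => f s ^ 2) ν :=
    (integrable_const (4 : ℝ)).mono' (hfm.pow 2).aestronglyMeasurable
    (Eventually.of_forall fun s => by
      rw [Real.norm_of_nonneg (by positivity)]
      nlinarith [hf2 s, norm_nonneg (expi u s - 1)])
  have h1 : ‖charFun ν (t + u) - charFun ν t‖ ≤ ∫ s, f s ∂ν := by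
    rw [hc, hc, ← integral_sub (hi _) (hi _)]
    refine (norm_integral_le_integral_norm _).trans (le_of_eq ?_)
    refine integral_congr_ae (Eventually.of_forall fun s => ?_)
    simp only [hf]
    rw [expi_add, ← mul_sub_one, norm_mul, norm_expi, one_mul]
  have h2 : (∫ s, f s ∂ν) ^ 2 ≤ ∫ s, f s ^ 2 ∂ν := by
    set a := ∫ s, f s ∂ν
    have : 0 ≤ ∫ s, (f s - a) ^ 2 ∂ν := integral_nonneg fun s => sq_nonneg _
    have h3 : ∀ s, (f s - a) ^ 2 = f s ^ 2 - (2 * a * f s - a ^ 2) := fun s => by ring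
    simp_rw [h3] at this
    have e1 : ∫ s, f s ^ 2 - (2 * a * f s - a ^ 2) ∂ν
        = ∫ s, f s ^ 2 ∂ν - ∫ s, (2 * a * f s - a ^ 2) ∂ν :=
      integral_sub hfi2 ((hfi.const_mul _).sub (integrable_const _))
    have e2 : ∫ s, (2 * a * f s - a ^ 2) ∂ν = ∫ s, 2 * a * f s ∂ν - ∫ _, a ^ 2 ∂ν :=
      integral_sub (hfi.const_mul _) (integrable_const _)
    rw [e1, e2, integral_const_mul, integral_const] at this
    simp only [probReal_univ, one_smul] at this
    nlinarith
  have hcos : ∀ v s : ℝ, ‖expi v s - 1‖ ^ 2 = 2 - 2 * Real.cos (s * v) := by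
    intro v s
    unfold expi
    rw [← Complex.ofReal_mul, ← Complex.normSq_eq_norm_sq, Complex.normSq_apply,
      Complex.sub_re, Complex.sub_im, Complex.exp_ofReal_mul_I_re, Complex.exp_ofReal_mul_I_im,
      Complex.one_re, Complex.one_im]
    nlinarith [Real.sin_sq_add_cos_sq (s * v)]
  have h3 : ∫ s, f s ^ 2 ∂ν ≤ ∫ s, (2 - 2 * (expi 1 s).re) ∂ν := by
    refine integral_mono_ae hfi2 ((integrable_const _).sub ((hi 1).re.const_mul 2)) ?_
    filter_upwards [hν] with s hs
    simp only [hf, hcos]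
    have : (expi 1 s).re = Real.cos s := by
      unfold expi
      rw [← Complex.ofReal_mul, Complex.exp_ofReal_mul_I_re, mul_one]
    rw [this]
    have : Real.cos s ≤ Real.cos (s * u) := by
      rw [← Real.cos_abs s, ← Real.cos_abs (s * u), abs_mul, abs_of_nonneg hu0]
      refine Real.cos_le_cos_of_nonneg_of_le_pi (by positivity) hs ?_
      nlinarith [abs_nonneg s]
    linarith
  have h4 : ∫ s, (2 - 2 * (expi 1 s).re) ∂ν = 2 * (1 - (charFun ν 1).re) := by
    have e1 : ∫ s, (2 - 2 * (expi 1 s).re) ∂ν = ∫ _, (2 : ℝ) ∂ν - ∫ s, 2 * (expi 1 s).re ∂ν :=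
      integral_sub (integrable_const _) ((hi 1).re.const_mul 2)
    have e2 : ∫ s, (expi 1 s).re ∂ν = (∫ s, expi 1 s ∂ν).re := integral_re (hi 1)
    rw [e1, integral_const_mul, hc 1, integral_const, e2]
    simp
    ring
  calc _ ≤ (∫ s, f s ∂ν) ^ 2 := by gcongr
    _ ≤ _ := h2.trans (h3.trans h4.le)

/-- **Bochner's theorem** for matrix coefficients: a vector whose matrix coefficient is continuous
at `0` has a spectral measure. -/
theorem exists_isSpectralMeasure_of_norm_one {U : ℝ → V →ₗᵢ[ℂ] V} (hU : IsUnitaryRep U) {w : V}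
    (hw : ‖w‖ = 1) (hcont : ContinuousAt (fun t => (inner ℂ w (U t w) : ℂ)) 0) :
    ∃ τ, IsSpectralMeasure U w τ := by
  set φ : ℝ → ℂ := fun t => inner ℂ w (U t w) with hφ
  have hφ0 : φ 0 = 1 := by
    simp only [hφ, hU.zero, inner_self_eq_norm_sq_to_K, hw]
    simp
  have hφneg : ∀ t, φ (-t) = conj (φ t) := fun t => by
    simp only [hφ]
    rw [inner_conj_symm, hU.inner_left]
  have hφc : Continuous φ := by
    -- Continuity at `0` spreads to all times because `‖U u w - U t w‖² = 2 - 2 Re φ(u - t)`.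
    have hUc : Continuous fun t => U t w := by
      rw [continuous_iff_continuousAt]
      intro t
      have h1 : ∀ u, ‖U u w - U t w‖ ^ 2 = 2 - 2 * (φ (u - t)).re := by
        intro u
        rw [norm_sub_sq (𝕜 := ℂ), LinearIsometry.norm_map, LinearIsometry.norm_map, hw,
          ← inner_conj_symm, hU.inner_left, ← hU.add, neg_add_eq_sub]
        simp only [hφ, RCLike.conj_re, RCLike.re_to_complex]
        ring
      have h2 : Tendsto (fun u => ‖U u w - U t w‖ ^ 2) (𝓝 t) (𝓝 0) := by
        simp only [h1]
        have h3 : Tendsto (fun u => φ (u - t)) (𝓝 t) (𝓝 (φ 0)) := by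
          refine (show Tendsto φ (𝓝 0) (𝓝 (φ 0)) from hcont).comp ?_
          have : Continuous fun u : ℝ => u - t := by fun_prop
          simpa using this.tendsto t
        have h4 := ((Complex.continuous_re.tendsto _).comp h3).const_mul (2 : ℝ)
        have h5 := h4.const_sub 2
        rw [hφ0] at h5
        simpa using h5
      rw [ContinuousAt, tendsto_iff_norm_sub_tendsto_zero]
      have h6 := h2.sqrt
      simpa [Real.sqrt_sq] using h6
    exact continuous_const.inner hUc
  -- Sampling with step `1/(j+1)` and with `N = (j+1)²` terms: a fixed time `t` has index about
  -- `(j+1)t`, which is negligible against `N`, so the damping disappears in the limit.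
  have hex : ∀ j : ℕ, ∃ ν : Measure ℝ, IsProbabilityMeasure ν ∧ (∀ᵐ s ∂ν, |s| ≤ Real.pi) ∧
      ∀ m : ℕ, m ≤ (j + 1) ^ 2 →
        charFun ν m = φ (m / (j + 1)) * (1 - m / ((j + 1) ^ 2 : ℕ)) := by
    intro j
    have := exists_fejer_measure (fun k : ℕ => U (k / (j + 1)) w)
      (φ := fun m : ℕ => φ (m / (j + 1))) (by simp [hφ0]) (fun k m => by
        simp only [hφ]
        rw [hU.inner_left, ← hU.add]
        congr 3
        push_cast
        ring) (N := (j + 1) ^ 2) (by positivity)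
    exact this
  choose ν hνp hνs hν using hex
  let μ : ℕ → Measure ℝ := fun j => (ν j).map (((j : ℝ) + 1) * ·)
  have hμp : ∀ j, IsProbabilityMeasure (μ j) := fun j =>
    Measure.isProbabilityMeasure_map (by fun_prop)
  have hj0 : ∀ j : ℕ, (0 : ℝ) < j + 1 := fun j => by positivity
  have hpos : ∀ t : ℝ, 0 ≤ t → Tendsto (fun j => charFun (μ j) t) atTop (𝓝 (φ t)) := by
    intro t ht
    have hinv : Tendsto (fun j : ℕ => 1 / ((j : ℝ) + 1)) atTop (𝓝 0) :=
      tendsto_one_div_add_atTop_nhds_zero_nat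
    have hfl : Tendsto (fun j : ℕ => (⌊((j : ℝ) + 1) * t⌋₊ : ℝ) / (j + 1)) atTop (𝓝 t) := by
      refine tendsto_of_tendsto_of_tendsto_of_le_of_le (g := fun j : ℕ => t - 1 / ((j : ℝ) + 1))
        (h := fun _ => t) ?_ tendsto_const_nhds ?_ ?_
      · simpa using hinv.const_sub t
      · intro j
        simp only
        rw [le_div_iff₀ (hj0 j), sub_mul, one_div, inv_mul_cancel₀ (hj0 j).ne']
        have := Nat.lt_floor_add_one (((j : ℝ) + 1) * t)
        linarith
      · intro j
        simp only
        rw [div_le_iff₀ (hj0 j)]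
        have := Nat.floor_le (a := ((j : ℝ) + 1) * t) (by have := hj0 j; positivity)
        linarith
    have hmain : Tendsto (fun j => charFun (ν j) (⌊((j : ℝ) + 1) * t⌋₊ : ℝ)) atTop (𝓝 (φ t)) := by
      have h1 : Tendsto (fun j : ℕ => φ ((⌊((j : ℝ) + 1) * t⌋₊ : ℝ) / (j + 1)) *
          (1 - (((⌊((j : ℝ) + 1) * t⌋₊ : ℝ) / (j + 1) * (1 / ((j : ℝ) + 1)) : ℝ) : ℂ)))
          atTop (𝓝 (φ t)) := by
        have h2 := ((Complex.continuous_ofReal.tendsto _).comp (hfl.mul hinv)).const_sub (1 : ℂ)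
        have h3 := ((hφc.tendsto t).comp hfl).mul h2
        simpa using h3
      refine h1.congr' ?_
      filter_upwards [eventually_ge_atTop ⌈t⌉₊] with j hj
      rw [hν j]
      · congr 2
        push_cast
        have : ((j : ℂ) + 1) ≠ 0 := by exact_mod_cast (hj0 j).ne'
        field_simp
      · refine Nat.floor_le_of_le ?_
        have h4 : t ≤ j := (Nat.le_ceil t).trans (by exact_mod_cast hj)
        push_cast
        nlinarith [hj0 j]
    -- The value at `1` corresponds to the time `1/(j+1)`, so it tends to `φ 0 = 1`; by
    -- `norm_charFun_sub_sq_le` the time `(j+1)t` may then be replaced by its integer part.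
    have hone : Tendsto (fun j => 2 * (1 - (charFun (ν j) 1).re)) atTop (𝓝 0) := by
      have h1 : Tendsto (fun j : ℕ => φ (1 / ((j : ℝ) + 1)) *
          (1 - (((1 / ((j : ℝ) + 1)) * (1 / ((j : ℝ) + 1)) : ℝ) : ℂ))) atTop (𝓝 1) := by
        have h2 := ((Complex.continuous_ofReal.tendsto _).comp (hinv.mul hinv)).const_sub (1 : ℂ)
        have h3 := ((hφc.tendsto 0).comp hinv).mul h2
        simpa [hφ0] using h3
      have h4 : Tendsto (fun j => charFun (ν j) 1) atTop (𝓝 1) := by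
        refine h1.congr fun j => ?_
        have h5 := hν j 1 (Nat.one_le_pow _ _ (by omega))
        rw [Nat.cast_one] at h5
        rw [h5]
        congr 2
        push_cast
        have : ((j : ℂ) + 1) ≠ 0 := by exact_mod_cast (hj0 j).ne'
        field_simp
      have h6 := (((Complex.continuous_re.tendsto _).comp h4).const_sub 1).const_mul (2 : ℝ)
      simpa using h6
    have hdiff : Tendsto (fun j => charFun (ν j) (((j : ℝ) + 1) * t)
        - charFun (ν j) (⌊((j : ℝ) + 1) * t⌋₊ : ℝ)) atTop (𝓝 0) := by
      rw [tendsto_zero_iff_norm_tendsto_zero]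
      have h1 := hone.sqrt
      rw [Real.sqrt_zero] at h1
      refine squeeze_zero (fun j => norm_nonneg _) (fun j => ?_) h1
      refine Real.le_sqrt_of_sq_le ?_
      have h2 := Nat.floor_le (a := ((j : ℝ) + 1) * t) (by have := hj0 j; positivity)
      have h3 := Nat.lt_floor_add_one (((j : ℝ) + 1) * t)
      have := norm_charFun_sub_sq_le (hνs j) (t := (⌊((j : ℝ) + 1) * t⌋₊ : ℝ))
        (u := ((j : ℝ) + 1) * t - ⌊((j : ℝ) + 1) * t⌋₊) (by linarith) (by linarith)
      simpa using this
    have hsum := hdiff.add hmain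
    simp only [sub_add_cancel, zero_add] at hsum
    refine hsum.congr fun j => ?_
    simp only [μ, charFun_map_mul]
  have hall : ∀ t : ℝ, Tendsto (fun j => charFun (μ j) t) atTop (𝓝 (φ t)) := by
    intro t
    rcases le_total 0 t with ht | ht
    · exact hpos t ht
    · have h1 := (Complex.continuous_conj.tendsto _).comp (hpos (-t) (by linarith))
      rw [hφneg, Complex.conj_conj] at h1
      refine h1.congr fun j => ?_
      rw [Function.comp_apply, charFun_neg, Complex.conj_conj]
  -- Convergence of the characteristic functions to a function continuous at `0` gives tightness;
  -- any limit point of the measures has characteristic function `φ`.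
  have htight := isTightMeasureSet_of_tendsto_charFun (μ := μ) hcont hall
  let m : ℕ → ProbabilityMeasure ℝ := fun j => ⟨μ j, hμp j⟩
  have hcomp : IsCompact (closure (Set.range m)) := by
    refine isCompact_closure_of_isTightMeasureSet (htight.subset ?_)
    rintro _ ⟨_, ⟨j, rfl⟩, rfl⟩
    exact ⟨j, rfl⟩
  obtain ⟨μ₀, -, hμ₀⟩ := isCompact_iff_ultrafilter_le_nhds.1 hcomp
    ((Ultrafilter.of (atTop : Filter ℕ)).map m) (by
      rw [le_principal_iff]
      exact Filter.mem_map.2 (Filter.univ_mem' fun j => subset_closure ⟨j, rfl⟩))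
  refine ⟨μ₀, inferInstance, fun t => ?_⟩
  have h1 : Tendsto m (Ultrafilter.of (atTop : Filter ℕ)) (𝓝 μ₀) := hμ₀
  rw [ProbabilityMeasure.tendsto_iff_forall_integral_rclike_tendsto ℂ] at h1
  have h2 := h1 (BoundedContinuousFunction.innerProbChar t)
  have h3 : Tendsto (fun j => charFun (μ j) t) (Ultrafilter.of (atTop : Filter ℕ)) (𝓝 (φ t)) :=
    (hall t).mono_left (Ultrafilter.of_le _)
  have h4 : Tendsto (fun j => charFun (μ j) t) (Ultrafilter.of (atTop : Filter ℕ))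
      (𝓝 (charFun (μ₀ : Measure ℝ) t)) := by
    simp only [charFun_eq_integral_innerProbChar]
    exact h2
  have h5 := tendsto_nhds_unique h3 h4
  rw [charFun_apply_real] at h5
  simp only [mul_comm (t : ℂ)] at h5
  exact h5

/-- **Bochner's theorem** for matrix coefficients. -/
theorem exists_isSpectralMeasure {U : ℝ → V →ₗᵢ[ℂ] V} (hU : IsUnitaryRep U) (w : V)
    (hcont : ContinuousAt (fun t => (inner ℂ w (U t w) : ℂ)) 0) :
    ∃ τ, IsSpectralMeasure U w τ := by
  rcases eq_or_ne w 0 with rfl | hw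
  · exact ⟨0, inferInstance, fun t => by simp⟩
  have hn : (‖w‖ : ℂ) ≠ 0 := by exact_mod_cast (norm_ne_zero_iff.2 hw)
  have hin : ∀ t, inner ℂ ((‖w‖ : ℂ)⁻¹ • w) (U t ((‖w‖ : ℂ)⁻¹ • w))
      = ((‖w‖ : ℂ)⁻¹ * (‖w‖ : ℂ)⁻¹) * inner ℂ w (U t w) := by
    intro t
    rw [map_smul, inner_smul_left, inner_smul_right, map_inv₀, Complex.conj_ofReal]
    ring
  obtain ⟨τ, hτ, h⟩ := exists_isSpectralMeasure_of_norm_one hU (w := (‖w‖ : ℂ)⁻¹ • w)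
    (by rw [norm_smul, norm_inv, Complex.norm_real, norm_norm,
      inv_mul_cancel₀ (norm_ne_zero_iff.2 hw)])
    (by simp only [hin]; exact hcont.const_mul _)
  refine ⟨Real.toNNReal (‖w‖ ^ 2) • τ, inferInstance, fun t => ?_⟩
  rw [integral_smul_nnreal_measure, ← h t, hin, NNReal.smul_def, Complex.real_smul,
    Real.coe_toNNReal _ (by positivity)]
  push_cast
  field_simp

end Bochner

/-! ### Weak limits and spectral measures -/

/-- To test weak convergence of a bounded sequence it suffices to test with a set of vectors. -/
lemma tendsto_inner_of_mem_closure_span {V : Type*} [NormedAddCommGroup V]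
    [InnerProductSpace ℂ V] {ι : Type*} {l : Filter ι} {x : ι → V} {x₀ : V} {C : ℝ}
    (hC : ∀ i, ‖x i‖ ≤ C) {S : Set V} (h : ∀ s ∈ S, Tendsto (fun i => (inner ℂ s (x i) : ℂ)) l
      (𝓝 (inner ℂ s x₀))) {y : V} (hy : y ∈ (Submodule.span ℂ S).topologicalClosure) :
    Tendsto (fun i => (inner ℂ y (x i) : ℂ)) l (𝓝 (inner ℂ y x₀)) := by
  have hspan : ∀ z ∈ Submodule.span ℂ S, Tendsto (fun i => (inner ℂ z (x i) : ℂ)) l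
      (𝓝 (inner ℂ z x₀)) := by
    intro z hz
    induction hz using Submodule.span_induction with
    | mem z hz => exact h z hz
    | zero => simp [tendsto_const_nhds]
    | add a b _ _ ha hb => simp only [inner_add_left]; exact ha.add hb
    | smul c a _ ha => simp only [inner_smul_left]; exact ha.const_mul _
  rw [Metric.tendsto_nhds]
  intro ε hε
  have hC0 : 0 ≤ max C 0 + ‖x₀‖ + 1 := by positivity
  obtain ⟨z, hz, hyz⟩ := Metric.mem_closure_iff.1 hy (ε / 2 / (max C 0 + ‖x₀‖ + 1)) (by positivity)
  filter_upwards [Metric.tendsto_nhds.1 (hspan z hz) (ε / 2) (by positivity)] with i hi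
  rw [dist_eq_norm] at hi hyz ⊢
  have e : inner ℂ y (x i) - inner ℂ y x₀
      = (inner ℂ (y - z) (x i) - inner ℂ (y - z) x₀ : ℂ) + (inner ℂ z (x i) - inner ℂ z x₀) := by
    simp only [inner_sub_left]; ring
  rw [e]
  have h1 : ‖(inner ℂ (y - z) (x i) - inner ℂ (y - z) x₀ : ℂ)‖ ≤ ε / 2 := by
    refine (norm_sub_le _ _).trans ?_
    calc _ ≤ ‖y - z‖ * ‖x i‖ + ‖y - z‖ * ‖x₀‖ :=
          add_le_add (norm_inner_le_norm _ _) (norm_inner_le_norm _ _)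
      _ = ‖y - z‖ * (‖x i‖ + ‖x₀‖) := by ring
      _ ≤ (ε / 2 / (max C 0 + ‖x₀‖ + 1)) * (max C 0 + ‖x₀‖ + 1) := by
          have := (hC i).trans (le_max_left C 0)
          exact mul_le_mul hyz.le (by linarith) (by positivity) (by positivity)
      _ = ε / 2 := by field_simp
  exact (norm_add_le _ _).trans_lt (by linarith)

/-- `U(h_i) w → a w + b U(-ξ) w` weakly on the orbit of `w`. -/
def HasWeakLimit {V : Type*} [NormedAddCommGroup V] [InnerProductSpace ℂ V]
    (U : ℝ → V →ₗᵢ[ℂ] V) (w : V) {ι : Type*} (l : Filter ι) (h : ι → ℝ) (a b : ℂ) (ξ : ℝ) : Prop :=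
  ∀ t, Tendsto (fun i => (inner ℂ (U t w) (U (h i) w) : ℂ)) l
    (𝓝 (inner ℂ (U t w) (a • w + b • U (-ξ) w)))

section

variable {V : Type*} [NormedAddCommGroup V] [InnerProductSpace ℂ V]
  {U : ℝ → V →ₗᵢ[ℂ] V} {w : V} {τ : Measure ℝ} [IsFiniteMeasure τ]
  {ι : Type*} {l : Filter ι} {h : ι → ℝ} {a b : ℂ} {ξ : ℝ}

/-- In `L²(τ)` the vectors `expLp τ (h i)` have constant norm and the exponentials span a dense
subspace, so convergence against exponentials extends to all test functions. -/
lemma HasWeakLimit.tendsto_model (hl : HasWeakLimit U w l h a b ξ) (hU : IsUnitaryRep U)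
    (hτ : IsSpectralMeasure U w τ) (G : Lp ℂ 2 τ) :
    Tendsto (fun i => (inner ℂ G (expLp τ (h i)) : ℂ)) l
      (𝓝 (inner ℂ G (a • expLp τ 0 + b • expLp τ (-ξ)))) := by
  refine tendsto_inner_of_mem_closure_span (C := ‖expLp τ 0‖) (S := Set.range (expLp τ))
    (fun i => ?_) ?_ (by rw [span_expLp_dense]; trivial)
  · simp only [expLp, LinearIsometry.norm_map, le_refl]
  · rintro _ ⟨t, rfl⟩
    have h1 := hl t
    simp only [inner_add_right, inner_smul_right] at h1 ⊢
    have h2 := hτ.inner_eq hU t 0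
    rw [hU.zero] at h2
    simpa only [h2, hτ.inner_eq hU] using h1

/-- Testing with the indicator of `{s₀}` turns weak convergence into convergence at the point `s₀`.
-/
lemma HasWeakLimit.tendsto_of_atom (hl : HasWeakLimit U w l h a b ξ) (hU : IsUnitaryRep U)
    (hτ : IsSpectralMeasure U w τ) {s₀ : ℝ} (hs : τ {s₀} ≠ 0) :
    Tendsto (fun i => expi (h i) s₀) l (𝓝 (a + b * expi (-ξ) s₀)) := by
  set G : Lp ℂ 2 τ := indicatorConstLp 2 (measurableSet_singleton s₀) (measure_ne_top τ {s₀})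
    (1 : ℂ) with hG
  have hin : ∀ t, (inner ℂ G (expLp τ t) : ℂ) = τ.real {s₀} * expi t s₀ := by
    intro t
    rw [hG, L2.inner_indicatorConstLp_one]
    rw [setIntegral_congr_ae (g := fun _ => expi t s₀) (measurableSet_singleton s₀)]
    · simp [measureReal_def]
    · filter_upwards [coeFn_expLp τ t] with s h1 h2
      rw [h1, Set.mem_singleton_iff.1 h2]
  have h1 := hl.tendsto_model hU hτ G
  simp only [inner_add_right, inner_smul_right, hin] at h1
  have h0 : (τ.real {s₀} : ℂ) ≠ 0 := by
    have : τ.real {s₀} ≠ 0 := by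
      rw [measureReal_def, ENNReal.toReal_ne_zero]
      exact ⟨hs, measure_ne_top _ _⟩
    exact_mod_cast this
  have h2 := h1.const_mul (τ.real {s₀} : ℂ)⁻¹
  refine (h2.congr fun i => ?_).trans (le_of_eq ?_)
  · field_simp
  · rw [expi_zero]
    congr 1
    field_simp

/-- The density `dρ/dτ` is bounded by `1`, so it is an admissible test function in `L²(τ)`. -/
lemma HasWeakLimit.tendsto_integral_of_le (hl : HasWeakLimit U w l h a 0 ξ) (hU : IsUnitaryRep U)
    (hτ : IsSpectralMeasure U w τ) {ρ : Measure ℝ} (hρ : ρ ≤ τ) :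
    Tendsto (fun i => ∫ s, expi (h i) s ∂ρ) l (𝓝 (a * ρ.real Set.univ)) := by
  have : IsFiniteMeasure ρ := isFiniteMeasure_of_le τ hρ
  have hm : MemLp (fun s => ((ρ.rnDeriv τ s).toReal : ℂ)) 2 τ := by
    refine MemLp.of_bound (Complex.measurable_ofReal.comp
      (Measure.measurable_rnDeriv ρ τ).ennreal_toReal).aestronglyMeasurable 1 ?_
    filter_upwards [Measure.rnDeriv_le_one_of_le hρ] with s hs
    rw [Complex.norm_real, Real.norm_of_nonneg ENNReal.toReal_nonneg]
    exact ENNReal.toReal_le_of_le_ofReal zero_le_one (by simpa using hs)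
  have hin : ∀ t, (inner ℂ (hm.toLp _) (expLp τ t) : ℂ) = ∫ s, expi t s ∂ρ := by
    intro t
    rw [← integral_rnDeriv_smul hρ.absolutelyContinuous, L2.inner_def]
    refine integral_congr_ae ?_
    filter_upwards [coeFn_expLp τ t, hm.coeFn_toLp] with s h1 h2
    rw [RCLike.inner_apply, h1, h2, Complex.conj_ofReal, Complex.real_smul, mul_comm]
  have h1 := hl.tendsto_model hU hτ (hm.toLp _)
  simp only [inner_add_right, inner_smul_right, hin, expi_zero, zero_mul, add_zero] at h1
  simpa using h1

/-- Different weak limits along the same sequence imply spectral disjointness. -/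
lemma HasWeakLimit.mutuallySingular {V' : Type*} [NormedAddCommGroup V'] [InnerProductSpace ℂ V']
    {U' : ℝ → V' →ₗᵢ[ℂ] V'} {w' : V'} {τ' : Measure ℝ} [IsFiniteMeasure τ'] [l.NeBot]
    {a' : ℂ} {ξ' : ℝ} (hl : HasWeakLimit U w l h a 0 ξ)
    (hl' : HasWeakLimit U' w' l h a' 0 ξ') (hU : IsUnitaryRep U) (hU' : IsUnitaryRep U')
    (hτ : IsSpectralMeasure U w τ) (hτ' : IsSpectralMeasure U' w' τ') (haa : a ≠ a') :
    τ ⟂ₘ τ' := by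
  -- The minimum of the two measures. Being below both, it satisfies `a ρ(ℝ) = a' ρ(ℝ)`, hence
  -- vanishes.
  set ρ := τ'.withDensity fun s => min (τ.rnDeriv τ' s) 1 with hρ
  have h1 : ρ ≤ τ :=
    (withDensity_mono (Eventually.of_forall fun s => min_le_left _ _)).trans
      (Measure.withDensity_rnDeriv_le τ τ')
  have h2 : ρ ≤ τ' :=
    (withDensity_mono (Eventually.of_forall fun s => min_le_right _ _)).trans
      (withDensity_one).le
  have h3 := tendsto_nhds_unique (hl.tendsto_integral_of_le hU hτ h1)
    (hl'.tendsto_integral_of_le hU' hτ' h2)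
  have : IsFiniteMeasure ρ := isFiniteMeasure_of_le τ h1
  have h4 : ρ.real Set.univ = 0 := by
    have h5 : (a - a') * ρ.real Set.univ = 0 := by rw [sub_mul, h3, sub_self]
    rcases mul_eq_zero.1 h5 with h6 | h6
    · exact absurd (sub_eq_zero.1 h6) haa
    · exact_mod_cast h6
  have h5 : ρ = 0 := by
    rw [← Measure.measure_univ_eq_zero]
    exact (measureReal_eq_zero_iff (measure_ne_top _ _)).1 h4
  rw [← Measure.rnDeriv_eq_zero]
  rw [hρ, withDensity_eq_zero_iff
    ((Measure.measurable_rnDeriv τ τ').min measurable_const).aemeasurable] at h5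
  filter_upwards [h5] with s hs
  simp only [Pi.zero_apply] at hs ⊢
  rcases min_eq_iff.1 hs with h6 | h6
  · exact h6.1
  · exact absurd h6.1 one_ne_zero

/-- A trigonometric polynomial is real analytic; if it is not identically zero, its zeros are
isolated, hence countable. -/
lemma countable_zeros_of_trig (P : ℝ →₀ ℂ) {s₁ : ℝ} (h1 : (P.sum fun t c => c * expi t s₁) ≠ 0) :
    {s : ℝ | (P.sum fun t c => c * expi t s) = 0}.Countable := by
  have han : AnalyticOnNhd ℝ (fun s : ℝ => P.sum fun t c => c * expi t s) Set.univ := by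
    intro s _
    unfold Finsupp.sum
    refine Finset.analyticAt_fun_sum _ fun t _ => ?_
    refine analyticAt_const.mul ?_
    unfold expi
    have h2 : AnalyticAt ℝ (fun s : ℝ => (s : ℂ)) s := Complex.ofRealCLM.analyticAt s
    have h3 : AnalyticAt ℝ (fun s : ℝ => (s : ℂ) * t * Complex.I) s :=
      (h2.mul analyticAt_const).mul analyticAt_const
    exact (analyticAt_cexp.restrictScalars (𝕜 := ℝ)).fun_comp h3
  rcases han.eqOn_zero_or_eventually_ne_zero_of_preconnected isPreconnected_univ with h2 | h2
  · exact absurd (h2 (Set.mem_univ s₁)) h1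
  · have h3 : {s : ℝ | (P.sum fun t c => c * expi t s) = 0}ᶜ ∈ codiscreteWithin Set.univ := h2
    have h4 := isDiscrete_of_codiscreteWithin h3
    rw [Set.inter_univ] at h4
    exact (HereditarilyLindelofSpace.isLindelof _).countable_of_isDiscrete h4

/-- If `τ` has no atoms at the zeros of `P` and `P(U) w ≠ 0`, then `w` lies in the cyclic
subspace of `P(U) w`. -/
lemma IsSpectralMeasure.mem_cyclicSpan_of_atoms [CompleteSpace V] (hU : IsUnitaryRep U)
    (hτ : IsSpectralMeasure U w τ) (P : ℝ →₀ ℂ) (hP : trigOp U w P ≠ 0)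
    (hat : ∀ s, (P.sum fun t c => c * expi t s) = 0 → τ {s} = 0) :
    w ∈ cyclicSpan U (trigOp U w P) := by
  refine hτ.mem_cyclicSpan_trigOp hU P ?_
  by_cases hex : ∃ s₁, (P.sum fun t c => c * expi t s₁) ≠ 0
  · obtain ⟨s₁, hs₁⟩ := hex
    have hc := countable_zeros_of_trig P hs₁
    rw [ae_iff]
    simp only [ne_eq, not_not]
    exact (measure_null_iff_singleton hc).2 fun s hs => hat s hs
  · push Not at hex
    refine absurd ?_ hP
    rw [← norm_eq_zero, hτ.norm_trigOp hU, norm_eq_zero, Lp.eq_zero_iff_ae_eq_zero]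
    filter_upwards [coeFn_trigFn τ P] with s hs
    rw [hs, hex, Pi.zero_apply]

end

/-! ### Functions supported on an interval -/

/-- Bounded measurable functions that vanish outside of `[a, b)`. -/
def boxFun (a b : ℝ) : Submodule ℂ (ℝ → ℂ) where
  carrier := {f | Measurable f ∧ (∃ M, ∀ x, ‖f x‖ ≤ M) ∧ ∀ x, x ∉ Set.Ico a b → f x = 0}
  zero_mem' := ⟨measurable_const, ⟨0, fun x => by simp⟩, fun x _ => rfl⟩
  add_mem' := by
    rintro f g ⟨hf, ⟨M, hM⟩, hf0⟩ ⟨hg, ⟨N, hN⟩, hg0⟩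
    exact ⟨hf.add hg, ⟨M + N, fun x => (norm_add_le _ _).trans (add_le_add (hM x) (hN x))⟩,
      fun x hx => by rw [Pi.add_apply, hf0 x hx, hg0 x hx, add_zero]⟩
  smul_mem' := by
    rintro c f ⟨hf, ⟨M, hM⟩, hf0⟩
    refine ⟨hf.const_smul c, ⟨‖c‖ * M, fun x => ?_⟩, fun x hx => ?_⟩
    · rw [Pi.smul_apply, norm_smul]
      exact mul_le_mul_of_nonneg_left (hM x) (norm_nonneg _)
    · rw [Pi.smul_apply, hf0 x hx, smul_zero]

/-- The translate of `f` by `c`. -/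
def shift (c : ℝ) (f : ℝ → ℂ) : ℝ → ℂ := fun s => f (s - c)

/-- The inner product of two functions on `ℝ`. -/
def boxInner (f g : ℝ → ℂ) : ℂ := ∫ s, conj (f s) * g s

/-- The indicator function of `[a, b)`. -/
def boxInd (a b : ℝ) : ℝ → ℂ := (Set.Ico a b).indicator fun _ => 1

/-- `∑_{c ∈ C} β(c) f(· - c)`. -/
def raise (C : Finset ℝ) (β : ℝ → ℂ) (f : ℝ → ℂ) : ℝ → ℂ := ∑ c ∈ C, β c • shift c f

lemma shift_add (c d : ℝ) (f : ℝ → ℂ) : shift (c + d) f = shift c (shift d f) := by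
  ext s
  simp only [shift]
  ring_nf

@[simp] lemma shift_zero (f : ℝ → ℂ) : shift 0 f = f := by
  ext s
  simp [shift]

lemma shift_boxInd (c a b : ℝ) : shift c (boxInd a b) = boxInd (a + c) (b + c) := by
  ext s
  simp only [shift, boxInd, Set.indicator, Set.mem_Ico]
  congr 1
  rw [eq_iff_iff]
  constructor <;> rintro ⟨h1, h2⟩ <;> constructor <;> linarith

lemma boxFun_mono {a b a' b' : ℝ} (ha : a' ≤ a) (hb : b ≤ b') : boxFun a b ≤ boxFun a' b' :=
  fun _ hf => ⟨hf.1, hf.2.1, fun x hx => hf.2.2 x fun h => hx ⟨ha.trans h.1, h.2.trans_le hb⟩⟩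

lemma shift_mem_boxFun {a b : ℝ} {f : ℝ → ℂ} (hf : f ∈ boxFun a b) (c : ℝ) :
    shift c f ∈ boxFun (a + c) (b + c) := by
  refine ⟨hf.1.comp (measurable_id.sub_const c), ?_, fun x hx => hf.2.2 _ fun h => hx ?_⟩
  · obtain ⟨M, hM⟩ := hf.2.1
    exact ⟨M, fun x => hM _⟩
  · exact ⟨by linarith [h.1], by linarith [h.2]⟩

lemma shift_mem_boxFun_of_le {a b a' b' : ℝ} {f : ℝ → ℂ} (hf : f ∈ boxFun a b) {c : ℝ}
    (h1 : a' ≤ a + c) (h2 : b + c ≤ b') : shift c f ∈ boxFun a' b' :=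
  boxFun_mono h1 h2 (shift_mem_boxFun hf c)

lemma boxInd_mem_boxFun (a b : ℝ) : boxInd a b ∈ boxFun a b := by
  refine ⟨measurable_const.indicator measurableSet_Ico, ⟨1, fun x => ?_⟩,
    fun x hx => Set.indicator_of_notMem hx _⟩
  unfold boxInd
  rw [Set.indicator]
  split_ifs <;> simp

lemma boxInd_mem_boxFun_of_le {a b a' b' : ℝ} (h1 : a' ≤ a) (h2 : b ≤ b') :
    boxInd a b ∈ boxFun a' b' :=
  boxFun_mono h1 h2 (boxInd_mem_boxFun a b)

lemma boxInd_add {a b c : ℝ} (h1 : a ≤ b) (h2 : b ≤ c) :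
    boxInd a b + boxInd b c = boxInd a c := by
  unfold boxInd
  rw [← Set.Ico_union_Ico_eq_Ico h1 h2, Set.indicator_union_of_disjoint]
  · rfl
  · rw [Set.disjoint_left]
    intro x hx hx'
    exact absurd hx.2 (not_lt.2 hx'.1)

lemma memLp_of_mem_boxFun {a b : ℝ} {f : ℝ → ℂ} (hf : f ∈ boxFun a b) : MemLp f 2 volume := by
  obtain ⟨M, hM⟩ := hf.2.1
  have h1 : MemLp f 2 (volume.restrict (Set.Ico a b)) :=
    MemLp.of_bound hf.1.aestronglyMeasurable M (Eventually.of_forall hM)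
  rw [← memLp_indicator_iff_restrict measurableSet_Ico] at h1
  convert h1 using 1
  ext x
  by_cases hx : x ∈ Set.Ico a b
  · rw [Set.indicator_of_mem hx]
  · rw [Set.indicator_of_notMem hx, hf.2.2 x hx]

lemma integrable_boxInner {a b a' b' : ℝ} {f g : ℝ → ℂ} (hf : f ∈ boxFun a b)
    (hg : g ∈ boxFun a' b') : Integrable fun s => conj (f s) * g s := by
  have hc : MemLp (fun s => conj (f s)) 2 volume := (memLp_of_mem_boxFun hf).star
  exact hc.integrable_mul (memLp_of_mem_boxFun hg)

lemma boxInner_add_right {a b a' b' a'' b'' : ℝ} {f g g' : ℝ → ℂ} (hf : f ∈ boxFun a b)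
    (hg : g ∈ boxFun a' b') (hg' : g' ∈ boxFun a'' b'') :
    boxInner f (g + g') = boxInner f g + boxInner f g' := by
  unfold boxInner
  rw [← integral_add (integrable_boxInner hf hg) (integrable_boxInner hf hg')]
  simp only [Pi.add_apply, mul_add]

lemma boxInner_smul_right (f g : ℝ → ℂ) (c : ℂ) : boxInner f (c • g) = c * boxInner f g := by
  unfold boxInner
  rw [← integral_const_mul]
  simp only [Pi.smul_apply, smul_eq_mul]
  congr 1
  ext s
  ring

lemma boxInner_conj (f g : ℝ → ℂ) : conj (boxInner f g) = boxInner g f := by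
  unfold boxInner
  rw [← integral_conj]
  congr 1
  ext s
  simp only [map_mul, Complex.conj_conj]
  ring

lemma boxInner_self (f : ℝ → ℂ) : boxInner f f = ((∫ s, ‖f s‖ ^ 2 : ℝ) : ℂ) := by
  unfold boxInner
  rw [← integral_complex_ofReal]
  congr 1
  ext s
  rw [Complex.conj_mul']
  push_cast
  rfl

lemma boxInner_shift_shift (f g : ℝ → ℂ) (c : ℝ) :
    boxInner (shift c f) (shift c g) = boxInner f g := by
  unfold boxInner shift
  exact integral_sub_right_eq_self (fun s => conj (f s) * g s) c

lemma boxInner_sum_right {ι : Type*} (s : Finset ι) {a b a' b' : ℝ} {f : ℝ → ℂ} {g : ι → ℝ → ℂ}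
    (hf : f ∈ boxFun a b) (hg : ∀ i ∈ s, g i ∈ boxFun a' b') :
    boxInner f (∑ i ∈ s, g i) = ∑ i ∈ s, boxInner f (g i) := by
  classical
  induction s using Finset.induction_on with
  | empty => simp [boxInner]
  | insert i s hi ih =>
    rw [Finset.sum_insert hi, Finset.sum_insert hi, boxInner_add_right hf
      (hg i (Finset.mem_insert_self _ _)) (Submodule.sum_mem _ fun j hj =>
        hg j (Finset.mem_insert_of_mem hj)), ih fun j hj => hg j (Finset.mem_insert_of_mem hj)]

lemma boxInner_smul_left (f g : ℝ → ℂ) (c : ℂ) :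
    boxInner (c • f) g = conj c * boxInner f g := by
  rw [← boxInner_conj, boxInner_smul_right, map_mul, boxInner_conj]

lemma boxInner_sum_left {ι : Type*} (s : Finset ι) {a b a' b' : ℝ} {f : ℝ → ℂ} {g : ι → ℝ → ℂ}
    (hf : f ∈ boxFun a b) (hg : ∀ i ∈ s, g i ∈ boxFun a' b') :
    boxInner (∑ i ∈ s, g i) f = ∑ i ∈ s, boxInner (g i) f := by
  rw [← boxInner_conj, boxInner_sum_right s hf hg, map_sum]
  simp only [boxInner_conj]

/-! ### Towers of intervals -/

namespace CFData

variable (D : CFData)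

lemma h_le_succ (n : ℕ) : D.h n ≤ D.h (n + 1) := by
  have := D.add_le n 0 (D.zero_mem n)
  linarith

lemma h_mono : Monotone D.h := monotone_nat_of_le_succ D.h_le_succ

lemma one_le_h (n : ℕ) : 1 ≤ D.h n := D.h_zero ▸ D.h_mono (Nat.zero_le n)

lemma h_pos (n : ℕ) : 0 < D.h n := zero_lt_one.trans_le (D.one_le_h n)

lemma card_pos (n : ℕ) : 0 < (D.C (n + 1)).card := Finset.card_pos.2 ⟨0, D.zero_mem n⟩

variable {D}

lemma shift_mem {n : ℕ} {c K : ℝ} (hc : c ∈ D.C (n + 1)) {f : ℝ → ℂ}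
    (hf : f ∈ boxFun K (D.h n - K)) : shift c f ∈ boxFun K (D.h (n + 1) - K) :=
  shift_mem_boxFun_of_le hf (by linarith [D.nonneg n c hc]) (by linarith [D.add_le n c hc])

lemma shift_mem_zero {n : ℕ} {c : ℝ} (hc : c ∈ D.C (n + 1)) {f : ℝ → ℂ}
    (hf : f ∈ boxFun 0 (D.h n)) : shift c f ∈ boxFun 0 (D.h (n + 1)) := by
  have := shift_mem (K := 0) hc (f := f) (by simpa using hf)
  simpa using this

lemma raise_mem {n : ℕ} {K : ℝ} (β : ℝ → ℂ) {f : ℝ → ℂ}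
    (hf : f ∈ boxFun K (D.h n - K)) : raise (D.C (n + 1)) β f ∈ boxFun K (D.h (n + 1) - K) :=
  Submodule.sum_mem _ fun _ hc => Submodule.smul_mem _ _ (shift_mem hc hf)

lemma raise_mem_zero {n : ℕ} (β : ℝ → ℂ) {f : ℝ → ℂ}
    (hf : f ∈ boxFun 0 (D.h n)) : raise (D.C (n + 1)) β f ∈ boxFun 0 (D.h (n + 1)) :=
  Submodule.sum_mem _ fun _ hc => Submodule.smul_mem _ _ (shift_mem_zero hc hf)

lemma eq_of_mem_Ico {n : ℕ} {c c' s : ℝ} (hc : c ∈ D.C (n + 1)) (hc' : c' ∈ D.C (n + 1))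
    (h1 : s - c ∈ Set.Ico 0 (D.h n)) (h2 : s - c' ∈ Set.Ico 0 (D.h n)) : c = c' := by
  by_contra hne
  have h3 : Disjoint (Set.Ico c (D.h n + c)) (Set.Ico c' (D.h n + c')) := D.disjoint n hc hc' hne
  exact (Set.disjoint_left.1 h3 : ∀ ⦃a⦄, _ → a ∉ _) (a := s) ⟨by linarith [h1.1], by linarith [h1.2]⟩
    ⟨by linarith [h2.1], by linarith [h2.2]⟩

lemma boxInner_shift_of_ne {n : ℕ} {c c' : ℝ} (hc : c ∈ D.C (n + 1)) (hc' : c' ∈ D.C (n + 1))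
    (hne : c ≠ c') {f g : ℝ → ℂ} (hf : f ∈ boxFun 0 (D.h n)) (hg : g ∈ boxFun 0 (D.h n)) :
    boxInner (shift c f) (shift c' g) = 0 := by
  unfold boxInner shift
  rw [← integral_zero ℝ ℂ (μ := volume)]
  congr 1
  ext s
  by_cases h1 : s - c ∈ Set.Ico 0 (D.h n)
  · by_cases h2 : s - c' ∈ Set.Ico 0 (D.h n)
    · exact absurd (eq_of_mem_Ico hc hc' h1 h2) hne
    · rw [hg.2.2 _ h2, mul_zero]
  · rw [hf.2.2 _ h1, map_zero, zero_mul]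

/-- The copies of the tower are disjoint, so only the diagonal terms of the double sum remain. -/
lemma boxInner_raise {n : ℕ} (β γ : ℝ → ℂ) {f g : ℝ → ℂ} (hf : f ∈ boxFun 0 (D.h n))
    (hg : g ∈ boxFun 0 (D.h n)) :
    boxInner (raise (D.C (n + 1)) β f) (raise (D.C (n + 1)) γ g)
      = (∑ c ∈ D.C (n + 1), conj (β c) * γ c) * boxInner f g := by
  rw [raise, boxInner_sum_left _ (raise_mem_zero γ hg)
    (fun c hc => Submodule.smul_mem _ _ (shift_mem_zero hc hf)), Finset.sum_mul]
  refine Finset.sum_congr rfl fun c hc => ?_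
  rw [boxInner_smul_left, raise, boxInner_sum_right _ (shift_mem_zero hc hf)
    (fun c hc => Submodule.smul_mem _ _ (shift_mem_zero hc hg)),
    Finset.sum_eq_single_of_mem c hc, boxInner_smul_right, boxInner_shift_shift]
  · ring
  · intro c' hc' hne
    rw [boxInner_smul_right, boxInner_shift_of_ne hc hc' hne.symm hf hg, mul_zero]

lemma norm_raise_le {n : ℕ} {β : ℝ → ℂ} (hβ : ∀ c ∈ D.C (n + 1), ‖β c‖ ≤ 1) {f : ℝ → ℂ}
    (hf : f ∈ boxFun 0 (D.h n)) {M : ℝ} (hM : ∀ x, ‖f x‖ ≤ M) (x : ℝ) :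
    ‖raise (D.C (n + 1)) β f x‖ ≤ M := by
  have hM0 : 0 ≤ M := (norm_nonneg _).trans (hM 0)
  unfold raise
  rw [Finset.sum_apply]
  by_cases hex : ∃ c ∈ D.C (n + 1), x - c ∈ Set.Ico 0 (D.h n)
  · obtain ⟨c, hc, hx⟩ := hex
    rw [Finset.sum_eq_single_of_mem c hc]
    · rw [Pi.smul_apply, norm_smul]
      calc _ ≤ 1 * M := mul_le_mul (hβ c hc) (hM _) (norm_nonneg _) zero_le_one
        _ = M := one_mul M
    · intro c' hc' hne
      rw [Pi.smul_apply, shift, hf.2.2 _ fun h => hne (eq_of_mem_Ico hc' hc h hx), smul_zero]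
  · rw [Finset.sum_eq_zero, norm_zero]
    · exact hM0
    · intro c hc
      rw [Pi.smul_apply, shift, hf.2.2 _ fun h => hex ⟨c, hc, h⟩, smul_zero]

end CFData

/-- The normalizing constants of the invariant measure of a `(C,F)`-flow. -/
structure CFData.IsWeight (D : CFData) (w : ℕ → ℝ) : Prop where
  pos : ∀ n, 0 < w n
  succ : ∀ n, w n = (D.C (n + 1)).card * w (n + 1)
  tendsto : Tendsto (fun n => w n * D.h n) atTop (𝓝 1)
  h_tendsto : Tendsto D.h atTop atTop

/-- The products `w n * D.h n` converge while the heights tend to infinity. Consequently pieces of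
bounded length at the ends of a tower are negligible in the limit. -/
lemma CFData.IsWeight.tendsto_zero {D : CFData} {w : ℕ → ℝ} (hw : D.IsWeight w) :
    Tendsto w atTop (𝓝 0) := by
  have h1 := hw.tendsto.mul (tendsto_inv_atTop_zero.comp hw.h_tendsto)
  rw [mul_zero] at h1
  refine h1.congr fun n => ?_
  have := (D.h_pos n).ne'
  simp only [Function.comp_apply]
  field_simp

/-! ### Rank one representations -/

/-- A representation `U` of `ℝ` with isometric (up to the factors `w n`) images of the towers
`L²([0, h n))`, on which `U` acts by translations as long as these make sense. The towers are
nested by means of the coefficients `β`. -/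
structure IsRankOne (D : CFData) (w : ℕ → ℝ) {V : Type*} [NormedAddCommGroup V]
    [InnerProductSpace ℂ V] (U : ℝ → V →ₗᵢ[ℂ] V) (β : ℕ → ℝ → ℂ) (E : ℕ → (ℝ → ℂ) → V) :
    Prop where
  weight : D.IsWeight w
  rep : IsUnitaryRep U
  map_add : ∀ n, ∀ f ∈ boxFun 0 (D.h n), ∀ g ∈ boxFun 0 (D.h n), E n (f + g) = E n f + E n g
  map_smul : ∀ n (c : ℂ), ∀ f ∈ boxFun 0 (D.h n), E n (c • f) = c • E n f
  inner_map : ∀ n, ∀ f ∈ boxFun 0 (D.h n), ∀ g ∈ boxFun 0 (D.h n),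
    inner ℂ (E n f) (E n g) = w n * boxInner f g
  translate : ∀ n t, ∀ f ∈ boxFun 0 (D.h n), shift t f ∈ boxFun 0 (D.h n) →
    U t (E n f) = E n (shift t f)
  refine : ∀ n, ∀ f ∈ boxFun 0 (D.h n),
    E n f = E (n + 1) (raise (D.C (n + 1)) (β (n + 1)) f)
  norm_coeff : ∀ n, ∀ c ∈ D.C (n + 1), ‖β (n + 1) c‖ = 1

namespace IsRankOne

variable {D : CFData} {w : ℕ → ℝ} {V : Type*} [NormedAddCommGroup V] [InnerProductSpace ℂ V]
  {U : ℝ → V →ₗᵢ[ℂ] V} {β : ℕ → ℝ → ℂ} {E : ℕ → (ℝ → ℂ) → V}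

lemma map_zero (H : IsRankOne D w U β E) (n : ℕ) : E n 0 = 0 := by
  have := H.map_smul n 0 0 (Submodule.zero_mem _)
  simpa using this

lemma map_sub (H : IsRankOne D w U β E) (n : ℕ) {f g : ℝ → ℂ} (hf : f ∈ boxFun 0 (D.h n))
    (hg : g ∈ boxFun 0 (D.h n)) : E n (f - g) = E n f - E n g := by
  have h1 := H.map_add n (f - g) (Submodule.sub_mem _ hf hg) g hg
  rw [sub_add_cancel] at h1
  rw [h1, add_sub_cancel_right]

lemma map_sum (H : IsRankOne D w U β E) (n : ℕ) {ι : Type*} (s : Finset ι) {g : ι → ℝ → ℂ}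
    (hg : ∀ i ∈ s, g i ∈ boxFun 0 (D.h n)) : E n (∑ i ∈ s, g i) = ∑ i ∈ s, E n (g i) := by
  classical
  induction s using Finset.induction_on with
  | empty => simp [H.map_zero]
  | insert i s hi ih =>
    rw [Finset.sum_insert hi, Finset.sum_insert hi, H.map_add n _
      (hg i (Finset.mem_insert_self _ _)) _ (Submodule.sum_mem _ fun j hj =>
        hg j (Finset.mem_insert_of_mem hj)), ih fun j hj => hg j (Finset.mem_insert_of_mem hj)]

lemma map_raise (H : IsRankOne D w U β E) (n : ℕ) (γ : ℝ → ℂ) {f : ℝ → ℂ}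
    (hf : f ∈ boxFun 0 (D.h n)) : E (n + 1) (raise (D.C (n + 1)) γ f)
      = ∑ c ∈ D.C (n + 1), γ c • E (n + 1) (shift c f) := by
  unfold raise
  rw [H.map_sum _ _ fun c hc => Submodule.smul_mem _ _ (CFData.shift_mem_zero hc hf)]
  exact Finset.sum_congr rfl fun c hc => H.map_smul _ _ _ (CFData.shift_mem_zero hc hf)

lemma norm_sq_map (H : IsRankOne D w U β E) (n : ℕ) {f : ℝ → ℂ} (hf : f ∈ boxFun 0 (D.h n)) :
    ‖E n f‖ ^ 2 = w n * ∫ s, ‖f s‖ ^ 2 := by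
  have h1 := H.inner_map n f hf f hf
  rw [boxInner_self, inner_self_eq_norm_sq_to_K] at h1
  exact Complex.ofReal_injective (by simpa using h1)

lemma norm_map_le (H : IsRankOne D w U β E) (n : ℕ) {f : ℝ → ℂ} (hf : f ∈ boxFun 0 (D.h n))
    {M a b : ℝ} (hM : ∀ x, ‖f x‖ ≤ M) (hab : a ≤ b) (h0 : ∀ x, x ∉ Set.Ico a b → f x = 0) :
    ‖E n f‖ ≤ M * √(w n * (b - a)) := by
  have hM0 : 0 ≤ M := (norm_nonneg _).trans (hM 0)
  have hw := (H.weight.pos n).le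
  rw [← Real.sqrt_sq hM0, ← Real.sqrt_mul (sq_nonneg M), ← Real.sqrt_sq (norm_nonneg (E n f))]
  refine Real.sqrt_le_sqrt ?_
  rw [H.norm_sq_map n hf, mul_left_comm]
  refine mul_le_mul_of_nonneg_left ?_ hw
  have h1 : ∀ s, ‖f s‖ ^ 2 ≤ (Set.Ico a b).indicator (fun _ => M ^ 2) s := by
    intro s
    by_cases hs : s ∈ Set.Ico a b
    · rw [Set.indicator_of_mem hs]
      exact pow_le_pow_left₀ (norm_nonneg _) (hM s) 2
    · rw [Set.indicator_of_notMem hs, h0 s hs]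
      simp
  calc ∫ s, ‖f s‖ ^ 2 ≤ ∫ s, (Set.Ico a b).indicator (fun _ => M ^ 2) s := by
        refine integral_mono_of_nonneg (Eventually.of_forall fun s => by positivity) ?_
          (Eventually.of_forall h1)
        rw [integrable_indicator_iff measurableSet_Ico]
        exact integrableOn_const (by simp)
    _ = M ^ 2 * (b - a) := by
        rw [integral_indicator measurableSet_Ico, setIntegral_const, measureReal_def,
          Real.volume_Ico, ENNReal.toReal_ofReal (by linarith), smul_eq_mul, mul_comm]

lemma norm_map_boxInd_le (H : IsRankOne D w U β E) (n : ℕ) {a b : ℝ} (ha : 0 ≤ a) (hab : a ≤ b)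
    (hb : b ≤ D.h n) : ‖E n (boxInd a b)‖ ≤ √(w n * (b - a)) := by
  have := H.norm_map_le n (boxInd_mem_boxFun_of_le ha hb) (M := 1) (fun x => by
    unfold boxInd
    rw [Set.indicator]
    split_ifs <;> simp) hab (boxInd_mem_boxFun a b).2.2
  rwa [one_mul] at this

/-- The closed subspace generated by the towers. -/
def _root_.SpectralMult.towerSpan (D : CFData) (E : ℕ → (ℝ → ℂ) → V) : Submodule ℂ V :=
  (Submodule.span ℂ {x | ∃ n a b, 0 ≤ a ∧ a ≤ b ∧ b ≤ D.h n ∧ x = E n (boxInd a b)}).topologicalClosure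

/-- Every function on a tower can be lifted to every higher tower. -/
lemma exists_lift (H : IsRankOne D w U β E) {n m : ℕ} (hnm : n ≤ m) {K M : ℝ} (hK : 0 ≤ K)
    {f : ℝ → ℂ} (hf : f ∈ boxFun K (D.h n - K)) (hM : ∀ x, ‖f x‖ ≤ M) :
    ∃ g ∈ boxFun K (D.h m - K), (∀ x, ‖g x‖ ≤ M) ∧ E n f = E m g := by
  induction m, hnm using Nat.le_induction with
  | base => exact ⟨f, hf, hM, rfl⟩
  | succ m hm ih =>
    obtain ⟨g, hg, hgM, hE⟩ := ih
    have hg0 : g ∈ boxFun 0 (D.h m) := boxFun_mono hK (by linarith) hg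
    exact ⟨raise (D.C (m + 1)) (β (m + 1)) g, CFData.raise_mem _ hg,
      CFData.norm_raise_le (fun c hc => (H.norm_coeff m c hc).le) hg0 hgM,
      hE.trans (H.refine m g hg0)⟩

/-- Functions that vanish near the ends of the towers suffice. -/
lemma mem_closure_cut (H : IsRankOne D w U β E) {n : ℕ} {f : ℝ → ℂ}
    (hf : f ∈ boxFun 0 (D.h n)) {K : ℝ} (hK : 0 ≤ K) :
    E n f ∈ closure {x | ∃ m, ∃ g ∈ boxFun K (D.h m - K), x = E m g} := by
  obtain ⟨M, hM⟩ := hf.2.1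
  have hM0 : 0 ≤ M := (norm_nonneg _).trans (hM 0)
  rw [Metric.mem_closure_iff]
  intro ε hε
  have h1 : Tendsto (fun m => 2 * (M * √(w m * K))) atTop (𝓝 0) := by
    have h2 := ((H.weight.tendsto_zero.mul_const K).sqrt.const_mul M).const_mul 2
    simpa using h2
  -- In a tower this high the two end pieces of length `K` together have norm less than `ε`,
  -- whatever function bounded by `M` sits there.
  obtain ⟨m, hm1, hm2, hm3⟩ := ((h1.eventually_lt_const hε).and
    ((eventually_ge_atTop n).and (H.weight.h_tendsto.eventually_ge_atTop (2 * K)))).exists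
  obtain ⟨g, hg, hgM, hE⟩ := H.exists_lift hm2 le_rfl (by simpa using hf) hM
  rw [sub_zero] at hg
  have hcut : ∀ a b, 0 ≤ a → b ≤ D.h m → (Set.Ico a b).indicator g ∈ boxFun a b ∧
      ∀ x, ‖(Set.Ico a b).indicator g x‖ ≤ M := by
    intro a b _ _
    have hb : ∀ x, ‖(Set.Ico a b).indicator g x‖ ≤ M := fun x =>
      (norm_indicator_le_norm_self _ _).trans (hgM x)
    exact ⟨⟨hg.1.indicator measurableSet_Ico, ⟨M, hb⟩,
      fun x hx => Set.indicator_of_notMem hx _⟩, hb⟩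
  obtain ⟨ha, haM⟩ := hcut 0 K le_rfl (by linarith)
  obtain ⟨hb, hbM⟩ := hcut K (D.h m - K) hK (by linarith)
  obtain ⟨hc, hcM⟩ := hcut (D.h m - K) (D.h m) (by linarith) le_rfl
  have hsum : g = (Set.Ico 0 K).indicator g + (Set.Ico K (D.h m - K)).indicator g
      + (Set.Ico (D.h m - K) (D.h m)).indicator g := by
    ext x
    simp only [Pi.add_apply, Set.indicator, Set.mem_Ico]
    by_cases hx : x ∈ Set.Ico 0 (D.h m)
    · rcases lt_or_ge x K with h3 | h3
      · rw [if_pos ⟨hx.1, h3⟩, if_neg (by rintro ⟨h4, _⟩; linarith),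
          if_neg (by rintro ⟨h4, _⟩; linarith)]
        ring
      · rcases lt_or_ge x (D.h m - K) with h4 | h4
        · rw [if_neg (by rintro ⟨_, h5⟩; linarith), if_pos ⟨h3, h4⟩,
            if_neg (by rintro ⟨h5, _⟩; linarith)]
          ring
        · rw [if_neg (by rintro ⟨_, h5⟩; linarith), if_neg (by rintro ⟨_, h5⟩; linarith),
            if_pos ⟨h4, hx.2⟩]
          ring
    · rw [hg.2.2 x hx]
      simp
  refine ⟨E m ((Set.Ico K (D.h m - K)).indicator g), ⟨m, _, hb, rfl⟩, ?_⟩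
  have ha0 := boxFun_mono le_rfl (by linarith : K ≤ D.h m) ha
  have hb0 := boxFun_mono hK (by linarith : D.h m - K ≤ D.h m) hb
  have hc0 := boxFun_mono (by linarith : 0 ≤ D.h m - K) le_rfl hc
  have hE2 : E m g = E m ((Set.Ico 0 K).indicator g) + E m ((Set.Ico K (D.h m - K)).indicator g)
      + E m ((Set.Ico (D.h m - K) (D.h m)).indicator g) := by
    rw [← H.map_add m _ ha0 _ hb0, ← H.map_add m _ (Submodule.add_mem _ ha0 hb0) _ hc0, ← hsum]
  rw [hE, dist_eq_norm, hE2]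
  have e : ∀ x y z : V, x + y + z - y = x + z := fun x y z => by abel
  rw [e]
  refine (norm_add_le _ _).trans_lt ?_
  have h3 := H.norm_map_le m ha0 haM hK ha.2.2
  have h4 := H.norm_map_le m hc0 hcM (by linarith : D.h m - K ≤ D.h m) hc.2.2
  rw [sub_zero] at h3
  rw [sub_sub_cancel] at h4
  linarith

end IsRankOne

/-! ### Translations by the height of a tower and their weak limits -/

namespace IsRankOne

variable {D : CFData} {w : ℕ → ℝ} {V : Type*} [NormedAddCommGroup V] [InnerProductSpace ℂ V]
  {U : ℝ → V →ₗᵢ[ℂ] V} {β : ℕ → ℝ → ℂ} {E : ℕ → (ℝ → ℂ) → V}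

lemma inner_map_raise (H : IsRankOne D w U β E) (n : ℕ) (γ : ℝ → ℂ) {f g : ℝ → ℂ}
    (hf : f ∈ boxFun 0 (D.h n)) (hg : g ∈ boxFun 0 (D.h n)) :
    inner ℂ (E n f) (E (n + 1) (raise (D.C (n + 1)) γ g))
      = ((D.C (n + 1)).card : ℂ)⁻¹ * (∑ c ∈ D.C (n + 1), conj (β (n + 1) c) * γ c)
        * inner ℂ (E n f) (E n g) := by
  rw [H.refine n f hf, H.inner_map _ _ (CFData.raise_mem_zero _ hf) _ (CFData.raise_mem_zero _ hg),
    CFData.boxInner_raise _ _ hf hg, ← H.refine n f hf, H.inner_map n f hf g hg, H.weight.succ n]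
  have : ((D.C (n + 1)).card : ℂ) ≠ 0 := by exact_mod_cast (D.card_pos n).ne'
  push_cast
  field_simp

/-- All copies have the same norm and are orthogonal. A single copy is therefore negligible when
there are many of them, which bounds the copy pushed out of the tower by a translation. -/
lemma norm_map_shift (H : IsRankOne D w U β E) (n : ℕ) {c : ℝ} (hc : c ∈ D.C (n + 1)) {f : ℝ → ℂ}
    (hf : f ∈ boxFun 0 (D.h n)) :
    ‖E (n + 1) (shift c f)‖ = ‖E n f‖ / √(D.C (n + 1)).card := by
  have h0 : (0 : ℝ) < (D.C (n + 1)).card := by exact_mod_cast D.card_pos n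
  have h1 : ‖E (n + 1) (shift c f)‖ ^ 2 = (‖E n f‖ / √(D.C (n + 1)).card) ^ 2 := by
    rw [div_pow, Real.sq_sqrt h0.le, H.norm_sq_map _ (CFData.shift_mem_zero hc hf),
      H.norm_sq_map _ hf, H.weight.succ n]
    have : ∫ s, ‖shift c f s‖ ^ 2 = ∫ s, ‖f s‖ ^ 2 :=
      integral_sub_right_eq_self (fun s => ‖f s‖ ^ 2) c
    rw [this]
    field_simp
  exact (sq_eq_sq₀ (norm_nonneg _) (by positivity)).1 h1

/-- Translation by the height of the tower, when `C_{n+1}` is an arithmetic progression. -/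
lemma norm_inner_translate_sub_le (H : IsRankOne D w U β E) {n r : ℕ} (hr : 0 < r)
    (hC : D.C (n + 1) = (Finset.range r).image fun j : ℕ => (j : ℝ) * D.h n)
    {f g : ℝ → ℂ} (hf : f ∈ boxFun 0 (D.h n)) (hg : g ∈ boxFun 0 (D.h n)) :
    ‖inner ℂ (E n f) (U (D.h n) (E n g)) - ((D.C (n + 1)).card : ℂ)⁻¹ *
      (∑ c ∈ (D.C (n + 1)).filter fun c => c - D.h n ∈ D.C (n + 1),
        conj (β (n + 1) c) * β (n + 1) (c - D.h n)) * inner ℂ (E n f) (E n g)‖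
      ≤ ‖E n f‖ * ‖E n g‖ / √r := by
  classical
  have hh := D.h_pos n
  have hinj : Function.Injective fun j : ℕ => (j : ℝ) * D.h n := fun i j hij => by
    have := mul_right_cancel₀ hh.ne' hij
    exact_mod_cast this
  have hcard : (D.C (n + 1)).card = r := by
    rw [hC, Finset.card_image_of_injective _ hinj, Finset.card_range]
  have hmem : ∀ j : ℕ, (j : ℝ) * D.h n ∈ D.C (n + 1) ↔ j < r := by
    intro j
    rw [hC, Finset.mem_image]
    constructor
    · rintro ⟨i, hi, hij⟩
      rw [← hinj hij]
      exact Finset.mem_range.1 hi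
    · intro hj
      exact ⟨j, Finset.mem_range.2 hj, rfl⟩
  set top : ℝ := ((r - 1 : ℕ) : ℝ) * D.h n with htop
  have htopC : top ∈ D.C (n + 1) := (hmem _).2 (by omega)
  -- Translation by `D.h n` moves the copy at `c - D.h n` to `c`, so `β (c - D.h n)` becomes the
  -- coefficient at `c`. The top copy has no successor and is split off as an error term.
  set γ : ℝ → ℂ := fun c => if c - D.h n ∈ D.C (n + 1) then β (n + 1) (c - D.h n) else 0 with hγ
  have hmain : U (D.h n) (E n g) = E (n + 1) (raise (D.C (n + 1)) γ g)
      + β (n + 1) top • U (D.h n) (E (n + 1) (shift top g)) := by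
    rw [H.refine n g hg, H.map_raise n _ hg, H.map_raise n _ hg, _root_.map_sum,
      ← Finset.sum_erase_add _ _ htopC, _root_.map_smul]
    congr 1
    have h1 : ∑ c ∈ D.C (n + 1), γ c • E (n + 1) (shift c g)
        = ∑ c ∈ (D.C (n + 1)).filter (fun c => c - D.h n ∈ D.C (n + 1)),
          β (n + 1) (c - D.h n) • E (n + 1) (shift c g) := by
      rw [Finset.sum_filter]
      refine Finset.sum_congr rfl fun c _ => ?_
      simp only [hγ]
      split_ifs <;> simp
    rw [h1]
    refine Finset.sum_bij (fun c _ => c + D.h n) ?_ ?_ ?_ ?_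
    · intro c hc
      obtain ⟨hne, hc⟩ := Finset.mem_erase.1 hc
      rw [Finset.mem_filter, add_sub_cancel_right]
      refine ⟨?_, hc⟩
      rw [hC] at hc
      obtain ⟨j, hj, rfl⟩ := Finset.mem_image.1 hc
      have h2 : j ≠ r - 1 := fun h => hne (by rw [htop, h])
      have := Finset.mem_range.1 hj
      have h3 := (hmem (j + 1)).2 (by omega)
      push_cast at h3
      rwa [add_mul, one_mul] at h3
    · intro c _ c' _ h
      exact add_right_cancel h
    · intro c hc
      obtain ⟨hc, hc'⟩ := Finset.mem_filter.1 hc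
      refine ⟨c - D.h n, Finset.mem_erase.2 ⟨fun h => ?_, hc'⟩, sub_add_cancel _ _⟩
      have h3 : c = ((r : ℕ) : ℝ) * D.h n := by
        rw [sub_eq_iff_eq_add] at h
        rw [h, htop, Nat.cast_sub (by omega : 1 ≤ r)]
        push_cast
        ring
      rw [h3, hmem] at hc
      omega
    · intro c hc
      obtain ⟨hne, hc⟩ := Finset.mem_erase.1 hc
      rw [add_sub_cancel_right, _root_.map_smul]
      congr 1
      have h2 : c + D.h n ∈ D.C (n + 1) := by
        rw [hC] at hc
        obtain ⟨j, hj, rfl⟩ := Finset.mem_image.1 hc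
        have h2 : j ≠ r - 1 := fun h => hne (by rw [htop, h])
        have := Finset.mem_range.1 hj
        have h3 := (hmem (j + 1)).2 (by omega)
        push_cast at h3
        rwa [add_mul, one_mul] at h3
      rw [add_comm c, shift_add]
      refine H.translate (n + 1) _ _ (CFData.shift_mem_zero hc hg) ?_
      rw [← shift_add, add_comm _ c]
      exact CFData.shift_mem_zero h2 hg
  have hsum : ∑ c ∈ D.C (n + 1), conj (β (n + 1) c) * γ c
      = ∑ c ∈ (D.C (n + 1)).filter fun c => c - D.h n ∈ D.C (n + 1),
        conj (β (n + 1) c) * β (n + 1) (c - D.h n) := by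
    rw [Finset.sum_filter]
    refine Finset.sum_congr rfl fun c _ => ?_
    simp only [hγ]
    split_ifs <;> simp
  rw [hmain, inner_add_right, H.inner_map_raise n γ hf hg, hsum, add_sub_cancel_left,
    inner_smul_right, norm_mul, H.norm_coeff n top htopC, one_mul]
  refine (norm_inner_le_norm _ _).trans ?_
  rw [LinearIsometry.norm_map, H.norm_map_shift n htopC hg, hcard, mul_div_assoc]

/-- Translation by the height of the tower, when `C_{n+1}` is the union of two arithmetic
progressions with slightly different steps. -/
lemma norm_inner_translate_sub_le_of_two_steps (H : IsRankOne D w U β E) {n : ℕ} (hn : 0 < n)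
    {ξ : ℝ} (hξ : 0 < ξ)
    (hC : D.C (n + 1) = (Finset.range n).image (fun j : ℕ => (j : ℝ) * D.h n) ∪
      (Finset.range n).image (fun j : ℕ => (j : ℝ) * (D.h n + ξ) + n * D.h n))
    (hβ : ∀ c ∈ D.C (n + 1), β (n + 1) c = 1)
    {f g : ℝ → ℂ} (hf : f ∈ boxFun 0 (D.h n)) (hfξ : shift ξ f ∈ boxFun 0 (D.h n))
    (hg : g ∈ boxFun 0 (D.h n)) :
    ‖inner ℂ (E n f) (U (D.h n) (E n g)) -
      inner ℂ (E n f) ((1 / 2 : ℂ) • E n g + (1 / 2 : ℂ) • U (-ξ) (E n g))‖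
      ≤ ‖E n f‖ * ‖E n g‖ / √n + ‖E n f‖ * ‖E n g‖ / n := by
  classical
  have hh := D.h_pos n
  have hn' : (0 : ℝ) < n := by exact_mod_cast hn
  set p : ℕ → ℝ := fun j => (j : ℝ) * D.h n with hp
  set q : ℕ → ℝ := fun j => (j : ℝ) * (D.h n + ξ) + n * D.h n with hq
  have hpinj : Function.Injective p := fun i j hij => by
    have := mul_right_cancel₀ hh.ne' hij
    exact_mod_cast this
  have hqinj : Function.Injective q := fun i j hij => by
    have := mul_right_cancel₀ (by positivity : D.h n + ξ ≠ 0) (add_right_cancel hij)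
    exact_mod_cast this
  have hdisj : Disjoint ((Finset.range n).image p) ((Finset.range n).image q) := by
    rw [Finset.disjoint_left]
    rintro x hx hx'
    obtain ⟨i, hi, rfl⟩ := Finset.mem_image.1 hx
    obtain ⟨j, hj, hij⟩ := Finset.mem_image.1 hx'
    have h1 : (i : ℝ) < n := by exact_mod_cast Finset.mem_range.1 hi
    have h2 : (0 : ℝ) ≤ j * (D.h n + ξ) := by positivity
    simp only [hp, hq] at hij
    nlinarith
  have hsumC : ∀ F : ℝ → V, ∑ c ∈ D.C (n + 1), F c
      = ∑ j ∈ Finset.range n, F (p j) + ∑ j ∈ Finset.range n, F (q j) := by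
    intro F
    rw [hC, Finset.sum_union hdisj, Finset.sum_image hpinj.injOn, Finset.sum_image hqinj.injOn]
  have hpC : ∀ j < n, p j ∈ D.C (n + 1) := fun j hj => by
    rw [hC]
    exact Finset.mem_union_left _ (Finset.mem_image_of_mem _ (Finset.mem_range.2 hj))
  have hqC : ∀ j < n, q j ∈ D.C (n + 1) := fun j hj => by
    rw [hC]
    exact Finset.mem_union_right _ (Finset.mem_image_of_mem _ (Finset.mem_range.2 hj))
  have hpC' : ∀ j < n, p (j + 1) ∈ D.C (n + 1) := fun j hj => by
    rcases Nat.lt_or_ge (j + 1) n with h | h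
    · exact hpC _ h
    · have : p (j + 1) = q 0 := by
        have : j + 1 = n := by omega
        simp [hp, hq, this]
      rw [this]
      exact hqC 0 hn
  have hcard : (D.C (n + 1)).card = 2 * n := by
    rw [hC, Finset.card_union_of_disjoint hdisj, Finset.card_image_of_injective _ hpinj,
      Finset.card_image_of_injective _ hqinj, Finset.card_range]
    ring
  have hone : ∀ {f' : ℝ → ℂ}, f' ∈ boxFun 0 (D.h n) →
      E n f' = ∑ c ∈ D.C (n + 1), E (n + 1) (shift c f') := by
    intro f' hf'
    rw [H.refine n f' hf', H.map_raise n _ hf']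
    exact Finset.sum_congr rfl fun c hc => by rw [hβ c hc, one_smul]
  have hin : ∀ {f' : ℝ → ℂ}, f' ∈ boxFun 0 (D.h n) → ∀ c ∈ D.C (n + 1),
      inner ℂ (E n f') (E (n + 1) (shift c g)) = (2 * n : ℂ)⁻¹ * inner ℂ (E n f') (E n g) := by
    intro f' hf' c hc
    have h1 := H.inner_map_raise n (fun c' => if c' = c then 1 else 0) hf' hg
    rw [H.map_raise n _ hg, hcard] at h1
    simp only [ite_smul, one_smul, zero_smul, Finset.sum_ite_eq', hc, if_true, mul_ite, mul_one,
      mul_zero, hβ c hc, _root_.map_one] at h1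
    rw [h1]
    push_cast
    ring
  obtain ⟨k, rfl⟩ : ∃ k, n = k + 1 := ⟨n - 1, by omega⟩
  set n := k + 1 with hnk
  -- The copies of the first progression move exactly onto their successors, the last one onto the
  -- first copy `q 0` of the second progression. In the second progression the step is `D.h n + ξ`,
  -- so a translation by `D.h n` falls short of the successor by `ξ`. The last copy is left over.
  have hmain : U (D.h n) (E n g) = ∑ j ∈ Finset.range n, E (n + 1) (shift (p (j + 1)) g)
      + (∑ j ∈ Finset.range k, U (-ξ) (E (n + 1) (shift (q (j + 1)) g))
      + U (D.h n) (E (n + 1) (shift (q k) g))) := by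
    rw [hone hg, hsumC, _root_.map_add, _root_.map_sum, _root_.map_sum]
    congr 1
    · refine Finset.sum_congr rfl fun j hj => ?_
      have hj := Finset.mem_range.1 hj
      have h2 : p (j + 1) = D.h n + p j := by simp only [hp]; push_cast; ring
      rw [h2, shift_add]
      refine H.translate (n + 1) _ _ (CFData.shift_mem_zero (hpC j hj) hg) ?_
      rw [← shift_add, ← h2]
      exact CFData.shift_mem_zero (hpC' j hj) hg
    · rw [hnk, Finset.sum_range_succ, ← hnk]
      congr 1
      refine Finset.sum_congr rfl fun j hj => ?_
      have hj := Finset.mem_range.1 hj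
      have h2 : q (j + 1) = (D.h n + ξ) + q j := by simp only [hq]; push_cast; ring
      have h3 : U (D.h n + ξ) (E (n + 1) (shift (q j) g)) = E (n + 1) (shift (q (j + 1)) g) := by
        rw [h2, shift_add (D.h n + ξ) (q j) g]
        refine H.translate (n + 1) _ _ (CFData.shift_mem_zero (hqC j (by omega)) hg) ?_
        rw [← shift_add, ← h2]
        exact CFData.shift_mem_zero (hqC _ (by omega)) hg
      rw [← h3, ← H.rep.add]
      congr 2
      ring
  have hUξ : U ξ (E n f) = E n (shift ξ f) := H.translate n ξ f hf hfξ
  have hnC : (n : ℂ) ≠ 0 := by exact_mod_cast hn.ne'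
  have hk : (k : ℂ) = n - 1 := by rw [hnk]; push_cast; ring
  have e1 : inner ℂ (E n f) (U (D.h n) (E n g))
      = (1 / 2 : ℂ) * inner ℂ (E n f) (E n g)
        + ((n - 1 : ℂ) * (2 * n : ℂ)⁻¹ * inner ℂ (E n (shift ξ f)) (E n g)
        + inner ℂ (E n f) (U (D.h n) (E (n + 1) (shift (q k) g)))) := by
    rw [hmain, inner_add_right, inner_add_right, inner_sum, inner_sum]
    congr 1
    · rw [Finset.sum_congr rfl fun j hj => hin hf _ (hpC' j (Finset.mem_range.1 hj)),
        Finset.sum_const, Finset.card_range, nsmul_eq_mul]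
      field_simp
    · congr 1
      rw [Finset.sum_congr rfl (g := fun _ => (2 * n : ℂ)⁻¹ * inner ℂ (E n (shift ξ f)) (E n g)),
        Finset.sum_const, Finset.card_range, nsmul_eq_mul, hk]
      · ring
      · intro j hj
        have hj := Finset.mem_range.1 hj
        rw [H.rep.inner_right, neg_neg, hUξ, hin hfξ _ (hqC _ (by omega))]
  have e2 : inner ℂ (E n f) ((1 / 2 : ℂ) • E n g + (1 / 2 : ℂ) • U (-ξ) (E n g))
      = (1 / 2 : ℂ) * inner ℂ (E n f) (E n g)
        + (1 / 2 : ℂ) * inner ℂ (E n (shift ξ f)) (E n g) := by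
    rw [inner_add_right, inner_smul_right, inner_smul_right, H.rep.inner_right, neg_neg, hUξ]
  have e3 : inner ℂ (E n f) (U (D.h n) (E n g)) -
      inner ℂ (E n f) ((1 / 2 : ℂ) • E n g + (1 / 2 : ℂ) • U (-ξ) (E n g))
      = inner ℂ (E n f) (U (D.h n) (E (n + 1) (shift (q k) g)))
        - (2 * n : ℂ)⁻¹ * inner ℂ (E n (shift ξ f)) (E n g) := by
    rw [e1, e2]
    field_simp
    ring
  rw [e3]
  refine (norm_sub_le _ _).trans (add_le_add ?_ ?_)
  · refine (norm_inner_le_norm _ _).trans ?_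
    rw [LinearIsometry.norm_map, H.norm_map_shift n (hqC k (by omega)) hg, hcard, mul_div_assoc]
    refine mul_le_mul_of_nonneg_left ?_ (norm_nonneg _)
    refine div_le_div_of_nonneg_left (norm_nonneg _) (Real.sqrt_pos.2 hn') (Real.sqrt_le_sqrt ?_)
    push_cast
    linarith
  · rw [norm_mul, ← hUξ, norm_inv, norm_mul, Complex.norm_natCast]
    have h1 := norm_inner_le_norm (𝕜 := ℂ) (U ξ (E n f)) (E n g)
    rw [LinearIsometry.norm_map] at h1
    calc (‖(2 : ℂ)‖ * (n : ℝ))⁻¹ * ‖(inner ℂ (U ξ (E n f)) (E n g) : ℂ)‖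
        ≤ (n : ℝ)⁻¹ * (‖E n f‖ * ‖E n g‖) := by
          refine mul_le_mul ?_ h1 (norm_nonneg _) (by positivity)
          refine inv_anti₀ hn' ?_
          rw [Complex.norm_ofNat]
          linarith
      _ = _ := by rw [inv_mul_eq_div]

/-- Weak limits of translation operators extend from the towers to their closed span. -/
lemma tendsto_inner_of_towers (H : IsRankOne D w U β E) {l : Filter ℕ} {t : ℕ → ℝ} {a b : ℂ}
    {ξ K : ℝ} (hK : 0 ≤ K)
    (h : ∀ n, ∀ f ∈ boxFun K (D.h n - K), ∀ g ∈ boxFun 0 (D.h n),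
      Tendsto (fun i => (inner ℂ (E n f) (U (t i) (E n g)) : ℂ)) l
        (𝓝 (inner ℂ (E n f) (a • E n g + b • U (-ξ) (E n g))))) :
    ∀ x ∈ towerSpan D E, ∀ y ∈ towerSpan D E,
      Tendsto (fun i => (inner ℂ x (U (t i) y) : ℂ)) l
        (𝓝 (inner ℂ x (a • y + b • U (-ξ) y))) := by
  have h1 : ∀ x ∈ towerSpan D E, ∀ m, ∀ g ∈ boxFun 0 (D.h m),
      Tendsto (fun i => (inner ℂ x (U (t i) (E m g)) : ℂ)) l
        (𝓝 (inner ℂ x (a • E m g + b • U (-ξ) (E m g)))) := by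
    intro x hx m g hg
    refine tendsto_inner_of_mem_closure_span (C := ‖E m g‖) (fun i => by
      rw [LinearIsometry.norm_map]) (S := {x | ∃ n, ∃ f ∈ boxFun K (D.h n - K), x = E n f}) ?_ ?_
    · rintro _ ⟨n, f, hf, rfl⟩
      obtain ⟨M, hM⟩ := hf.2.1
      obtain ⟨N, hN⟩ := hg.2.1
      obtain ⟨f', hf', -, hfE⟩ := H.exists_lift (le_max_left n m) hK hf hM
      obtain ⟨g', hg', -, hgE⟩ := H.exists_lift (le_max_right n m) le_rfl (by simpa using hg) hN
      rw [hfE, hgE]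
      exact h _ _ hf' _ (by simpa using hg')
    · refine Submodule.topologicalClosure_minimal _ ?_ (Submodule.isClosed_topologicalClosure _) hx
      rw [Submodule.span_le]
      rintro _ ⟨n, a', b', h1, h2, h3, rfl⟩
      exact closure_mono Submodule.subset_span
        (H.mem_closure_cut (boxInd_mem_boxFun_of_le h1 h3) hK)
  intro x hx y hy
  -- The second variable is extended through the adjoint: `⟪x, U t y⟫` is the conjugate of `⟪y, U
  -- (-t) x⟫`.
  have h2 := tendsto_inner_of_mem_closure_span (C := ‖x‖) (l := l) (x := fun i => U (-t i) x)
    (x₀ := conj a • x + conj b • U ξ x) (fun i => by rw [LinearIsometry.norm_map])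
    (S := {x | ∃ n a b, 0 ≤ a ∧ a ≤ b ∧ b ≤ D.h n ∧ x = E n (boxInd a b)}) ?_ hy
  · have h3 := (Complex.continuous_conj.tendsto _).comp h2
    have h4 : conj (inner ℂ y (conj a • x + conj b • U ξ x) : ℂ)
        = inner ℂ x (a • y + b • U (-ξ) y) := by
      rw [inner_conj_symm, inner_add_left, inner_smul_left, inner_smul_left, Complex.conj_conj,
        Complex.conj_conj, H.rep.inner_left, inner_add_right, inner_smul_right, inner_smul_right]
    rw [h4] at h3
    refine h3.congr fun i => ?_
    rw [Function.comp_apply, inner_conj_symm, H.rep.inner_left, neg_neg]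
  · rintro _ ⟨n, a', b', h1', h2', h3', rfl⟩
    have h3 := (Complex.continuous_conj.tendsto _).comp
      (h1 x hx n _ (boxInd_mem_boxFun_of_le h1' h3'))
    have h4 : conj (inner ℂ x (a • E n (boxInd a' b') + b • U (-ξ) (E n (boxInd a' b'))) : ℂ)
        = inner ℂ (E n (boxInd a' b')) (conj a • x + conj b • U ξ x) := by
      rw [inner_conj_symm, inner_add_left, inner_smul_left, inner_smul_left, H.rep.inner_left,
        neg_neg, inner_add_right, inner_smul_right, inner_smul_right]
    rw [h4] at h3
    refine h3.congr fun i => ?_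
    rw [Function.comp_apply, inner_conj_symm, H.rep.inner_left]

/-- The weak limit of the translations by `h n` along arithmetic steps. -/
lemma tendsto_inner_of_one_step (H : IsRankOne D w U β E) {l : Filter ℕ} (hl : l ≤ atTop)
    {r : ℕ → ℕ} (hr : Tendsto r l atTop)
    (hC : ∀ᶠ n in l, D.C (n + 1) = (Finset.range (r n)).image fun j : ℕ => (j : ℝ) * D.h n)
    {a : ℂ} (ha : Tendsto (fun n => ((D.C (n + 1)).card : ℂ)⁻¹ *
      ∑ c ∈ (D.C (n + 1)).filter fun c => c - D.h n ∈ D.C (n + 1),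
        conj (β (n + 1) c) * β (n + 1) (c - D.h n)) l (𝓝 a)) :
    ∀ x ∈ towerSpan D E, ∀ y ∈ towerSpan D E,
      Tendsto (fun n => (inner ℂ x (U (D.h n) y) : ℂ)) l
        (𝓝 (inner ℂ x (a • y + (0 : ℂ) • U (-0) y))) := by
  refine H.tendsto_inner_of_towers (K := 0) le_rfl fun m f hf g hg => ?_
  rw [sub_zero] at hf
  obtain ⟨M, hM⟩ := hf.2.1
  obtain ⟨N, hN⟩ := hg.2.1
  rw [zero_smul, add_zero, inner_smul_right]
  have h1 := ha.mul_const (inner ℂ (E m f) (E m g))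
  have h2 : Tendsto (fun n => ‖E m f‖ * ‖E m g‖ / √(r n)) l (𝓝 0) :=
    Tendsto.div_atTop tendsto_const_nhds
      (Real.tendsto_sqrt_atTop.comp (tendsto_natCast_atTop_atTop.comp hr))
  have h3 : Tendsto (fun n => (inner ℂ (E m f) (U (D.h n) (E m g)) : ℂ) -
      ((D.C (n + 1)).card : ℂ)⁻¹ * (∑ c ∈ (D.C (n + 1)).filter fun c => c - D.h n ∈ D.C (n + 1),
        conj (β (n + 1) c) * β (n + 1) (c - D.h n)) * inner ℂ (E m f) (E m g)) l (𝓝 0) := by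
    rw [tendsto_zero_iff_norm_tendsto_zero]
    refine tendsto_of_tendsto_of_tendsto_of_le_of_le' tendsto_const_nhds h2
      (Eventually.of_forall fun n => norm_nonneg _) ?_
    filter_upwards [hC, hl (eventually_ge_atTop m), hr.eventually_gt_atTop 0] with n h4 h5 h6
    obtain ⟨f', hf', -, hfE⟩ := H.exists_lift h5 le_rfl (by simpa using hf) hM
    obtain ⟨g', hg', -, hgE⟩ := H.exists_lift h5 le_rfl (by simpa using hg) hN
    rw [sub_zero] at hf' hg'
    rw [hfE, hgE]
    exact H.norm_inner_translate_sub_le h6 h4 hf' hg'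
  have h4 := h3.add h1
  simpa using h4

/-- The weak limit of the translations by `h n` along double arithmetic steps. -/
lemma tendsto_inner_of_two_steps (H : IsRankOne D w U β E) {l : Filter ℕ} (hl : l ≤ atTop)
    {ξ : ℝ} (hξ : 0 < ξ)
    (hC : ∀ᶠ n in l, D.C (n + 1) = (Finset.range n).image (fun j : ℕ => (j : ℝ) * D.h n) ∪
      (Finset.range n).image (fun j : ℕ => (j : ℝ) * (D.h n + ξ) + n * D.h n))
    (hβ : ∀ᶠ n in l, ∀ c ∈ D.C (n + 1), β (n + 1) c = 1) :
    ∀ x ∈ towerSpan D E, ∀ y ∈ towerSpan D E,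
      Tendsto (fun n => (inner ℂ x (U (D.h n) y) : ℂ)) l
        (𝓝 (inner ℂ x ((1 / 2 : ℂ) • y + (1 / 2 : ℂ) • U (-ξ) y))) := by
  -- A margin of width `ξ` at both ends keeps the translate of `f` by `ξ` inside the tower.
  refine H.tendsto_inner_of_towers hξ.le fun m f hf g hg => ?_
  obtain ⟨M, hM⟩ := hf.2.1
  obtain ⟨N, hN⟩ := hg.2.1
  have hcast : Tendsto (fun n : ℕ => (n : ℝ)) l atTop := tendsto_natCast_atTop_atTop.mono_left hl
  have h2 : Tendsto (fun n : ℕ => ‖E m f‖ * ‖E m g‖ / √n + ‖E m f‖ * ‖E m g‖ / n) l (𝓝 0) := by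
    have h3 := (tendsto_const_nhds (x := ‖E m f‖ * ‖E m g‖)).div_atTop
      (Real.tendsto_sqrt_atTop.comp hcast)
    have h4 := (tendsto_const_nhds (x := ‖E m f‖ * ‖E m g‖)).div_atTop hcast
    simpa using h3.add h4
  rw [tendsto_iff_norm_sub_tendsto_zero]
  refine tendsto_of_tendsto_of_tendsto_of_le_of_le' tendsto_const_nhds h2
    (Eventually.of_forall fun n => norm_nonneg _) ?_
  filter_upwards [hC, hβ, hl (eventually_ge_atTop m), hl (eventually_gt_atTop 0)] with n h4 h5 h6 h7
  obtain ⟨f', hf', -, hfE⟩ := H.exists_lift h6 hξ.le hf hM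
  obtain ⟨g', hg', -, hgE⟩ := H.exists_lift h6 le_rfl (by simpa using hg) hN
  rw [sub_zero] at hg'
  rw [hfE, hgE]
  exact H.norm_inner_translate_sub_le_of_two_steps h7 hξ h4 h5 (boxFun_mono hξ.le (by linarith) hf')
    (shift_mem_boxFun_of_le hf' (by linarith) (by linarith)) hg'

end IsRankOne

/-- If `u = ∑ b_i U(t_i) u'` and the spectral measure of `u'` has at most an atom at `0`, and this
only if all the `b_i` are `1`, then `u'` lies in the cyclic space of `u`. -/
lemma mem_cyclicSpan_of_sum {V : Type*} [NormedAddCommGroup V] [InnerProductSpace ℂ V]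
    [CompleteSpace V] {U : ℝ → V →ₗᵢ[ℂ] V} (hU : IsUnitaryRep U) {u' : V} {τ : Measure ℝ}
    (hτ : IsSpectralMeasure U u' τ) {ι : Type*} {S : Finset ι} (hS : S.Nonempty) {t : ι → ℝ}
    {b : ι → ℂ} (hu : ∑ i ∈ S, b i • U (t i) u' ≠ 0)
    (hat : ∀ s, τ {s} ≠ 0 → s = 0 ∧ ∀ i ∈ S, b i = 1) :
    u' ∈ cyclicSpan U (∑ i ∈ S, b i • U (t i) u') := by
  have := hτ.1
  set P : ℝ →₀ ℂ := ∑ i ∈ S, Finsupp.single (t i) (b i) with hP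
  have h1 : trigOp U u' P = ∑ i ∈ S, b i • U (t i) u' := by
    simp only [hP, trigOp, map_sum, Finsupp.linearCombination_single]
  have h2 : ∀ s, (P.sum fun t c => c * expi t s) = ∑ i ∈ S, b i * expi (t i) s := by
    intro s
    change Finsupp.linearCombination ℂ (fun t => expi t s) P = _
    simp only [hP, map_sum, Finsupp.linearCombination_single, smul_eq_mul]
  rw [← h1]
  refine hτ.mem_cyclicSpan_of_atoms hU P (by rwa [h1]) fun s hs => ?_
  by_contra h3
  -- At `s = 0` with all coefficients equal to `1` the polynomial takes the value `S.card`, which is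
  -- not `0`.
  obtain ⟨rfl, h4⟩ := hat s h3
  rw [h2, Finset.sum_congr rfl fun i hi => by rw [h4 i hi, expi_zero_right, one_mul]] at hs
  rw [Finset.sum_const, nsmul_eq_mul, mul_one, Nat.cast_eq_zero, Finset.card_eq_zero] at hs
  exact hS.ne_empty hs

/-! ### Continuity, invariance and cyclicity of the span of the towers -/

namespace IsRankOne

variable {D : CFData} {w : ℕ → ℝ} {V : Type*} [NormedAddCommGroup V] [InnerProductSpace ℂ V]
  {U : ℝ → V →ₗᵢ[ℂ] V} {β : ℕ → ℝ → ℂ} {E : ℕ → (ℝ → ℂ) → V}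

lemma map_boxInd_add (H : IsRankOne D w U β E) (n : ℕ) {a b c : ℝ} (ha : 0 ≤ a) (hab : a ≤ b)
    (hbc : b ≤ c) (hc : c ≤ D.h n) :
    E n (boxInd a b) + E n (boxInd b c) = E n (boxInd a c) := by
  rw [← H.map_add n _ (boxInd_mem_boxFun_of_le ha (hbc.trans hc)) _
    (boxInd_mem_boxFun_of_le (ha.trans hab) hc), boxInd_add hab hbc]

lemma translate_boxInd (H : IsRankOne D w U β E) (n : ℕ) {a b t : ℝ} (ha : 0 ≤ a)
    (hb : b ≤ D.h n) (hat : 0 ≤ a + t) (hbt : b + t ≤ D.h n) :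
    U t (E n (boxInd a b)) = E n (boxInd (a + t) (b + t)) := by
  rw [H.translate n t _ (boxInd_mem_boxFun_of_le ha hb), shift_boxInd]
  rw [shift_boxInd]
  exact boxInd_mem_boxFun_of_le hat hbt

lemma mem_towerSpan (n : ℕ) {a b : ℝ} (ha : 0 ≤ a) (hab : a ≤ b) (hb : b ≤ D.h n) :
    E n (boxInd a b) ∈ towerSpan D E :=
  Submodule.le_topologicalClosure _ (Submodule.subset_span ⟨n, a, b, ha, hab, hb, rfl⟩)

/-- The translate of `[a, b)` overlaps the original except for one piece of length `t` at each end.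
The piece that may leave the tower is only estimated in norm, which `U t` preserves. -/
lemma norm_translate_sub_le (H : IsRankOne D w U β E) (n : ℕ) {a b t : ℝ} (ha : 0 ≤ a)
    (hb : b ≤ D.h n) (ht : 0 ≤ t) (htb : t ≤ b - a) :
    ‖U t (E n (boxInd a b)) - E n (boxInd a b)‖ ≤ 2 * √(w n * t) := by
  have e : U t (E n (boxInd a b)) - E n (boxInd a b)
      = U t (E n (boxInd (b - t) b)) - E n (boxInd a (a + t)) := by
    have h1 := H.map_boxInd_add n ha (by linarith : a ≤ b - t) (by linarith : b - t ≤ b) hb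
    have h2 := H.map_boxInd_add n ha (by linarith : a ≤ a + t) (by linarith : a + t ≤ b) hb
    rw [← sub_eq_zero, ← h1]
    nth_rewrite 1 [_root_.map_add]
    rw [H.translate_boxInd n ha (by linarith) (by linarith) (by linarith), sub_add_cancel, h1, ← h2]
    abel
  rw [e]
  refine (norm_sub_le _ _).trans ?_
  rw [LinearIsometry.norm_map]
  have h1 := H.norm_map_boxInd_le n (by linarith : 0 ≤ b - t) (by linarith : b - t ≤ b) hb
  have h2 := H.norm_map_boxInd_le n ha (by linarith : a ≤ a + t) (by linarith)
  rw [sub_sub_cancel] at h1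
  rw [add_sub_cancel_left] at h2
  linarith

/-- Strong continuity at `0`, checked on indicators of intervals and extended by density; it
supplies the hypothesis of Bochner's theorem. -/
lemma tendsto_translate (H : IsRankOne D w U β E) {x : V} (hx : x ∈ towerSpan D E) :
    Tendsto (fun t => U t x) (𝓝 0) (𝓝 x) := by
  have hspan : ∀ z ∈ Submodule.span ℂ
      {x | ∃ n a b, 0 ≤ a ∧ a ≤ b ∧ b ≤ D.h n ∧ x = E n (boxInd a b)},
      Tendsto (fun t => U t z) (𝓝 0) (𝓝 z) := by
    intro z hz
    induction hz using Submodule.span_induction with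
    | mem z hz =>
      obtain ⟨n, a, b, ha, hab, hb, rfl⟩ := hz
      rcases hab.eq_or_lt with rfl | hab
      · have : boxInd a a = 0 := by ext s; simp [boxInd]
        simp only [this, H.map_zero, _root_.map_zero]
        exact tendsto_const_nhds
      · rw [tendsto_iff_norm_sub_tendsto_zero]
        have h1 : Tendsto (fun t : ℝ => 2 * √(w n * |t|)) (𝓝 0) (𝓝 0) := by
          have : Continuous fun t : ℝ => 2 * √(w n * |t|) := by fun_prop
          simpa using this.tendsto 0
        refine tendsto_of_tendsto_of_tendsto_of_le_of_le' tendsto_const_nhds h1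
          (Eventually.of_forall fun t => norm_nonneg _) ?_
        have h2 : ∀ᶠ t : ℝ in 𝓝 0, |t| < b - a := by
          have : Continuous fun t : ℝ => |t| := by fun_prop
          refine (this.tendsto 0).eventually_lt_const ?_
          simpa using hab
        filter_upwards [h2] with t ht
        rcases le_total 0 t with h0 | h0
        · rw [abs_of_nonneg h0] at ht ⊢
          exact H.norm_translate_sub_le n ha hb h0 ht.le
        · rw [abs_of_nonpos h0] at ht ⊢
          rw [← LinearIsometry.norm_map (U (-t)), _root_.map_sub, H.rep.neg_apply_self, norm_sub_rev]
          exact H.norm_translate_sub_le n ha hb (by linarith) ht.le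
    | zero => simp
    | add a b _ _ ha hb => simp only [_root_.map_add]; exact ha.add hb
    | smul c a _ ha => simp only [_root_.map_smul]; exact ha.const_smul c
  rw [Metric.tendsto_nhds]
  intro ε hε
  obtain ⟨z, hz, hxz⟩ := Metric.mem_closure_iff.1 hx (ε / 3) (by positivity)
  filter_upwards [Metric.tendsto_nhds.1 (hspan z hz) (ε / 3) (by positivity)] with t ht
  rw [dist_eq_norm] at *
  have e : U t x - x = U t (x - z) + (U t z - z) - (x - z) := by rw [_root_.map_sub]; abel
  rw [e]
  calc _ ≤ ‖U t (x - z)‖ + ‖U t z - z‖ + ‖x - z‖ :=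
        (norm_sub_le _ _).trans (add_le_add_left (norm_add_le _ _) _)
    _ < ε := by rw [LinearIsometry.norm_map]; linarith

lemma exists_spectralMeasure (H : IsRankOne D w U β E) {x : V} (hx : x ∈ towerSpan D E) :
    ∃ τ, IsSpectralMeasure U x τ := by
  refine exists_isSpectralMeasure H.rep x ?_
  have := (tendsto_const_nhds (x := x)).inner (𝕜 := ℂ) (H.tendsto_translate hx)
  rw [ContinuousAt, H.rep.zero]
  exact this

/-- Dominated convergence in a tower. -/
lemma tendsto_map_of_dominated (H : IsRankOne D w U β E) (n : ℕ) {f : ℕ → ℝ → ℂ} {g : ℝ → ℂ}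
    (hf : ∀ k, f k ∈ boxFun 0 (D.h n)) (hg : g ∈ boxFun 0 (D.h n)) {M : ℝ}
    (hM : ∀ k x, ‖f k x‖ ≤ M) (hlim : ∀ x, Tendsto (fun k => f k x) atTop (𝓝 (g x))) :
    Tendsto (fun k => E n (f k)) atTop (𝓝 (E n g)) := by
  rw [tendsto_iff_norm_sub_tendsto_zero]
  have hgM : ∀ x, ‖g x‖ ≤ M := fun x =>
    le_of_tendsto (hlim x).norm (Eventually.of_forall fun k => hM k x)
  have h1 : ∀ k, ‖E n (f k) - E n g‖ ^ 2 = w n * ∫ s, ‖f k s - g s‖ ^ 2 := fun k => by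
    rw [← H.map_sub n (hf k) hg, H.norm_sq_map n (Submodule.sub_mem _ (hf k) hg)]
    rfl
  have h2 : Tendsto (fun k => ∫ s, ‖f k s - g s‖ ^ 2) atTop (𝓝 (∫ _ : ℝ, (0 : ℝ))) := by
    refine tendsto_integral_of_dominated_convergence
      ((Set.Ico 0 (D.h n)).indicator fun _ => (M + M) ^ 2) (fun k => ?_) ?_ (fun k => ?_) ?_
    · exact (((hf k).1.sub hg.1).norm.pow_const 2).aestronglyMeasurable
    · rw [integrable_indicator_iff measurableSet_Ico]
      exact integrableOn_const (by simp)
    · refine Eventually.of_forall fun s => ?_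
      rw [Real.norm_of_nonneg (by positivity)]
      by_cases hs : s ∈ Set.Ico 0 (D.h n)
      · rw [Set.indicator_of_mem hs]
        exact pow_le_pow_left₀ (norm_nonneg _)
          ((norm_sub_le _ _).trans (add_le_add (hM k s) (hgM s))) 2
      · rw [Set.indicator_of_notMem hs, (hf k).2.2 s hs, hg.2.2 s hs]
        simp
    · refine Eventually.of_forall fun s => ?_
      have := ((hlim s).sub_const (g s)).norm.pow 2
      simpa using this
  have h3 : Tendsto (fun k => ‖E n (f k) - E n g‖ ^ 2) atTop (𝓝 0) := by
    simp only [h1]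
    simpa using h2.const_mul (w n)
  have h4 := h3.sqrt
  simpa [Real.sqrt_sq (norm_nonneg _)] using h4

lemma indicator_mem_boxFun {a b : ℝ} {A : Set ℝ} (hA : MeasurableSet A) :
    (A ∩ Set.Ico a b).indicator (fun _ => (1 : ℂ)) ∈ boxFun a b := by
  refine ⟨measurable_const.indicator (hA.inter measurableSet_Ico), ⟨1, fun x => ?_⟩, fun x hx =>
    Set.indicator_of_notMem (fun h => hx h.2) _⟩
  rw [Set.indicator]
  split_ifs <;> simp

/-- The span is defined by intervals only. Intervals generate the Borel sets by the π-λ theorem, and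
dominated convergence leads on to simple functions and then to bounded measurable functions. -/
lemma map_mem_towerSpan (H : IsRankOne D w U β E) (n : ℕ) {f : ℝ → ℂ}
    (hf : f ∈ boxFun 0 (D.h n)) : E n f ∈ towerSpan D E := by
  have hc : IsClosed (towerSpan D E : Set V) := Submodule.isClosed_topologicalClosure _
  have h0 := (D.h_pos n).le
  have hset : ∀ A : Set ℝ, MeasurableSet A →
      E n ((A ∩ Set.Ico 0 (D.h n)).indicator fun _ => (1 : ℂ)) ∈ towerSpan D E := by
    intro A hA
    induction A, hA using MeasurableSpace.induction_on_inter
      ((BorelSpace.measurable_eq (α := ℝ)).trans (borel_eq_generateFrom_Ico ℝ))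
      (isPiSystem_Ico id id) with
    | empty =>
      simp only [Set.empty_inter, Set.indicator_empty]
      exact (H.map_zero n).symm ▸ Submodule.zero_mem _
    | basic A hA =>
      obtain ⟨a, b, -, rfl⟩ := hA
      rw [Set.Ico_inter_Ico]
      rcases le_total (max a 0) (min b (D.h n)) with h1 | h1
      · exact mem_towerSpan n (le_max_right _ _) h1 (min_le_right _ _)
      · rw [Set.Ico_eq_empty (not_lt.2 h1), Set.indicator_empty]
        exact (H.map_zero n).symm ▸ Submodule.zero_mem _
    | compl A hA ih =>
      have : (Aᶜ ∩ Set.Ico 0 (D.h n)).indicator (fun _ => (1 : ℂ))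
          = boxInd 0 (D.h n) - (A ∩ Set.Ico 0 (D.h n)).indicator fun _ => 1 := by
        ext x
        by_cases h1 : x ∈ A <;> by_cases h2 : x ∈ Set.Ico 0 (D.h n) <;>
          simp [boxInd, Set.indicator, h1, -Set.mem_Ico, h2]
      rw [this, H.map_sub n (boxInd_mem_boxFun _ _) (indicator_mem_boxFun hA)]
      exact Submodule.sub_mem _ (mem_towerSpan n le_rfl h0 le_rfl) ih
    | iUnion F hd hF ih =>
      have hlim := H.tendsto_map_of_dominated n (M := 1)
        (f := fun k => ∑ i ∈ Finset.range k, (F i ∩ Set.Ico 0 (D.h n)).indicator fun _ => (1 : ℂ))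
        (g := ((⋃ i, F i) ∩ Set.Ico 0 (D.h n)).indicator fun _ => (1 : ℂ))
        (fun k => Submodule.sum_mem _ fun i _ => indicator_mem_boxFun (hF i))
        (indicator_mem_boxFun (MeasurableSet.iUnion hF)) ?_ ?_
      · refine hc.mem_of_tendsto hlim (Eventually.of_forall fun k => ?_)
        rw [H.map_sum n _ fun i _ => indicator_mem_boxFun (hF i)]
        exact Submodule.sum_mem _ fun i _ => ih i
      · intro k x
        rw [Finset.sum_apply]
        by_cases hex : ∃ i ∈ Finset.range k, x ∈ F i
        · obtain ⟨i, hi, hx⟩ := hex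
          rw [Finset.sum_eq_single_of_mem i hi]
          · rw [Set.indicator]
            split_ifs <;> simp
          · exact fun j _ hj => Set.indicator_of_notMem
              (fun h => Set.disjoint_left.1 (hd hj) h.1 hx) _
        · rw [Finset.sum_eq_zero fun i hi =>
            Set.indicator_of_notMem (fun h => hex ⟨i, hi, h.1⟩) _]
          simp
      · intro x
        by_cases hex : ∃ i, x ∈ F i
        · obtain ⟨i, hx⟩ := hex
          refine tendsto_const_nhds.congr' ?_
          filter_upwards [eventually_gt_atTop i] with k hk
          rw [Finset.sum_apply, Finset.sum_eq_single_of_mem i (Finset.mem_range.2 hk)]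
          · by_cases h2 : x ∈ Set.Ico 0 (D.h n)
            · rw [Set.indicator_of_mem (Set.mem_inter (Set.mem_iUnion.2 ⟨i, hx⟩) h2),
                Set.indicator_of_mem (Set.mem_inter hx h2)]
            · rw [Set.indicator_of_notMem (fun h => h2 h.2), Set.indicator_of_notMem (fun h => h2 h.2)]
          · exact fun j _ hj => Set.indicator_of_notMem
              (fun h => Set.disjoint_left.1 (hd hj) h.1 hx) _
        · rw [Set.indicator_of_notMem (fun h => hex (Set.mem_iUnion.1 h.1))]
          refine tendsto_const_nhds.congr fun k => ?_
          rw [Finset.sum_apply, Finset.sum_eq_zero fun i hi =>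
            Set.indicator_of_notMem (fun h => hex ⟨i, h.1⟩) _]
  have hmem : ∀ s : SimpleFunc ℝ ℂ, (Set.Ico 0 (D.h n)).indicator s ∈ boxFun 0 (D.h n) := by
    intro s
    refine ⟨s.measurable.indicator measurableSet_Ico, ?_, fun x hx =>
      Set.indicator_of_notMem hx _⟩
    obtain ⟨M, hM⟩ := s.exists_forall_norm_le
    exact ⟨M, fun x => (norm_indicator_le_norm_self _ _).trans (hM x)⟩
  have hsimple : ∀ s : SimpleFunc ℝ ℂ,
      E n ((Set.Ico 0 (D.h n)).indicator s) ∈ towerSpan D E := by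
    intro s
    induction s using SimpleFunc.induction with
    | const c hs =>
      rename_i A
      have : (Set.Ico 0 (D.h n)).indicator
          (SimpleFunc.piecewise A hs (SimpleFunc.const ℝ c) (SimpleFunc.const ℝ 0))
          = c • (A ∩ Set.Ico 0 (D.h n)).indicator fun _ => (1 : ℂ) := by
        ext x
        by_cases h1 : x ∈ A <;> by_cases h2 : x ∈ Set.Ico 0 (D.h n) <;>
          simp [Set.indicator, h1, -Set.mem_Ico, h2, Set.piecewise]
      rw [this, H.map_smul n _ _ (indicator_mem_boxFun hs)]
      exact Submodule.smul_mem _ _ (hset A hs)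
    | add _ hf hg =>
      rw [SimpleFunc.coe_add, Set.indicator_add', H.map_add n _ (hmem _) _ (hmem _)]
      exact Submodule.add_mem _ hf hg
  obtain ⟨M, hM⟩ := hf.2.1
  have hM0 : 0 ≤ M := (norm_nonneg _).trans (hM 0)
  have hsm : StronglyMeasurable f := hf.1.stronglyMeasurable
  have hfi : (Set.Ico 0 (D.h n)).indicator f = f := by
    rw [Set.indicator_eq_self]
    intro x hx
    by_contra h
    exact hx (hf.2.2 x h)
  refine hc.mem_of_tendsto (H.tendsto_map_of_dominated n (M := M)
    (fun k => hmem (hsm.approxBounded M k)) hf (fun k x => (norm_indicator_le_norm_self _ _).trans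
      (hsm.norm_approxBounded_le hM0 k x)) fun x => ?_) (Eventually.of_forall fun k => hsimple _)
  by_cases hx : x ∈ Set.Ico 0 (D.h n)
  · simp only [Set.indicator_of_mem hx]
    exact hsm.tendsto_approxBounded_of_norm_le (hM x)
  · simp only [Set.indicator_of_notMem hx, hf.2.2 x hx]
    exact tendsto_const_nhds

/-- After cutting off margins of width `|t|`, which is harmless by `mem_closure_cut`, the
translation by `t` stays inside the tower. -/
lemma apply_mem_towerSpan (H : IsRankOne D w U β E) {x : V} (hx : x ∈ towerSpan D E) (t : ℝ) :
    U t x ∈ towerSpan D E := by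
  have hc : IsClosed (towerSpan D E : Set V) := Submodule.isClosed_topologicalClosure _
  have hcut : ∀ n, ∀ f ∈ boxFun 0 (D.h n), U t (E n f) ∈ towerSpan D E := by
    intro n f hf
    rw [← SetLike.mem_coe, ← hc.closure_eq]
    refine map_mem_closure (U t).continuous (H.mem_closure_cut hf (K := |t|) (abs_nonneg t)) ?_
    rintro _ ⟨m, g, hg, rfl⟩
    have hs : shift t g ∈ boxFun 0 (D.h m) :=
      shift_mem_boxFun_of_le hg (by linarith [neg_abs_le t]) (by linarith [le_abs_self t])
    rw [H.translate m t _ (boxFun_mono (abs_nonneg t) (by linarith [abs_nonneg t]) hg) hs]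
    exact H.map_mem_towerSpan m hs
  have hle : towerSpan D E ≤ (towerSpan D E).comap (U t).toLinearMap := by
    refine Submodule.topologicalClosure_minimal _ ?_ (hc.preimage (U t).continuous)
    rw [Submodule.span_le]
    rintro _ ⟨n, a, b, ha, -, hb, rfl⟩
    exact hcut n _ (boxInd_mem_boxFun_of_le ha hb)
  exact hle hx

/-- If spectral measures have no atoms (except possibly at `0`, and this only if all the
coefficients are trivial), then the bottom tower generates everything. -/
lemma towerSpan_eq_cyclicSpan [CompleteSpace V] (H : IsRankOne D w U β E)
    (hat : ∀ x ∈ towerSpan D E, ∀ τ, IsSpectralMeasure U x τ → ∀ s, τ {s} ≠ 0 →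
      s = 0 ∧ ∀ n, ∀ c ∈ D.C (n + 1), β (n + 1) c = 1) :
    towerSpan D E = cyclicSpan U (E 0 (boxInd 0 1)) := by
  set Z := cyclicSpan U (E 0 (boxInd 0 1)) with hZ
  have hZc : IsClosed (Z : Set V) := Submodule.isClosed_topologicalClosure _
  have hne : ∀ n δ, 0 < δ → δ ≤ D.h n → E n (boxInd 0 δ) ≠ 0 := by
    intro n δ hδ hδn h0
    have h1 := H.norm_sq_map n (boxInd_mem_boxFun_of_le (le_refl 0) hδn)
    have h2 : ∫ s, ‖boxInd 0 δ s‖ ^ 2 = δ := by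
      have : ∀ s, ‖boxInd 0 δ s‖ ^ 2 = (Set.Ico 0 δ).indicator (fun _ => (1 : ℝ)) s := by
        intro s
        unfold boxInd
        simp only [Set.indicator]
        split_ifs <;> simp
      simp_rw [this]
      rw [integral_indicator measurableSet_Ico, setIntegral_const, measureReal_def,
        Real.volume_Ico, ENNReal.toReal_ofReal (by linarith)]
      simp
    rw [h0, h2, norm_zero] at h1
    have := mul_pos (H.weight.pos n) hδ
    norm_num at h1
    exact h1.elim (H.weight.pos n).ne' hδ.ne'
  have hbox : ∀ j : ℕ, ((1 : ℝ) / 2) ^ j ≤ 1 := fun j =>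
    pow_le_one₀ (by norm_num) (by norm_num)
  -- For `j = 0` the induction climbs the towers, and for fixed `n` it then halves the interval.
  -- Each time the vector known to lie in `Z` is a trigonometric polynomial in `U` applied to the
  -- next one, and `mem_cyclicSpan_of_sum` recovers the latter.
  have hsmall : ∀ n j : ℕ, E n (boxInd 0 ((1 / 2) ^ j)) ∈ Z := by
    intro n j
    induction j with
    | zero =>
      rw [pow_zero]
      induction n with
      | zero => exact self_mem_cyclicSpan H.rep _
      | succ n ih =>
        have h1 : E n (boxInd 0 1)
            = ∑ c ∈ D.C (n + 1), β (n + 1) c • U c (E (n + 1) (boxInd 0 1)) := by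
          rw [H.refine n _ (boxInd_mem_boxFun_of_le le_rfl (D.one_le_h n)), H.map_raise n _
            (boxInd_mem_boxFun_of_le le_rfl (D.one_le_h n))]
          refine Finset.sum_congr rfl fun c hc => ?_
          rw [shift_boxInd, H.translate_boxInd (n + 1) le_rfl (D.one_le_h _)
            (by linarith [D.nonneg n c hc]) (by linarith [D.add_le n c hc, D.one_le_h n])]
        have hmem : E (n + 1) (boxInd 0 1) ∈ towerSpan D E :=
          mem_towerSpan (n + 1) le_rfl zero_le_one (D.one_le_h _)
        obtain ⟨τ, hτ⟩ := H.exists_spectralMeasure hmem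
        have h2 := mem_cyclicSpan_of_sum H.rep hτ (S := D.C (n + 1)) ⟨0, D.zero_mem n⟩
          (t := id) (b := β (n + 1)) (by
            simp only [id]
            rw [← h1]
            exact hne n 1 zero_lt_one (D.one_le_h n))
          fun s hs => ⟨(hat _ hmem τ hτ s hs).1, (hat _ hmem τ hτ s hs).2 n⟩
        simp only [id] at h2
        rw [← h1] at h2
        exact cyclicSpan_le H.rep ih h2
    | succ j ih =>
      set δ : ℝ := (1 / 2) ^ (j + 1) with hδ
      have hδ0 : 0 < δ := by positivity
      have h2δ : ((1 : ℝ) / 2) ^ j = δ + δ := by rw [hδ, pow_succ]; ring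
      have hδh : δ + δ ≤ D.h n := h2δ ▸ (hbox j).trans (D.one_le_h n)
      have h1 : E n (boxInd 0 ((1 / 2) ^ j))
          = ∑ i ∈ Finset.range 2, (1 : ℂ) • U (i * δ) (E n (boxInd 0 δ)) := by
        rw [Finset.sum_range_succ, Finset.sum_range_one, one_smul, one_smul, h2δ,
          ← H.map_boxInd_add n le_rfl hδ0.le (by linarith : δ ≤ δ + δ) hδh]
        congr 1
        · rw [Nat.cast_zero, zero_mul, H.rep.zero]
        · rw [Nat.cast_one, one_mul, H.translate_boxInd n le_rfl (by linarith) (by linarith) hδh,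
            zero_add]
      have hmem : E n (boxInd 0 δ) ∈ towerSpan D E :=
        mem_towerSpan n le_rfl hδ0.le (by linarith)
      obtain ⟨τ, hτ⟩ := H.exists_spectralMeasure hmem
      have h2 := mem_cyclicSpan_of_sum H.rep hτ (S := Finset.range 2) ⟨0, by simp⟩
        (t := fun i : ℕ => (i : ℝ) * δ) (b := fun _ => (1 : ℂ)) (by
          rw [← h1]
          exact hne n _ (by positivity) (h2δ ▸ hδh))
        fun s hs => ⟨(hat _ hmem τ hτ s hs).1, fun _ _ => rfl⟩
      rw [← h1] at h2
      exact cyclicSpan_le H.rep ih h2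
  refine le_antisymm ?_ ?_
  · refine Submodule.topologicalClosure_minimal _ ?_ hZc
    rw [Submodule.span_le]
    rintro _ ⟨n, a, b, ha, hab, hb, rfl⟩
    -- Concatenating `K` translates of a dyadic interval; intervals of arbitrary length are then
    -- limits of such unions.
    have hsteps : ∀ j K : ℕ, a + K * (1 / 2) ^ j ≤ D.h n →
        E n (boxInd a (a + K * (1 / 2) ^ j)) ∈ Z := by
      intro j K
      have hδ0 : (0 : ℝ) < (1 / 2) ^ j := by positivity
      induction K with
      | zero =>
        intro _
        have : boxInd a (a + (0 : ℕ) * (1 / 2) ^ j) = 0 := by ext s; simp [boxInd]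
        rw [this, H.map_zero]
        exact Submodule.zero_mem _
      | succ K ih =>
        intro hK
        push_cast at hK ⊢
        have h1 : (0 : ℝ) ≤ K * (1 / 2) ^ j := by positivity
        rw [← H.map_boxInd_add n ha (by linarith : a ≤ a + K * (1 / 2) ^ j)
          (by nlinarith) hK]
        refine Submodule.add_mem _ (ih (by nlinarith)) ?_
        have h2 := H.translate_boxInd n (a := 0) (b := (1 / 2) ^ j) (t := a + K * (1 / 2) ^ j)
          le_rfl ((hbox j).trans (D.one_le_h n)) (by linarith) (by linarith)
        rw [zero_add, show ((1 : ℝ) / 2) ^ j + (a + K * (1 / 2) ^ j)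
          = a + (K + 1) * (1 / 2) ^ j by ring] at h2
        rw [← h2]
        exact apply_mem_cyclicSpan H.rep (hsmall n j) _
    have hlim : Tendsto (fun j : ℕ => E n (boxInd a
        (a + (⌊(b - a) / (1 / 2) ^ j⌋₊ : ℝ) * (1 / 2) ^ j))) atTop (𝓝 (E n (boxInd a b))) := by
      rw [tendsto_iff_norm_sub_tendsto_zero]
      have h1 : Tendsto (fun j : ℕ => √(w n * (1 / 2) ^ j)) atTop (𝓝 0) := by
        have h2 := ((tendsto_pow_atTop_nhds_zero_of_lt_one (r := (1 / 2 : ℝ)) (by norm_num)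
          (by norm_num)).const_mul (w n)).sqrt
        simpa using h2
      refine squeeze_zero (fun j => norm_nonneg _) (fun j => ?_) h1
      have hδ0 : (0 : ℝ) < (1 / 2) ^ j := by positivity
      have h3 := Nat.floor_le (a := (b - a) / (1 / 2) ^ j) (by
        have : 0 ≤ b - a := by linarith
        positivity)
      have h4 := Nat.lt_floor_add_one ((b - a) / (1 / 2 : ℝ) ^ j)
      rw [le_div_iff₀ hδ0] at h3
      rw [div_lt_iff₀ hδ0] at h4
      set m : ℝ := (⌊(b - a) / (1 / 2 : ℝ) ^ j⌋₊ : ℝ) with hm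
      have hm0 : 0 ≤ m := by positivity
      have h5 : 0 ≤ m * (1 / 2) ^ j := by positivity
      rw [← H.map_boxInd_add n ha (by linarith : a ≤ a + m * (1 / 2) ^ j)
        (by linarith : a + m * (1 / 2) ^ j ≤ b) hb, norm_sub_rev, add_sub_cancel_left]
      refine (H.norm_map_boxInd_le n (by linarith) (by linarith) hb).trans ?_
      refine Real.sqrt_le_sqrt (mul_le_mul_of_nonneg_left ?_ (H.weight.pos n).le)
      linarith
    refine hZc.mem_of_tendsto hlim (Eventually.of_forall fun j => hsteps j _ ?_)
    have hδ0 : (0 : ℝ) < (1 / 2) ^ j := by positivity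
    have h3 := Nat.floor_le (a := (b - a) / (1 / 2) ^ j) (by
      have : 0 ≤ b - a := by linarith
      positivity)
    rw [le_div_iff₀ hδ0] at h3
    linarith
  · refine Submodule.topologicalClosure_minimal _ ?_ (Submodule.isClosed_topologicalClosure _)
    rw [Submodule.span_le]
    rintro _ ⟨t, rfl⟩
    exact H.apply_mem_towerSpan (mem_towerSpan 0 le_rfl zero_le_one (D.one_le_h 0)) t

end IsRankOne

/-! ### Comparison of two systems of coefficients up to translations -/

namespace IsRankOne

variable {D : CFData} {w : ℕ → ℝ} {V : Type*} [NormedAddCommGroup V] [InnerProductSpace ℂ V]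
  {U : ℝ → V →ₗᵢ[ℂ] V} {β : ℕ → ℝ → ℂ} {E : ℕ → (ℝ → ℂ) → V}

lemma indicator_mem_boxFun_of_mem {a b a' b' : ℝ} {g : ℝ → ℂ} (hg : g ∈ boxFun a b) :
    (Set.Ico a' b').indicator g ∈ boxFun a' b' := by
  obtain ⟨M, hM⟩ := hg.2.1
  exact ⟨hg.1.indicator measurableSet_Ico, ⟨M, fun x =>
    (norm_indicator_le_norm_self _ _).trans (hM x)⟩, fun x hx => Set.indicator_of_notMem hx _⟩

/-- In a high tower, correlations are determined by the tower. -/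
lemma norm_inner_translate_sub_boxInner_le (H : IsRankOne D w U β E) (n : ℕ) {t : ℝ} {g : ℝ → ℂ}
    (hg : g ∈ boxFun 0 (D.h n)) {M : ℝ} (hM : ∀ x, ‖g x‖ ≤ M) (ht : 2 * |t| ≤ D.h n) :
    ‖inner ℂ (E n g) (U t (E n g))
      - w n * boxInner g (shift t ((Set.Ico |t| (D.h n - |t|)).indicator g))‖
      ≤ ‖E n g‖ * (2 * (M * √(w n * |t|))) := by
  set k := |t| with hk
  have hk0 : 0 ≤ k := abs_nonneg t
  set b := (Set.Ico k (D.h n - k)).indicator g with hb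
  have hbm : b ∈ boxFun k (D.h n - k) := indicator_mem_boxFun_of_mem hg
  have hb0 : b ∈ boxFun 0 (D.h n) := boxFun_mono hk0 (by linarith) hbm
  set a := (Set.Ico 0 k).indicator g with ha
  set c := (Set.Ico (D.h n - k) (D.h n)).indicator g with hc
  have ha0 : a ∈ boxFun 0 (D.h n) :=
    boxFun_mono le_rfl (by linarith) (indicator_mem_boxFun_of_mem hg)
  have hc0 : c ∈ boxFun 0 (D.h n) :=
    boxFun_mono (by linarith) le_rfl (indicator_mem_boxFun_of_mem hg)
  have hsum : g - b = a + c := by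
    ext x
    simp only [Pi.sub_apply, Pi.add_apply, ha, hb, hc, Set.indicator, Set.mem_Ico]
    by_cases hx : x ∈ Set.Ico 0 (D.h n)
    · rcases lt_or_ge x k with h3 | h3
      · rw [if_neg (by rintro ⟨h4, _⟩; linarith), if_pos ⟨hx.1, h3⟩,
          if_neg (by rintro ⟨h4, _⟩; linarith)]
        ring
      · rcases lt_or_ge x (D.h n - k) with h4 | h4
        · rw [if_pos ⟨h3, h4⟩, if_neg (by rintro ⟨_, h5⟩; linarith),
            if_neg (by rintro ⟨h5, _⟩; linarith)]
          ring
        · rw [if_neg (by rintro ⟨_, h5⟩; linarith), if_neg (by rintro ⟨_, h5⟩; linarith),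
            if_pos ⟨h4, hx.2⟩]
          ring
    · rw [hg.2.2 x hx]
      simp
  have hs : shift t b ∈ boxFun 0 (D.h n) :=
    shift_mem_boxFun_of_le hbm (by linarith [neg_abs_le t]) (by linarith [le_abs_self t])
  rw [← H.inner_map n g hg _ hs, ← H.translate n t b hb0 hs, ← inner_sub_right,
    ← _root_.map_sub, ← H.map_sub n hg hb0, hsum, H.map_add n a ha0 c hc0]
  refine (norm_inner_le_norm _ _).trans (mul_le_mul_of_nonneg_left ?_ (norm_nonneg _))
  rw [LinearIsometry.norm_map]
  refine (norm_add_le _ _).trans ?_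
  have h1 := H.norm_map_le n ha0 (M := M) (a := 0) (b := k)
    (fun x => (norm_indicator_le_norm_self _ _).trans (hM x)) hk0
    fun x hx => Set.indicator_of_notMem hx _
  have h2 := H.norm_map_le n hc0 (M := M) (a := D.h n - k) (b := D.h n)
    (fun x => (norm_indicator_le_norm_self _ _).trans (hM x)) (by linarith)
    fun x hx => Set.indicator_of_notMem hx _
  rw [sub_zero] at h1
  rw [sub_sub_cancel] at h2
  linarith

lemma inner_raise_raise (H : IsRankOne D w U β E) (n : ℕ) (b b' : ℝ → ℂ) {f f' : ℝ → ℂ}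
    (hf : f ∈ boxFun 0 (D.h n)) (hf' : f' ∈ boxFun 0 (D.h n)) :
    inner ℂ (E (n + 1) (raise (D.C (n + 1)) b f)) (E (n + 1) (raise (D.C (n + 1)) b' f'))
      = ((D.C (n + 1)).card : ℂ)⁻¹ * (∑ c ∈ D.C (n + 1), conj (b c) * b' c)
        * inner ℂ (E n f) (E n f') := by
  rw [H.inner_map _ _ (CFData.raise_mem_zero _ hf) _ (CFData.raise_mem_zero _ hf'),
    CFData.boxInner_raise _ _ hf hf', H.inner_map n f hf f' hf', H.weight.succ n]
  have : ((D.C (n + 1)).card : ℂ) ≠ 0 := by exact_mod_cast (D.card_pos n).ne'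
  push_cast
  field_simp

/-- The error made by raising an approximation with some of the coefficients left out. -/
lemma norm_sq_raise_sub_raise_le (H : IsRankOne D w U β E) (n : ℕ) {b : ℝ → ℂ}
    (hb : ∀ c ∈ D.C (n + 1), ‖b c‖ = 1) {S : Set ℝ} [DecidablePred (· ∈ S)] {f f' : ℝ → ℂ}
    (hf : f ∈ boxFun 0 (D.h n)) (hf' : f' ∈ boxFun 0 (D.h n)) :
    ‖E (n + 1) (raise (D.C (n + 1)) b f - raise (D.C (n + 1)) (S.indicator b) f')‖ ^ 2
      ≤ ‖E n (f - f')‖ ^ 2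
        + ((D.C (n + 1)).filter (· ∉ S)).card / (D.C (n + 1)).card * ‖E n f‖ ^ 2 := by
  have hff := Submodule.sub_mem _ hf hf'
  have hC0 : (0 : ℝ) < (D.C (n + 1)).card := by exact_mod_cast D.card_pos n
  -- The error over the copies in `S` is `f - f'`, and over the other copies it is all of `f`. The
  -- two parts live on disjoint copies, so their squared norms add.
  have e : raise (D.C (n + 1)) b f - raise (D.C (n + 1)) (S.indicator b) f'
      = raise (D.C (n + 1)) (S.indicator b) (f - f') + raise (D.C (n + 1)) (Sᶜ.indicator b) f := by
    unfold raise
    rw [← Finset.sum_sub_distrib, ← Finset.sum_add_distrib]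
    refine Finset.sum_congr rfl fun c hc => ?_
    ext s
    by_cases hcS : c ∈ S <;> simp [Set.indicator, hcS, shift, mul_sub]
  have hu := CFData.raise_mem_zero (n := n) (S.indicator b) hff
  have hv := CFData.raise_mem_zero (n := n) (Sᶜ.indicator b) hf
  have horth : inner ℂ (E (n + 1) (raise (D.C (n + 1)) (S.indicator b) (f - f')))
      (E (n + 1) (raise (D.C (n + 1)) (Sᶜ.indicator b) f)) = 0 := by
    rw [H.inner_raise_raise n _ _ hff hf, Finset.sum_eq_zero, mul_zero, zero_mul]
    intro c hc
    by_cases hcS : c ∈ S <;> simp [Set.indicator, hcS]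
  have hnorm : ∀ (R : Set ℝ) [DecidablePred (· ∈ R)] (g : ℝ → ℂ), g ∈ boxFun 0 (D.h n) →
      ‖E (n + 1) (raise (D.C (n + 1)) (R.indicator b) g)‖ ^ 2
        = ((D.C (n + 1)).filter (· ∈ R)).card / (D.C (n + 1)).card * ‖E n g‖ ^ 2 := by
    intro R _ g hg
    have h1 := H.inner_raise_raise n (R.indicator b) (R.indicator b) hg hg
    rw [inner_self_eq_norm_sq_to_K, inner_self_eq_norm_sq_to_K] at h1
    have h2 : ∑ c ∈ D.C (n + 1), conj (R.indicator b c) * R.indicator b c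
        = ((D.C (n + 1)).filter (· ∈ R)).card := by
      rw [Finset.card_filter, Nat.cast_sum]
      refine Finset.sum_congr rfl fun c hc => ?_
      rw [Complex.conj_mul']
      by_cases hcR : c ∈ R <;> simp [Set.indicator, hcR, hb c hc]
    rw [h2] at h1
    refine Complex.ofReal_injective ?_
    push_cast
    rw [div_eq_inv_mul]
    exact h1
  rw [e, H.map_add _ _ hu _ hv, norm_add_sq (𝕜 := ℂ), horth, hnorm S _ hff, hnorm Sᶜ _ hf,
    _root_.map_zero, mul_zero, add_zero]
  refine add_le_add ?_ (le_of_eq ?_)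
  · refine mul_le_of_le_one_left (by positivity) ?_
    rw [div_le_one hC0]
    exact_mod_cast Finset.card_filter_le _ _
  · simp only [Set.mem_compl_iff]

lemma norm_sq_raise (H : IsRankOne D w U β E) (n : ℕ) {b : ℝ → ℂ}
    (hb : ∀ c ∈ D.C (n + 1), ‖b c‖ = 1) {f : ℝ → ℂ} (hf : f ∈ boxFun 0 (D.h n)) :
    ‖E (n + 1) (raise (D.C (n + 1)) b f)‖ ^ 2 = ‖E n f‖ ^ 2 := by
  have hC0 : ((D.C (n + 1)).card : ℂ) ≠ 0 := by exact_mod_cast (D.card_pos n).ne'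
  have h1 := H.inner_raise_raise n b b hf hf
  rw [inner_self_eq_norm_sq_to_K, inner_self_eq_norm_sq_to_K] at h1
  have h2 : ∑ c ∈ D.C (n + 1), conj (b c) * b c = (D.C (n + 1)).card := by
    rw [Finset.sum_congr rfl fun c hc => by rw [Complex.conj_mul', hb c hc]]
    simp
  rw [h2, inv_mul_cancel₀ hC0, one_mul] at h1
  exact Complex.ofReal_injective (by push_cast; exact h1)

/-- The successive lifts of the indicator function of the bottom tower. -/
def _root_.SpectralMult.towerLift (D : CFData) (β : ℕ → ℝ → ℂ) : ℕ → ℝ → ℂ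
  | 0 => boxInd 0 1
  | n + 1 => raise (D.C (n + 1)) (β (n + 1)) (towerLift D β n)

lemma towerLift_mem (D : CFData) (β : ℕ → ℝ → ℂ) (n : ℕ) :
    towerLift D β n ∈ boxFun 0 (D.h n) := by
  induction n with
  | zero => exact boxInd_mem_boxFun_of_le le_rfl (D.one_le_h 0)
  | succ n ih => exact CFData.raise_mem_zero _ ih

lemma map_towerLift (H : IsRankOne D w U β E) (n : ℕ) :
    E n (towerLift D β n) = E 0 (boxInd 0 1) := by
  induction n with
  | zero => rfl
  | succ n ih => rw [← ih, H.refine n _ (towerLift_mem D β n)]; rfl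

lemma norm_towerLift_le (H : IsRankOne D w U β E) (n : ℕ) (x : ℝ) :
    ‖towerLift D β n x‖ ≤ 1 := by
  induction n generalizing x with
  | zero =>
    unfold towerLift boxInd
    rw [Set.indicator]
    split_ifs <;> simp
  | succ n ih =>
    exact CFData.norm_raise_le (fun c hc => (H.norm_coeff n c hc).le) (towerLift_mem D β n) ih x

variable {V' : Type*} [NormedAddCommGroup V'] [InnerProductSpace ℂ V']
  {U' : ℝ → V' →ₗᵢ[ℂ] V'} {γ : ℕ → ℝ → ℂ} {E' : ℕ → (ℝ → ℂ) → V'}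

lemma norm_map_eq (H : IsRankOne D w U β E) (H' : IsRankOne D w U' γ E') (n : ℕ) {f : ℝ → ℂ}
    (hf : f ∈ boxFun 0 (D.h n)) : ‖E n f‖ = ‖E' n f‖ := by
  refine (sq_eq_sq₀ (norm_nonneg _) (norm_nonneg _)).1 ?_
  rw [H.norm_sq_map n hf, H'.norm_sq_map n hf]

open Classical in
/-- Approximate intertwining of the lifts of `towerLift D β N` by means of `β` and of `γ`. -/
lemma exists_approx_lift (H : IsRankOne D w U β E) (H' : IsRankOne D w U' γ E') {z ε : ℕ → ℝ}
    (hγ : ∀ n, 1 ≤ n → ∀ c ∈ D.C (n + 1), c + z (n + 1) ∈ D.C (n + 1) →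
      γ (n + 1) (c + z (n + 1)) = β (n + 1) c)
    (hε : ∀ n, 1 ≤ n → (((D.C (n + 1)).filter fun c => c + z (n + 1) ∉ D.C (n + 1)).card : ℝ)
      ≤ ε n * (D.C (n + 1)).card) {N M : ℕ} (hN : 1 ≤ N) (hNM : N ≤ M) :
    ∃ a ∈ boxFun 0 (D.h M), ∃ G ∈ boxFun 0 (D.h M),
      shift (∑ i ∈ Finset.Ico N M, z (i + 1)) a ∈ boxFun 0 (D.h M) ∧
      E' N (towerLift D β N) = E' M G ∧ ‖E' M G‖ ^ 2 = ‖E 0 (boxInd 0 1)‖ ^ 2 ∧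
      ‖E' M (towerLift D β M - a)‖ ^ 2 ≤ (∑ i ∈ Finset.Ico N M, ε i) * ‖E 0 (boxInd 0 1)‖ ^ 2 ∧
      ‖E' M (G - shift (∑ i ∈ Finset.Ico N M, z (i + 1)) a)‖ ^ 2
        ≤ (∑ i ∈ Finset.Ico N M, ε i) * ‖E 0 (boxInd 0 1)‖ ^ 2 := by
  -- Here `a` is the part of the `β`-lift up to level `M` whose copies remain in the tower under all
  -- translations so far, and `G` is the `γ`-lift from level `N` to `M` of the same initial
  -- function. Translation by the accumulated `z` carries `a` to a part of `G`, and each level adds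
  -- the error `ε`.
  induction M, hNM using Nat.le_induction with
  | base =>
    refine ⟨towerLift D β N, towerLift_mem D β N, towerLift D β N, towerLift_mem D β N, ?_⟩
    simp only [Finset.Ico_self, Finset.sum_empty, shift_zero, sub_self, H'.map_zero]
    refine ⟨towerLift_mem D β N, trivial, ?_, ?_, ?_⟩
    · rw [← norm_map_eq H H' N (towerLift_mem D β N), H.map_towerLift]
    · simp
    · simp
  | succ M hM ih =>
    obtain ⟨a, ha, G, hG, hsa, hE, hEn, h1, h2⟩ := ih
    have hM1 : 1 ≤ M := hN.trans hM
    rw [Finset.sum_Ico_succ_top hM, Finset.sum_Ico_succ_top hM]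
    set Z := ∑ i ∈ Finset.Ico N M, z (i + 1) with hZ
    set Q := ‖E 0 (boxInd 0 1)‖ ^ 2 with hQ
    set C := D.C (M + 1) with hC
    obtain ⟨S, hS⟩ : ∃ S : Set ℝ, ∀ c, c ∈ S ↔ c + z (M + 1) ∈ C :=
      ⟨{c | c + z (M + 1) ∈ C}, fun _ => Iff.rfl⟩
    obtain ⟨S', hS'⟩ : ∃ S : Set ℝ, ∀ c, c ∈ S ↔ c - z (M + 1) ∈ C :=
      ⟨{c | c - z (M + 1) ∈ C}, fun _ => Iff.rfl⟩
    have hC0 : (0 : ℝ) < C.card := by exact_mod_cast D.card_pos M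
    have hQ0 : 0 ≤ Q := by positivity
    have hcard : (C.filter (· ∈ S)).card = (C.filter (· ∈ S')).card := by
      refine Finset.card_bij' (fun c _ => c + z (M + 1)) (fun c _ => c - z (M + 1)) ?_ ?_ ?_ ?_
      · intro c hc
        rw [Finset.mem_filter, hS] at hc
        rw [Finset.mem_filter, hS', add_sub_cancel_right]
        exact ⟨hc.2, hc.1⟩
      · intro c hc
        rw [Finset.mem_filter, hS'] at hc
        rw [Finset.mem_filter, hS, sub_add_cancel]
        exact ⟨hc.2, hc.1⟩
      · intro c _
        ring
      · intro c _
        ring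
    have hcard' : (C.filter (· ∉ S)).card = (C.filter (· ∉ S')).card := by
      have h3 := Finset.card_filter_add_card_filter_not (s := C) (· ∈ S)
      have h4 := Finset.card_filter_add_card_filter_not (s := C) (· ∈ S')
      omega
    have hbad : ((C.filter (· ∉ S)).card : ℝ) / C.card ≤ ε M := by
      rw [div_le_iff₀ hC0]
      simp only [hS]
      exact hε M hM1
    -- The point of the hypothesis on `γ`: moving a copy by `z (M + 1)` turns its `β`-coefficient
    -- into the `γ`-coefficient of its new place.
    have hshift : shift (Z + z (M + 1)) (raise C (S.indicator (β (M + 1))) a)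
        = raise C (S'.indicator (γ (M + 1))) (shift Z a) := by
      ext s
      simp only [shift, raise, Finset.sum_apply, Pi.smul_apply, smul_eq_mul]
      have e1 : ∀ (R : Set ℝ) (b F : ℝ → ℂ), ∑ c ∈ C, R.indicator b c * F c
          = ∑ c ∈ C.filter (· ∈ R), b c * F c := by
        intro R b F
        rw [Finset.sum_filter]
        refine Finset.sum_congr rfl fun c _ => ?_
        by_cases hc : c ∈ R <;> simp [Set.indicator, hc]
      rw [e1 S _ fun c => a (s - (Z + z (M + 1)) - c), e1 S' _ fun c => a (s - c - Z)]
      refine Finset.sum_bij' (fun c _ => c + z (M + 1)) (fun c _ => c - z (M + 1)) ?_ ?_ ?_ ?_ ?_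
      · intro c hc
        rw [Finset.mem_filter, hS] at hc
        rw [Finset.mem_filter, hS', add_sub_cancel_right]
        exact ⟨hc.2, hc.1⟩
      · intro c hc
        rw [Finset.mem_filter, hS'] at hc
        rw [Finset.mem_filter, hS, sub_add_cancel]
        exact ⟨hc.2, hc.1⟩
      · intro c _
        ring
      · intro c _
        ring
      · intro c hc
        rw [Finset.mem_filter, hS] at hc
        rw [hγ M hM1 c hc.1 hc.2]
        congr 2
        ring
    refine ⟨raise C (S.indicator (β (M + 1))) a, CFData.raise_mem_zero _ ha,
      raise C (γ (M + 1)) G, CFData.raise_mem_zero _ hG, ?_, ?_, ?_, ?_, ?_⟩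
    · rw [hshift]
      exact CFData.raise_mem_zero _ hsa
    · rw [hE, H'.refine M G hG]
    · rw [H'.norm_sq_raise M (H'.norm_coeff M) hG, hEn]
    · refine (H'.norm_sq_raise_sub_raise_le M (H.norm_coeff M) (S := S) (towerLift_mem D β M)
        ha).trans ?_
      rw [← norm_map_eq H H' M (towerLift_mem D β M), H.map_towerLift, add_mul]
      exact add_le_add h1 (mul_le_mul_of_nonneg_right hbad hQ0)
    · rw [hshift]
      refine (H'.norm_sq_raise_sub_raise_le M (H'.norm_coeff M) (S := S') hG hsa).trans ?_
      rw [hEn, add_mul, ← hcard']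
      exact add_le_add h2 (mul_le_mul_of_nonneg_right hbad hQ0)

open Classical in
/-- If the coefficients `β` and `γ` agree up to a summable error after translations by `z`, then
the spectral measure of the bottom tower for `β` is also the spectral measure of some vector
for `γ`. -/
theorem exists_inner_eq_of_shift [CompleteSpace V'] (H : IsRankOne D w U β E)
    (H' : IsRankOne D w U' γ E') {z ε : ℕ → ℝ} (hsum : Summable ε) (hε0 : ∀ n, 0 ≤ ε n)
    (hγ : ∀ n, 1 ≤ n → ∀ c ∈ D.C (n + 1), c + z (n + 1) ∈ D.C (n + 1) →
      γ (n + 1) (c + z (n + 1)) = β (n + 1) c)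
    (hε : ∀ n, 1 ≤ n → (((D.C (n + 1)).filter fun c => c + z (n + 1) ∉ D.C (n + 1)).card : ℝ)
      ≤ ε n * (D.C (n + 1)).card) :
    ∃ y ∈ towerSpan D E', ∀ t,
      inner ℂ y (U' t y) = inner ℂ (E 0 (boxInd 0 1)) (U t (E 0 (boxInd 0 1))) := by
  set w0 := E 0 (boxInd 0 1) with hw0
  set y : ℕ → V' := fun N => E' N (towerLift D β N) with hy
  set Z : ℕ → ℝ := fun N => ∑ i ∈ Finset.range N, z (i + 1) with hZ
  have hynorm : ∀ N, ‖y N‖ = ‖w0‖ := fun N => by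
    rw [hy, ← norm_map_eq H H' N (towerLift_mem D β N), H.map_towerLift]
  -- The vectors `y N` do not converge, but after translation by `Z N` they form a Cauchy sequence,
  -- because the total error beyond level `N` is the tail of a convergent series.
  have hdist : ∀ N M, 1 ≤ N → N ≤ M → dist (U' (Z N) (y N)) (U' (Z M) (y M))
      ≤ 2 * (√(∑ i ∈ Finset.Ico N M, ε i) * ‖w0‖) := by
    intro N M hN hM
    obtain ⟨a, ha, G, hG, hsa, hE, hEn, h1, h2⟩ := H.exists_approx_lift H' hγ hε hN hM
    have hZM : Z M = Z N + ∑ i ∈ Finset.Ico N M, z (i + 1) := by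
      rw [hZ]
      exact (Finset.sum_range_add_sum_Ico _ hM).symm
    set ζ := ∑ i ∈ Finset.Ico N M, z (i + 1) with hζ
    rw [dist_eq_norm, hZM, H'.rep.add, ← _root_.map_sub,
      LinearIsometry.norm_map]
    have h0 : 0 ≤ ∑ i ∈ Finset.Ico N M, ε i := Finset.sum_nonneg fun i _ => hε0 i
    have hsq : ∀ x : V', ‖x‖ ^ 2 ≤ (∑ i ∈ Finset.Ico N M, ε i) * ‖w0‖ ^ 2 →
        ‖x‖ ≤ √(∑ i ∈ Finset.Ico N M, ε i) * ‖w0‖ := by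
      intro x hx
      rw [← Real.sqrt_sq (norm_nonneg w0), ← Real.sqrt_mul h0]
      exact Real.le_sqrt_of_sq_le hx
    have e : y N - U' ζ (y M) = E' M (G - shift ζ a) - U' ζ (E' M (towerLift D β M - a)) := by
      rw [H'.map_sub M hG hsa, H'.map_sub M (towerLift_mem D β M) ha, _root_.map_sub,
        H'.translate M ζ a ha hsa]
      simp only [hy, hE]
      abel
    rw [e]
    refine (norm_sub_le _ _).trans ?_
    rw [LinearIsometry.norm_map, two_mul]
    exact add_le_add (hsq _ h2) (hsq _ h1)
  -- The index is shifted by one because the assumptions on the coefficients start at `n = 1`.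
  have hcauchy : CauchySeq fun N => U' (Z (N + 1)) (y (N + 1)) := by
    have htail : Tendsto (fun N => 2 * (√(∑' i, ε (i + (N + 1))) * ‖w0‖)) atTop (𝓝 0) := by
      have h3 := (tendsto_sum_nat_add ε).comp (tendsto_add_atTop_nat 1)
      have := (h3.sqrt.mul_const ‖w0‖).const_mul 2
      simpa using this
    refine cauchySeq_of_le_tendsto_0' _ (fun N M hNM => ?_) htail
    refine (hdist (N + 1) (M + 1) (by omega) (by omega)).trans ?_
    gcongr
    rw [Finset.sum_Ico_eq_sum_range]
    have h4 : Summable fun i => ε (i + (N + 1)) := (summable_nat_add_iff (N + 1)).2 hsum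
    simp only [add_comm (N + 1)]
    exact h4.sum_le_tsum _ fun i _ => hε0 _
  obtain ⟨u, hu⟩ := cauchySeq_tendsto_of_complete hcauchy
  refine ⟨u, ?_, fun t => ?_⟩
  · refine (Submodule.isClosed_topologicalClosure _).mem_of_tendsto hu
      (Eventually.of_forall fun N => ?_)
    exact H'.apply_mem_towerSpan (H'.map_mem_towerSpan _ (towerLift_mem D β _)) _
  · have h1 : Tendsto (fun N => (inner ℂ (y (N + 1)) (U' t (y (N + 1))) : ℂ)) atTop
        (𝓝 (inner ℂ u (U' t u))) := by
      have h2 := hu.inner (𝕜 := ℂ) (((U' t).continuous.tendsto u).comp hu)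
      refine h2.congr fun N => ?_
      have h3 : ∀ s x, U' t (U' s x) = U' s (U' t x) := fun s x => by
        rw [← H'.rep.add, add_comm, H'.rep.add]
      simp only [Function.comp_apply]
      rw [h3, LinearIsometry.inner_map_map]
    -- In both representations the correlation of `towerLift D β N` at time `t` is, up to effects of
    -- the ends of the tower, the same integral over the tower.
    have h2 : Tendsto (fun N => ‖(inner ℂ (y N) (U' t (y N)) : ℂ) - inner ℂ w0 (U t w0)‖) atTop
        (𝓝 0) := by
      have hb : Tendsto (fun N => 4 * (‖w0‖ * √(w N * |t|))) atTop (𝓝 0) := by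
        have := ((H.weight.tendsto_zero.mul_const |t|).sqrt.const_mul ‖w0‖).const_mul 4
        simpa using this
      refine squeeze_zero' (Eventually.of_forall fun N => norm_nonneg _) ?_ hb
      filter_upwards [H.weight.h_tendsto.eventually_ge_atTop (2 * |t|)] with N hN
      have h4 := H.norm_inner_translate_sub_boxInner_le N (towerLift_mem D β N)
        (H.norm_towerLift_le N) hN
      have h5 := H'.norm_inner_translate_sub_boxInner_le N (towerLift_mem D β N)
        (H.norm_towerLift_le N) hN
      have h6 := hynorm N
      simp only [hy] at h6 ⊢
      rw [H.map_towerLift, ← hw0] at h4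
      rw [h6] at h5
      rw [norm_sub_rev] at h4
      have := norm_sub_le_norm_sub_add_norm_sub (inner ℂ (E' N (towerLift D β N))
        (U' t (E' N (towerLift D β N))))
        (w N * boxInner (towerLift D β N) (shift t ((Set.Ico |t| (D.h N - |t|)).indicator
          (towerLift D β N)))) (inner ℂ w0 (U t w0))
      linarith
    have h3 := tendsto_iff_norm_sub_tendsto_zero.2 (h2.comp (tendsto_add_atTop_nat 1))
    exact tendsto_nhds_unique h1 h3

end IsRankOne

namespace CFData

variable (D : CFData)

/-! ### Positions in the towers -/

/-- The element `c` of `C_{n+1}` such that `s` lies in `F_n + c` (or `0` if there is none). -/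
def dig (n : ℕ) (s : ℝ) : ℝ := ∑ c ∈ D.C (n + 1), (Set.Ico c (D.h n + c)).indicator (fun _ => c) s

open Classical in
/-- The position in `F_n` of a point with position `s` in `F_{n+1}` (or `-1` if there is none). -/
def down (n : ℕ) (s : ℝ) : ℝ :=
  if s - D.dig n s ∈ Set.Ico 0 (D.h n) then s - D.dig n s else -1

lemma measurable_dig (n : ℕ) : Measurable (D.dig n) :=
  Finset.measurable_sum _ fun _ _ => measurable_const.indicator measurableSet_Ico

lemma measurable_down (n : ℕ) : Measurable (D.down n) :=
  Measurable.ite ((measurable_id.sub (D.measurable_dig n)) measurableSet_Ico)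
    (measurable_id.sub (D.measurable_dig n)) measurable_const

variable {D}

lemma dig_eq {n : ℕ} {c s : ℝ} (hc : c ∈ D.C (n + 1)) (hs : s - c ∈ Set.Ico 0 (D.h n)) :
    D.dig n s = c := by
  unfold dig
  rw [Finset.sum_eq_single_of_mem c hc, Set.indicator_of_mem]
  · exact ⟨by linarith [hs.1], by linarith [hs.2]⟩
  · intro c' hc' hne
    refine Set.indicator_of_notMem (fun h => hne (eq_of_mem_Ico hc' hc ?_ hs)) _
    exact ⟨by linarith [h.1], by linarith [h.2]⟩

lemma dig_eq_zero {n : ℕ} {s : ℝ} (h : ∀ c ∈ D.C (n + 1), s - c ∉ Set.Ico 0 (D.h n)) :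
    D.dig n s = 0 :=
  Finset.sum_eq_zero fun c hc => Set.indicator_of_notMem (fun h' => h c hc
    ⟨by linarith [h'.1], by linarith [h'.2]⟩) _

lemma dig_mem (n : ℕ) (s : ℝ) : D.dig n s ∈ D.C (n + 1) := by
  by_cases h : ∃ c ∈ D.C (n + 1), s - c ∈ Set.Ico 0 (D.h n)
  · obtain ⟨c, hc, hs⟩ := h
    rwa [dig_eq hc hs]
  · push Not at h
    rw [dig_eq_zero h]
    exact D.zero_mem n

lemma down_eq {n : ℕ} {c s : ℝ} (hc : c ∈ D.C (n + 1)) (hs : s - c ∈ Set.Ico 0 (D.h n)) :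
    D.down n s = s - c := by
  rw [down, dig_eq hc hs, if_pos hs]

lemma down_eq_neg_one {n : ℕ} {s : ℝ} (h : ∀ c ∈ D.C (n + 1), s - c ∉ Set.Ico 0 (D.h n)) :
    D.down n s = -1 := by
  rw [down, if_neg (h _ (dig_mem n s))]

lemma down_mem_iff {n : ℕ} {s : ℝ} :
    D.down n s ∈ Set.Ico 0 (D.h n) ↔ ∃ c ∈ D.C (n + 1), s - c ∈ Set.Ico 0 (D.h n) := by
  constructor
  · intro h
    by_contra h'
    push Not at h'
    rw [down_eq_neg_one h'] at h
    linarith [h.1]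
  · rintro ⟨c, hc, hs⟩
    rwa [down_eq hc hs]

/-- Sequences of positions in the towers with index at least `n`. -/
def IsPath (D : CFData) (n : ℕ) (u : ℕ → ℝ) : Prop :=
  u n ∈ Set.Ico 0 (D.h n) ∧ ∀ m, n ≤ m → u (m + 1) - u m ∈ D.C (m + 1)

lemma IsPath.mem {n : ℕ} {u : ℕ → ℝ} (hu : D.IsPath n u) {m : ℕ} (hm : n ≤ m) :
    u m ∈ Set.Ico 0 (D.h m) := by
  induction m, hm using Nat.le_induction with
  | base => exact hu.1
  | succ m hm ih =>
    have h1 := hu.2 m hm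
    exact ⟨by linarith [D.nonneg m _ h1, ih.1], by linarith [D.add_le m _ h1, ih.2]⟩

lemma IsPath.mono {n : ℕ} {u : ℕ → ℝ} (hu : D.IsPath n u) {m : ℕ} (hm : n ≤ m) : D.IsPath m u :=
  ⟨hu.mem hm, fun k hk => hu.2 k (hm.trans hk)⟩

lemma IsPath.sub_mem {n : ℕ} {u : ℕ → ℝ} (hu : D.IsPath n u) {m : ℕ} (hm : n ≤ m) :
    u (m + 1) - (u (m + 1) - u m) ∈ Set.Ico 0 (D.h m) := by
  rw [sub_sub_cancel]
  exact hu.mem hm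

lemma IsPath.down_eq {n : ℕ} {u : ℕ → ℝ} (hu : D.IsPath n u) {m : ℕ} (hm : n ≤ m) :
    D.down m (u (m + 1)) = u m := by
  rw [CFData.down_eq (hu.2 m hm) (hu.sub_mem hm), sub_sub_cancel]

lemma IsPath.dig_eq {n : ℕ} {u : ℕ → ℝ} (hu : D.IsPath n u) {m : ℕ} (hm : n ≤ m) :
    D.dig m (u (m + 1)) = u (m + 1) - u m :=
  CFData.dig_eq (hu.2 m hm) (hu.sub_mem hm)

lemma IsPath.eq_of_eventuallyEq {n : ℕ} {u u' : ℕ → ℝ} (hu : D.IsPath n u) (hu' : D.IsPath n u')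
    (h : u =ᶠ[atTop] u') {m : ℕ} (hm : n ≤ m) : u m = u' m := by
  obtain ⟨N, hN⟩ := eventually_atTop.1 h
  obtain ⟨k, hk⟩ : ∃ k, N ≤ m + k := ⟨N, Nat.le_add_left _ _⟩
  induction k generalizing m with
  | zero => exact hN m hk
  | succ k ih =>
    rw [← hu.down_eq hm, ← hu'.down_eq hm, ih (hm.trans (Nat.le_succ m)) (by omega)]

lemma isPath_level {n : ℕ} (q : D.Level n) :
    D.IsPath n fun m => (q.1 : ℝ) + ∑ k ∈ Finset.range (m - n), (q.2 k : ℝ) := by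
  refine ⟨by simp, fun m hm => ?_⟩
  obtain ⟨k, rfl⟩ := Nat.exists_eq_add_of_le hm
  simp only [Nat.add_sub_cancel_left, add_assoc]
  rw [Finset.sum_range_succ, add_sub_add_left_eq_sub, add_sub_cancel_left]
  have h : ∀ a, a = k + n + 1 → (q.2 k : ℝ) ∈ D.C a := by
    rintro _ rfl
    exact (q.2 k).2
  exact h _ (by omega)

lemma IsPath.exists_level {n : ℕ} {u : ℕ → ℝ} (hu : D.IsPath n u) :
    ∃ q : D.Level n, D.germ n q = (u : Germ (atTop : Filter ℕ) ℝ) := by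
  refine ⟨⟨⟨u n, hu.1⟩, fun k => ⟨u (k + n + 1) - u (k + n), hu.2 _ (Nat.le_add_left _ _)⟩⟩, ?_⟩
  refine Germ.coe_eq.2 (eventually_atTop.2 ⟨n, fun m hm => ?_⟩)
  obtain ⟨k, rfl⟩ := Nat.exists_eq_add_of_le hm
  simp only [Nat.add_sub_cancel_left]
  have := Finset.sum_range_sub (fun j => u (j + n)) k
  simp only [Nat.add_right_comm _ 1 n] at this
  rw [this, zero_add, add_comm k n]
  ring

lemma mem_levelSet_iff {n : ℕ} {x : D.X} :
    x ∈ D.levelSet n ↔ ∃ u, D.IsPath n u ∧ (u : Germ (atTop : Filter ℕ) ℝ) = x.val := by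
  constructor
  · rintro ⟨q, rfl⟩
    exact ⟨_, isPath_level q, rfl⟩
  · rintro ⟨u, hu, hx⟩
    obtain ⟨q, hq⟩ := hu.exists_level
    exact ⟨q, X.ext (hq.trans hx)⟩

lemma levelSet_mono : Monotone D.levelSet := fun n m hnm x hx => by
  rw [mem_levelSet_iff] at hx ⊢
  obtain ⟨u, hu, h⟩ := hx
  exact ⟨u, hu.mono hnm, h⟩

lemma exists_mem_levelSet (x : D.X) : ∃ n, x ∈ D.levelSet n := ⟨_, D.mem_levelSet_index x⟩

lemma index_le_iff {x : D.X} {n : ℕ} : D.index x ≤ n ↔ x ∈ D.levelSet n :=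
  ⟨fun h => levelSet_mono h (D.mem_levelSet_index x), fun h => Nat.sInf_le h⟩

open Classical in
/-- The position of `x` in `F_n` (or `-1` if `x` does not belong to `X_n`). -/
def pos (n : ℕ) (x : D.X) : ℝ :=
  if h : ∃ u, D.IsPath n u ∧ (u : Germ (atTop : Filter ℕ) ℝ) = x.val then h.choose n else -1

lemma IsPath.pos_eq {n : ℕ} {u : ℕ → ℝ} {x : D.X} (hu : D.IsPath n u)
    (hx : (u : Germ (atTop : Filter ℕ) ℝ) = x.val) {m : ℕ} (hm : n ≤ m) : pos m x = u m := by
  have h : ∃ u, D.IsPath m u ∧ (u : Germ (atTop : Filter ℕ) ℝ) = x.val := ⟨u, hu.mono hm, hx⟩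
  rw [pos, dif_pos h]
  exact h.choose_spec.1.eq_of_eventuallyEq (hu.mono hm)
    (Germ.coe_eq.1 (h.choose_spec.2.trans hx.symm)) le_rfl

lemma isPath_pos {n : ℕ} {x : D.X} (hx : x ∈ D.levelSet n) : D.IsPath n fun m => pos m x := by
  obtain ⟨u, hu, h⟩ := mem_levelSet_iff.1 hx
  refine ⟨?_, fun m hm => ?_⟩
  · simp only [hu.pos_eq h le_rfl]
    exact hu.1
  · simp only [hu.pos_eq h hm, hu.pos_eq h (hm.trans (Nat.le_succ m))]
    exact hu.2 m hm

lemma coe_pos (x : D.X) : ((fun m => pos m x : ℕ → ℝ) : Germ (atTop : Filter ℕ) ℝ) = x.val := by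
  obtain ⟨n, hn⟩ := exists_mem_levelSet x
  obtain ⟨u, hu, h⟩ := mem_levelSet_iff.1 hn
  rw [← h]
  exact Germ.coe_eq.2 (eventually_atTop.2 ⟨n, fun m hm => hu.pos_eq h hm⟩)

lemma pos_of_notMem {n : ℕ} {x : D.X} (hx : x ∉ D.levelSet n) : pos n x = -1 := by
  rw [mem_levelSet_iff] at hx
  rw [pos, dif_neg hx]

lemma pos_mem_iff {n : ℕ} {x : D.X} : pos n x ∈ Set.Ico 0 (D.h n) ↔ x ∈ D.levelSet n := by
  refine ⟨fun h => ?_, fun h => (isPath_pos h).1⟩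
  by_contra h'
  rw [pos_of_notMem h'] at h
  linarith [h.1]

/-- Otherwise the path of positions of `x` could be continued one level down, and `x` would lie in
`X_n`. When `x` is not even in `X_{n+1}`, the conventional position `-1` does the job. -/
lemma sub_notMem_of_notMem {n : ℕ} {x : D.X} (hx : x ∉ D.levelSet n) {c : ℝ}
    (hc : c ∈ D.C (n + 1)) : pos (n + 1) x - c ∉ Set.Ico 0 (D.h n) := by
  intro hs
  by_cases h1 : x ∈ D.levelSet (n + 1)
  · refine hx (mem_levelSet_iff.2 ⟨fun m => if m = n then pos (n + 1) x - c else pos m x, ⟨?_, ?_⟩, ?_⟩)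
    · simpa using hs
    · intro m hm
      rcases hm.eq_or_lt with rfl | hm
      · simpa using hc
      · simp only [if_neg hm.ne', if_neg (by omega : m + 1 ≠ n)]
        exact (isPath_pos h1).2 m hm
    · rw [← coe_pos x]
      refine Germ.coe_eq.2 (eventually_atTop.2 ⟨n + 1, fun m hm => ?_⟩)
      exact if_neg (by omega)
  · rw [pos_of_notMem h1] at hs
    linarith [hs.1, D.nonneg n c hc]

lemma pos_eq_down (n : ℕ) (x : D.X) : pos n x = D.down n (pos (n + 1) x) := by
  by_cases hx : x ∈ D.levelSet n
  · exact ((isPath_pos hx).down_eq le_rfl).symm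
  · rw [pos_of_notMem hx, down_eq_neg_one fun c hc => sub_notMem_of_notMem hx hc]

lemma ext_of_pos {x y : D.X} (h : ∀ᶠ n in atTop, pos n x = pos n y) : x = y :=
  X.ext ((coe_pos x).symm.trans ((Germ.coe_eq.2 h).trans (coe_pos y)))

/-- Replaces the digits, defined through a choice of coordinates, by an explicit measurable function
of the position. Below the index of `x` both sides are `0` by convention. -/
lemma digit_eq (x : D.X) (n : ℕ) : D.digit x (n + 1) = D.dig n (pos (n + 1) x) := by
  unfold digit
  split_ifs with h
  · have hle : D.index x ≤ n := Nat.lt_succ_iff.1 h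
    have h1 := isPath_level (D.coord x)
    have h2 : D.germ _ (D.coord x) = x.val := congrArg X.val (D.mem_levelSet_index x).choose_spec
    rw [(isPath_pos (index_le_iff.1 hle)).dig_eq le_rfl, h1.pos_eq h2 hle,
      h1.pos_eq h2 (hle.trans (Nat.le_succ n)), show n + 1 - D.index x = n - D.index x + 1 by omega,
      Finset.sum_range_succ, add_sub_add_left_eq_sub, add_sub_cancel_left,
      Nat.add_sub_cancel]
  · have h1 : x ∉ D.levelSet n := fun h' => h (Nat.lt_succ_iff.2 (index_le_iff.2 h'))
    rw [dig_eq_zero fun c hc => sub_notMem_of_notMem h1 hc]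

/-! ### The Borel structure -/

lemma measurable_emb (n : ℕ) : Measurable (D.emb n) := fun _ hA =>
  MeasurableSpace.measurableSet_iInf.1 hA n

lemma measurable_of_comp_emb {β : Type*} [MeasurableSpace β] {f : D.X → β}
    (h : ∀ n, Measurable (f ∘ D.emb n)) : Measurable f := fun _ hA =>
  MeasurableSpace.measurableSet_iInf.2 fun n => h n hA

lemma pos_emb {n : ℕ} (q : D.Level n) {m : ℕ} (hm : n ≤ m) :
    pos m (D.emb n q) = (q.1 : ℝ) + ∑ k ∈ Finset.range (m - n), (q.2 k : ℝ) :=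
  (isPath_level q).pos_eq rfl hm

lemma measurable_pos (n : ℕ) : Measurable (pos n : D.X → ℝ) := by
  refine measurable_of_comp_emb fun m => ?_
  have h1 : ∀ k, m ≤ k → Measurable (pos k ∘ D.emb m) := by
    intro k hk
    have : pos k ∘ D.emb m = fun q : D.Level m =>
        (q.1 : ℝ) + ∑ j ∈ Finset.range (k - m), (q.2 j : ℝ) := funext fun q => pos_emb q hk
    rw [this]
    refine (measurable_subtype_coe.comp measurable_fst).add (Finset.measurable_sum _ fun j _ => ?_)
    exact measurable_subtype_coe.comp ((measurable_pi_apply j).comp measurable_snd)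
  obtain ⟨k, hk⟩ : ∃ k, m ≤ n + k := ⟨m, Nat.le_add_left _ _⟩
  induction k generalizing n with
  | zero => exact h1 n hk
  | succ k ih =>
    have : pos n ∘ D.emb m = D.down n ∘ (pos (n + 1) ∘ D.emb m) := funext fun q => pos_eq_down n _
    rw [this]
    exact (D.measurable_down n).comp (ih (n + 1) (by omega))

lemma measurableSet_levelSet (n : ℕ) : MeasurableSet (D.levelSet n) := by
  have : D.levelSet n = pos n ⁻¹' Set.Ico 0 (D.h n) := Set.ext fun x => pos_mem_iff.symm
  rw [this]
  exact measurable_pos n measurableSet_Ico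

open Classical in
/-- A left inverse of the embedding of `X_n`. -/
def lift (n : ℕ) (x : D.X) : D.Level n :=
  (⟨if pos n x ∈ Set.Ico 0 (D.h n) then pos n x else 0, by
    split_ifs with h
    · exact h
    · exact ⟨le_rfl, D.h_pos n⟩⟩,
   fun k => ⟨if pos (k + n + 1) x - pos (k + n) x ∈ D.C (k + n + 1) then
      pos (k + n + 1) x - pos (k + n) x else 0, by
    split_ifs with h
    · exact h
    · exact D.zero_mem _⟩)

lemma emb_lift {n : ℕ} {x : D.X} (hx : x ∈ D.levelSet n) : D.emb n (lift n x) = x := by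
  have h := isPath_pos hx
  refine ext_of_pos (eventually_atTop.2 ⟨n, fun m hm => ?_⟩)
  rw [pos_emb _ hm]
  simp only [lift, if_pos h.1]
  rw [Finset.sum_congr rfl fun k _ => if_pos (h.2 (k + n) (Nat.le_add_left _ _))]
  obtain ⟨k, rfl⟩ := Nat.exists_eq_add_of_le hm
  have := Finset.sum_range_sub (fun j => pos (j + n) x) k
  simp only [Nat.add_right_comm _ 1 n] at this
  rw [Nat.add_sub_cancel_left, this, zero_add, add_comm k n]
  ring

-- On `X_n` the embedding is inverted by `lift`, which is built from differences of positions. So a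
-- set whose preimages in all levels are measurable is already measurable in terms of positions.
variable (D) in
lemma measurableSpace_eq :
    (inferInstance : MeasurableSpace D.X) = ⨆ n, MeasurableSpace.comap (pos n) inferInstance := by
  refine le_antisymm ?_ (iSup_le fun n => (measurable_pos n).comap_le)
  intro A hA
  set m' : MeasurableSpace D.X := ⨆ n, MeasurableSpace.comap (pos n) inferInstance with hm'
  have hpos : ∀ n, Measurable[m'] (pos n : D.X → ℝ) := fun n =>
    measurable_iff_comap_le.2 (le_iSup (fun n => MeasurableSpace.comap (pos n) inferInstance) n)
  have hlift : ∀ n, Measurable[m'] (lift n : D.X → D.Level n) := by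
    intro n
    refine Measurable.prodMk ?_ (measurable_pi_lambda _ fun k => ?_)
    · refine Measurable.subtype_mk ?_
      exact Measurable.ite (hpos n measurableSet_Ico) (hpos n) measurable_const
    · refine Measurable.subtype_mk ?_
      have hd : Measurable[m'] fun x : D.X => pos (k + n + 1) x - pos (k + n) x :=
        (hpos _).sub (hpos _)
      exact Measurable.ite (hd (D.C (k + n + 1)).measurableSet) hd measurable_const
  have hlev : ∀ n, MeasurableSet[m'] (D.levelSet n) := by
    intro n
    have : D.levelSet n = pos n ⁻¹' Set.Ico 0 (D.h n) := Set.ext fun x => pos_mem_iff.symm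
    rw [this]
    exact hpos n measurableSet_Ico
  have hA' : A = ⋃ n, D.levelSet n ∩ lift n ⁻¹' (D.emb n ⁻¹' A) := by
    ext x
    simp only [Set.mem_iUnion, Set.mem_inter_iff, Set.mem_preimage]
    constructor
    · intro hx
      obtain ⟨n, hn⟩ := exists_mem_levelSet x
      exact ⟨n, hn, by rwa [emb_lift hn]⟩
    · rintro ⟨n, hn, hx⟩
      rwa [emb_lift hn] at hx
  rw [hA']
  exact MeasurableSet.iUnion fun n => (hlev n).inter (hlift n (measurable_emb n hA))

lemma measurable_of_comp_pos {β : Type*} [MeasurableSpace β] {f : β → D.X}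
    (h : ∀ n, Measurable fun b => pos n (f b)) : Measurable f := by
  have := measurableSpace_eq D
  rw [measurable_iff_le_map]
  intro A hA
  change MeasurableSet[inferInstance] A at hA
  rw [this] at hA
  have h2 : (⨆ n, MeasurableSpace.comap (pos n : D.X → ℝ) inferInstance)
      ≤ MeasurableSpace.map f inferInstance := by
    refine iSup_le fun n => ?_
    rw [← measurable_iff_comap_le]
    intro B hB
    exact h n hB
  exact h2 A hA

/-- Positions in higher towers determine those in lower towers. -/
lemma exists_pos_eq_comp {n m : ℕ} (hnm : n ≤ m) :
    ∃ g : ℝ → ℝ, Measurable g ∧ (∀ s, g s ∈ Set.Ico 0 (D.h n) → s ∈ Set.Ico 0 (D.h m)) ∧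
      ∀ x : D.X, pos n x = g (pos m x) := by
  induction m, hnm using Nat.le_induction with
  | base => exact ⟨id, measurable_id, fun s hs => hs, fun x => rfl⟩
  | succ m hm ih =>
    obtain ⟨g, hg, hg1, hg2⟩ := ih
    refine ⟨g ∘ D.down m, hg.comp (D.measurable_down m), fun s hs => ?_, fun x => ?_⟩
    · obtain ⟨c, hc, h1⟩ := down_mem_iff.1 (hg1 _ hs)
      exact ⟨by linarith [h1.1, D.nonneg m c hc], by linarith [h1.2, D.add_le m c hc]⟩
    · rw [hg2 x, Function.comp_apply, ← pos_eq_down]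

/-- The sets of points whose position in a tower lies in a given set. -/
def posSets (D : CFData) (N : ℕ) : Set (Set D.X) :=
  {A | ∃ n, N ≤ n ∧ ∃ B ⊆ Set.Ico 0 (D.h n), MeasurableSet B ∧ A = pos n ⁻¹' B}

lemma exists_preimage_pos_eq {n m : ℕ} {B : Set ℝ} (hB : MeasurableSet B)
    (hB0 : B ⊆ Set.Ico 0 (D.h n)) (hnm : n ≤ m) :
    ∃ B' ⊆ Set.Ico 0 (D.h m), MeasurableSet B' ∧ (pos n ⁻¹' B : Set D.X) = pos m ⁻¹' B' := by
  obtain ⟨g, hg, hg1, hg2⟩ := exists_pos_eq_comp (D := D) hnm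
  refine ⟨g ⁻¹' B, fun s hs => hg1 s (hB0 hs), hg hB, ?_⟩
  ext x
  simp only [Set.mem_preimage, hg2 x]

variable (D) in
lemma isPiSystem_posSets (N : ℕ) : IsPiSystem (D.posSets N) := by
  rintro _ ⟨n, hn, B, hB0, hB, rfl⟩ _ ⟨m, hm, B', hB0', hB', rfl⟩ -
  obtain ⟨A, hA0, hA, e⟩ := exists_preimage_pos_eq hB hB0 (le_max_left n m)
  obtain ⟨A', hA0', hA', e'⟩ := exists_preimage_pos_eq hB' hB0' (le_max_right n m)
  refine ⟨max n m, hn.trans (le_max_left _ _), A ∩ A', Set.inter_subset_left.trans hA0,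
    hA.inter hA', ?_⟩
  rw [e, e', Set.preimage_inter]

variable (D) in
lemma generateFrom_posSets (N : ℕ) :
    (inferInstance : MeasurableSpace D.X) = MeasurableSpace.generateFrom (D.posSets N) := by
  refine le_antisymm ?_ (MeasurableSpace.generateFrom_le ?_)
  · rw [measurableSpace_eq D]
    refine iSup_le fun n => ?_
    rw [← measurable_iff_comap_le]
    have hlarge : ∀ m, N ≤ m → Measurable[MeasurableSpace.generateFrom (D.posSets N)]
        (pos m : D.X → ℝ) := by
      intro m hm B hB
      have hI : MeasurableSet[MeasurableSpace.generateFrom (D.posSets N)]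
          (pos m ⁻¹' Set.Ico 0 (D.h m) : Set D.X) :=
        MeasurableSpace.measurableSet_generateFrom ⟨m, hm, _, subset_rfl, measurableSet_Ico, rfl⟩
      have e : (pos m ⁻¹' B : Set D.X) = (pos m ⁻¹' (B ∩ Set.Ico 0 (D.h m)))
          ∪ ((pos m ⁻¹' Set.Ico 0 (D.h m))ᶜ ∩ {_x | (-1 : ℝ) ∈ B}) := by
        ext x
        by_cases hx : x ∈ D.levelSet m
        · have := pos_mem_iff.2 hx
          simp only [Set.mem_preimage, Set.mem_union, Set.mem_inter_iff, Set.mem_compl_iff, this]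
          tauto
        · have h1 := fun h => hx (pos_mem_iff.1 h)
          simp only [Set.mem_preimage, Set.mem_union, Set.mem_inter_iff, Set.mem_compl_iff,
            Set.mem_ofPred_eq, pos_of_notMem hx]
          tauto
      rw [e]
      refine MeasurableSet.union (MeasurableSpace.measurableSet_generateFrom
        ⟨m, hm, _, Set.inter_subset_right, hB.inter measurableSet_Ico, rfl⟩)
        (hI.compl.inter (MeasurableSet.const _))
    obtain ⟨g, hg, -, hg2⟩ := exists_pos_eq_comp (D := D) (le_max_left n N)
    have : (pos n : D.X → ℝ) = g ∘ pos (max n N) := funext hg2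
    rw [this]
    exact hg.comp (hlarge _ (le_max_right _ _))
  · rintro _ ⟨n, -, B, -, hB, rfl⟩
    exact measurable_pos n hB

lemma iUnion_levelSet_add (N : ℕ) : ⋃ n, D.levelSet (n + N) = Set.univ := by
  refine Set.eq_univ_of_forall fun x => ?_
  obtain ⟨n, hn⟩ := exists_mem_levelSet x
  exact Set.mem_iUnion.2 ⟨n, levelSet_mono (Nat.le_add_right _ _) hn⟩

lemma preimage_pos_Ico (n : ℕ) : (pos n ⁻¹' Set.Ico 0 (D.h n) : Set D.X) = D.levelSet n :=
  Set.ext fun _ => pos_mem_iff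

/-- Finite measures on `X` are determined by the distributions of the positions. -/
lemma measure_ext_of_pos {μ ν : Measure D.X} [IsFiniteMeasure μ] (N : ℕ)
    (h : ∀ n, N ≤ n → ∀ B ⊆ Set.Ico 0 (D.h n), MeasurableSet B → μ (pos n ⁻¹' B) = ν (pos n ⁻¹' B)) :
    μ = ν := by
  refine ext_of_generate_finite _ (generateFrom_posSets D N) (isPiSystem_posSets D N) ?_ ?_
  · rintro _ ⟨n, hn, B, hB0, hB, rfl⟩
    exact h n hn B hB0 hB
  · rw [← iUnion_levelSet_add N, Monotone.measure_iUnion, Monotone.measure_iUnion]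
    · congr 1
      ext n
      rw [← preimage_pos_Ico]
      exact h _ (Nat.le_add_left _ _) _ subset_rfl measurableSet_Ico
    all_goals exact fun a b hab => levelSet_mono (Nat.add_le_add_right hab N)

end CFData

namespace CFData

variable (D : CFData)

/-! ### The distributions of the positions -/

open Classical in
/-- The set of positions in `F_m` of the points of `X_n`. -/
def reach (n : ℕ) : ℕ → Set ℝ
  | 0 => if n = 0 then Set.Ico 0 (D.h n) else ∅
  | m + 1 => if n = m + 1 then Set.Ico 0 (D.h n) else D.down m ⁻¹' reach n m

variable {D}

lemma reach_self (n : ℕ) : D.reach n n = Set.Ico 0 (D.h n) := by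
  cases n <;> simp [reach]

lemma reach_succ {n m : ℕ} (h : n ≤ m) : D.reach n (m + 1) = D.down m ⁻¹' D.reach n m := by
  rw [reach, if_neg (by omega)]

lemma measurableSet_reach {n m : ℕ} (h : n ≤ m) : MeasurableSet (D.reach n m) := by
  induction m, h using Nat.le_induction with
  | base => rw [reach_self]; exact measurableSet_Ico
  | succ m hm ih => rw [reach_succ hm]; exact D.measurable_down m ih

lemma down_preimage_subset (m : ℕ) : D.down m ⁻¹' Set.Ico 0 (D.h m) ⊆ Set.Ico 0 (D.h (m + 1)) := by
  intro s hs
  obtain ⟨c, hc, h1⟩ := down_mem_iff.1 hs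
  exact ⟨by linarith [h1.1, D.nonneg m c hc], by linarith [h1.2, D.add_le m c hc]⟩

lemma reach_subset {n k m : ℕ} (hnk : n ≤ k) (hkm : k ≤ m) : D.reach n m ⊆ D.reach k m := by
  have h0 : ∀ j, n ≤ j → D.reach n j ⊆ Set.Ico 0 (D.h j) := by
    intro j hj
    induction j, hj using Nat.le_induction with
    | base => rw [reach_self]
    | succ j hj ih =>
      rw [reach_succ hj]
      exact (Set.preimage_mono ih).trans (down_preimage_subset j)
  induction m, hkm using Nat.le_induction with
  | base => rw [reach_self]; exact h0 k hnk
  | succ m hm ih =>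
    rw [reach_succ (hnk.trans hm), reach_succ hm]
    exact Set.preimage_mono ih

lemma reach_subset_Ico {n m : ℕ} (h : n ≤ m) : D.reach n m ⊆ Set.Ico 0 (D.h m) :=
  (reach_subset h le_rfl).trans (reach_self m).subset

lemma pos_mem_reach_iff {n m : ℕ} (h : n ≤ m) {x : D.X} :
    pos m x ∈ D.reach n m ↔ x ∈ D.levelSet n := by
  induction m, h using Nat.le_induction with
  | base => rw [reach_self, pos_mem_iff]
  | succ m hm ih => rw [reach_succ hm, Set.mem_preimage, ← pos_eq_down, ih]

/-- The positions in `F_{m+1}` of the points of `X_n` are the disjoint translates by `c ∈ C_{m+1}`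
of their positions in `F_m`. -/
lemma volume_inter_reach_succ {n m : ℕ} (h : n ≤ m) {B : Set ℝ} (hB : MeasurableSet B) :
    volume (B ∩ D.reach n (m + 1))
      = ∑ c ∈ D.C (m + 1), volume ((fun s => s + c) ⁻¹' B ∩ D.reach n m) := by
  have e : B ∩ D.reach n (m + 1)
      = ⋃ c ∈ D.C (m + 1), (fun s => s - c) ⁻¹' ((fun s => s + c) ⁻¹' B ∩ D.reach n m) := by
    ext s
    simp only [reach_succ h, Set.mem_inter_iff, Set.mem_preimage, Set.mem_iUnion, sub_add_cancel,
      exists_prop]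
    constructor
    · rintro ⟨h1, h2⟩
      obtain ⟨c, hc, h3⟩ := down_mem_iff.1 (reach_subset_Ico h h2)
      rw [down_eq hc h3] at h2
      exact ⟨c, hc, h1, h2⟩
    · rintro ⟨c, hc, h1, h2⟩
      rw [down_eq hc (reach_subset_Ico h h2)]
      exact ⟨h1, h2⟩
  have hm : ∀ c : ℝ, MeasurableSet ((fun s : ℝ => s + c) ⁻¹' B ∩ D.reach n m) := fun c =>
    (measurable_add_const c hB).inter (measurableSet_reach h)
  rw [e, measure_biUnion_finset]
  · refine Finset.sum_congr rfl fun c _ => ?_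
    exact (measurePreserving_sub_right volume c).measure_preimage (hm c).nullMeasurableSet
  · intro c hc c' hc' hne
    rw [Function.onFun, Set.disjoint_left]
    intro s h1 h2
    exact hne (eq_of_mem_Ico hc hc' (reach_subset_Ico h h1.2) (reach_subset_Ico h h2.2))
  · exact fun c _ => measurable_id.sub_const c (hm c)

variable (D) in
/-- The normalization of the measure on `X_n`. -/
def levelWeight (n : ℕ) : ℝ≥0∞ := (∏ k ∈ Finset.range n, ((D.C (k + 1)).card : ℝ≥0∞))⁻¹

lemma levelWeight_succ (n : ℕ) :
    D.levelWeight (n + 1) = D.levelWeight n * ((D.C (n + 1)).card : ℝ≥0∞)⁻¹ := by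
  unfold levelWeight
  rw [Finset.prod_range_succ, ENNReal.mul_inv]
  · exact Or.inr (ENNReal.natCast_ne_top _)
  · exact Or.inr (by exact_mod_cast (D.card_pos n).ne')

variable (D) in
/-- The sum of the first `k` digits. -/
def digitSum (n k : ℕ) (q : ∀ k : ℕ, D.C (k + n + 1)) : ℝ := ∑ j ∈ Finset.range k, (q j : ℝ)

lemma measurable_digitSum (n k : ℕ) : Measurable (D.digitSum n k) :=
  Finset.measurable_sum _ fun j _ => measurable_subtype_coe.comp (measurable_pi_apply j)

/-- The digits are independent, so adding one more of them is a convolution. -/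
lemma map_digitSum_succ (n k : ℕ) : (Measure.infinitePi (D.unif n)).map (D.digitSum n (k + 1))
    = ((Measure.infinitePi (D.unif n)).map (D.digitSum n k)).conv
      ((D.unif n k).map ((↑) : D.C (k + n + 1) → ℝ)) := by
  have hind := ProbabilityTheory.iIndepFun_infinitePi (P := D.unif n)
    (X := fun i => ((↑) : D.C (i + n + 1) → ℝ)) (fun i => measurable_subtype_coe)
  have h1 := hind.indepFun_finsetSum_of_notMem
    (fun i => measurable_subtype_coe.comp (measurable_pi_apply i))
    (s := Finset.range k) (i := k) (by simp)
  have e : (∑ j ∈ Finset.range k, fun ω : (∀ k : ℕ, D.C (k + n + 1)) => (ω j : ℝ))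
      = D.digitSum n k := by
    ext ω
    simp [digitSum, Finset.sum_apply]
  rw [e] at h1
  have h2 := h1.map_add_eq_map_conv_map (measurable_digitSum n k)
    (measurable_subtype_coe.comp (measurable_pi_apply k))
  have e2 : D.digitSum n (k + 1) = D.digitSum n k
      + fun ω : (∀ k : ℕ, D.C (k + n + 1)) => (ω k : ℝ) := by
    ext ω
    simp [digitSum, Finset.sum_range_succ]
  rw [e2]
  refine h2.trans ?_
  congr 1
  have h3 := Measure.infinitePi_map_eval (D.unif n) k
  rw [← h3, Measure.map_map measurable_subtype_coe (measurable_pi_apply k)]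

lemma conv_unif_apply (M : Measure ℝ) [SFinite M] (n k : ℕ) {B : Set ℝ} (hB : MeasurableSet B) :
    (M.conv ((D.unif n k).map ((↑) : D.C (k + n + 1) → ℝ))) B
      = ((D.C (k + n + 1)).card : ℝ≥0∞)⁻¹ *
        ∑ c ∈ D.C (k + n + 1), M ((fun s => s + c) ⁻¹' B) := by
  have hadd : Measurable fun p : ℝ × ℝ => p.1 + p.2 := measurable_fst.add measurable_snd
  rw [Measure.conv, Measure.map_apply hadd hB, Measure.prod_apply_symm (hadd hB),
    lintegral_map _ measurable_subtype_coe, lintegral_fintype, Finset.mul_sum,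
    ← Finset.sum_coe_sort (D.C (k + n + 1))
      fun c => ((D.C (k + n + 1)).card : ℝ≥0∞)⁻¹ * M ((fun s => s + c) ⁻¹' B)]
  · refine Finset.sum_congr rfl fun c _ => ?_
    rw [unif, PMF.toMeasure_apply_singleton _ _ (measurableSet_singleton _),
      PMF.uniformOfFintype_apply, Fintype.card_coe, mul_comm]
    rfl
  · exact measurable_measure_prodMk_right (hadd hB)

/-- Convolving with the equidistribution on the next `C` averages over translates, which is also
what `volume_inter_reach_succ` does with Lebesgue measure. So the position stays uniformly
distributed on `reach`. -/
lemma map_position_apply (n k : ℕ) {B : Set ℝ} (hB : MeasurableSet B) :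
    (((volume.restrict (Set.Ico 0 (D.h n)))).conv
      ((Measure.infinitePi (D.unif n)).map (D.digitSum n k))) B * D.levelWeight n
      = D.levelWeight (k + n) * volume (B ∩ D.reach n (k + n)) := by
  have : ∀ k, IsProbabilityMeasure ((Measure.infinitePi (D.unif n)).map (D.digitSum n k)) :=
    fun k => Measure.isProbabilityMeasure_map (measurable_digitSum n k).aemeasurable
  induction k generalizing B with
  | zero =>
    have h0 : D.digitSum n 0 = fun _ => 0 := by
      ext q
      simp [digitSum]
    rw [h0, Measure.map_const, measure_univ, one_smul, Measure.conv_dirac_zero, zero_add,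
      reach_self, Measure.restrict_apply hB, mul_comm]
  | succ k ih =>
    rw [map_digitSum_succ, ← Measure.conv_assoc, conv_unif_apply _ _ _ hB, mul_assoc,
      Finset.sum_mul, Finset.sum_congr rfl fun c _ => ih (measurable_add_const c hB),
      ← Finset.mul_sum, Nat.add_right_comm k 1 n,
      volume_inter_reach_succ (Nat.le_add_left n k) hB, levelWeight_succ]
    ring

/-- The measure on `X_n`, viewed as a measure on `X`. -/
def levelImage (D : CFData) (n : ℕ) : Measure D.X := (D.levelMeasure n).map (D.emb n)

lemma levelImage_preimage_pos {n m : ℕ} (h : n ≤ m) {B : Set ℝ} (hB : MeasurableSet B) :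
    D.levelImage n (pos m ⁻¹' B) = D.levelWeight m * volume (B ∩ D.reach n m) := by
  obtain ⟨k, rfl⟩ := Nat.exists_eq_add_of_le' h
  rw [← map_position_apply n k hB, levelImage, Measure.map_apply (measurable_emb n)
    (measurable_pos _ hB), levelMeasure, Measure.smul_apply, smul_eq_mul, mul_comm]
  congr 1
  have h1 : volume.restrict (Set.Ico 0 (D.h n))
      = (Measure.comap ((↑) : Set.Ico (0 : ℝ) (D.h n) → ℝ) volume).map (↑) :=
    (map_comap_subtype_coe measurableSet_Ico _).symm
  have : IsFiniteMeasure (Measure.comap ((↑) : Set.Ico (0 : ℝ) (D.h n) → ℝ) volume) := by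
    refine ⟨?_⟩
    have h2 := congrArg (fun m => m Set.univ) h1
    simp only [Measure.map_apply measurable_subtype_coe MeasurableSet.univ,
      Set.preimage_univ] at h2
    rw [← h2]
    exact measure_lt_top _ _
  have hadd : Measurable fun p : ℝ × ℝ => p.1 + p.2 := measurable_fst.add measurable_snd
  rw [h1, Measure.conv, Measure.map_prod_map _ _ measurable_subtype_coe (measurable_digitSum n k),
    Measure.map_map hadd (measurable_subtype_coe.prodMap (measurable_digitSum n k)),
    Measure.map_apply (hadd.comp (measurable_subtype_coe.prodMap (measurable_digitSum n k))) hB]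
  congr 1
  ext q
  simp only [Set.mem_preimage, Function.comp_apply, Prod.map_fst, Prod.map_snd]
  rw [pos_emb q h, Nat.add_sub_cancel]
  rfl

lemma levelWeight_ne_top (n : ℕ) : D.levelWeight n ≠ ∞ := by
  unfold levelWeight
  rw [ENNReal.inv_ne_top]
  exact_mod_cast Finset.prod_ne_zero_iff.2 fun k _ => (D.card_pos k).ne'

lemma levelImage_univ (n : ℕ) :
    D.levelImage n Set.univ = D.levelWeight n * ENNReal.ofReal (D.h n) := by
  have := levelImage_preimage_pos (le_refl n) (D := D) MeasurableSet.univ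
  rwa [reach_self, Set.univ_inter, Real.volume_Ico, sub_zero, Set.preimage_univ] at this

instance (n : ℕ) : IsFiniteMeasure (D.levelImage n) := ⟨by
  rw [levelImage_univ]
  exact ENNReal.mul_lt_top (levelWeight_ne_top n).lt_top ENNReal.ofReal_lt_top⟩

/-- Consistency of the measures on the levels, tested on sets given by positions in high towers,
where both sides are multiples of Lebesgue measure by the same factor. -/
lemma restrict_levelImage {n m : ℕ} (h : n ≤ m) :
    (D.levelImage m).restrict (D.levelSet n) = D.levelImage n := by
  refine measure_ext_of_pos m fun k hk B hB0 hB => ?_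
  have hnk := h.trans hk
  have e : (pos k ⁻¹' B ∩ D.levelSet n : Set D.X) = pos k ⁻¹' (B ∩ D.reach n k) := by
    ext x
    simp only [Set.mem_inter_iff, Set.mem_preimage, pos_mem_reach_iff hnk]
  rw [Measure.restrict_apply (measurable_pos k hB), e,
    levelImage_preimage_pos hk (hB.inter (measurableSet_reach hnk)),
    levelImage_preimage_pos hnk hB, Set.inter_assoc,
    Set.inter_eq_left.2 (reach_subset h hk)]

/-- By `restrict_levelImage` each of the pieces assembled in `rawMeasure` agrees with the image of
the level measure of any higher level. -/
lemma restrict_rawMeasure (m : ℕ) :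
    D.rawMeasure.restrict (D.levelSet m) = D.levelImage m := by
  have hms : ∀ n, MeasurableSet (disjointed D.levelSet n) := fun n =>
    MeasurableSet.disjointed (fun n => measurableSet_levelSet n) n
  have hterm : ∀ n, ((D.levelImage n).restrict (disjointed D.levelSet n)).restrict (D.levelSet m)
      = (D.levelImage m).restrict (disjointed D.levelSet n) := by
    intro n
    rcases le_or_gt n m with h | h
    · rw [Measure.restrict_restrict (measurableSet_levelSet m), Set.inter_eq_right.2
        ((disjointed_subset _ n).trans (levelSet_mono h)), ← restrict_levelImage h,
        Measure.restrict_restrict (hms n), Set.inter_eq_left.2 (disjointed_subset _ n)]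
    · have hd : Disjoint (D.levelSet m) (disjointed D.levelSet n) := by
        rw [Set.disjoint_left]
        intro x hx hx'
        rw [← Nat.sub_add_cancel (Nat.one_le_of_lt h), levelSet_mono.disjointed_add_one] at hx'
        exact hx'.2 (levelSet_mono (by omega) hx)
      rw [Measure.restrict_restrict (measurableSet_levelSet m), hd.inter_eq,
        Measure.restrict_empty, ← restrict_levelImage le_rfl, Measure.restrict_restrict (hms n),
        hd.symm.inter_eq, Measure.restrict_empty]
  rw [rawMeasure, Measure.restrict_sum _ (measurableSet_levelSet m)]
  have : (Measure.sum fun n => (((D.levelMeasure n).map (D.emb n)).restrict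
      (disjointed D.levelSet n)).restrict (D.levelSet m))
      = Measure.sum fun n => (D.levelImage m).restrict (disjointed D.levelSet n) :=
    congrArg _ (funext hterm)
  rw [this, ← Measure.restrict_iUnion (disjoint_disjointed _) hms, iUnion_disjointed]
  have hu : ⋃ n, D.levelSet n = Set.univ := iUnion_levelSet_add 0
  rw [hu, Measure.restrict_univ]

lemma rawMeasure_preimage_pos (n : ℕ) {B : Set ℝ} (hB0 : B ⊆ Set.Ico 0 (D.h n))
    (hB : MeasurableSet B) : D.rawMeasure (pos n ⁻¹' B) = D.levelWeight n * volume B := by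
  have h1 : (pos n ⁻¹' B : Set D.X) ⊆ D.levelSet n := by
    rw [← preimage_pos_Ico]
    exact Set.preimage_mono hB0
  have h2 := levelImage_preimage_pos (le_refl n) (D := D) hB
  rwa [← restrict_rawMeasure, Measure.restrict_apply (measurable_pos n hB),
    Set.inter_eq_left.2 h1, reach_self, Set.inter_eq_left.2 hB0] at h2

/-- Compare the total length of the disjoint copies of `F_n` with the length of `F_{n+1}`. -/
lemma card_mul_h_le (n : ℕ) : (D.C (n + 1)).card * D.h n ≤ D.h (n + 1) := by
  have h1 : volume (⋃ c ∈ D.C (n + 1), Set.Ico c (D.h n + c)) ≤ volume (Set.Ico 0 (D.h (n + 1))) := by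
    refine measure_mono (Set.iUnion₂_subset fun c hc s hs => ?_)
    exact ⟨(D.nonneg n c hc).trans hs.1, hs.2.trans_le (D.add_le n c hc)⟩
  rw [measure_biUnion_finset (D.disjoint n) fun _ _ => measurableSet_Ico] at h1
  simp only [Real.volume_Ico, add_sub_cancel_right, sub_zero, Finset.sum_const, nsmul_eq_mul] at h1
  rw [← ENNReal.ofReal_natCast, ← ENNReal.ofReal_mul (Nat.cast_nonneg _)] at h1
  exact (ENNReal.ofReal_le_ofReal_iff (D.h_pos _).le).1 h1

variable (D) in
/-- The number of copies of `F_0` that are used to build `F_n`. -/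
def copies (n : ℕ) : ℝ := ∏ k ∈ Finset.range n, ((D.C (k + 1)).card : ℝ)

lemma copies_pos (n : ℕ) : 0 < D.copies n :=
  Finset.prod_pos fun k _ => by exact_mod_cast D.card_pos k

lemma levelWeight_eq (n : ℕ) : D.levelWeight n = ENNReal.ofReal (D.copies n)⁻¹ := by
  rw [ENNReal.ofReal_inv_of_pos (copies_pos n), levelWeight, copies, ENNReal.ofReal_prod_of_nonneg]
  · simp
  · exact fun _ _ => Nat.cast_nonneg _

/-- The conditions under which the invariant measure is finite and nonatomic. -/
structure IsFinite (D : CFData) : Prop where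
  bdd : ∃ M, ∀ n, D.h n ≤ M * D.copies n
  h_tendsto : Tendsto D.h atTop atTop

variable (D) in
/-- The measure of `X_n`, before normalization. -/
def mass (n : ℕ) : ℝ := D.h n / D.copies n

variable (D) in
/-- The measure of `X`, before normalization. -/
def total : ℝ := ⨆ n, D.mass n

lemma mass_mono : Monotone D.mass := by
  refine monotone_nat_of_le_succ fun n => ?_
  unfold mass
  have e : D.copies (n + 1) = D.copies n * (D.C (n + 1)).card := Finset.prod_range_succ _ _
  have h1 := copies_pos (D := D) n
  have h2 : (0 : ℝ) < (D.C (n + 1)).card := by exact_mod_cast D.card_pos n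
  rw [e, div_le_div_iff₀ h1 (mul_pos h1 h2)]
  nlinarith [card_mul_h_le (D := D) n]

lemma IsFinite.bddAbove (hD : D.IsFinite) : BddAbove (Set.range D.mass) := by
  obtain ⟨M, hM⟩ := hD.bdd
  refine ⟨M, ?_⟩
  rintro _ ⟨n, rfl⟩
  rw [mass, div_le_iff₀ (copies_pos n)]
  exact hM n

lemma IsFinite.tendsto_mass (hD : D.IsFinite) : Tendsto D.mass atTop (𝓝 D.total) :=
  tendsto_atTop_ciSup mass_mono hD.bddAbove

lemma IsFinite.total_pos (hD : D.IsFinite) : 0 < D.total := by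
  have h1 : D.mass 0 ≤ D.total := le_ciSup hD.bddAbove 0
  have h2 : 0 < D.mass 0 := div_pos (D.h_pos 0) (copies_pos 0)
  exact h2.trans_le h1

lemma rawMeasure_levelSet (n : ℕ) : D.rawMeasure (D.levelSet n) = ENNReal.ofReal (D.mass n) := by
  rw [← preimage_pos_Ico, rawMeasure_preimage_pos n subset_rfl measurableSet_Ico, Real.volume_Ico,
    sub_zero, levelWeight_eq, ← ENNReal.ofReal_mul (inv_nonneg.2 (copies_pos n).le), mass,
    inv_mul_eq_div]

lemma IsFinite.rawMeasure_univ (hD : D.IsFinite) :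
    D.rawMeasure Set.univ = ENNReal.ofReal D.total := by
  have hu : ⋃ n, D.levelSet n = Set.univ := iUnion_levelSet_add 0
  have h1 := tendsto_measure_iUnion_atTop (μ := D.rawMeasure) levelSet_mono
  rw [hu] at h1
  refine tendsto_nhds_unique h1 ?_
  refine (ENNReal.tendsto_ofReal hD.tendsto_mass).congr fun n => ?_
  exact (rawMeasure_levelSet n).symm

variable (D) in
/-- The density of the distribution of the position in `F_n`. -/
def weight (n : ℕ) : ℝ := (D.copies n)⁻¹ / D.total

lemma IsFinite.weight_pos (hD : D.IsFinite) (n : ℕ) : 0 < D.weight n :=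
  div_pos (inv_pos.2 (copies_pos n)) hD.total_pos

lemma IsFinite.isWeight (hD : D.IsFinite) : D.IsWeight D.weight where
  pos := hD.weight_pos
  succ n := by
    have e : D.copies (n + 1) = D.copies n * (D.C (n + 1)).card := Finset.prod_range_succ _ _
    have h1 := (copies_pos (D := D) n).ne'
    have h2 : ((D.C (n + 1)).card : ℝ) ≠ 0 := by exact_mod_cast (D.card_pos n).ne'
    have h3 := hD.total_pos.ne'
    rw [weight, weight, e]
    field_simp
  tendsto := by
    have h1 := hD.tendsto_mass.div_const D.total
    rw [div_self hD.total_pos.ne'] at h1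
    refine h1.congr fun n => ?_
    rw [weight, mass]
    ring
  h_tendsto := hD.h_tendsto

lemma IsFinite.measure_preimage_pos (hD : D.IsFinite) (n : ℕ) {B : Set ℝ}
    (hB0 : B ⊆ Set.Ico 0 (D.h n)) (hB : MeasurableSet B) :
    D.measure (pos n ⁻¹' B) = ENNReal.ofReal (D.weight n) * volume B := by
  rw [measure, Measure.smul_apply, hD.rawMeasure_univ, rawMeasure_preimage_pos n hB0 hB,
    levelWeight_eq, smul_eq_mul, ← mul_assoc, ← ENNReal.ofReal_inv_of_pos hD.total_pos,
    ← ENNReal.ofReal_mul (inv_nonneg.2 hD.total_pos.le), weight, div_eq_inv_mul]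

lemma IsFinite.isProbabilityMeasure (hD : D.IsFinite) : IsProbabilityMeasure D.measure := ⟨by
  rw [measure, Measure.smul_apply, smul_eq_mul, hD.rawMeasure_univ]
  exact ENNReal.inv_mul_cancel (ENNReal.ofReal_pos.2 hD.total_pos).ne' ENNReal.ofReal_ne_top⟩

lemma IsFinite.restrict_map_pos (hD : D.IsFinite) (n : ℕ) :
    (D.measure.map (pos n)).restrict (Set.Ico 0 (D.h n))
      = ENNReal.ofReal (D.weight n) • volume.restrict (Set.Ico 0 (D.h n)) := by
  ext B hB
  rw [Measure.restrict_apply hB, Measure.map_apply (measurable_pos n) (hB.inter measurableSet_Ico),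
    hD.measure_preimage_pos n Set.inter_subset_right (hB.inter measurableSet_Ico),
    Measure.smul_apply, Measure.restrict_apply hB, smul_eq_mul]

end CFData

namespace CFData

variable {D : CFData}

/-! ### The flow -/

lemma isPath_add {n : ℕ} {x : D.X} (hx : x ∈ D.levelSet n) {t : ℝ}
    (ht : pos n x + t ∈ Set.Ico 0 (D.h n)) : D.IsPath n fun m => pos m x + t :=
  ⟨ht, fun m hm => by
    rw [add_sub_add_right_eq_sub]
    exact (isPath_pos hx).2 m hm⟩

lemma val_add (x : D.X) (t : ℝ) : x.val + (t : Germ (atTop : Filter ℕ) ℝ)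
    = ((fun m => pos m x + t : ℕ → ℝ) : Germ (atTop : Filter ℕ) ℝ) := by
  rw [← coe_pos x]
  rfl

lemma mem_core_iff {x : D.X} :
    x ∈ D.core ↔ ∀ t, ∀ᶠ m in atTop, pos m x + t ∈ Set.Ico 0 (D.h m) := by
  constructor
  · intro hx t
    obtain ⟨n, q, hq⟩ := hx t
    have h1 := isPath_level q
    have h2 : ((fun m => pos m x + t : ℕ → ℝ) : Germ (atTop : Filter ℕ) ℝ) = _ :=
      (val_add x t).symm.trans hq.symm
    filter_upwards [Germ.coe_eq.1 h2, eventually_ge_atTop n] with m hm hn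
    rw [hm]
    exact h1.mem hn
  · intro h t
    obtain ⟨n, hn⟩ := exists_mem_levelSet x
    obtain ⟨m, hm, hnm⟩ := ((h t).and (eventually_ge_atTop n)).exists
    obtain ⟨q, hq⟩ := (isPath_add (levelSet_mono hnm hn) hm).exists_level
    exact ⟨m, q, hq.trans (val_add x t).symm⟩

lemma flow_val {x : D.X} (hx : x ∈ D.core) (t : ℝ) :
    (D.flow t x).val = x.val + (t : Germ (atTop : Filter ℕ) ℝ) := by
  rw [flow, dif_pos hx]

lemma flow_of_notMem {x : D.X} (hx : x ∉ D.core) (t : ℝ) : D.flow t x = x := by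
  rw [flow, dif_neg hx]

lemma pos_flow {x : D.X} (hx : x ∈ D.core) {n : ℕ} (hn : x ∈ D.levelSet n) {t : ℝ}
    (ht : pos n x + t ∈ Set.Ico 0 (D.h n)) {m : ℕ} (hm : n ≤ m) :
    pos m (D.flow t x) = pos m x + t :=
  (isPath_add hn ht).pos_eq ((val_add x t).symm.trans (flow_val hx t).symm) hm

lemma eventually_pos_flow {x : D.X} (hx : x ∈ D.core) (t : ℝ) :
    ∀ᶠ m in atTop, pos m (D.flow t x) = pos m x + t := by
  obtain ⟨n, hn⟩ := exists_mem_levelSet x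
  filter_upwards [mem_core_iff.1 hx t, eventually_ge_atTop n] with m hm hnm
  exact pos_flow hx (levelSet_mono hnm hn) hm le_rfl

lemma flow_mem_core_iff {x : D.X} (t : ℝ) : D.flow t x ∈ D.core ↔ x ∈ D.core := by
  by_cases hx : x ∈ D.core
  · refine ⟨fun _ => hx, fun _ => mem_core_iff.2 fun s => ?_⟩
    filter_upwards [eventually_pos_flow hx t, mem_core_iff.1 hx (t + s)] with m h1 h2
    rwa [h1, add_assoc]
  · rw [flow_of_notMem hx]

lemma flow_zero (x : D.X) : D.flow 0 x = x := by
  by_cases hx : x ∈ D.core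
  · refine ext_of_pos ?_
    filter_upwards [eventually_pos_flow hx 0] with m hm
    rw [hm, add_zero]
  · exact flow_of_notMem hx 0

lemma flow_add (s t : ℝ) (x : D.X) : D.flow (s + t) x = D.flow s (D.flow t x) := by
  by_cases hx : x ∈ D.core
  · refine ext_of_pos ?_
    filter_upwards [eventually_pos_flow hx (s + t), eventually_pos_flow hx t,
      eventually_pos_flow ((flow_mem_core_iff t).2 hx) s] with m h1 h2 h3
    rw [h1, h3, h2]
    ring
  · rw [flow_of_notMem hx, flow_of_notMem hx, flow_of_notMem hx]

lemma mem_core_iff_exists {x : D.X} :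
    x ∈ D.core ↔ ∀ N : ℕ, ∃ n, pos n x ∈ Set.Ico (N : ℝ) (D.h n - N) := by
  rw [mem_core_iff]
  constructor
  · intro h N
    obtain ⟨n, h1, h2⟩ := ((h N).and (h (-N))).exists
    exact ⟨n, by linarith [h2.1], by linarith [h1.2]⟩
  · intro h t
    obtain ⟨N, hN⟩ := exists_nat_ge |t|
    obtain ⟨n, hn⟩ := h N
    have hN0 : (0 : ℝ) ≤ N := Nat.cast_nonneg N
    have hx : x ∈ D.levelSet n := pos_mem_iff.1 ⟨by linarith [hn.1], by linarith [hn.2]⟩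
    filter_upwards [eventually_ge_atTop n] with m hm
    exact (isPath_add hx (t := t) ⟨by linarith [hn.1, neg_abs_le t],
      by linarith [hn.2, le_abs_self t]⟩).mem hm

lemma measurableSet_core : MeasurableSet D.core := by
  have : D.core = ⋂ N : ℕ, ⋃ n, pos n ⁻¹' Set.Ico (N : ℝ) (D.h n - N) := by
    ext x
    simp only [Set.mem_iInter, Set.mem_iUnion, Set.mem_preimage, mem_core_iff_exists]
  rw [this]
  exact MeasurableSet.iInter fun N => MeasurableSet.iUnion fun n =>
    measurable_pos n measurableSet_Ico

/-- A point outside the core stays, for some `N`, within distance `N` of the ends of all towers. In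
the tower of level `m` such points have measure at most `2N` times the weight, which tends to `0`.
-/
lemma IsFinite.measure_core_compl (hD : D.IsFinite) : D.measure D.coreᶜ = 0 := by
  have hsub : D.coreᶜ ⊆ ⋃ N : ℕ, ⋃ n, {x | x ∈ D.levelSet n ∧
      ∀ m, pos m x ∉ Set.Ico (N : ℝ) (D.h m - N)} := by
    intro x hx
    rw [Set.mem_compl_iff, mem_core_iff_exists] at hx
    push Not at hx
    obtain ⟨N, hN⟩ := hx
    obtain ⟨n, hn⟩ := exists_mem_levelSet x
    exact Set.mem_iUnion.2 ⟨N, Set.mem_iUnion.2 ⟨n, hn, hN⟩⟩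
  refine measure_mono_null hsub (measure_iUnion_null fun N => measure_iUnion_null fun n => ?_)
  have hb : ∀ m, n ≤ m → D.measure {x | x ∈ D.levelSet n ∧
      ∀ m, pos m x ∉ Set.Ico (N : ℝ) (D.h m - N)} ≤ ENNReal.ofReal (D.weight m) * (2 * N) := by
    intro m hm
    have h1 : {x : D.X | x ∈ D.levelSet n ∧ ∀ m, pos m x ∉ Set.Ico (N : ℝ) (D.h m - N)}
        ⊆ pos m ⁻¹' ((Set.Ico 0 (N : ℝ) ∪ Set.Ico (D.h m - N) (D.h m)) ∩ Set.Ico 0 (D.h m)) := by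
      rintro x ⟨hx, h2⟩
      have h3 := pos_mem_iff.2 (levelSet_mono hm hx)
      refine ⟨?_, h3⟩
      by_contra h4
      simp only [Set.mem_union, Set.mem_Ico, not_or, not_and, not_lt] at h4
      refine h2 m ⟨h4.1 h3.1, ?_⟩
      by_contra h5
      exact absurd (h4.2 (not_lt.1 h5)) (not_le.2 h3.2)
    refine (measure_mono h1).trans ?_
    rw [hD.measure_preimage_pos m Set.inter_subset_right
      ((measurableSet_Ico.union measurableSet_Ico).inter measurableSet_Ico)]
    gcongr
    refine (measure_mono Set.inter_subset_left).trans ((measure_union_le _ _).trans ?_)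
    rw [Real.volume_Ico, Real.volume_Ico, sub_zero, sub_sub_cancel, ENNReal.ofReal_natCast, two_mul]
  have hlim : Tendsto (fun m => ENNReal.ofReal (D.weight m) * (2 * N)) atTop (𝓝 0) := by
    have h2 := ENNReal.tendsto_ofReal hD.isWeight.tendsto_zero
    rw [ENNReal.ofReal_zero] at h2
    have h3 := ENNReal.Tendsto.mul_const h2 (b := 2 * (N : ℝ≥0∞))
      (Or.inr (ENNReal.mul_ne_top (by simp) (ENNReal.natCast_ne_top N)))
    rwa [zero_mul] at h3
  exact le_antisymm (ge_of_tendsto hlim (eventually_atTop.2 ⟨n, hb⟩)) zero_le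

lemma IsFinite.ae_mem_core (hD : D.IsFinite) : ∀ᵐ x ∂D.measure, x ∈ D.core :=
  hD.measure_core_compl

-- The position of `T_t x` in `F_n` is determined by its position in a high tower `F_m`, which is
-- eventually the position of `x` plus `t`. So it is a pointwise limit of measurable functions of
-- `(t, x)`.
open Classical in
lemma measurable_flow : Measurable fun p : ℝ × D.X => D.flow p.1 p.2 := by
  refine measurable_of_comp_pos fun n => ?_
  choose g hg _ hg2 using fun m => exists_pos_eq_comp (D := D) (Nat.le_add_left n m)
  have hF : ∀ m, Measurable fun p : ℝ × D.X =>
      (Prod.snd ⁻¹' D.core).piecewise (fun p => g m (pos (m + n) p.2 + p.1)) (fun p => pos n p.2) p := by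
    intro m
    refine Measurable.piecewise (measurable_snd measurableSet_core)
      ((hg m).comp (((measurable_pos _).comp measurable_snd).add measurable_fst))
      ((measurable_pos n).comp measurable_snd)
  refine measurable_of_tendsto_metrizable hF (tendsto_pi_nhds.2 fun p => ?_)
  by_cases hp : p ∈ (Prod.snd ⁻¹' D.core : Set (ℝ × D.X))
  · refine tendsto_const_nhds.congr' ?_
    filter_upwards [(tendsto_add_atTop_nat n).eventually (eventually_pos_flow hp p.1)] with m hm
    rw [Set.piecewise_eq_of_mem _ _ _ hp, hg2 m, hm]
  · refine tendsto_const_nhds.congr fun m => ?_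
    rw [Set.piecewise_eq_of_notMem _ _ _ hp, flow_of_notMem hp]

/-- A comparison on the sets that are determined by positions is enough for probability
measures to coincide. -/
lemma measure_eq_of_le {μ ν : Measure D.X} [IsProbabilityMeasure μ] [IsProbabilityMeasure ν]
    (h : ∀ n, ∀ B ⊆ Set.Ico 0 (D.h n), MeasurableSet B → μ (pos n ⁻¹' B) ≤ ν (pos n ⁻¹' B)) :
    μ = ν := by
  refine measure_ext_of_pos 0 fun n _ B hB0 hB => le_antisymm (h n B hB0 hB) ?_
  have hA : MeasurableSet (pos n ⁻¹' B : Set D.X) := measurable_pos n hB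
  have hcompl : μ (pos n ⁻¹' B)ᶜ ≤ ν (pos n ⁻¹' B)ᶜ := by
    have hmono : Monotone fun k => D.levelSet (k + n) ∩ (pos n ⁻¹' B)ᶜ := fun a b hab =>
      Set.inter_subset_inter_left _ (levelSet_mono (Nat.add_le_add_right hab n))
    have e : (⋃ k, D.levelSet (k + n) ∩ (pos n ⁻¹' B)ᶜ) = (pos n ⁻¹' B)ᶜ := by
      rw [← Set.iUnion_inter, iUnion_levelSet_add, Set.univ_inter]
    have h1 := tendsto_measure_iUnion_atTop (μ := μ) hmono
    have h2 := tendsto_measure_iUnion_atTop (μ := ν) hmono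
    rw [e] at h1 h2
    refine le_of_tendsto_of_tendsto' h1 h2 fun k => ?_
    obtain ⟨B', hB0', hB', e'⟩ := exists_preimage_pos_eq (D := D) hB hB0 (Nat.le_add_left n k)
    simp only [Function.comp_apply]
    rw [e', ← preimage_pos_Ico, ← Set.preimage_compl, ← Set.preimage_inter]
    exact h _ _ Set.inter_subset_left (measurableSet_Ico.inter hB'.compl)
  rw [prob_compl_eq_one_sub hA, prob_compl_eq_one_sub hA] at hcompl
  have h3 := tsub_le_tsub_left hcompl 1
  rwa [ENNReal.sub_sub_cancel ENNReal.one_ne_top prob_le_one,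
    ENNReal.sub_sub_cancel ENNReal.one_ne_top prob_le_one] at h3

/-- Inside a tower the flow is a translation and preserves Lebesgue measure, except for a piece of
length at most `|t|` at one end; in high towers this loss is negligible. For probability measures
the resulting inequality is enough. -/
lemma IsFinite.measurePreserving_flow (hD : D.IsFinite) (t : ℝ) :
    MeasurePreserving (D.flow t) D.measure D.measure := by
  have hT : Measurable (D.flow t) := measurable_flow.comp measurable_prodMk_left
  have := hD.isProbabilityMeasure
  have : IsProbabilityMeasure (D.measure.map (D.flow t)) :=
    Measure.isProbabilityMeasure_map hT.aemeasurable
  refine ⟨hT, (measure_eq_of_le fun n B hB0 hB => ?_).symm⟩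
  rw [Measure.map_apply hT (measurable_pos n hB)]
  have hk : ∀ k, n ≤ k → D.measure (pos n ⁻¹' B)
      ≤ D.measure (D.flow t ⁻¹' (pos n ⁻¹' B)) + ENNReal.ofReal (D.weight k) * ENNReal.ofReal |t| := by
    intro k hk
    obtain ⟨B', hB0', hB', e⟩ := exists_preimage_pos_eq (D := D) hB hB0 hk
    set A : Set ℝ := (fun s => s + t) ⁻¹' B' ∩ Set.Ico 0 (D.h k) with hA
    have hAm : MeasurableSet A := (measurable_add_const t hB').inter measurableSet_Ico
    have h1 : D.measure (pos k ⁻¹' A) ≤ D.measure (D.flow t ⁻¹' (pos k ⁻¹' B')) := by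
      refine measure_mono_ae ?_
      filter_upwards [hD.ae_mem_core] with x hx hxA
      have h2 := pos_flow hx (pos_mem_iff.1 hxA.2) (hB0' hxA.1) le_rfl
      change pos k (D.flow t x) ∈ B'
      rw [h2]
      exact hxA.1
    rw [e]
    refine le_trans ?_ (add_le_add_left h1 _)
    rw [hD.measure_preimage_pos k hB0' hB',
      hD.measure_preimage_pos k Set.inter_subset_right hAm, ← mul_add]
    gcongr
    have h3 : volume B' = volume ((fun s => s + t) ⁻¹' B') :=
      ((measurePreserving_add_right volume t).measure_preimage hB'.nullMeasurableSet).symm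
    rw [h3]
    have h4 : (fun s => s + t) ⁻¹' B' ⊆ A ∪ (Set.Ico (-|t|) 0 ∩ Set.Ici (-t)
        ∪ Set.Ico (D.h k) (D.h k + |t|) ∩ Set.Iio (D.h k - t)) := by
      intro s hs
      have h5 := hB0' hs
      by_cases h6 : s ∈ Set.Ico 0 (D.h k)
      · exact Or.inl ⟨hs, h6⟩
      · refine Or.inr ?_
        rcases lt_or_ge s 0 with h7 | h7
        · exact Or.inl ⟨⟨by linarith [h5.1, le_abs_self t], h7⟩, by
            have := h5.1
            simp only [Set.mem_Ici]
            linarith⟩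
        · have h8 : D.h k ≤ s := by
            by_contra h9
            exact h6 ⟨h7, not_le.1 h9⟩
          exact Or.inr ⟨⟨h8, by linarith [h5.2, neg_abs_le t]⟩, by
            have := h5.2
            simp only [Set.mem_Iio]
            linarith⟩
    refine (measure_mono h4).trans ((measure_union_le _ _).trans ?_)
    gcongr
    -- Only the end selected by the sign of `t` matters, so the loss is at most `|t|`.
    rcases le_total 0 t with ht | ht
    · have e1 : Set.Ico (D.h k) (D.h k + |t|) ∩ Set.Iio (D.h k - t) = ∅ := by
        ext s
        simp only [Set.mem_inter_iff, Set.mem_Ico, Set.mem_Iio, Set.mem_empty_iff_false, iff_false]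
        rintro ⟨⟨h5, _⟩, h6⟩
        linarith
      rw [e1, Set.union_empty]
      refine (measure_mono Set.inter_subset_left).trans ?_
      rw [Real.volume_Ico, zero_sub, neg_neg]
    · have e1 : Set.Ico (-|t|) 0 ∩ Set.Ici (-t) = ∅ := by
        ext s
        simp only [Set.mem_inter_iff, Set.mem_Ico, Set.mem_Ici, Set.mem_empty_iff_false, iff_false]
        rintro ⟨⟨_, h5⟩, h6⟩
        linarith
      rw [e1, Set.empty_union]
      refine (measure_mono Set.inter_subset_left).trans ?_
      rw [Real.volume_Ico, add_sub_cancel_left]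
  have hlim : Tendsto (fun k => D.measure (D.flow t ⁻¹' (pos n ⁻¹' B))
      + ENNReal.ofReal (D.weight k) * ENNReal.ofReal |t|) atTop
      (𝓝 (D.measure (D.flow t ⁻¹' (pos n ⁻¹' B)) + 0)) := by
    refine tendsto_const_nhds.add ?_
    have h2 := ENNReal.tendsto_ofReal hD.isWeight.tendsto_zero
    rw [ENNReal.ofReal_zero] at h2
    have h3 := ENNReal.Tendsto.mul_const h2 (b := ENNReal.ofReal |t|)
      (Or.inr ENNReal.ofReal_ne_top)
    rwa [zero_mul] at h3
  rw [add_zero] at hlim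
  exact ge_of_tendsto hlim (eventually_atTop.2 ⟨n, hk⟩)

end CFData

namespace CFData

variable {D : CFData} {K : Type*} [CommGroup K]

/-! ### The cocycle -/

lemma measurable_comp_dig {α : Type*} [MeasurableSpace α] (f : ℝ → α) (n : ℕ) : Measurable fun s => f (D.dig n s) := by
  have h1 : Measurable fun s => (⟨D.dig n s, dig_mem n s⟩ : D.C (n + 1)) :=
    (D.measurable_dig n).subtype_mk
  have h2 : Measurable fun c : D.C (n + 1) => f c := Measurable.of_discrete
  exact h2.comp h1

/-- The product of the values of the cocycle maps at the first `n` digits. -/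
def phase (a : ℕ → ℝ → K) (n : ℕ) (x : D.X) : K :=
  ∏ k ∈ Finset.range n, a (k + 1) (D.dig k (pos (k + 1) x))

/-- From level `n` on the positions of `x` and `T_t x` differ by the constant `t`, so their later
digits coincide and only the first `n` factors remain. On this level the cocycle is thus a
coboundary of `phase`. -/
lemma cocycle_eq (a : ℕ → ℝ → K) {x : D.X} (hx : x ∈ D.core) {n : ℕ} (hn : x ∈ D.levelSet n)
    {t : ℝ} (ht : pos n x + t ∈ Set.Ico 0 (D.h n)) :
    D.cocycle a (D.flow t x) x = phase a n (D.flow t x) / phase a n x := by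
  have h1 : ∀ m, n ≤ m → pos m (D.flow t x) = pos m x + t := fun m hm => pos_flow hx hn ht hm
  have hn' : D.flow t x ∈ D.levelSet n := by
    rw [← pos_mem_iff, h1 n le_rfl]
    exact ht
  unfold cocycle phase
  rw [finprod_eq_prod_of_mulSupport_subset (s := Finset.range n), ← Finset.prod_div_distrib]
  · simp only [digit_eq]
  · intro k hk
    rw [Finset.coe_range, Set.mem_Iio]
    by_contra hkn
    refine hk ?_
    have hkn := not_lt.1 hkn
    beta_reduce
    rw [digit_eq, digit_eq, (isPath_pos hn').dig_eq hkn, (isPath_pos hn).dig_eq hkn, h1 k hkn,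
      h1 (k + 1) (hkn.trans (Nat.le_succ k)), add_sub_add_right_eq_sub, div_self']

lemma cocycle_self (a : ℕ → ℝ → K) (x : D.X) : D.cocycle a x x = 1 := by
  simp [cocycle]

lemma eventually_cocycle_eq (a : ℕ → ℝ → K) (t : ℝ) (x : D.X) :
    ∀ᶠ m in atTop, D.cocycle a (D.flow t x) x = phase a m (D.flow t x) / phase a m x := by
  by_cases hx : x ∈ D.core
  · obtain ⟨n, hn⟩ := exists_mem_levelSet x
    filter_upwards [mem_core_iff.1 hx t, eventually_ge_atTop n] with m hm hnm
    exact cocycle_eq a hx (levelSet_mono hnm hn) hm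
  · rw [flow_of_notMem hx, cocycle_self]
    simp

lemma cocycle_flow_add (a : ℕ → ℝ → K) (s t : ℝ) (x : D.X) :
    D.cocycle a (D.flow (s + t) x) x
      = D.cocycle a (D.flow s (D.flow t x)) (D.flow t x) * D.cocycle a (D.flow t x) x := by
  obtain ⟨m, h1, h2, h3⟩ := ((eventually_cocycle_eq a (s + t) x).and
    ((eventually_cocycle_eq a s (D.flow t x)).and (eventually_cocycle_eq a t x))).exists
  rw [h1, h2, h3, flow_add, div_mul_div_cancel]

variable [MeasurableSpace K] [TopologicalSpace K] [IsTopologicalGroup K] [PolishSpace K] [BorelSpace K]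

lemma measurable_phase (a : ℕ → ℝ → K) (n : ℕ) : Measurable (phase a n : D.X → K) :=
  Finset.measurable_prod _ fun k _ => (measurable_comp_dig _ k).comp (measurable_pos (k + 1))

lemma measurable_cocycle (a : ℕ → ℝ → K) :
    Measurable fun p : ℝ × D.X => D.cocycle a (D.flow p.1 p.2) p.2 := by
  refine measurable_of_tendsto_metrizable
    (f := fun m (p : ℝ × D.X) => phase a m (D.flow p.1 p.2) / phase a m p.2) (fun m => ?_)
    (tendsto_pi_nhds.2 fun p => ?_)
  · exact ((measurable_phase a m).comp measurable_flow).div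
      ((measurable_phase a m).comp measurable_snd)
  · refine tendsto_const_nhds.congr' ?_
    filter_upwards [eventually_cocycle_eq a p.1 p.2] with m hm
    exact hm

end CFData

/-! ### Haar measure on `K / H` and the compact group extension -/

lemma measurable_quotientMk {K : Type*} [CommGroup K] [MeasurableSpace K] (H : Subgroup K) :
    Measurable (QuotientGroup.mk : K → K ⧸ H) :=
  measurable_quotient_mk''

section Haar

variable {K : Type*} [CommGroup K] [TopologicalSpace K] [IsTopologicalGroup K] [CompactSpace K]
  [MeasurableSpace K] [BorelSpace K]

lemma isProbabilityMeasure_haarQuotient (H : Subgroup K) :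
    IsProbabilityMeasure (haarQuotient H) := by
  refine ⟨?_⟩
  rw [haarQuotient, Measure.map_apply (measurable_quotientMk H) MeasurableSet.univ,
    Set.preimage_univ]
  exact Measure.haarMeasure_self

lemma map_mul_haarQuotient (H : Subgroup K) (k : K) (hm : Measurable fun q : K ⧸ H => (k : K ⧸ H) * q) :
    (haarQuotient H).map (fun q : K ⧸ H => (k : K ⧸ H) * q) = haarQuotient H := by
  have h1 := map_mul_left_eq_self (Measure.haarMeasure (⊤ : TopologicalSpace.PositiveCompacts K)) k
  rw [haarQuotient, Measure.map_map hm (measurable_quotientMk H)]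
  conv_rhs => rw [← h1, Measure.map_map (measurable_quotientMk H) (measurable_const_mul k)]
  rfl

end Haar

namespace CFData

variable {D : CFData} {K : Type*} [CommGroup K] [TopologicalSpace K] [IsTopologicalGroup K]
  [CompactSpace K] [PolishSpace K] [MeasurableSpace K] [BorelSpace K]

lemma IsFinite.isFlow_extension (hD : D.IsFinite) {H : Subgroup K} (hH : IsClosed (H : Set K))
    (a : ℕ → ℝ → K) : IsFlow (D.extension H a) (D.measure.prod (haarQuotient H)) := by
  have := hD.isProbabilityMeasure
  have := isProbabilityMeasure_haarQuotient H
  have : BorelSpace (K ⧸ H) := QuotientGroup.borelSpace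
  have hmul : Measurable fun p : (ℝ × D.X) × (K ⧸ H) =>
      (QuotientGroup.mk (D.cocycle a (D.flow p.1.1 p.1.2) p.1.2) : K ⧸ H) * p.2 :=
    ((measurable_quotientMk H).comp ((measurable_cocycle a).comp measurable_fst)).mul measurable_snd
  refine ⟨?_, ?_, ?_, ?_⟩
  · rintro ⟨x, k⟩
    simp only [extension, flow_zero, cocycle_self]
    rw [QuotientGroup.mk_one, one_mul]
  · rintro s t ⟨x, k⟩
    simp only [extension]
    rw [cocycle_flow_add, flow_add, QuotientGroup.mk_mul, mul_assoc]
  · have h1 : Measurable fun p : ℝ × (D.X × (K ⧸ H)) => D.flow p.1 p.2.1 :=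
      measurable_flow.comp (measurable_fst.prodMk measurable_snd.fst)
    have h2 : Measurable fun p : ℝ × (D.X × (K ⧸ H)) => ((p.1, p.2.1), p.2.2) :=
      (measurable_fst.prodMk measurable_snd.fst).prodMk measurable_snd.snd
    have h3 := hmul.comp h2
    exact h1.prodMk h3
  · intro t
    refine (hD.measurePreserving_flow t).skew_product
      (g := fun x q => (QuotientGroup.mk (D.cocycle a (D.flow t x) x) : K ⧸ H) * q) ?_ ?_
    · have h2 : Measurable fun p : D.X × (K ⧸ H) => ((t, p.1), p.2) :=
        (measurable_const.prodMk measurable_fst).prodMk measurable_snd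
      have h3 := hmul.comp h2
      exact h3
    · exact Eventually.of_forall fun x => map_mul_haarQuotient H _ (measurable_const_mul _)

end CFData

/-! ### The Koopman representation -/

section Koopman

variable {Y : Type*} [MeasurableSpace Y] {T : ℝ → Y → Y} {ν : Measure Y}

lemma coeFn_koopman (hT : IsFlow T ν) (t : ℝ) (f : Lp ℂ 2 ν) :
    koopman hT t f =ᵐ[ν] f ∘ T (-t) :=
  Lp.coeFn_compMeasurePreserving f (hT.measurePreserving (-t))

lemma isUnitaryRep_koopman (hT : IsFlow T ν) : IsUnitaryRep (koopman hT) where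
  zero f := by
    refine Lp.ext ((coeFn_koopman hT 0 f).trans (Eventually.of_forall fun y => ?_))
    rw [Function.comp_apply, neg_zero, hT.zero]
  add s t f := by
    refine Lp.ext ((coeFn_koopman hT (s + t) f).trans ?_)
    have h1 := (hT.measurePreserving (-s)).quasiMeasurePreserving.ae_eq_comp (coeFn_koopman hT t f)
    filter_upwards [coeFn_koopman hT s (koopman hT t f), h1] with y h2 h3
    rw [h2, h3, Function.comp_apply, Function.comp_apply, Function.comp_apply, ← hT.add, neg_add_rev]

end Koopman

lemma continuous_circle_coe : Continuous fun z : Circle => (z : ℂ) := continuous_subtype_val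

/-! ### Characters of the quotient group -/

section Characters

variable {K : Type*} [CommGroup K] [TopologicalSpace K]

/-- A character that is trivial on `H`, viewed as a character of `K / H`. -/
def quotChar {H : Subgroup K} (χ : dualQuotient H) : K ⧸ H →* Circle :=
  QuotientGroup.lift H (ContinuousMonoidHom.toMonoidHom (χ : PontryaginDual K)) χ.2

lemma quotChar_mk {H : Subgroup K} (χ : dualQuotient H) (k : K) :
    quotChar χ (k : K ⧸ H) = (χ : PontryaginDual K) k := rfl

lemma continuous_quotChar {H : Subgroup K} (χ : dualQuotient H) : Continuous (quotChar χ) :=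
  isQuotientMap_quotient_mk'.continuous_iff.2 (map_continuous (χ : PontryaginDual K))

variable [IsTopologicalGroup K] [CompactSpace K] [MeasurableSpace K] [BorelSpace K]

lemma integral_haarQuotient (H : Subgroup K) {f : K ⧸ H → ℂ} (hf : Continuous f) :
    ∫ q, f q ∂(haarQuotient H)
      = ∫ k, f (k : K ⧸ H) ∂(Measure.haarMeasure (⊤ : TopologicalSpace.PositiveCompacts K)) := by
  have hm : Measurable f := by
    intro s hs
    change MeasurableSet (QuotientGroup.mk ⁻¹' (f ⁻¹' s))
    exact (hf.comp continuous_quotient_mk').measurable hs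
  rw [haarQuotient, integral_map (measurable_quotientMk H).aemeasurable
    hm.stronglyMeasurable.aestronglyMeasurable]

/-- Translation by a point where `χ` and `η` differ multiplies the integral by a number other than
`1`, while Haar measure is invariant. -/
lemma integral_conj_quotChar_mul {H : Subgroup K} {χ η : dualQuotient H} (h : χ ≠ η) :
    ∫ q, conj (quotChar χ q : ℂ) * (quotChar η q : ℂ) ∂(haarQuotient H) = 0 := by
  have hc : Continuous fun q : K ⧸ H => conj (quotChar χ q : ℂ) * (quotChar η q : ℂ) :=
    (Complex.continuous_conj.comp (continuous_circle_coe.comp (continuous_quotChar χ))).mul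
      (continuous_circle_coe.comp (continuous_quotChar η))
  rw [integral_haarQuotient H hc]
  obtain ⟨k, hk⟩ : ∃ k, (χ : PontryaginDual K) k ≠ (η : PontryaginDual K) k := by
    by_contra h'
    push Not at h'
    exact h (Subtype.ext (PontryaginDual.ext h'))
  set I := ∫ k, conj (quotChar χ (k : K ⧸ H) : ℂ) * (quotChar η (k : K ⧸ H) : ℂ)
    ∂(Measure.haarMeasure (⊤ : TopologicalSpace.PositiveCompacts K)) with hI
  set z : ℂ := conj ((χ : PontryaginDual K) k : ℂ) * ((η : PontryaginDual K) k : ℂ) with hz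
  have h1 : z * I = I := by
    have h2 := integral_mul_left_eq_self (μ := Measure.haarMeasure
      (⊤ : TopologicalSpace.PositiveCompacts K))
      (fun k : K => conj (quotChar χ (k : K ⧸ H) : ℂ) * (quotChar η (k : K ⧸ H) : ℂ)) k
    rw [hI, ← integral_const_mul]
    conv_rhs => rw [← h2]
    congr 1
    ext k'
    simp only [quotChar_mk, map_mul, Circle.coe_mul, hz]
    ring
  have hz1 : z ≠ 1 := by
    intro hz1
    refine hk (Circle.ext ?_)
    have h3 : ((χ : PontryaginDual K) k : ℂ) * conj ((χ : PontryaginDual K) k : ℂ) = 1 := by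
      rw [Complex.mul_conj, Circle.normSq_coe, Complex.ofReal_one]
    calc ((χ : PontryaginDual K) k : ℂ) = ((χ : PontryaginDual K) k : ℂ) * z := by rw [hz1, mul_one]
      _ = _ := by rw [hz, ← mul_assoc, h3, one_mul]
  have h4 : (z - 1) * I = 0 := by rw [sub_mul, one_mul, h1, sub_self]
  exact (mul_eq_zero.1 h4).resolve_left (sub_ne_zero.2 hz1)

end Characters

namespace CFData

variable {D : CFData} {K : Type*} [CommGroup K] [TopologicalSpace K] {H : Subgroup K}

/-! ### The rank one representation given by a character -/

/-- The function on `X × K / H` given by a character and a function on the tower `F_n`. -/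
def towerFun (a : ℕ → ℝ → K) (χ : dualQuotient H) (n : ℕ) (g : ℝ → ℂ) (p : D.X × (K ⧸ H)) : ℂ :=
  g (pos n p.1) * conj ((χ : PontryaginDual K) (phase a n p.1) : ℂ) * (quotChar χ p.2 : ℂ)

lemma norm_towerFun (a : ℕ → ℝ → K) (χ : dualQuotient H) (n : ℕ) (g : ℝ → ℂ)
    (p : D.X × (K ⧸ H)) : ‖towerFun a χ n g p‖ = ‖g (pos n p.1)‖ := by
  rw [towerFun, norm_mul, norm_mul, RCLike.norm_conj, Circle.norm_coe, Circle.norm_coe, mul_one,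
    mul_one]

/-- Compatibility of consecutive towers. -/
lemma towerFun_raise (a : ℕ → ℝ → K) (χ : dualQuotient H) (n : ℕ) {g : ℝ → ℂ}
    (hg : g ∈ boxFun 0 (D.h n)) (p : D.X × (K ⧸ H)) :
    towerFun a χ (n + 1) (raise (D.C (n + 1))
      (fun c => ((χ : PontryaginDual K) (a (n + 1) c) : ℂ)) g) p = towerFun a χ n g p := by
  obtain ⟨x, q⟩ := p
  unfold towerFun raise
  simp only [Finset.sum_apply, Pi.smul_apply, smul_eq_mul, shift]
  by_cases hx : x ∈ D.levelSet n
  · have h1 := isPath_pos hx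
    have hc := h1.2 n le_rfl
    rw [Finset.sum_eq_single_of_mem _ hc, sub_sub_cancel]
    · have h2 : phase a (n + 1) x = phase a n x * a (n + 1) (pos (n + 1) x - pos n x) := by
        rw [phase, Finset.prod_range_succ, h1.dig_eq le_rfl, phase]
      rw [h2, map_mul, Circle.coe_mul, map_mul]
      set u : ℂ := ((χ : PontryaginDual K) (a (n + 1) (pos (n + 1) x - pos n x)) : ℂ) with hu
      have h3 : u * conj u = 1 := by
        rw [Complex.mul_conj, Circle.normSq_coe, Complex.ofReal_one]
      linear_combination (g (pos n x) * conj ((χ : PontryaginDual K) (phase a n x) : ℂ)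
        * (quotChar χ q : ℂ)) * h3
    · intro c hc' hne
      rw [hg.2.2 _ fun h => hne (eq_of_mem_Ico hc' hc h (h1.sub_mem le_rfl)), mul_zero]
  · rw [Finset.sum_eq_zero, pos_of_notMem hx, hg.2.2 (-1) fun h => by linarith [h.1]]
    · simp
    · intro c hc
      rw [hg.2.2 _ (sub_notMem_of_notMem hx hc), mul_zero]

/-- The flow acts by translations as long as these make sense. -/
lemma towerFun_extension (a : ℕ → ℝ → K) (χ : dualQuotient H) (n : ℕ) {g : ℝ → ℂ} {t : ℝ}
    (hg : g ∈ boxFun 0 (D.h n)) (hgt : shift t g ∈ boxFun 0 (D.h n)) {p : D.X × (K ⧸ H)}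
    (hp : p.1 ∈ D.core) :
    towerFun a χ n g (D.extension H a (-t) p) = towerFun a χ n (shift t g) p := by
  obtain ⟨x, q⟩ := p
  simp only at hp
  simp only [towerFun, extension, shift]
  by_cases hx : x ∈ D.levelSet n ∧ pos n x + -t ∈ Set.Ico 0 (D.h n)
  · rw [pos_flow hp hx.1 hx.2 le_rfl, map_mul, quotChar_mk, cocycle_eq a hp hx.1 hx.2, map_div,
      Circle.coe_mul, Circle.coe_div, ← sub_eq_add_neg]
    set u : ℂ := ((χ : PontryaginDual K) (phase a n (D.flow (-t) x)) : ℂ) with hu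
    set u' : ℂ := ((χ : PontryaginDual K) (phase a n x) : ℂ) with hu'
    have h3 : u * conj u = 1 := by
      rw [Complex.mul_conj, Circle.normSq_coe, Complex.ofReal_one]
    have h4 : u' * conj u' = 1 := by
      rw [Complex.mul_conj, Circle.normSq_coe, Complex.ofReal_one]
    have h5 : u'⁻¹ = conj u' := inv_eq_of_mul_eq_one_right h4
    rw [div_eq_mul_inv, h5]
    linear_combination (g (pos n x - t) * conj u' * (quotChar χ q : ℂ)) * h3
  -- If the orbit segment is not contained in the tower, both sides vanish: `g` and its translate
  -- are supported in the tower, and the position `-1` of points outside `X_n` is outside both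
  -- supports.
  · have h1 : g (pos n x - t) = 0 := by
      by_cases hxn : x ∈ D.levelSet n
      · exact hg.2.2 _ fun h => hx ⟨hxn, by rwa [← sub_eq_add_neg]⟩
      · have := hgt.2.2 (-1) fun h => by linarith [h.1]
        rwa [shift, ← pos_of_notMem hxn] at this
    have h2 : g (pos n (D.flow (-t) x)) = 0 := by
      by_contra hne
      have h3 : pos n (D.flow (-t) x) ∈ Set.Ico 0 (D.h n) := by
        by_contra h'
        exact hne (hg.2.2 _ h')
      have h4 : pos n (D.flow (-t) x) + t ∈ Set.Ico 0 (D.h n) := by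
        by_contra h'
        have := hgt.2.2 _ h'
        rw [shift, add_sub_cancel_right] at this
        exact hne this
      have h5 := pos_flow ((flow_mem_core_iff (-t)).2 hp) (pos_mem_iff.1 h3) h4 le_rfl
      rw [← flow_add, add_neg_cancel, flow_zero] at h5
      refine hx ⟨pos_mem_iff.1 (h5 ▸ h4), ?_⟩
      rw [h5, add_neg_cancel_right]
      exact h3
    rw [h1, h2]
    simp

variable [IsTopologicalGroup K] [CompactSpace K] [PolishSpace K] [MeasurableSpace K] [BorelSpace K]

lemma measurable_towerFun (hH : IsClosed (H : Set K)) (a : ℕ → ℝ → K) (χ : dualQuotient H) (n : ℕ)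
    {g : ℝ → ℂ} (hg : Measurable g) : Measurable (towerFun (D := D) a χ n g) := by
  have : BorelSpace (K ⧸ H) := QuotientGroup.borelSpace
  have h1 : Measurable fun k : K => ((χ : PontryaginDual K) k : ℂ) :=
    (continuous_circle_coe.comp (map_continuous (χ : PontryaginDual K))).measurable
  have h2 : Measurable fun q : K ⧸ H => (quotChar χ q : ℂ) :=
    (continuous_circle_coe.comp (continuous_quotChar χ)).measurable
  exact ((hg.comp ((measurable_pos n).comp measurable_fst)).mul
    (Complex.continuous_conj.measurable.comp
      (h1.comp ((measurable_phase a n).comp measurable_fst)))).mul (h2.comp measurable_snd)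

lemma IsFinite.memLp_towerFun (hD : D.IsFinite) (hH : IsClosed (H : Set K)) (a : ℕ → ℝ → K)
    (χ : dualQuotient H) (n : ℕ) {g : ℝ → ℂ} (hg : g ∈ boxFun 0 (D.h n)) :
    MemLp (towerFun a χ n g) 2 (D.measure.prod (haarQuotient H)) := by
  have := hD.isProbabilityMeasure
  have := isProbabilityMeasure_haarQuotient H
  obtain ⟨M, hM⟩ := hg.2.1
  refine MemLp.of_bound (measurable_towerFun hH a χ n hg.1).aestronglyMeasurable M
    (Eventually.of_forall fun p => ?_)
  rw [norm_towerFun]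
  exact hM _

open Classical in
/-- The element of `L²(X × K / H)` given by a character and a function on the tower `F_n`. -/
def towerMap (D : CFData) (a : ℕ → ℝ → K) (χ : dualQuotient H) (n : ℕ) (g : ℝ → ℂ) :
    Lp ℂ 2 (D.measure.prod (haarQuotient H)) :=
  if h : MemLp (towerFun a χ n g) 2 (D.measure.prod (haarQuotient H)) then h.toLp else 0

lemma IsFinite.coeFn_towerMap (hD : D.IsFinite) (hH : IsClosed (H : Set K)) (a : ℕ → ℝ → K)
    (χ : dualQuotient H) (n : ℕ) {g : ℝ → ℂ} (hg : g ∈ boxFun 0 (D.h n)) :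
    D.towerMap a χ n g =ᵐ[D.measure.prod (haarQuotient H)] towerFun a χ n g := by
  rw [towerMap, dif_pos (hD.memLp_towerFun hH a χ n hg)]
  exact MemLp.coeFn_toLp _

lemma IsFinite.integral_comp_pos (hD : D.IsFinite) (n : ℕ) {F : ℝ → ℂ} (hF : Measurable F)
    (h0 : ∀ s, s ∉ Set.Ico 0 (D.h n) → F s = 0) :
    ∫ x, F (pos n x) ∂D.measure = D.weight n * ∫ s, F s := by
  rw [← integral_map (measurable_pos n).aemeasurable hF.aestronglyMeasurable,
    ← setIntegral_eq_integral_of_forall_compl_eq_zero h0, hD.restrict_map_pos,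
    integral_smul_measure, setIntegral_eq_integral_of_forall_compl_eq_zero h0,
    ENNReal.toReal_ofReal (hD.weight_pos n).le]
  rfl

lemma IsFinite.inner_towerMap (hD : D.IsFinite) (hH : IsClosed (H : Set K)) (a : ℕ → ℝ → K)
    (χ η : dualQuotient H) {n m : ℕ} {f g : ℝ → ℂ} (hf : f ∈ boxFun 0 (D.h n))
    (hg : g ∈ boxFun 0 (D.h m)) : inner ℂ (D.towerMap a χ n f) (D.towerMap a η m g)
      = ∫ p, conj (towerFun a χ n f p) * towerFun a η m g p ∂(D.measure.prod (haarQuotient H)) := by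
  rw [L2.inner_def]
  refine integral_congr_ae ?_
  filter_upwards [hD.coeFn_towerMap hH a χ n hf, hD.coeFn_towerMap hH a η m hg] with p h1 h2
  rw [h1, h2, RCLike.inner_apply, mul_comm]

/-- By Fubini the integral over `K / H` splits off, and different characters are orthogonal there.
-/
lemma IsFinite.inner_towerMap_of_ne (hD : D.IsFinite) (hH : IsClosed (H : Set K)) (a : ℕ → ℝ → K)
    {χ η : dualQuotient H} (h : χ ≠ η) {n m : ℕ} {f g : ℝ → ℂ} (hf : f ∈ boxFun 0 (D.h n))
    (hg : g ∈ boxFun 0 (D.h m)) : inner ℂ (D.towerMap a χ n f) (D.towerMap a η m g) = 0 := by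
  have := hD.isProbabilityMeasure
  have := isProbabilityMeasure_haarQuotient H
  rw [hD.inner_towerMap hH a χ η hf hg]
  have e : (fun p : D.X × (K ⧸ H) => conj (towerFun a χ n f p) * towerFun a η m g p)
      = fun p => (conj (f (pos n p.1)) * ((χ : PontryaginDual K) (phase a n p.1) : ℂ)
          * (g (pos m p.1) * conj ((η : PontryaginDual K) (phase a m p.1) : ℂ)))
        * (conj (quotChar χ p.2 : ℂ) * (quotChar η p.2 : ℂ)) := by
    ext p
    simp only [towerFun, map_mul, Complex.conj_conj]
    ring
  rw [e, integral_prod_mul (fun x : D.X => conj (f (pos n x)) *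
    ((χ : PontryaginDual K) (phase a n x) : ℂ) * (g (pos m x) *
      conj ((η : PontryaginDual K) (phase a m x) : ℂ)))
    (fun q => conj (quotChar χ q : ℂ) * (quotChar η q : ℂ)), integral_conj_quotChar_mul h, mul_zero]

/-- The conjugate phase in `towerFun` absorbs the cocycle: along the flow the change of phase
cancels the rotation in the fibre, so what remains is a translation of the function on the tower.
Phases have modulus one, so inner products reduce to Lebesgue integrals. -/
theorem IsFinite.isRankOne (hD : D.IsFinite) (hH : IsClosed (H : Set K)) (a : ℕ → ℝ → K)
    (χ : dualQuotient H) :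
    IsRankOne D D.weight (koopman (hD.isFlow_extension hH a))
      (fun n c => ((χ : PontryaginDual K) (a n c) : ℂ)) (D.towerMap a χ) where
  weight := hD.isWeight
  rep := isUnitaryRep_koopman _
  map_add n f hf g hg := by
    refine Lp.ext ?_
    filter_upwards [hD.coeFn_towerMap hH a χ n hf, hD.coeFn_towerMap hH a χ n hg,
      hD.coeFn_towerMap hH a χ n (Submodule.add_mem _ hf hg),
      Lp.coeFn_add (D.towerMap a χ n f) (D.towerMap a χ n g)] with p h1 h2 h3 h4
    rw [h3, h4, Pi.add_apply, h1, h2]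
    simp only [towerFun, Pi.add_apply]
    ring
  map_smul n c f hf := by
    refine Lp.ext ?_
    filter_upwards [hD.coeFn_towerMap hH a χ n hf,
      hD.coeFn_towerMap hH a χ n (Submodule.smul_mem _ c hf),
      Lp.coeFn_smul c (D.towerMap a χ n f)] with p h1 h2 h3
    rw [h2, h3, Pi.smul_apply, h1]
    simp only [towerFun, Pi.smul_apply, smul_eq_mul]
    ring
  inner_map n f hf g hg := by
    have := hD.isProbabilityMeasure
    have := isProbabilityMeasure_haarQuotient H
    rw [hD.inner_towerMap hH a χ χ hf hg]
    have e : (fun p : D.X × (K ⧸ H) => conj (towerFun a χ n f p) * towerFun a χ n g p)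
        = fun p => conj (f (pos n p.1)) * g (pos n p.1) := by
      ext p
      have h3 : ∀ z : Circle, (z : ℂ) * conj (z : ℂ) = 1 := fun z => by
        rw [Complex.mul_conj, Circle.normSq_coe, Complex.ofReal_one]
      simp only [towerFun, map_mul, Complex.conj_conj]
      linear_combination (conj (f (pos n p.1)) * g (pos n p.1) * ((quotChar χ p.2 : ℂ)
        * conj (quotChar χ p.2 : ℂ))) * h3 ((χ : PontryaginDual K) (phase a n p.1))
        + (conj (f (pos n p.1)) * g (pos n p.1)) * h3 (quotChar χ p.2)
    have hFm : Measurable fun s => conj (f s) * g s :=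
      (Complex.continuous_conj.measurable.comp hf.1).mul hg.1
    rw [e, boxInner, ← hD.integral_comp_pos n hFm fun s hs => by rw [hg.2.2 s hs, mul_zero]]
    have hfst := measurePreserving_fst (μ := D.measure) (ν := haarQuotient H)
    conv_rhs => rw [← hfst.map_eq]
    exact (integral_map (f := fun x : D.X => conj (f (pos n x)) * g (pos n x))
      measurable_fst.aemeasurable (hFm.comp (measurable_pos n)).aestronglyMeasurable).symm
  translate n t f hf hft := by
    have := hD.isProbabilityMeasure
    have := isProbabilityMeasure_haarQuotient H
    have hT := hD.isFlow_extension hH a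
    refine Lp.ext ((coeFn_koopman hT t _).trans ?_)
    have hcore : ∀ᵐ p ∂(D.measure.prod (haarQuotient H)), p.1 ∈ D.core :=
      (measurePreserving_fst (μ := D.measure) (ν := haarQuotient H)).quasiMeasurePreserving.ae
        hD.ae_mem_core
    filter_upwards [(hT.measurePreserving (-t)).quasiMeasurePreserving.ae_eq_comp
      (hD.coeFn_towerMap hH a χ n hf), hD.coeFn_towerMap hH a χ n hft, hcore] with p h1 h2 h3
    rw [h1, h2, Function.comp_apply, towerFun_extension a χ n hf hft h3]
  refine n f hf := by
    refine Lp.ext ?_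
    filter_upwards [hD.coeFn_towerMap hH a χ n hf,
      hD.coeFn_towerMap hH a χ (n + 1) (raise_mem_zero _ hf)] with p h1 h2
    rw [h1, h2, towerFun_raise a χ n hf]
  norm_coeff n c _ := Circle.norm_coe _

end CFData

/-! ### Characters of compact Abelian groups -/

/-- A commuting family of operators has a common eigenvector in every nontrivial finite-dimensional
invariant subspace. -/
lemma exists_common_eigenvector {V ι : Type*} [AddCommGroup V] [Module ℂ V] {F : ι → V →ₗ[ℂ] V}
    (hF : ∀ i j x, F i (F j x) = F j (F i x)) {W : Submodule ℂ V} [FiniteDimensional ℂ W]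
    (hW : W ≠ ⊥) (hinv : ∀ i, ∀ x ∈ W, F i x ∈ W) :
    ∃ x ∈ W, x ≠ 0 ∧ ∀ i, ∃ c : ℂ, F i x = c • x := by
  induction hn : Module.finrank ℂ W using Nat.strong_induction_on generalizing W with
  | _ n ih =>
    by_cases hsc : ∀ i, ∃ c : ℂ, ∀ x ∈ W, F i x = c • x
    · obtain ⟨x, hx, hx0⟩ := Submodule.exists_mem_ne_zero_of_ne_bot hW
      exact ⟨x, hx, hx0, fun i => (hsc i).imp fun c hc => hc x hx⟩
    · push Not at hsc
      obtain ⟨i, hi⟩ := hsc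
      have : Nontrivial W := Submodule.nontrivial_iff_ne_bot.2 hW
      obtain ⟨c, hc⟩ := Module.End.exists_eigenvalue ((F i).restrict (hinv i))
      obtain ⟨v, hv⟩ := hc.exists_hasEigenvector
      set W' : Submodule ℂ V := W ⊓ LinearMap.ker (F i - c • LinearMap.id) with hW'
      have hmem : ∀ x, x ∈ W' ↔ x ∈ W ∧ F i x = c • x := by
        intro x
        rw [hW', Submodule.mem_inf, LinearMap.mem_ker, LinearMap.sub_apply, sub_eq_zero]
        rfl
      have hle : W' ≤ W := inf_le_left
      have hv' : (v : V) ∈ W' := by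
        rw [hmem]
        exact ⟨v.2, congrArg Subtype.val hv.apply_eq_smul⟩
      have hne : W' ≠ ⊥ := fun h => hv.2 (Subtype.ext ((Submodule.mem_bot ℂ).1 (h ▸ hv')))
      have hlt : W' < W := by
        refine lt_of_le_of_ne hle fun h => ?_
        obtain ⟨x, hx, hx'⟩ := hi c
        exact hx' ((hmem x).1 (h ▸ hx)).2
      have : FiniteDimensional ℂ W' := Submodule.finiteDimensional_of_le hle
      obtain ⟨x, hx, hx0, hxi⟩ := ih _ (hn ▸ Submodule.finrank_lt_finrank_of_lt hlt) hne
        (fun j x hx => by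
          rw [hmem] at hx ⊢
          exact ⟨hinv j x hx.1, by rw [hF, hx.2, map_smul]⟩) rfl
      exact ⟨x, hle hx, hx0, hxi⟩

/-! ### Compact operators with continuous kernels -/

section CompactKernel

variable {V : Type*} [NormedAddCommGroup V] [InnerProductSpace ℂ V] {G : Type*}
  [TopologicalSpace G] [CompactSpace G]

/-- The operator that sends `f` to the function `x ↦ ⟪k x, f⟫`. -/
def kernelOp {k : G → V} (hk : Continuous k) : V →L[ℂ] BoundedContinuousFunction G ℂ :=
  LinearMap.mkContinuous
    { toFun := fun f => BoundedContinuousFunction.mkOfCompact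
        ⟨fun x => inner ℂ (k x) f, hk.inner continuous_const⟩
      map_add' := fun f g => by
        ext x
        exact inner_add_right _ _ _
      map_smul' := fun c f => by
        ext x
        exact inner_smul_right _ _ _ }
    (sSup (Set.range fun x => ‖k x‖)) fun f => by
      have hb : BddAbove (Set.range fun x => ‖k x‖) := (isCompact_range hk.norm).bddAbove
      have h0 : 0 ≤ sSup (Set.range fun x => ‖k x‖) :=
        Real.sSup_nonneg (by rintro _ ⟨x, rfl⟩; exact norm_nonneg _)
      refine (BoundedContinuousFunction.norm_le (by positivity)).2 fun x => ?_
      exact (norm_inner_le_norm _ _).trans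
        (mul_le_mul_of_nonneg_right (le_csSup hb ⟨x, rfl⟩) (norm_nonneg _))

/-- Arzelà–Ascoli: the images of the unit ball are bounded by `sup ‖k x‖` and inherit equicontinuity
from `k`. -/
lemma isCompactOperator_kernelOp {k : G → V} (hk : Continuous k) :
    IsCompactOperator (kernelOp hk) := by
  refine (isCompactOperator_iff_isCompact_closure_image_closedBall
    (kernelOp hk : V →ₗ[ℂ] BoundedContinuousFunction G ℂ) zero_lt_one).2 ?_
  obtain ⟨M, hM⟩ := (isCompact_range hk.norm).bddAbove
  refine BoundedContinuousFunction.arzela_ascoli (Metric.closedBall 0 M)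
    (isCompact_closedBall 0 M) _ ?_ ?_
  · rintro _ x ⟨f, hf, rfl⟩
    rw [mem_closedBall_zero_iff] at hf ⊢
    refine (norm_inner_le_norm (k x) f).trans ?_
    calc ‖k x‖ * ‖f‖ ≤ ‖k x‖ * 1 := mul_le_mul_of_nonneg_left hf (norm_nonneg _)
      _ ≤ M := by rw [mul_one]; exact hM ⟨x, rfl⟩
  · intro x₀
    rw [Metric.equicontinuousAt_iff_right]
    intro ε hε
    filter_upwards [Metric.tendsto_nhds.1 (hk.tendsto x₀) ε hε] with x hx
    rintro ⟨_, f, hf, rfl⟩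
    rw [mem_closedBall_zero_iff] at hf
    change dist (inner ℂ (k x₀) f) (inner ℂ (k x) f) < ε
    rw [dist_eq_norm, ← inner_sub_left]
    refine (norm_inner_le_norm _ _).trans_lt ?_
    rw [dist_eq_norm, norm_sub_rev] at hx
    calc ‖k x₀ - k x‖ * ‖f‖ ≤ ‖k x₀ - k x‖ * 1 := mul_le_mul_of_nonneg_left hf (norm_nonneg _)
      _ < ε := by rwa [mul_one]

end CompactKernel

/-- The operator is `T* T`. -/
lemma _root_.IsCompactOperator.exists_adjoint_comp_self {V : Type*} [NormedAddCommGroup V]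
    [InnerProductSpace ℂ V] [CompleteSpace V] {T : V →L[ℂ] V} (hT : IsCompactOperator T) :
    ∃ A : V →L[ℂ] V, IsCompactOperator A ∧ ∀ f f', inner ℂ (A f) f' = inner ℂ (T f) (T f') := by
  obtain ⟨S, hS⟩ : ∃ S : V →L[ℂ] V, ∀ x y, inner ℂ (S y) x = inner ℂ y (T x) :=
    ⟨ContinuousLinearMap.adjoint T, ContinuousLinearMap.adjoint_inner_left T⟩
  exact ⟨S.comp T, hT.clm_comp S, fun f f' => hS f' (T f)⟩

/-! ### The regular representation and the separation of points by characters -/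

section PeterWeyl

variable {G : Type*} [CommGroup G] [TopologicalSpace G] [IsTopologicalGroup G] [CompactSpace G]
  [T2Space G] [MeasurableSpace G] [BorelSpace G] {μ : Measure G} [μ.IsHaarMeasure] [μ.Regular]

variable (μ) in
/-- The regular representation. -/
def regRep (g : G) : Lp ℂ 2 μ →ₗᵢ[ℂ] Lp ℂ 2 μ :=
  Lp.compMeasurePreservingₗᵢ ℂ (fun x => g * x) (measurePreserving_mul_left μ g)

lemma coeFn_regRep (g : G) (f : Lp ℂ 2 μ) : regRep μ g f =ᵐ[μ] fun x => f (g * x) :=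
  Lp.coeFn_compMeasurePreserving f (measurePreserving_mul_left μ g)

lemma regRep_one (f : Lp ℂ 2 μ) : regRep μ 1 f = f := by
  refine Lp.ext ((coeFn_regRep 1 f).trans (Eventually.of_forall fun x => ?_))
  simp only [one_mul]

lemma regRep_mul (g h : G) (f : Lp ℂ 2 μ) : regRep μ (g * h) f = regRep μ g (regRep μ h f) := by
  refine Lp.ext ((coeFn_regRep (g * h) f).trans ?_)
  have h1 := (measurePreserving_mul_left μ g).quasiMeasurePreserving.ae_eq_comp (coeFn_regRep h f)
  filter_upwards [coeFn_regRep g (regRep μ h f), h1] with x h2 h3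
  rw [h2]
  refine Eq.trans ?_ h3.symm
  simp only [Function.comp_apply, mul_assoc, mul_left_comm g h x]

lemma regRep_comm (g h : G) (f : Lp ℂ 2 μ) :
    regRep μ g (regRep μ h f) = regRep μ h (regRep μ g f) := by
  rw [← regRep_mul, mul_comm, regRep_mul]

lemma inner_regRep_right (g : G) (f f' : Lp ℂ 2 μ) :
    inner ℂ f (regRep μ g f') = inner ℂ (regRep μ g⁻¹ f) f' := by
  rw [← LinearIsometry.inner_map_map (regRep μ g⁻¹), ← regRep_mul, inv_mul_cancel, regRep_one]

lemma continuous_regRep (f : Lp ℂ 2 μ) : Continuous fun g => regRep μ g f := by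
  have h := Continuous.compMeasurePreservingLp (μ := μ) (ν := μ) (p := 2)
    (f := fun _ : G => f) (g := fun g : G => (⟨fun x => g * x, by fun_prop⟩ : C(G, G)))
    continuous_const (ContinuousMap.continuous_of_continuous_uncurry _ (by
      simp only [Function.uncurry_def, ContinuousMap.coe_mk]
      fun_prop)) (fun g => measurePreserving_mul_left μ g) (by simp)
  exact h

/-- If `g` is not told apart from `1` by characters, then `g` acts trivially on the vectors that are
common eigenvectors of the regular representation. -/
lemma regRep_eq_of_forall_eq_smul {g₀ : G} (hg₀ : ∀ χ : PontryaginDual G, χ g₀ = 1)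
    {f : Lp ℂ 2 μ} (hf0 : f ≠ 0) (hf : ∀ g, ∃ c : ℂ, regRep μ g f = c • f) :
    regRep μ g₀ f = f := by
  choose c hc using hf
  have hcirc : ∀ g, ‖c g‖ = 1 := by
    intro g
    have h1 : ‖regRep μ g f‖ = ‖f‖ := LinearIsometry.norm_map _ _
    rw [hc, norm_smul] at h1
    exact mul_right_cancel₀ (norm_ne_zero_iff.2 hf0) (by rw [h1, one_mul])
  have hsm : ∀ z z' : ℂ, z • f = z' • f → z = z' := fun z z' h => by
    rw [← sub_eq_zero, ← sub_smul, smul_eq_zero] at h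
    exact sub_eq_zero.1 (h.resolve_right hf0)
  have hcont : Continuous c := by
    have h2 : ∀ g, c g = inner ℂ f (regRep μ g f) / inner ℂ f f := by
      intro g
      rw [hc, inner_smul_right, mul_div_cancel_right₀]
      exact inner_self_ne_zero.2 hf0
    have h3 : c = fun g => inner ℂ f (regRep μ g f) / inner ℂ f f := funext h2
    rw [h3]
    exact (continuous_const.inner (continuous_regRep f)).div_const _
  let χ : G →ₜ* Circle :=
    { toFun := fun g => ⟨c g, mem_sphere_zero_iff_norm.2 (hcirc g)⟩
      map_one' := Circle.ext (hsm _ _ (by rw [← hc, regRep_one, Circle.coe_one, one_smul]))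
      map_mul' := fun g h => Circle.ext (hsm (c (g * h)) (c g * c h) (by
        rw [← hc, regRep_mul, hc h, map_smul, hc g, smul_smul, mul_comm]))
      continuous_toFun := hcont.subtype_mk _ }
  have h4 : χ g₀ = 1 := hg₀ χ
  have h5 : c g₀ = 1 := congrArg (fun z : Circle => (z : ℂ)) h4
  rw [hc, h5, one_smul]

/-- If `N = regRep μ g₀ - 1` were not zero on `W`, its image would contain a common eigenvector `u`
of the regular representation. That vector is fixed by `g₀`, but fixed vectors of a unitary operator
are orthogonal to the range of the operator minus the identity. -/
lemma regRep_eq_of_finiteDimensional {g₀ : G} (hg₀ : ∀ χ : PontryaginDual G, χ g₀ = 1)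
    {W : Submodule ℂ (Lp ℂ 2 μ)} [FiniteDimensional ℂ W] (hW : ∀ g, ∀ f ∈ W, regRep μ g f ∈ W)
    {f : Lp ℂ 2 μ} (hf : f ∈ W) : regRep μ g₀ f = f := by
  set N : Lp ℂ 2 μ →ₗ[ℂ] Lp ℂ 2 μ := (regRep μ g₀).toLinearMap - LinearMap.id with hN
  have hNapp : ∀ f, N f = regRep μ g₀ f - f := fun f => rfl
  by_contra hne
  have hbot : W.map N ≠ ⊥ := by
    intro h
    have h1 : N f ∈ W.map N := Submodule.mem_map_of_mem hf
    rw [h, Submodule.mem_bot, hNapp, sub_eq_zero] at h1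
    exact hne h1
  obtain ⟨u, hu, hu0, hu1⟩ := exists_common_eigenvector
    (F := fun g => (regRep μ g).toLinearMap) (fun g h f => regRep_comm g h f) hbot (by
      rintro g _ ⟨f, hf, rfl⟩
      refine ⟨regRep μ g f, hW g f hf, ?_⟩
      change regRep μ g₀ (regRep μ g f) - regRep μ g f = regRep μ g (regRep μ g₀ f - f)
      rw [map_sub, regRep_comm])
  have h2 := regRep_eq_of_forall_eq_smul hg₀ hu0 hu1
  obtain ⟨f', -, rfl⟩ := hu
  refine hu0 (inner_self_eq_zero (𝕜 := ℂ).1 ?_)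
  have h3 : regRep μ g₀⁻¹ (N f') = N f' := by
    conv_lhs => rw [← h2]
    rw [← regRep_mul, inv_mul_cancel, regRep_one]
  have h4 : inner ℂ (N f') (N f') = inner ℂ (N f') (regRep μ g₀ f') - inner ℂ (N f') f' := by
    rw [← inner_sub_right]
    rfl
  rw [h4, inner_regRep_right, h3, sub_self]

/-- If `g₀` acts trivially on the finite-dimensional invariant subspaces, then it acts trivially on
everything seen by a compact operator that intertwines the regular representation and its inverse. -/
lemma apply_regRep_eq_of_isCompactOperator {g₀ : G} (hg₀ : ∀ χ : PontryaginDual G, χ g₀ = 1)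
    (T : Lp ℂ 2 μ →L[ℂ] Lp ℂ 2 μ) (hT : IsCompactOperator T)
    (hTL : ∀ g f, T (regRep μ g f) = regRep μ g⁻¹ (T f)) (f : Lp ℂ 2 μ) :
    T (regRep μ g₀ f) = T f := by
  obtain ⟨A, hAcomp, hAinner⟩ : ∃ A : Lp ℂ 2 μ →L[ℂ] Lp ℂ 2 μ, IsCompactOperator A ∧
      ∀ f f', inner ℂ (A f) f' = inner ℂ (T f) (T f') :=
    hT.exists_adjoint_comp_self
  have hAsymm : (A : Lp ℂ 2 μ →ₗ[ℂ] Lp ℂ 2 μ).IsSymmetric := by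
    intro f f'
    change inner ℂ (A f) f' = inner ℂ f (A f')
    rw [hAinner, ← inner_conj_symm f, hAinner, inner_conj_symm]
  have hAL : ∀ g f, A (regRep μ g f) = regRep μ g (A f) := by
    intro g f
    refine ext_inner_right ℂ fun f' => ?_
    have e1 : inner ℂ (regRep μ g (A f)) f' = inner ℂ (A f) (regRep μ g⁻¹ f') := by
      rw [inner_regRep_right, inv_inv]
    have e2 : inner ℂ (T f) (regRep μ g (T f')) = inner ℂ (regRep μ g⁻¹ (T f)) (T f') :=
      inner_regRep_right _ _ _
    rw [e1, hAinner, hAinner, hTL, hTL, inv_inv, e2]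
  obtain ⟨L, hL⟩ : ∃ L : Lp ℂ 2 μ →L[ℂ] Lp ℂ 2 μ, ∀ f, L f = T (regRep μ g₀ f) - T f :=
    ⟨T.comp (regRep μ g₀).toContinuousLinearMap - T, fun f => rfl⟩
  -- The eigenspaces of `A = T* T` for `c ≠ 0` are finite-dimensional and invariant, so `g₀` acts
  -- trivially on them; on the kernel of `A` the operator `T` vanishes. By the spectral theorem
  -- these spaces together are dense.
  have hle : (⨆ c, Module.End.eigenspace (A : Lp ℂ 2 μ →ₗ[ℂ] Lp ℂ 2 μ) c)
      ≤ LinearMap.ker (L : Lp ℂ 2 μ →ₗ[ℂ] Lp ℂ 2 μ) := by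
    refine iSup_le fun c f hf => ?_
    have hf' : A f = c • f := Module.End.mem_eigenspace_iff.1 hf
    rw [LinearMap.mem_ker]
    change L f = 0
    rw [hL, sub_eq_zero]
    rcases eq_or_ne c 0 with rfl | hc
    · have h1 : T f = 0 := by
        rw [← inner_self_eq_zero (𝕜 := ℂ), ← hAinner, hf', zero_smul, inner_zero_left]
      rw [hTL, h1, map_zero]
    · have : FiniteDimensional ℂ (Module.End.eigenspace (A : Lp ℂ 2 μ →ₗ[ℂ] Lp ℂ 2 μ) c) :=
        ContinuousLinearMap.finite_dimensional_eigenspace hAcomp c hc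
      rw [regRep_eq_of_finiteDimensional hg₀ (fun g f hf => ?_) hf]
      rw [Module.End.mem_eigenspace_iff] at hf ⊢
      change A (regRep μ g f) = _
      rw [hAL, ← map_smul]
      exact congrArg _ hf
  have h1 := Submodule.topologicalClosure_minimal _ hle L.isClosed_ker
  rw [Submodule.topologicalClosure_eq_top_iff.2
    (ContinuousLinearMap.orthogonalComplement_iSup_eigenspaces_eq_bot hAcomp hAsymm)] at h1
  have h2 : L f = 0 := h1 (Submodule.mem_top (x := f))
  rwa [hL, sub_eq_zero] at h2

/-- For fixed `κ` the operator sending `f` to `x ↦ ⟪regRep x κ, f⟫` is compact, so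
`apply_regRep_eq_of_isCompactOperator` applies. The resulting functions of `x` are continuous;
equality almost everywhere becomes equality at `x = 1`. -/
lemma regRep_eq_self {g₀ : G} (hg₀ : ∀ χ : PontryaginDual G, χ g₀ = 1) (ψ : Lp ℂ 2 μ) :
    regRep μ g₀ ψ = ψ := by
  have hmain : ∀ κ : Lp ℂ 2 μ, inner ℂ κ (regRep μ g₀ ψ) = inner ℂ κ ψ := by
    intro κ
    have hk : Continuous fun x => regRep μ x κ := continuous_regRep κ
    obtain ⟨T, hTapp, hTcomp⟩ : ∃ T : Lp ℂ 2 μ →L[ℂ] Lp ℂ 2 μ,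
        (∀ f, T f =ᵐ[μ] fun x => inner ℂ (regRep μ x κ) f) ∧ IsCompactOperator T :=
      ⟨(BoundedContinuousFunction.toLp 2 μ ℂ).comp (kernelOp hk), fun f =>
        BoundedContinuousFunction.coeFn_toLp 2 μ ℂ (kernelOp hk f),
        (isCompactOperator_kernelOp hk).clm_comp (BoundedContinuousFunction.toLp 2 μ ℂ)⟩
    have hTL : ∀ g f, T (regRep μ g f) = regRep μ g⁻¹ (T f) := by
      intro g f
      refine Lp.ext ((hTapp _).trans ?_)
      have h1 := (measurePreserving_mul_left μ g⁻¹).quasiMeasurePreserving.ae_eq_comp (hTapp f)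
      filter_upwards [coeFn_regRep g⁻¹ (T f), h1] with x h2 h3
      rw [h2]
      refine Eq.trans ?_ h3.symm
      rw [Function.comp_apply, inner_regRep_right, regRep_mul]
    have h1 := apply_regRep_eq_of_isCompactOperator hg₀ T hTcomp hTL ψ
    have h2 : (fun x => inner ℂ (regRep μ x κ) (regRep μ g₀ ψ)) =ᵐ[μ]
        fun x => inner ℂ (regRep μ x κ) ψ := by
      refine (hTapp _).symm.trans (EventuallyEq.trans ?_ (hTapp ψ))
      rw [h1]
    have h3 := congrFun ((Continuous.ae_eq_iff_eq μ (hk.inner continuous_const)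
      (hk.inner continuous_const)).1 h2) 1
    simpa only [regRep_one] using h3
  exact ext_inner_left ℂ hmain

/-- Characters separate the points of a compact Abelian group. -/
theorem exists_character_ne_one {G : Type*} [CommGroup G] [TopologicalSpace G]
    [IsTopologicalGroup G] [CompactSpace G] [T2Space G] {g₀ : G} (hg : g₀ ≠ 1) :
    ∃ χ : PontryaginDual G, χ g₀ ≠ 1 := by
  borelize G
  by_contra! hg₀
  obtain ⟨μ, _, _⟩ : ∃ μ : Measure G, μ.IsHaarMeasure ∧ μ.Regular :=
    ⟨Measure.haarMeasure ⊤, inferInstance, inferInstance⟩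
  -- A Urysohn function separating `g₀` from `1` cannot be invariant under translation by `g₀`.
  obtain ⟨φ, hφ0, hφ1, -⟩ := exists_continuous_zero_one_of_isClosed
    (isClosed_singleton (x := g₀)) (isClosed_singleton (x := (1 : G))) (by simpa using hg)
  obtain ⟨ψ, hψ⟩ : ∃ ψ : C(G, ℂ), ∀ x, ψ x = φ x := ⟨⟨fun x => (φ x : ℂ), by fun_prop⟩, fun x => rfl⟩
  have h1 : regRep μ g₀ (ContinuousMap.toLp 2 μ ℂ ψ) = ContinuousMap.toLp 2 μ ℂ ψ :=
    regRep_eq_self hg₀ _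
  have h2 := ContinuousMap.coeFn_toLp (p := 2) μ (𝕜 := ℂ) ψ
  have h3 : (fun x => ψ (g₀ * x)) =ᵐ[μ] ψ := by
    have h4 := (measurePreserving_mul_left μ g₀).quasiMeasurePreserving.ae_eq_comp h2
    have h5 := coeFn_regRep g₀ (ContinuousMap.toLp 2 μ ℂ ψ)
    rw [h1] at h5
    exact h4.symm.trans (h5.symm.trans h2)
  have h6 := congrFun ((Continuous.ae_eq_iff_eq μ (by fun_prop) ψ.continuous).1 h3) 1
  simp only [mul_one] at h6
  rw [hψ, hψ, hφ1 rfl, hφ0 rfl] at h6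
  simp at h6

end PeterWeyl

/-! ### Density of the functions that come from characters and towers -/

section Quotient

variable {K : Type*} [CommGroup K] [TopologicalSpace K] [IsTopologicalGroup K] [CompactSpace K]
  {H : Subgroup K}

lemma t3Space_quotient (hH : IsClosed (H : Set K)) : T3Space (K ⧸ H) := by
  have : IsClosed (H : Set K) := hH
  infer_instance

lemma exists_quotChar_ne_one (hH : IsClosed (H : Set K)) {q : K ⧸ H} (hq : q ≠ 1) :
    ∃ χ : dualQuotient H, quotChar χ q ≠ 1 := by
  have := t3Space_quotient hH
  obtain ⟨ψ, hψ⟩ := exists_character_ne_one hq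
  let χ : PontryaginDual K :=
    ContinuousMonoidHom.comp (A := K) (C := Circle) ψ ⟨QuotientGroup.mk' H, continuous_quotient_mk'⟩
  have hχ : ∀ k : K, χ k = ψ (k : K ⧸ H) := fun k => rfl
  refine ⟨⟨χ, fun k hk => ?_⟩, ?_⟩
  · rw [hχ, (QuotientGroup.eq_one_iff k).2 hk, map_one]
  · obtain ⟨k, rfl⟩ := QuotientGroup.mk_surjective q
    exact hψ

/-- A character of `K / H` as a continuous function. -/
def quotCharMap (χ : dualQuotient H) : C(K ⧸ H, ℂ) :=
  ⟨fun q => (quotChar χ q : ℂ), continuous_circle_coe.comp (continuous_quotChar χ)⟩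

lemma quotCharMap_apply (χ : dualQuotient H) (q : K ⧸ H) :
    quotCharMap χ q = (quotChar χ q : ℂ) := rfl

/-- Stone–Weierstrass: the span of the characters is a self-adjoint algebra, and it separates points
since characters of the compact group `K / H` do. -/
lemma span_quotCharMap_closure (hH : IsClosed (H : Set K)) :
    (Submodule.span ℂ (Set.range (quotCharMap (H := H)))).topologicalClosure = ⊤ := by
  have := t3Space_quotient hH
  have hone : quotCharMap (1 : dualQuotient H) = 1 := by
    ext q
    obtain ⟨k, rfl⟩ := QuotientGroup.mk_surjective q
    rw [quotCharMap_apply, quotChar_mk]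
    exact Circle.coe_one
  have hmul : ∀ χ η : dualQuotient H, quotCharMap (χ * η) = quotCharMap χ * quotCharMap η := by
    intro χ η
    ext q
    obtain ⟨k, rfl⟩ := QuotientGroup.mk_surjective q
    rw [ContinuousMap.mul_apply, quotCharMap_apply, quotCharMap_apply, quotCharMap_apply]
    exact Circle.coe_mul _ _
  have hstar : ∀ χ : dualQuotient H, star (quotCharMap χ) = quotCharMap χ⁻¹ := by
    intro χ
    ext q
    obtain ⟨k, rfl⟩ := QuotientGroup.mk_surjective q
    rw [ContinuousMap.star_apply, quotCharMap_apply, quotCharMap_apply]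
    exact (Circle.coe_inv_eq_conj _).symm
  obtain ⟨A, hA⟩ : ∃ A : StarSubalgebra ℂ C(K ⧸ H, ℂ),
      (A : Set C(K ⧸ H, ℂ)) = Submodule.span ℂ (Set.range (quotCharMap (H := H))) := by
    refine ⟨⟨(Submodule.span ℂ (Set.range (quotCharMap (H := H)))).toSubalgebra
      (Submodule.subset_span ⟨1, hone⟩) ?_, ?_⟩, rfl⟩
    · intro f g hf hg
      refine Submodule.span_induction₂ (p := fun f g _ _ =>
        f * g ∈ Submodule.span ℂ (Set.range (quotCharMap (H := H)))) ?_ ?_ ?_ ?_ ?_ ?_ ?_ hf hg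
      · rintro _ _ ⟨χ, rfl⟩ ⟨η, rfl⟩
        rw [← hmul]
        exact Submodule.subset_span ⟨_, rfl⟩
      · intro y _
        rw [zero_mul]
        exact zero_mem _
      · intro x _
        rw [mul_zero]
        exact zero_mem _
      · intro x y z _ _ _ h1 h2
        rw [add_mul]
        exact add_mem h1 h2
      · intro x y z _ _ _ h1 h2
        rw [mul_add]
        exact add_mem h1 h2
      · intro r x y _ _ h
        rw [smul_mul_assoc]
        exact Submodule.smul_mem _ _ h
      · intro r x y _ _ h
        rw [mul_smul_comm]
        exact Submodule.smul_mem _ _ h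
    · intro f hf
      change star f ∈ Submodule.span ℂ (Set.range (quotCharMap (H := H)))
      refine Submodule.span_induction (p := fun f _ =>
        star f ∈ Submodule.span ℂ (Set.range (quotCharMap (H := H)))) ?_ ?_ ?_ ?_ hf
      · rintro _ ⟨χ, rfl⟩
        rw [hstar]
        exact Submodule.subset_span ⟨_, rfl⟩
      · rw [star_zero]
        exact zero_mem _
      · intro x y _ _ h1 h2
        rw [star_add]
        exact add_mem h1 h2
      · intro r x _ h
        rw [star_smul]
        exact Submodule.smul_mem _ _ h
  have hsep : A.SeparatesPoints := by
    intro p q hpq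
    obtain ⟨χ, hχ⟩ := exists_quotChar_ne_one hH (q := p / q) (div_ne_one.2 hpq)
    refine ⟨_, ⟨quotCharMap χ, ?_, rfl⟩, fun h => hχ ?_⟩
    · change quotCharMap χ ∈ (A : Set C(K ⧸ H, ℂ))
      rw [hA]
      exact Submodule.subset_span ⟨χ, rfl⟩
    · rw [map_div, div_eq_one]
      exact Circle.ext h
  have h1 := ContinuousMap.starSubalgebra_topologicalClosure_eq_top_of_separatesPoints A hsep
  refine SetLike.coe_injective ?_
  rw [Submodule.topologicalClosure_coe, ← hA, ← StarSubalgebra.topologicalClosure_coe, h1]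
  rfl

variable [PolishSpace K] [MeasurableSpace K] [BorelSpace K]

/-- The characters of `K / H` span a dense subspace of `L²(K / H)`. -/
lemma eq_top_of_forall_quotChar_mem (hH : IsClosed (H : Set K)) [IsFiniteMeasure (haarQuotient H)]
    {W : Submodule ℂ (Lp ℂ 2 (haarQuotient H))} (hW : IsClosed (W : Set (Lp ℂ 2 (haarQuotient H))))
    (h : ∀ (χ : dualQuotient H) (f : Lp ℂ 2 (haarQuotient H)),
      f =ᵐ[haarQuotient H] (fun q => (quotChar χ q : ℂ)) → f ∈ W) : W = ⊤ := by
  have := t3Space_quotient hH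
  have : BorelSpace (K ⧸ H) := QuotientGroup.borelSpace
  have h1 := (ContinuousMap.toLp_denseRange ℂ (haarQuotient H) ℂ
    ENNReal.ofNat_ne_top (p := 2)).topologicalClosure_map_submodule (span_quotCharMap_closure hH)
  rw [eq_top_iff, ← h1]
  refine Submodule.topologicalClosure_minimal _ ?_ hW
  rw [Submodule.map_span, Submodule.span_le]
  rintro _ ⟨_, ⟨χ, rfl⟩, rfl⟩
  exact h χ _ (ContinuousMap.coeFn_toLp (haarQuotient H) (quotCharMap χ))

end Quotient

/-! ### Totality of the tower functions in `L²(X × K / H)` -/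

namespace CFData

variable {D : CFData} {K : Type*} [CommGroup K] [TopologicalSpace K] [IsTopologicalGroup K]
  [CompactSpace K] [PolishSpace K] [MeasurableSpace K] [BorelSpace K] {H : Subgroup K}

/-- The first `n` digits of a point are functions of its position in `F_n`. So the phase can be
absorbed into the function on the tower. -/
lemma exists_character_phase_eq (a : ℕ → ℝ → K) (χ : PontryaginDual K) (n : ℕ) :
    ∃ u : ℝ → Circle, Measurable (fun s => (u s : ℂ)) ∧ ∀ x : D.X, χ (phase a n x) = u (pos n x) := by
  choose! g hg hg1 hg2 using fun k (hk : k ≤ n) => exists_pos_eq_comp (D := D) hk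
  refine ⟨fun s => ∏ k ∈ Finset.range n, χ (a (k + 1) (D.dig k (g (k + 1) s))), ?_, fun x => ?_⟩
  · have e : (fun s => ((∏ k ∈ Finset.range n, χ (a (k + 1) (D.dig k (g (k + 1) s))) : Circle) : ℂ))
        = fun s => ∏ k ∈ Finset.range n, (χ (a (k + 1) (D.dig k (g (k + 1) s))) : ℂ) :=
      funext fun s => map_prod Circle.coeHom _ _
    rw [e]
    refine Finset.measurable_prod _ fun k hk => ?_
    exact (measurable_comp_dig (fun c => (χ (a (k + 1) c) : ℂ)) k).comp
      (hg (k + 1) (Finset.mem_range.1 hk))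
  · rw [phase, map_prod]
    refine Finset.prod_congr rfl fun k hk => ?_
    rw [hg2 (k + 1) (Finset.mem_range.1 hk) x]

/-- The function `g` is the indicator of `B` times the phase, so that the conjugate phase in
`towerFun` cancels. -/
lemma exists_towerFun_eq (a : ℕ → ℝ → K) (χ : dualQuotient H) {n : ℕ} {B : Set ℝ}
    (hB : MeasurableSet B) (hB0 : B ⊆ Set.Ico 0 (D.h n)) :
    ∃ g ∈ boxFun 0 (D.h n), ∀ p : D.X × (K ⧸ H),
      towerFun a χ n g p = (pos n ⁻¹' B).indicator (fun _ => (quotChar χ p.2 : ℂ)) p.1 := by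
  obtain ⟨u, hu, hux⟩ := exists_character_phase_eq (D := D) a (χ : PontryaginDual K) n
  refine ⟨B.indicator fun s => (u s : ℂ),
    ⟨hu.indicator hB, ⟨1, fun s => ?_⟩, fun s hs => ?_⟩,
    fun p => ?_⟩
  · by_cases hs : s ∈ B
    · rw [Set.indicator_of_mem hs, Circle.norm_coe]
    · rw [Set.indicator_of_notMem hs, norm_zero]
      exact zero_le_one
  · exact Set.indicator_of_notMem (fun h => hs (hB0 h)) _
  · rw [towerFun, hux]
    by_cases hs : pos n p.1 ∈ B
    · rw [Set.indicator_of_mem hs, Set.indicator_of_mem (show p.1 ∈ pos n ⁻¹' B from hs),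
        Complex.mul_conj, Circle.normSq_coe, Complex.ofReal_one, one_mul]
    · rw [Set.indicator_of_notMem hs, Set.indicator_of_notMem (show p.1 ∉ pos n ⁻¹' B from hs),
        zero_mul, zero_mul]

lemma isCountablySpanning_posSets (D : CFData) : IsCountablySpanning (D.posSets 0) := by
  refine ⟨fun n => D.levelSet (n + 0), fun n => ⟨n, Nat.zero_le _, _, subset_rfl, measurableSet_Ico,
    (preimage_pos_Ico n).symm⟩, iUnion_levelSet_add 0⟩

/-- For a fixed set `A` of positions, pairing `f` with `1_A ⊗ φ` is a continuous functional of `φ ∈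
L²(K / H)` that kills the characters, hence everything. So `conj f` has integral zero over all
rectangles of a generating π-system, and then over all measurable sets. -/
lemma IsFinite.eq_zero_of_forall_inner_towerMap (hD : D.IsFinite) (hH : IsClosed (H : Set K))
    (a : ℕ → ℝ → K) {f : Lp ℂ 2 (D.measure.prod (haarQuotient H))}
    (hf : ∀ (χ : dualQuotient H) (n : ℕ), ∀ g ∈ boxFun 0 (D.h n),
      inner ℂ f (D.towerMap a χ n g) = 0) : f = 0 := by
  have := hD.isProbabilityMeasure
  have := isProbabilityMeasure_haarQuotient H
  have hfi : Integrable (fun p => conj (f p)) (D.measure.prod (haarQuotient H)) :=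
    (Complex.conjCLE.toContinuousLinearMap.integrable_comp
      ((Lp.memLp f).integrable one_le_two) : _)
  have hsnd : MeasurePreserving Prod.snd (D.measure.prod (haarQuotient H)) (haarQuotient H) := measurePreserving_snd
  -- rectangles
  have hrect : ∀ A ∈ D.posSets 0, ∀ C : Set (K ⧸ H), MeasurableSet C →
      ∫ p in A ×ˢ C, conj (f p) ∂(D.measure.prod (haarQuotient H)) = 0 := by
    rintro _ ⟨n, -, B, hB0, hB, rfl⟩ C hC
    have hBm : MeasurableSet ((pos n ⁻¹' B : Set D.X) ×ˢ (Set.univ : Set (K ⧸ H))) :=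
      (measurable_pos n hB).prod MeasurableSet.univ
    set F : Lp ℂ 2 (D.measure.prod (haarQuotient H)) := ((Lp.memLp f).indicator hBm).toLp with hF
    have hFe : F =ᵐ[(D.measure.prod (haarQuotient H))] ((pos n ⁻¹' B : Set D.X) ×ˢ (Set.univ : Set (K ⧸ H))).indicator f :=
      MemLp.coeFn_toLp _
    obtain ⟨S, hS⟩ : ∃ S : Lp ℂ 2 (haarQuotient H) →L[ℂ] Lp ℂ 2 (D.measure.prod (haarQuotient H)),
        ∀ φ, S φ =ᵐ[(D.measure.prod (haarQuotient H))] fun p => φ p.2 :=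
      ⟨(Lp.compMeasurePreservingₗᵢ ℂ Prod.snd hsnd).toContinuousLinearMap,
        fun φ => Lp.coeFn_compMeasurePreserving φ hsnd⟩
    have hin : ∀ φ : Lp ℂ 2 (haarQuotient H), inner ℂ F (S φ)
        = ∫ p, conj (f p) * ((pos n ⁻¹' B : Set D.X).indicator (fun _ => φ p.2) p.1) ∂(D.measure.prod (haarQuotient H)) := by
      intro φ
      rw [L2.inner_def]
      refine integral_congr_ae ?_
      filter_upwards [hFe, hS φ] with p h1 h2
      rw [h1, h2, RCLike.inner_apply]
      by_cases hp : p.1 ∈ (pos n ⁻¹' B : Set D.X)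
      · rw [Set.indicator_of_mem hp, Set.indicator_of_mem (Set.mk_mem_prod hp (Set.mem_univ _)),
          mul_comm]
      · rw [Set.indicator_of_notMem hp, Set.indicator_of_notMem fun h => hp h.1, map_zero,
          mul_zero, mul_zero]
    have htop := eq_top_of_forall_quotChar_mem hH
      (W := LinearMap.ker (((innerSL ℂ F).comp S : Lp ℂ 2 (haarQuotient H) →L[ℂ] ℂ) :
        Lp ℂ 2 (haarQuotient H) →ₗ[ℂ] ℂ)) ((innerSL ℂ F).comp S).isClosed_ker (by
      intro χ φ hφ
      change inner ℂ F (S φ) = 0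
      obtain ⟨g, hg, hgp⟩ := exists_towerFun_eq (D := D) a χ hB hB0
      rw [hin, ← hf χ n g hg, L2.inner_def]
      refine integral_congr_ae ?_
      filter_upwards [hD.coeFn_towerMap hH a χ n hg,
        hsnd.quasiMeasurePreserving.ae_eq_comp hφ] with p h1 h2
      rw [h1, RCLike.inner_apply, hgp, mul_comm]
      simp only [Function.comp_apply] at h2
      rw [h2])
    have hCm : MemLp (C.indicator fun _ => (1 : ℂ)) 2 (haarQuotient H) :=
      memLp_indicator_const 2 hC 1 (Or.inr (measure_ne_top _ _))
    have h0 : inner ℂ F (S hCm.toLp) = 0 := by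
      have : hCm.toLp ∈ LinearMap.ker (((innerSL ℂ F).comp S : Lp ℂ 2 (haarQuotient H) →L[ℂ] ℂ) :
        Lp ℂ 2 (haarQuotient H) →ₗ[ℂ] ℂ) := htop ▸ Submodule.mem_top
      exact this
    rw [hin] at h0
    rw [← h0, ← integral_indicator ((measurable_pos n hB).prod hC)]
    refine integral_congr_ae ?_
    filter_upwards [hsnd.quasiMeasurePreserving.ae_eq_comp (MemLp.coeFn_toLp hCm)] with p h1
    simp only [Function.comp_apply] at h1
    rw [h1]
    by_cases hp : p.1 ∈ (pos n ⁻¹' B : Set D.X)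
    · by_cases hq : p.2 ∈ C
      · rw [Set.indicator_of_mem hp, Set.indicator_of_mem (Set.mk_mem_prod hp hq),
          Set.indicator_of_mem hq, mul_one]
      · rw [Set.indicator_of_mem hp, Set.indicator_of_notMem (fun h => hq h.2),
          Set.indicator_of_notMem hq, mul_zero]
    · rw [Set.indicator_of_notMem hp, Set.indicator_of_notMem (fun h => hp h.1), mul_zero]
  -- all measurable sets
  have huniv : ∫ p, conj (f p) ∂(D.measure.prod (haarQuotient H)) = 0 := by
    have hmono : Monotone fun n => D.levelSet n ×ˢ (Set.univ : Set (K ⧸ H)) := fun n m hnm =>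
      Set.prod_mono (levelSet_mono hnm) subset_rfl
    have hU : (⋃ n, D.levelSet n ×ˢ (Set.univ : Set (K ⧸ H))) = Set.univ := by
      rw [← Set.iUnion_prod_const, show (⋃ n, D.levelSet n) = Set.univ from iUnion_levelSet_add 0,
        Set.univ_prod_univ]
    have h1 := tendsto_setIntegral_of_monotone
      (fun n => (measurableSet_levelSet (D := D) n).prod MeasurableSet.univ) hmono
      (hfi.integrableOn (s := ⋃ n, D.levelSet n ×ˢ (Set.univ : Set (K ⧸ H))))
    rw [hU, Measure.restrict_univ] at h1
    refine tendsto_nhds_unique h1 ((tendsto_const_nhds (x := (0 : ℂ))).congr fun n => ?_)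
    exact (hrect _ ⟨n, Nat.zero_le _, _, subset_rfl, measurableSet_Ico,
      (preimage_pos_Ico n).symm⟩ _ MeasurableSet.univ).symm
  have hall : ∀ s : Set (D.X × (K ⧸ H)), MeasurableSet s → ∫ p in s, conj (f p) ∂(D.measure.prod (haarQuotient H)) = 0 := by
    intro s hs
    induction s, hs using MeasurableSpace.induction_on_inter
      (generateFrom_eq_prod (generateFrom_posSets D 0).symm
        MeasurableSpace.generateFrom_measurableSet (isCountablySpanning_posSets D)
        isCountablySpanning_measurableSet).symm
      ((isPiSystem_posSets D 0).prod MeasurableSpace.isPiSystem_measurableSet) with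
    | empty => simp
    | basic t ht =>
      obtain ⟨A, hA, C, hC, rfl⟩ := ht
      exact hrect A hA C hC
    | compl t htm h =>
      have := integral_add_compl htm hfi
      rwa [h, zero_add, huniv] at this
    | iUnion g hd hm h =>
      rw [integral_iUnion hm hd hfi.integrableOn]
      simp only [h, tsum_zero]
  have hz := hfi.ae_eq_zero_of_forall_setIntegral_eq_zero fun s hs _ => hall s hs
  refine Lp.ext ?_
  filter_upwards [hz, Lp.coeFn_zero ℂ 2 (D.measure.prod (haarQuotient H))] with p h1 h2
  rw [h2]
  exact (map_eq_zero (starRingEnd ℂ)).1 h1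

end CFData

/-! ### Consequences of the construction -/

/-- The indices `n` for which the step from `n` to `n + 1` is of a given kind. -/
def stepFilter {β : Type*} (κ : ℕ → β) (b : β) : Filter ℕ := atTop ⊓ 𝓟 {n | κ (n + 1) = b}

lemma stepFilter_le {β : Type*} (κ : ℕ → β) (b : β) : stepFilter κ b ≤ atTop := inf_le_left

lemma eventually_stepFilter {β : Type*} (κ : ℕ → β) (b : β) :
    ∀ᶠ n in stepFilter κ b, 1 ≤ n ∧ κ (n + 1) = b := by
  filter_upwards [stepFilter_le κ b (eventually_ge_atTop 1),
    mem_inf_of_right (mem_principal_self {n | κ (n + 1) = b})] with n h1 h2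
  exact ⟨h1, h2⟩

lemma stepFilter_neBot {β : Type*} {κ : ℕ → β} {b : β} (h : (κ ⁻¹' {b}).Infinite) :
    (stepFilter κ b).NeBot := by
  rw [stepFilter, ← frequently_mem_iff_neBot, frequently_atTop]
  intro N
  obtain ⟨m, hm, hN⟩ := h.exists_gt N
  refine ⟨m - 1, by omega, ?_⟩
  rw [Set.mem_ofPred_eq, Nat.sub_add_cancel (by omega)]
  exact hm

/-- If `s ≠ 0`, the conditions `s ξ_i ∈ 2πℤ` would give an integral relation between `ξ 0` and `ξ
1`. -/
lemma eq_zero_of_expi_eq_one {ξ : Fin 2 → ℝ} (hξ : ∀ i, 0 < ξ i) (hli : LinearIndependent ℚ ξ)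
    {s : ℝ} (h : ∀ i, expi (-ξ i) s = 1) : s = 0 := by
  by_contra hs
  have hk : ∀ i, ∃ k : ℤ, s * ξ i = k * (2 * Real.pi) := by
    intro i
    obtain ⟨k, hk⟩ := Complex.exp_eq_one_iff.1 (h i)
    refine ⟨-k, ?_⟩
    have h1 : ((s * ξ i : ℝ) : ℂ) * Complex.I = ((-k : ℤ) * (2 * Real.pi) : ℝ) * Complex.I := by
      push_cast at hk ⊢
      linear_combination -hk
    exact_mod_cast mul_right_cancel₀ Complex.I_ne_zero h1
  choose k hk using hk
  have h2 : (k 1 : ℝ) * ξ 0 + (-k 0 : ℝ) * ξ 1 = 0 := by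
    have h3 : s * ((k 1 : ℝ) * ξ 0 + (-k 0 : ℝ) * ξ 1) = 0 := by
      linear_combination (k 1 : ℝ) * hk 0 - (k 0 : ℝ) * hk 1
    exact (mul_eq_zero.1 h3).resolve_left hs
  have h4 := LinearIndependent.pair_iff.1 (show LinearIndependent ℚ ![ξ 0, ξ 1] by
    rwa [show ![ξ 0, ξ 1] = ξ from by ext i; fin_cases i <;> rfl]) (k 1 : ℚ) (-k 0 : ℚ) (by
      simp only [Rat.smul_def]
      push_cast
      exact h2)
  have h5 : (k 1 : ℤ) = 0 := by exact_mod_cast h4.1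
  have h6 := hk 1
  rw [h5, Int.cast_zero, zero_mul] at h6
  exact hs ((mul_eq_zero.1 h6).resolve_right (hξ 1).ne')

/-- A mean of numbers of modulus one equals `1` only if all of them do; the term `i = 0` is `χ p`.
-/
lemma norm_orbitMean_character {K : Type*} [CommGroup K] [TopologicalSpace K]
    {v : K ≃ₜ* K} {χ : PontryaginDual K} {p : K} (hp : p ∈ periodicPoints v)
    (h : orbitMean v χ p = 1) : χ p = 1 := by
  have hm : 0 < period v p := Function.minimalPeriod_pos_of_mem_periodicPts hp
  have hm' : (period v p : ℂ) ≠ 0 := by exact_mod_cast hm.ne'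
  have h1 : ∑ i ∈ Finset.range (period v p), (χ (v^[i] p) : ℂ) = period v p := by
    rw [orbitMean] at h
    field_simp at h
    exact h
  have h2 : ∑ i ∈ Finset.range (period v p), (1 - (χ (v^[i] p) : ℂ).re) = 0 := by
    have := congrArg Complex.re h1
    rw [Complex.re_sum, Complex.natCast_re] at this
    rw [Finset.sum_sub_distrib, this]
    simp
  have hle : ∀ z : Circle, 0 ≤ 1 - (z : ℂ).re := fun z => by
    have := Complex.re_le_norm (z : ℂ)
    rw [Circle.norm_coe] at this
    linarith
  have h3 := (Finset.sum_eq_zero_iff_of_nonneg fun i _ => hle _).1 h2 0 (Finset.mem_range.2 hm)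
  simp only [Function.iterate_zero, id_eq] at h3
  have h4 : ((χ p : ℂ).re) ^ 2 + ((χ p : ℂ).im) ^ 2 = 1 := by
    have := Circle.normSq_coe (χ p)
    rw [Complex.normSq_apply] at this
    linear_combination this
  refine Circle.ext (Complex.ext ?_ ?_)
  · rw [Circle.coe_one, Complex.one_re]
    linarith
  · rw [Circle.coe_one, Complex.one_im]
    have h5 : (χ p : ℂ).re = 1 := by linarith
    rw [h5] at h4
    have : ((χ p : ℂ).im) ^ 2 = 0 := by linarith
    exact pow_eq_zero_iff two_ne_zero |>.1 this

namespace IsConstruction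

variable {K : Type*} [CommGroup K] [TopologicalSpace K] [IsTopologicalGroup K]
  {v : K ≃ₜ* K} {ξ : Fin 2 → ℝ} {κ : ℕ → Fin 2 ⊕ periodicPoints v} {D : CFData} {a : ℕ → ℝ → K}

lemma period_pos (p : periodicPoints v) : 0 < period v p :=
  Function.minimalPeriod_pos_of_mem_periodicPts p.2

lemma card_inr (h : IsConstruction v ξ κ D a) {n : ℕ} (hn : 1 ≤ n) {p : periodicPoints v}
    (hp : κ (n + 1) = Sum.inr p) : (D.C (n + 1)).card = n ^ 3 * period v p := by
  rw [h.C_inr n hn p hp, Finset.card_image_of_injective, Finset.card_range]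
  intro i j hij
  exact_mod_cast mul_right_cancel₀ (D.h_pos n).ne' hij

lemma card_inl (h : IsConstruction v ξ κ D a) (hξ : ∀ i, 0 < ξ i) {n : ℕ} (hn : 1 ≤ n) {i : Fin 2}
    (hi : κ (n + 1) = Sum.inl i) : (D.C (n + 1)).card = 2 * n := by
  have hh := D.h_pos n
  have hx := hξ i
  rw [h.C_inl n hn i hi, Finset.card_union_of_disjoint, Finset.card_image_of_injective,
    Finset.card_image_of_injective, Finset.card_range, two_mul]
  · intro i j hij
    exact_mod_cast mul_right_cancel₀ (by positivity) (add_right_cancel hij)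
  · intro i j hij
    exact_mod_cast mul_right_cancel₀ hh.ne' hij
  · rw [Finset.disjoint_left]
    rintro x hx1 hx2
    obtain ⟨j, hj, rfl⟩ := Finset.mem_image.1 hx1
    obtain ⟨j', hj', e⟩ := Finset.mem_image.1 hx2
    have h1 : (j : ℝ) < n := by exact_mod_cast Finset.mem_range.1 hj
    have h2 : (0 : ℝ) ≤ j' * (D.h n + ξ i) := by positivity
    nlinarith

lemma two_le_card (h : IsConstruction v ξ κ D a) (hξ : ∀ i, 0 < ξ i) {n : ℕ} (hn : 2 ≤ n) :
    2 ≤ (D.C (n + 1)).card := by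
  rcases hk : κ (n + 1) with i | p
  · rw [h.card_inl hξ (by omega) hk]
    omega
  · rw [h.card_inr (by omega) hk]
    have := period_pos p
    have h2 : 2 ^ 3 ≤ n ^ 3 := Nat.pow_le_pow_left hn 3
    nlinarith

/-- The spacers add at most `1 + ξ 0 + ξ 1` per copy. -/
lemma h_succ_le (h : IsConstruction v ξ κ D a) (hξ : ∀ i, 0 < ξ i) {n : ℕ} (hn : 1 ≤ n) :
    D.h (n + 1) ≤ (D.C (n + 1)).card * (D.h n + (1 + ξ 0 + ξ 1)) := by
  have h0 := hξ 0
  have h1 := hξ 1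
  have hn' : (1 : ℝ) ≤ n := by exact_mod_cast hn
  rcases hk : κ (n + 1) with i | p
  · rw [h.card_inl hξ hn hk, h.h_inl n hn i hk]
    have h2 : ξ i ≤ ξ 0 + ξ 1 := by
      fin_cases i
      · simp only [Fin.zero_eta]; linarith
      · simp only [Fin.mk_one]; linarith
    push_cast
    nlinarith
  · rw [h.card_inr hn hk, h.h_inr n hn p hk]
    have h2 : (1 : ℝ) ≤ ((n ^ 3 * period v p : ℕ) : ℝ) := by
      have := period_pos p
      have h3 : 0 < n ^ 3 := by positivity
      exact_mod_cast Nat.mul_pos h3 this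
    nlinarith

/-- With `c = 1 + ξ 0 + ξ 1`, one step gives `h_{n+1} + 2c ≤ #C_{n+1} (h_n + 2c)` as soon as
`#C_{n+1} ≥ 2`. So `(h_n + 2c) / copies` does not increase from level `2` on and bounds the mass.
The heights at least double. -/
lemma isFinite (h : IsConstruction v ξ κ D a) (hξ : ∀ i, 0 < ξ i) : D.IsFinite := by
  set c : ℝ := 1 + ξ 0 + ξ 1 with hc
  have hc0 : 0 < c := by have h0 := hξ 0; have h1 := hξ 1; positivity
  constructor
  · have hcop : ∀ n, D.copies (n + 1) = D.copies n * (D.C (n + 1)).card := fun n =>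
      Finset.prod_range_succ _ _
    have hanti : ∀ n, D.mass (n + 2) + 2 * c / D.copies (n + 2)
        ≤ D.mass 2 + 2 * c / D.copies 2 := by
      intro n
      induction n with
      | zero => simp
      | succ n ih =>
        refine le_trans ?_ ih
        have h1 := h.h_succ_le hξ (n := n + 2) (by omega)
        have h2 : (2 : ℝ) ≤ (D.C (n + 2 + 1)).card := by
          exact_mod_cast h.two_le_card hξ (n := n + 2) (by omega)
        have h3 := CFData.copies_pos (D := D) (n + 2)
        rw [CFData.mass, CFData.mass, show n + 1 + 2 = n + 2 + 1 by ring, hcop (n + 2), ← add_div,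
          ← add_div, div_le_div_iff₀ (by positivity) h3]
        have h4 : D.h (n + 2 + 1) + 2 * c ≤ (D.C (n + 2 + 1)).card * (D.h (n + 2) + 2 * c) := by
          nlinarith
        nlinarith
    refine ⟨D.mass 2 + 2 * c / D.copies 2, fun n => ?_⟩
    have h3 := CFData.copies_pos (D := D) n
    rw [← div_le_iff₀ h3]
    refine le_trans (CFData.mass_mono (D := D) (Nat.le_add_right n 2)) (le_trans ?_ (hanti n))
    have h4 := CFData.copies_pos (D := D) (n + 2)
    exact le_add_of_nonneg_right (by positivity)
  · have hgrow : ∀ n, (2 : ℝ) ^ n ≤ D.h (n + 2) := by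
      intro n
      induction n with
      | zero => simpa using D.one_le_h 2
      | succ n ih =>
        have h2 : (2 : ℝ) ≤ (D.C (n + 2 + 1)).card := by
          exact_mod_cast h.two_le_card hξ (n := n + 2) (by omega)
        have h5 := CFData.card_mul_h_le (D := D) (n + 2)
        have h6 := D.h_pos (n + 2)
        rw [pow_succ, show n + 1 + 2 = n + 2 + 1 by ring]
        nlinarith
    rw [← tendsto_add_atTop_iff_nat 2]
    exact tendsto_atTop_mono hgrow (tendsto_pow_atTop_atTop_of_one_lt one_lt_two)

/-- The mean value of the increments of the cocycle. -/
lemma tendsto_coeff (h : IsConstruction v ξ κ D a) (χ : PontryaginDual K) (p : periodicPoints v) :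
    Tendsto (fun n => ((D.C (n + 1)).card : ℂ)⁻¹ *
      ∑ c ∈ (D.C (n + 1)).filter fun c => c - D.h n ∈ D.C (n + 1),
        conj (χ (a (n + 1) c) : ℂ) * (χ (a (n + 1) (c - D.h n)) : ℂ)) (stepFilter κ (Sum.inr p))
      (𝓝 (conj (orbitMean v χ p))) := by
  set m := period v p with hm
  have hm0 : 0 < m := period_pos p
  have hlim : Tendsto (fun n : ℕ => 4 / (n : ℝ)) (stepFilter κ (Sum.inr p)) (𝓝 0) :=
    (tendsto_const_div_atTop_nhds_zero_nat 4).mono_left (stepFilter_le _ _)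
  rw [tendsto_iff_norm_sub_tendsto_zero]
  refine tendsto_of_tendsto_of_tendsto_of_le_of_le' tendsto_const_nhds hlim
    (Eventually.of_forall fun n => norm_nonneg _) ?_
  filter_upwards [eventually_stepFilter κ (Sum.inr p)] with n hn
  choose! B hBC hB hBcard using h.increments n hn.1 p hn.2
  set C := D.C (n + 1) with hC
  set S := C.filter fun c => c - D.h n ∈ C with hS
  set F : ℝ → ℂ := fun c => conj (χ (a (n + 1) c) : ℂ) * (χ (a (n + 1) (c - D.h n)) : ℂ) with hF
  set G : ℕ → ℂ := fun i => conj (χ (v^[i] (p : K)) : ℂ) with hG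
  have hn0 : (0 : ℝ) < n := by exact_mod_cast hn.1
  have hmR : (0 : ℝ) < m := by exact_mod_cast hm0
  have hCpos : (0 : ℝ) < C.card := by exact_mod_cast D.card_pos n
  have hFB : ∀ i < m, ∀ c ∈ B i, F c = G i := by
    intro i hi c hc
    have h1 := ((hB i hi) c hc).2
    simp only [hF, hG]
    rw [h1, map_mul, Circle.coe_mul, map_mul]
    have h3 : (χ (a (n + 1) (c - D.h n)) : ℂ) * conj (χ (a (n + 1) (c - D.h n)) : ℂ) = 1 := by
      rw [Complex.mul_conj, Circle.normSq_coe, Complex.ofReal_one]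
    linear_combination conj (χ (v^[i] (p : K)) : ℂ) * h3
  -- The points `v^i(p)` with `i < m` are distinct, so an increment determines `i`.
  have hdisj : ((Finset.range m : Finset ℕ) : Set ℕ).PairwiseDisjoint B := by
    intro i hi j hj hij
    rw [Function.onFun, Finset.disjoint_left]
    intro c hci hcj
    have hi' : i < m := Finset.mem_range.1 hi
    have hj' : j < m := Finset.mem_range.1 hj
    have h1 := ((hB i hi') c hci).2
    rw [((hB j hj') c hcj).2] at h1
    exact hij (((Function.iterate_injOn_Iio_minimalPeriod (f := v) (x := (p : K))) hj' hi'
      (mul_left_cancel h1)).symm)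
  set T := (Finset.range m).biUnion B with hT
  have hTS : T ⊆ S := by
    intro c hc
    obtain ⟨i, hi, hci⟩ := Finset.mem_biUnion.1 hc
    have hi' := Finset.mem_range.1 hi
    exact Finset.mem_filter.2 ⟨hBC i hi' hci, ((hB i hi') c hci).1⟩
  have hsum1 : ∑ c ∈ T, F c = ∑ i ∈ Finset.range m, ((B i).card : ℂ) * G i := by
    rw [hT, Finset.sum_biUnion hdisj]
    refine Finset.sum_congr rfl fun i hi => ?_
    rw [Finset.sum_congr rfl (hFB i (Finset.mem_range.1 hi)), Finset.sum_const, nsmul_eq_mul]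
  -- Summing the `m` lower bounds for the sizes of the `B i` shows that the increments are
  -- prescribed outside a share `2/n`. A further `2/n` comes from replacing the frequencies by
  -- `1/m`, whence the bound `4/n`.
  have hcardT : (C.card : ℝ) - T.card ≤ C.card * (2 / n) := by
    have h1 : (T.card : ℝ) = ∑ i ∈ Finset.range m, ((B i).card : ℝ) := by
      rw [hT, Finset.card_biUnion hdisj]
      push_cast
      rfl
    have h2 : ∑ i ∈ Finset.range m, (C.card : ℝ) * (1 / m - 2 / (n * m))
        ≤ ∑ i ∈ Finset.range m, ((B i).card : ℝ) := by
      refine Finset.sum_le_sum fun i hi => ?_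
      have h3 := (abs_lt.1 (hBcard i (Finset.mem_range.1 hi))).1
      have h4 : (1 : ℝ) / m - 2 / (n * m) ≤ (B i).card / C.card := by linarith
      rw [le_div_iff₀ hCpos] at h4
      linarith
    rw [Finset.sum_const, Finset.card_range, nsmul_eq_mul] at h2
    have h5 : (m : ℝ) * (C.card * (1 / m - 2 / (n * m))) = C.card - C.card * (2 / n) := by
      field_simp
    rw [h1]
    linarith
  have hrest : ‖∑ c ∈ S \ T, F c‖ ≤ C.card * (2 / n) := by
    refine (norm_sum_le_of_le (f := F) (s := S \ T) (n := fun _ => 1) fun c _ => ?_).trans ?_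
    · simp only [hF]
      rw [norm_mul, RCLike.norm_conj, Circle.norm_coe, Circle.norm_coe, one_mul]
    · rw [Finset.sum_const, nsmul_eq_mul, mul_one, Finset.card_sdiff_of_subset hTS,
        Nat.cast_sub (Finset.card_le_card hTS)]
      have : (S.card : ℝ) ≤ C.card := by exact_mod_cast Finset.card_filter_le _ _
      linarith
  have hmean : conj (orbitMean v χ p) = ∑ i ∈ Finset.range m, (1 / m : ℂ) * G i := by
    rw [orbitMean, map_mul, map_sum, map_inv₀, Complex.conj_natCast, Finset.mul_sum]
    simp only [hG, one_div, hm]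
  have hdiff : ‖∑ i ∈ Finset.range m, (((B i).card : ℂ) / C.card * G i - (1 / m : ℂ) * G i)‖
      ≤ 2 / n := by
    refine (norm_sum_le_of_le (n := fun _ => 2 / ((n : ℝ) * m)) _ fun i hi => ?_).trans ?_
    · rw [← sub_mul, norm_mul]
      simp only [hG]
      rw [RCLike.norm_conj, Circle.norm_coe, mul_one]
      have h3 := (hBcard i (Finset.mem_range.1 hi)).le
      have h4 : ((B i).card : ℂ) / C.card - 1 / m
          = (((B i).card / C.card - 1 / m : ℝ) : ℂ) := by push_cast; rfl
      rw [h4, Complex.norm_real, Real.norm_eq_abs]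
      exact h3
    · rw [Finset.sum_const, Finset.card_range, nsmul_eq_mul]
      have : (m : ℝ) * (2 / (n * m)) = 2 / n := by field_simp
      exact this.le
  have hCne : (C.card : ℂ) ≠ 0 := by exact_mod_cast hCpos.ne'
  have e : ((C.card : ℂ)⁻¹ * ∑ c ∈ S, F c) - conj (orbitMean v χ p)
      = (C.card : ℂ)⁻¹ * ∑ c ∈ S \ T, F c
        + ∑ i ∈ Finset.range m, (((B i).card : ℂ) / C.card * G i - (1 / m : ℂ) * G i) := by
    rw [← Finset.sum_sdiff hTS, hsum1, hmean, Finset.sum_sub_distrib, mul_add, Finset.mul_sum]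
    have : ∀ i, (C.card : ℂ)⁻¹ * (((B i).card : ℂ) * G i) = ((B i).card : ℂ) / C.card * G i :=
      fun i => by rw [div_eq_mul_inv]; ring
    simp only [Finset.mul_sum, this]
    ring
  rw [e]
  refine (norm_add_le _ _).trans ?_
  have h6 : ‖(C.card : ℂ)⁻¹ * ∑ c ∈ S \ T, F c‖ ≤ 2 / n := by
    rw [norm_mul, norm_inv, Complex.norm_natCast]
    calc (C.card : ℝ)⁻¹ * ‖∑ c ∈ S \ T, F c‖ ≤ (C.card : ℝ)⁻¹ * (C.card * (2 / n)) :=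
          mul_le_mul_of_nonneg_left hrest (by positivity)
      _ = 2 / n := by field_simp
  calc _ ≤ 2 / (n : ℝ) + 2 / n := add_le_add h6 hdiff
    _ = 4 / n := by ring

end IsConstruction

/-! ### Spectral types of the representations given by characters -/

/-- The vector `y` has spectral measure `τ'` because its matrix coefficients are those of `u'`, and
it lies in the cyclic space of `u`, so this measure is absolutely continuous with respect to `τ`. -/
lemma IsRankOne.absolutelyContinuous_of_inner_eq {D : CFData} {w : ℕ → ℝ}
    {V V' : Type*} [NormedAddCommGroup V] [InnerProductSpace ℂ V]
    [NormedAddCommGroup V'] [InnerProductSpace ℂ V'] {U : ℝ → V →ₗᵢ[ℂ] V}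
    {U' : ℝ → V' →ₗᵢ[ℂ] V'} {E : ℕ → (ℝ → ℂ) → V} {β : ℕ → ℝ → ℂ} (H : IsRankOne D w U β E)
    {u : V} {u' : V'} (hcyc : towerSpan D E = cyclicSpan U u)
    (hex : ∃ y ∈ towerSpan D E, ∀ t, inner ℂ y (U t y) = inner ℂ u' (U' t u'))
    {τ τ' : Measure ℝ} (hτ : IsSpectralMeasure U u τ) (hτ' : IsSpectralMeasure U' u' τ') :
    τ' ≪ τ := by
  obtain ⟨y, hy, hyt⟩ := hex
  have := hτ.1
  obtain ⟨ρ, hρ, hac⟩ := hτ.exists_of_mem_cyclicSpan H.rep (hcyc ▸ hy)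
  have h1 : IsSpectralMeasure U y τ' := ⟨hτ'.1, fun t => (hyt t).trans (hτ'.2 t)⟩
  have := hτ'.1
  have := hρ.1
  rwa [h1.unique hρ]

open Classical in
lemma card_filter_add_notMem_le {C : Finset ℝ} {r : ℕ} {h : ℝ}
    (hC : C = (Finset.range r).image fun j : ℕ => (j : ℝ) * h) {k : ℕ} :
    (C.filter fun c => c + k * h ∉ C).card ≤ k := by
  have hsub : (C.filter fun c => c + k * h ∉ C)
      ⊆ (Finset.Ico (r - k) r).image fun j : ℕ => (j : ℝ) * h := by
    intro c hc
    obtain ⟨hc1, hc2⟩ := Finset.mem_filter.1 hc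
    rw [hC] at hc1 hc2
    obtain ⟨j, hj, rfl⟩ := Finset.mem_image.1 hc1
    refine Finset.mem_image_of_mem _ (Finset.mem_Ico.2 ⟨?_, Finset.mem_range.1 hj⟩)
    by_contra hlt
    refine hc2 (Finset.mem_image.2 ⟨j + k, Finset.mem_range.2 (by omega), ?_⟩)
    push_cast
    ring
  refine (Finset.card_le_card hsub).trans (Finset.card_image_le.trans ?_)
  rw [Nat.card_Ico]
  omega

open Classical in
lemma card_filter_sub_notMem_le {C : Finset ℝ} {r : ℕ} {h : ℝ}
    (hC : C = (Finset.range r).image fun j : ℕ => (j : ℝ) * h) {k : ℕ} :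
    (C.filter fun c => c + -(k * h) ∉ C).card ≤ k := by
  have hsub : (C.filter fun c => c + -(k * h) ∉ C)
      ⊆ (Finset.range k).image fun j : ℕ => (j : ℝ) * h := by
    intro c hc
    obtain ⟨hc1, hc2⟩ := Finset.mem_filter.1 hc
    rw [hC] at hc1 hc2
    obtain ⟨j, hj, rfl⟩ := Finset.mem_image.1 hc1
    refine Finset.mem_image_of_mem _ (Finset.mem_range.2 ?_)
    by_contra hlt
    push Not at hlt
    have := Finset.mem_range.1 hj
    refine hc2 (Finset.mem_image.2 ⟨j - k, Finset.mem_range.2 (by omega), ?_⟩)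
    push_cast [hlt]
    ring
  refine (Finset.card_le_card hsub).trans (Finset.card_image_le.trans ?_)
  rw [Finset.card_range]

/-- The vector given by the indicator function of the bottom tower. -/
def bottom {V : Type*} (E : ℕ → (ℝ → ℂ) → V) : V := E 0 (boxInd 0 1)

namespace IsConstruction

variable {K : Type*} [CommGroup K] [TopologicalSpace K] [IsTopologicalGroup K]
  {v : K ≃ₜ* K} {ξ : Fin 2 → ℝ} {κ : ℕ → Fin 2 ⊕ periodicPoints v} {D : CFData} {a : ℕ → ℝ → K}

/-! ### Weak limits along the two kinds of steps, and absence of atoms -/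

section WeakLimits

variable {w : ℕ → ℝ} {V : Type*} [NormedAddCommGroup V] [InnerProductSpace ℂ V]
  {U : ℝ → V →ₗᵢ[ℂ] V} {χ : PontryaginDual K} {E : ℕ → (ℝ → ℂ) → V}

lemma tendsto_inner_inr (h : IsConstruction v ξ κ D a)
    (H : IsRankOne D w U (fun n c => (χ (a n c) : ℂ)) E) (p : periodicPoints v) :
    ∀ x ∈ towerSpan D E, ∀ y ∈ towerSpan D E,
      Tendsto (fun n => (inner ℂ x (U (D.h n) y) : ℂ)) (stepFilter κ (Sum.inr p))
        (𝓝 (inner ℂ x (conj (orbitMean v χ p) • y + (0 : ℂ) • U (-0) y))) := by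
  refine H.tendsto_inner_of_one_step (r := fun n => n ^ 3 * period v p) (stepFilter_le _ _) ?_ ?_
    (h.tendsto_coeff χ p)
  · refine Tendsto.mono_left (tendsto_atTop_mono (fun n => ?_) tendsto_id) (stepFilter_le _ _)
    exact (Nat.le_self_pow three_ne_zero n).trans (Nat.le_mul_of_pos_right _ (period_pos p))
  · filter_upwards [eventually_stepFilter κ (Sum.inr p)] with n hn
    exact h.C_inr n hn.1 p hn.2

lemma tendsto_inner_inl (h : IsConstruction v ξ κ D a) (hξ : ∀ i, 0 < ξ i)
    (H : IsRankOne D w U (fun n c => (χ (a n c) : ℂ)) E) (i : Fin 2) :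
    ∀ x ∈ towerSpan D E, ∀ y ∈ towerSpan D E,
      Tendsto (fun n => (inner ℂ x (U (D.h n) y) : ℂ)) (stepFilter κ (Sum.inl i))
        (𝓝 (inner ℂ x ((1 / 2 : ℂ) • y + (1 / 2 : ℂ) • U (-ξ i) y))) := by
  refine H.tendsto_inner_of_two_steps (stepFilter_le _ _) (hξ i) ?_ ?_
  · filter_upwards [eventually_stepFilter κ (Sum.inl i)] with n hn
    exact h.C_inl n hn.1 i hn.2
  · filter_upwards [eventually_stepFilter κ (Sum.inl i)] with n hn c hc
    rw [h.trivial_inl n hn.1 i hn.2 c hc, map_one, Circle.coe_one]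

lemma hasWeakLimit_inr (h : IsConstruction v ξ κ D a)
    (H : IsRankOne D w U (fun n c => (χ (a n c) : ℂ)) E) (p : periodicPoints v) {x : V}
    (hx : x ∈ towerSpan D E) :
    HasWeakLimit U x (stepFilter κ (Sum.inr p)) D.h (conj (orbitMean v χ p)) 0 0 :=
  fun t => h.tendsto_inner_inr H p _ (H.apply_mem_towerSpan hx t) x hx

lemma hasWeakLimit_inl (h : IsConstruction v ξ κ D a) (hξ : ∀ i, 0 < ξ i)
    (H : IsRankOne D w U (fun n c => (χ (a n c) : ℂ)) E) (i : Fin 2) {x : V}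
    (hx : x ∈ towerSpan D E) :
    HasWeakLimit U x (stepFilter κ (Sum.inl i)) D.h (1 / 2) (1 / 2) (ξ i) :=
  fun t => h.tendsto_inner_inl hξ H i _ (H.apply_mem_towerSpan hx t) x hx

/-- If `1` and the weak limit `(1 + e^{-iξs}) / 2` have the same modulus, then they agree. -/
lemma eq_one_of_tendsto_half {ι : Type*} {l : Filter ι} [l.NeBot] {u : ι → ℂ} (hu : ∀ i, ‖u i‖ = 1)
    {z : ℂ} (hz : ‖z‖ = 1) (hl : Tendsto u l (𝓝 (1 / 2 + 1 / 2 * z))) : z = 1 := by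
  have h1 : ‖(1 / 2 + 1 / 2 * z : ℂ)‖ = 1 :=
    tendsto_nhds_unique hl.norm (by simp only [hu]; exact tendsto_const_nhds)
  have h2 : ‖(1 : ℂ) + z‖ = ‖(1 : ℂ)‖ + ‖z‖ := by
    have e : (1 / 2 + 1 / 2 * z : ℂ) = (1 / 2 : ℂ) * (1 + z) := by ring
    rw [e, norm_mul] at h1
    rw [hz, norm_one]
    norm_num at h1
    linarith
  have h3 := (sameRay_iff_norm_add.2 h2)
  have h4 := (sameRay_iff_of_norm_eq (by rw [hz, norm_one])).1 h3
  exact h4.symm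

/-- At an atom the weak limits become numerical. Those along `W_0` and `W_1` have modulus one, which
forces `s = 0`; then `e^{i h_n s} = 1` for all `n`, so every `l_χ(p)` is `1` and `χ` is trivial on a
dense set. -/
lemma eq_zero_of_atom (h : IsConstruction v ξ κ D a) (hξ : ∀ i, 0 < ξ i)
    (hli : LinearIndependent ℚ ξ) (hκ : ∀ b, (κ ⁻¹' {b}).Infinite)
    (hdense : Dense (periodicPoints v))
    (H : IsRankOne D w U (fun n c => (χ (a n c) : ℂ)) E) {x : V} (hx : x ∈ towerSpan D E)
    {τ : Measure ℝ} (hτ : IsSpectralMeasure U x τ) {s : ℝ} (hs : τ {s} ≠ 0) : s = 0 ∧ χ = 1 := by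
  have := hτ.1
  have hs0 : s = 0 := by
    refine eq_zero_of_expi_eq_one hξ hli fun i => ?_
    have := stepFilter_neBot (hκ (Sum.inl i))
    exact eq_one_of_tendsto_half (fun n => norm_expi _ _) (norm_expi _ _)
      ((h.hasWeakLimit_inl hξ H i hx).tendsto_of_atom H.rep hτ hs)
  refine ⟨hs0, ?_⟩
  have hper : ∀ p ∈ periodicPoints v, χ p = 1 := by
    intro p hp
    have := stepFilter_neBot (hκ (Sum.inr ⟨p, hp⟩))
    have h1 := (h.hasWeakLimit_inr H ⟨p, hp⟩ hx).tendsto_of_atom H.rep hτ hs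
    simp only [hs0, expi_zero_right, zero_mul, add_zero] at h1
    refine norm_orbitMean_character hp ?_
    have h2 := tendsto_nhds_unique h1 tendsto_const_nhds
    rw [← Complex.conj_conj (orbitMean v χ p), h2, map_one]
  refine PontryaginDual.ext fun k => ?_
  exact congrFun (Continuous.ext_on hdense (map_continuous χ) continuous_const hper) k

lemma towerSpan_eq_cyclicSpan [CompleteSpace V] (h : IsConstruction v ξ κ D a) (hξ : ∀ i, 0 < ξ i)
    (hli : LinearIndependent ℚ ξ) (hκ : ∀ b, (κ ⁻¹' {b}).Infinite)
    (hdense : Dense (periodicPoints v))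
    (H : IsRankOne D w U (fun n c => (χ (a n c) : ℂ)) E) :
    towerSpan D E = cyclicSpan U (bottom E) := by
  refine H.towerSpan_eq_cyclicSpan fun x hx τ hτ s hs => ?_
  obtain ⟨h1, h2⟩ := h.eq_zero_of_atom hξ hli hκ hdense H hx hτ hs
  refine ⟨h1, fun n c _ => ?_⟩
  rw [h2]
  exact Circle.coe_one

end WeakLimits

/-! ### Spectral comparison of characters on the same orbit -/

section OrbitEquivalence

variable {w : ℕ → ℝ} {V V' : Type*} [NormedAddCommGroup V] [InnerProductSpace ℂ V]
  [NormedAddCommGroup V'] [InnerProductSpace ℂ V'] [CompleteSpace V']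
  {U : ℝ → V →ₗᵢ[ℂ] V} {U' : ℝ → V' →ₗᵢ[ℂ] V'}
  {χ : PontryaginDual K} {E : ℕ → (ℝ → ℂ) → V} {E' : ℕ → (ℝ → ℂ) → V'}

/-- Translations and errors are all `0` here. This compares the realizations of one and the same
character over different quotients of `K`. -/
lemma exists_inner_eq_of_same {β : ℕ → ℝ → ℂ} (H : IsRankOne D w U β E) (H' : IsRankOne D w U' β E') :
    ∃ y ∈ towerSpan D E', ∀ t, inner ℂ y (U' t y) = inner ℂ (bottom E) (U t (bottom E)) := by
  refine H.exists_inner_eq_of_shift H' (z := 0) (ε := 0) summable_zero (fun n => le_rfl) ?_ ?_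
  · intro n _ c _ _
    simp
  · intro n _
    simp only [Pi.zero_apply, add_zero, zero_mul]
    refine le_of_eq ?_
    rw [Nat.cast_eq_zero, Finset.card_eq_zero, Finset.filter_eq_empty_iff]
    exact fun c hc => not_not.2 hc

lemma summable_inv_sq : Summable fun n : ℕ => 1 / (n : ℝ) ^ 2 :=
  Real.summable_one_div_nat_pow.2 one_lt_two

/-- A translation by `m n` steps in a progression of `n³ m` terms pushes out the share `1/n²`, which
is summable. -/
lemma mul_le_inv_sq_mul {n : ℕ} (hn : 1 ≤ n) (m : ℕ) :
    ((m * n : ℕ) : ℝ) ≤ 1 / (n : ℝ) ^ 2 * ((n ^ 3 * m : ℕ) : ℝ) := by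
  have hn0 : (n : ℝ) ≠ 0 := by exact_mod_cast (by omega : n ≠ 0)
  push_cast
  refine le_of_eq ?_
  field_simp

/-- The translations are `z_{n+1}` at the steps given by periodic points and `0` at the others,
where the coefficients are trivial; equivariance reads `χ(α(c + z)) = (χ ∘ v)(α(c))`. -/
lemma exists_inner_eq_of_dualAut (h : IsConstruction v ξ κ D a)
    (H : IsRankOne D w U (fun n c => (dualAut v χ (a n c) : ℂ)) E)
    (H' : IsRankOne D w U' (fun n c => (χ (a n c) : ℂ)) E') :
    ∃ y ∈ towerSpan D E', ∀ t, inner ℂ y (U' t y) = inner ℂ (bottom E) (U t (bottom E)) := by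
  set z : ℕ → ℝ := fun k => Sum.elim (fun _ : Fin 2 => (0 : ℝ))
    (fun p : periodicPoints v => ((period v p * (k - 1) : ℕ) : ℝ) * D.h (k - 1)) (κ k) with hz
  have hzl : ∀ n i, κ (n + 1) = Sum.inl i → z (n + 1) = 0 := fun n i hk => by
    simp only [hz, hk, Sum.elim_inl]
  have hzr : ∀ n p, κ (n + 1) = Sum.inr p → z (n + 1) = ((period v p * n : ℕ) : ℝ) * D.h n :=
    fun n p hk => by simp only [hz, hk, Sum.elim_inr, Nat.add_sub_cancel]
  refine H.exists_inner_eq_of_shift H' (z := z) summable_inv_sq (fun n => by positivity) ?_ ?_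
  · intro n hn c hc hcz
    rcases hk : κ (n + 1) with i | p
    · rw [hzl n i hk, add_zero, h.trivial_inl n hn i hk c hc, map_one, map_one]
    · rw [hzr n p hk] at hcz ⊢
      rw [h.shift n hn p hk c hc hcz]
      rfl
  · intro n hn
    rcases hk : κ (n + 1) with i | p
    · rw [hzl n i hk, Finset.filter_false_of_mem fun c hc => not_not.2 (by rwa [add_zero]),
        Finset.card_empty, Nat.cast_zero]
      positivity
    · rw [hzr n p hk, h.card_inr hn hk]
      exact (Nat.cast_le.2 (card_filter_add_notMem_le (h.C_inr n hn p hk))).trans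
        (mul_le_inv_sq_mul hn _)

/-- The opposite translations exchange the roles of `χ` and `χ ∘ v`. -/
lemma exists_inner_eq_of_dualAut_symm (h : IsConstruction v ξ κ D a)
    (H : IsRankOne D w U (fun n c => (χ (a n c) : ℂ)) E)
    (H' : IsRankOne D w U' (fun n c => (dualAut v χ (a n c) : ℂ)) E') :
    ∃ y ∈ towerSpan D E', ∀ t, inner ℂ y (U' t y) = inner ℂ (bottom E) (U t (bottom E)) := by
  set z : ℕ → ℝ := fun k => Sum.elim (fun _ : Fin 2 => (0 : ℝ))
    (fun p : periodicPoints v => -(((period v p * (k - 1) : ℕ) : ℝ) * D.h (k - 1))) (κ k) with hz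
  have hzl : ∀ n i, κ (n + 1) = Sum.inl i → z (n + 1) = 0 := fun n i hk => by
    simp only [hz, hk, Sum.elim_inl]
  have hzr : ∀ n p, κ (n + 1) = Sum.inr p → z (n + 1) = -(((period v p * n : ℕ) : ℝ) * D.h n) :=
    fun n p hk => by simp only [hz, hk, Sum.elim_inr, Nat.add_sub_cancel]
  refine H.exists_inner_eq_of_shift H' (z := z) summable_inv_sq (fun n => by positivity) ?_ ?_
  · intro n hn c hc hcz
    rcases hk : κ (n + 1) with i | p
    · rw [hzl n i hk, add_zero, h.trivial_inl n hn i hk c hc, map_one, map_one]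
    · rw [hzr n p hk] at hcz ⊢
      have h1 := h.shift n hn p hk _ hcz (by rwa [neg_add_cancel_right])
      rw [neg_add_cancel_right] at h1
      rw [h1]
      rfl
  · intro n hn
    rcases hk : κ (n + 1) with i | p
    · rw [hzl n i hk, Finset.filter_false_of_mem fun c hc => not_not.2 (by rwa [add_zero]),
        Finset.card_empty, Nat.cast_zero]
      positivity
    · rw [hzr n p hk, h.card_inr hn hk]
      exact (Nat.cast_le.2 (card_filter_sub_notMem_le (h.C_inr n hn p hk))).trans
        (mul_le_inv_sq_mul hn _)

end OrbitEquivalence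

end IsConstruction

/-! ### Multiplicities of an orthogonal sum of cyclic spaces -/

/-- Countably many mutually singular measures are carried by disjoint sets. -/
lemma exists_disjoint_carriers {α Q : Type*} [MeasurableSpace α] [Countable Q] {ν : Q → Measure α}
    (h : ∀ q q', q ≠ q' → ν q ⟂ₘ ν q') :
    ∃ S : Q → Set α, (∀ q, MeasurableSet (S q)) ∧ (∀ q, ν q (S q)ᶜ = 0) ∧
      ∀ q q', q ≠ q' → Disjoint (S q) (S q') := by
  choose! A hA h1 h2 using h
  -- `B q` avoids the null sets attached to all `q' ≠ q`, so it carries `ν q` and is null for the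
  -- other measures; removing the other `B q'` makes the carriers disjoint without changing anything
  -- up to null sets.
  set B : Q → Set α := fun q => ⋂ q', ⋂ (_ : q ≠ q'), (A q q')ᶜ with hB
  have hBm : ∀ q, MeasurableSet (B q) := fun q =>
    MeasurableSet.iInter fun q' => MeasurableSet.iInter fun hq => (hA q q' hq).compl
  have hBfull : ∀ q, ν q (B q)ᶜ = 0 := by
    intro q
    simp only [hB, Set.compl_iInter, compl_compl]
    exact measure_iUnion_null fun q' => measure_iUnion_null fun hq => h1 q q' hq
  have hBnull : ∀ q q', q ≠ q' → ν q' (B q) = 0 := fun q q' hq =>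
    measure_mono_null (Set.iInter₂_subset q' hq) (h2 q q' hq)
  refine ⟨fun q => B q \ ⋃ q', ⋃ (_ : q ≠ q'), B q', fun q => (hBm q).diff
    (MeasurableSet.iUnion fun q' => MeasurableSet.iUnion fun _ => hBm q'), fun q => ?_, ?_⟩
  · change ν q (B q \ ⋃ q', ⋃ (_ : q ≠ q'), B q')ᶜ = 0
    rw [Set.sdiff_eq, Set.compl_inter, compl_compl]
    refine measure_union_null (hBfull q) ?_
    exact measure_iUnion_null fun q' => measure_iUnion_null fun hq => hBnull q' q hq.symm
  · intro q q' hq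
    rw [Set.disjoint_left]
    rintro s ⟨-, hs1⟩ ⟨hs2, -⟩
    exact hs1 (Set.mem_iUnion.2 ⟨q', Set.mem_iUnion.2 ⟨hq, hs2⟩⟩)

/-- The multiplicity set of an orthogonal sum of cyclic spaces whose spectral types are pairwise
either equivalent or mutually singular consists of the cardinalities of the equivalence classes. -/
theorem hasMultiplicitySet_of_family {V I : Type*} [NormedAddCommGroup V] [InnerProductSpace ℂ V]
    [Countable I] {U : ℝ → V →ₗᵢ[ℂ] V} {W : Submodule ℂ V} {w : I → V} {r : Setoid I}
    {ρ : I → Measure ℝ} (horth : ∀ χ η, χ ≠ η → ∀ t, inner ℂ (w χ) (U t (w η)) = 0)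
    (hspan : (Submodule.span ℂ (Set.range fun p : I × ℝ => U p.2 (w p.1))).topologicalClosure = W)
    (hρ : ∀ χ, IsSpectralMeasure U (w χ) (ρ χ)) (hne : ∀ χ, ρ χ ≠ 0)
    (hequiv : ∀ χ η, r χ η → ρ χ ≪ ρ η) (hsing : ∀ χ η, ¬ r χ η → ρ χ ⟂ₘ ρ η) :
    HasMultiplicitySet U W {n | ∃ χ, n = {η | r χ η}.encard} := by
  classical
  have hfin : ∀ χ, IsFiniteMeasure (ρ χ) := fun χ => (hρ χ).1
  set cls : I → Quotient r := Quotient.mk r with hcls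
  have hclsr : ∀ χ η, cls χ = cls η ↔ r χ η := fun χ η => Quotient.eq
  have hout : ∀ χ, r χ (cls χ).out := fun χ => r.symm' (Quotient.mk_out (s := r) χ)
  set ν : Quotient r → Measure ℝ := fun q => ρ q.out with hν
  obtain ⟨S, hSm, hSfull, hSdisj⟩ := exists_disjoint_carriers (ν := ν) fun q q' hq =>
    hsing _ _ fun h => hq (by rw [← Quotient.out_eq q, ← Quotient.out_eq q']; exact Quotient.sound h)
  have hSnull : ∀ q q', q ≠ q' → ν q' (S q) = 0 := fun q q' hq =>
    measure_mono_null (Set.disjoint_left.1 (hSdisj q q' hq)) (hSfull q')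
  have hνfin : ∀ q, IsFiniteMeasure (ν q) := fun q => hfin _
  -- One representative of each class is summed; the sum may be infinite, so `toFinite` provides an
  -- equivalent finite measure.
  set σ₀ := Measure.sum ν with hσ₀
  have hσ : ∀ A : Set ℝ, σ₀.toFinite A = 0 ↔ ∀ q, ν q A = 0 := by
    intro A
    rw [← Measure.sum_apply_eq_zero]
    exact ⟨fun h => absolutelyContinuous_toFinite σ₀ h, fun h => toFinite_absolutelyContinuous σ₀ h⟩
  have hU0 : σ₀.toFinite (⋃ q, S q)ᶜ = 0 := (hσ _).2 fun q =>
    measure_mono_null (Set.compl_subset_compl.2 (Set.subset_iUnion S q)) (hSfull q)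
  -- The family is reindexed by `ℕ`; unused indices get the zero vector and the empty set.
  obtain ⟨e, he⟩ := Countable.exists_injective_nat I
  set wN : ℕ → V := Function.extend e w 0 with hwN
  set SN : ℕ → Set ℝ := Function.extend e (fun χ => S (cls χ)) (fun _ => ∅) with hSN
  have hwe : ∀ χ, wN (e χ) = w χ := fun χ => he.extend_apply _ _ _
  have hSe : ∀ χ, SN (e χ) = S (cls χ) := fun χ => he.extend_apply _ _ _
  have hw0 : ∀ k, (∀ χ, e χ ≠ k) → wN k = 0 := fun k hk =>
    Function.extend_apply' _ _ _ fun ⟨χ, hχ⟩ => hk χ hχ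
  have hS0 : ∀ k, (∀ χ, e χ ≠ k) → SN k = ∅ := fun k hk =>
    Function.extend_apply' _ _ _ fun ⟨χ, hχ⟩ => hk χ hχ
  have hl : ∀ χ, ∀ s ∈ S (cls χ), {k | s ∈ SN k}.encard = {η | r χ η}.encard := by
    intro χ s hs
    have : {k | s ∈ SN k} = e '' {η | r χ η} := by
      ext k
      constructor
      · intro hk
        by_cases hex : ∃ η, e η = k
        · obtain ⟨η, rfl⟩ := hex
          refine ⟨η, ?_, rfl⟩
          rw [Set.mem_ofPred_eq, hSe] at hk
          rw [Set.mem_ofPred_eq, ← hclsr]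
          by_contra hne
          exact Set.disjoint_left.1 (hSdisj _ _ hne) hs hk
        · push Not at hex
          rw [Set.mem_ofPred_eq, hS0 k hex] at hk
          exact absurd hk (Set.notMem_empty s)
      · rintro ⟨η, hη, rfl⟩
        rw [Set.mem_ofPred_eq, hSe, ← (hclsr χ η).2 hη]
        exact hs
    rw [this, he.encard_image]
  have hmem : ∀ s ∈ ⋃ q, S q, ∃ χ, s ∈ S (cls χ) := by
    intro s hs
    obtain ⟨q, hq⟩ := Set.mem_iUnion.1 hs
    refine ⟨q.out, ?_⟩
    rwa [hcls, Quotient.out_eq]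
  refine ⟨σ₀.toFinite, fun s => {k | s ∈ SN k}.encard, ⟨inferInstance, wN, SN, ?_, ?_, ?_, ?_⟩, ?_⟩
  · intro j k hjk t
    by_cases hj : ∃ χ, e χ = j
    · by_cases hk : ∃ χ, e χ = k
      · obtain ⟨χ, rfl⟩ := hj
        obtain ⟨η, rfl⟩ := hk
        rw [hwe, hwe]
        exact horth _ _ (fun h => hjk (congrArg e h)) t
      · push Not at hk
        rw [hw0 k hk, map_zero, inner_zero_right]
    · push Not at hj
      rw [hw0 j hj, inner_zero_left]
  · rw [← hspan]
    congr 1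
    refine le_antisymm (Submodule.span_le.2 ?_) (Submodule.span_le.2 ?_)
    · rintro _ ⟨⟨k, t⟩, rfl⟩
      by_cases hk : ∃ χ, e χ = k
      · obtain ⟨χ, rfl⟩ := hk
        refine Submodule.subset_span ⟨(χ, t), ?_⟩
        simp only [hwe]
      · push Not at hk
        simp only [hw0 k hk, map_zero]
        exact zero_mem _
    · rintro _ ⟨⟨χ, t⟩, rfl⟩
      refine Submodule.subset_span ⟨(e χ, t), ?_⟩
      simp only [hwe]
  · intro k
    by_cases hk : ∃ χ, e χ = k
    · obtain ⟨χ, rfl⟩ := hk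
      rw [hwe, hSe]
      refine ⟨hSm _, ρ χ, hρ χ, (hequiv _ _ (hout χ)).trans ?_,
        Measure.AbsolutelyContinuous.trans ?_ (hequiv _ _ (r.symm' (hout χ)))⟩
      · refine Measure.AbsolutelyContinuous.mk fun N hN h0 => ?_
        rw [Measure.restrict_apply hN] at h0
        have h1 : ν (cls χ) (N ∩ S (cls χ)) = 0 := (hσ _).1 h0 _
        refine measure_mono_null (fun s hs => ?_) (measure_union_null h1 (hSfull (cls χ)))
        by_cases hsS : s ∈ S (cls χ)
        · exact Or.inl ⟨hs, hsS⟩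
        · exact Or.inr hsS
      · refine Measure.AbsolutelyContinuous.mk fun N hN h0 => ?_
        rw [Measure.restrict_apply hN, hσ]
        intro q
        by_cases hq : cls χ = q
        · rw [← hq]
          exact measure_mono_null Set.inter_subset_left h0
        · exact measure_mono_null Set.inter_subset_right (hSnull _ _ hq)
    · push Not at hk
      rw [hw0 k hk, hS0 k hk]
      refine ⟨MeasurableSet.empty, 0, ⟨inferInstance, fun t => by simp⟩, ?_, ?_⟩
      · exact Measure.AbsolutelyContinuous.zero _
      · rw [Measure.restrict_empty]
  · rw [ae_iff]
    refine measure_mono_null (fun s hs => ?_) hU0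
    intro hsU
    obtain ⟨χ, hχ⟩ := hmem s hsU
    refine hs ⟨rfl, ?_⟩
    simp only [hl χ s hχ]
    exact (Set.encard_pos.2 ⟨χ, r.refl' χ⟩).ne'
  · ext n
    simp only [Set.mem_ofPred_eq]
    constructor
    · rintro ⟨χ, rfl⟩ h0
      have h1 : σ₀.toFinite (S (cls χ)) = 0 := measure_mono_null (fun s hs => hl χ s hs) h0
      have h2 : ν (cls χ) = 0 := by
        rw [← Measure.measure_univ_eq_zero, ← Set.union_compl_self (S (cls χ))]
        exact measure_union_null ((hσ _).1 h1 _) (hSfull _)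
      exact hne _ h2
    · intro h
      by_contra hn
      push Not at hn
      refine h (measure_mono_null (t := (⋃ q, S q)ᶜ) (fun s hs hsU => ?_) hU0)
      obtain ⟨χ, hχ⟩ := hmem s hsU
      exact hn χ (hs.symm.trans (hl χ s hχ))

/-- The dual of a compact group is discrete, and it is second countable as a space of continuous
maps on `K`. -/
lemma countable_pontryaginDual (K : Type*) [CommGroup K] [TopologicalSpace K]
    [CompactSpace K] [PolishSpace K] [IsTopologicalGroup K] : Countable (PontryaginDual K) := by
  have h1 : SecondCountableTopology (K →ₜ* Circle) :=
    (ContinuousMonoidHom.isEmbedding_toContinuousMap K Circle).secondCountableTopology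
  have h2 : SecondCountableTopology (PontryaginDual K) := h1
  exact TopologicalSpace.separableSpace_iff_countable.1 inferInstance

/-! ### Constants and eigenvectors -/

section Eigenvectors

variable {V : Type*} [NormedAddCommGroup V] [InnerProductSpace ℂ V] {U : ℝ → V →ₗᵢ[ℂ] V}

lemma isSpectralMeasure_of_eigenvector {f : V} {s : ℝ} (hf : ∀ t, U t f = expi t s • f) :
    IsSpectralMeasure U f (ENNReal.ofReal (‖f‖ ^ 2) • Measure.dirac s) := by
  refine ⟨Measure.smul_finite _ ENNReal.ofReal_ne_top, fun t => ?_⟩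
  rw [integral_smul_measure, integral_dirac, ENNReal.toReal_ofReal (by positivity), hf,
    inner_smul_right, inner_self_eq_norm_sq_to_K, expi]
  simp only [Complex.real_smul, Complex.ofReal_pow, Complex.coe_algebraMap]
  ring

/-- The projection of an eigenvector to a closed invariant subspace is an eigenvector. -/
lemma starProjection_eigenvector [CompleteSpace V] (hU : IsUnitaryRep U) {Z : Submodule ℂ V}
    [Z.HasOrthogonalProjection] (hZ : ∀ t, ∀ x ∈ Z, U t x ∈ Z) {f : V} {s : ℝ}
    (hf : ∀ t, U t f = expi t s • f) (t : ℝ) :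
    U t (Z.starProjection f) = expi t s • Z.starProjection f := by
  rw [← map_smul, ← hf t]
  symm
  refine Submodule.eq_starProjection_of_mem_of_inner_eq_zero
    (hZ t _ (Submodule.starProjection_apply_mem Z f)) fun z hz => ?_
  rw [← map_sub, hU.inner_left]
  exact Submodule.starProjection_inner_eq_zero _ _ (hZ _ z hz)

/-- The space of invariant vectors of a cyclic representation is at most one-dimensional. -/
lemma eq_zero_of_invariant {w f e : V} (hf : f ∈ cyclicSpan U w)
    (he : e ∈ cyclicSpan U w) (hfi : ∀ t, U t f = f) (hei : ∀ t, U t e = e) (he0 : e ≠ 0)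
    (hfe : inner ℂ e f = 0) : f = 0 := by
  have hzero : ∀ g ∈ cyclicSpan U w, (∀ t, U t g = g) → inner ℂ g w = 0 → g = 0 := by
    intro g hg hgi hgw
    have h1 : cyclicSpan U w ≤ (ℂ ∙ g)ᗮ := by
      refine Submodule.topologicalClosure_minimal _ ?_ (Submodule.isClosed_orthogonal _)
      rw [Submodule.span_le]
      rintro _ ⟨t, rfl⟩
      rw [SetLike.mem_coe, Submodule.mem_orthogonal_singleton_iff_inner_right, ← hgi t,
        LinearIsometry.inner_map_map, hgw]
    have h2 := Submodule.mem_orthogonal_singleton_iff_inner_right.1 (h1 hg)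
    exact inner_self_eq_zero.1 h2
  have hew : inner ℂ e w ≠ 0 := fun h => he0 (hzero e he hei h)
  set c : ℂ := conj (inner ℂ f w / inner ℂ e w) with hc
  have h1 : f - c • e = 0 := by
    refine hzero _ (Submodule.sub_mem _ hf (Submodule.smul_mem _ _ he)) (fun t => ?_) ?_
    · rw [map_sub, map_smul, hfi, hei]
    · rw [inner_sub_left, inner_smul_left, hc, Complex.conj_conj, div_mul_cancel₀ _ hew, sub_self]
  have h2 : f = c • e := sub_eq_zero.1 h1
  rw [h2, inner_smul_right, mul_eq_zero] at hfe
  rw [h2, hfe.resolve_right (inner_self_ne_zero.2 he0), zero_smul]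

end Eigenvectors

namespace CFData

variable {D : CFData} {K : Type*} [CommGroup K] [TopologicalSpace K] [IsTopologicalGroup K]
  [CompactSpace K] [PolishSpace K] [MeasurableSpace K] [BorelSpace K] {H : Subgroup K}

lemma _root_.SpectralMult.isClosed_towerSpan {V : Type*} [NormedAddCommGroup V] [InnerProductSpace ℂ V]
    (D : CFData) (E : ℕ → (ℝ → ℂ) → V) : IsClosed (towerSpan D E : Set V) :=
  Submodule.isClosed_topologicalClosure _

lemma IsFinite.towerSpan_le_orthogonal (hD : D.IsFinite) (hH : IsClosed (H : Set K)) (a : ℕ → ℝ → K)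
    {χ η : dualQuotient H} (h : χ ≠ η) :
    towerSpan D (D.towerMap a χ) ≤ (towerSpan D (D.towerMap a η))ᗮ := by
  refine Submodule.topologicalClosure_minimal _ ?_ (Submodule.isClosed_orthogonal _)
  rw [Submodule.span_le]
  rintro _ ⟨n, b, b', hb, hbb', hb', rfl⟩
  rw [SetLike.mem_coe, towerSpan, Submodule.orthogonal_closure, Submodule.mem_orthogonal]
  intro u hu
  induction hu using Submodule.span_induction with
  | mem u hu =>
    obtain ⟨m, d, d', hd, hdd', hd', rfl⟩ := hu
    exact hD.inner_towerMap_of_ne hH a h.symm (boxInd_mem_boxFun_of_le hd hd')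
      (boxInd_mem_boxFun_of_le hb hb')
  | zero => exact inner_zero_left _
  | add x y _ _ hx hy => rw [inner_add_left, hx, hy, add_zero]
  | smul c x _ hx => rw [inner_smul_left, hx, mul_zero]

lemma IsFinite.towerMap_mem (hD : D.IsFinite) (hH : IsClosed (H : Set K)) (a : ℕ → ℝ → K)
    (χ : dualQuotient H) (n : ℕ) {g : ℝ → ℂ} (hg : g ∈ boxFun 0 (D.h n)) :
    D.towerMap a χ n g ∈ towerSpan D (D.towerMap a χ) :=
  (hD.isRankOne hH a χ).map_mem_towerSpan n hg

/-- The constants belong to the space of the trivial character. -/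
lemma IsFinite.const_mem_towerSpan (hD : D.IsFinite) (hH : IsClosed (H : Set K)) (a : ℕ → ℝ → K)
    [IsFiniteMeasure (D.measure.prod (haarQuotient H))] :
    Lp.const 2 (D.measure.prod (haarQuotient H)) (1 : ℂ)
      ∈ towerSpan D (D.towerMap a (1 : dualQuotient H)) := by
  have := hD.isProbabilityMeasure
  have := isProbabilityMeasure_haarQuotient H
  have HR := hD.isRankOne hH a (1 : dualQuotient H)
  set e := Lp.const 2 (D.measure.prod (haarQuotient H)) (1 : ℂ) with he
  -- These vectors are the indicator functions of `X_n × K / H`, of squared norm `w_n h_n → 1`.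
  set x : ℕ → Lp ℂ 2 (D.measure.prod (haarQuotient H)) := fun n =>
    D.towerMap a (1 : dualQuotient H) n (boxInd 0 (D.h n)) with hx
  have hbox : ∀ n, boxInd 0 (D.h n) ∈ boxFun 0 (D.h n) := fun n =>
    boxInd_mem_boxFun_of_le le_rfl le_rfl
  have hself : ∀ n, inner ℂ (x n) (x n) = ((D.weight n * D.h n : ℝ) : ℂ) := by
    intro n
    rw [hx, HR.inner_map n _ (hbox n) _ (hbox n), boxInner]
    have e1 : (fun s => conj (boxInd 0 (D.h n) s) * boxInd 0 (D.h n) s)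
        = (Set.Ico 0 (D.h n)).indicator fun _ => (1 : ℂ) := by
      ext s
      by_cases hs : s ∈ Set.Ico 0 (D.h n)
      · simp [boxInd, Set.indicator_of_mem hs]
      · simp [boxInd, Set.indicator_of_notMem hs]
    rw [e1, integral_indicator measurableSet_Ico, setIntegral_const, measureReal_def,
      Real.volume_Ico, sub_zero, ENNReal.toReal_ofReal (D.h_pos n).le, Complex.real_smul, mul_one]
    push_cast
    rfl
  have hcross : ∀ n, inner ℂ e (x n) = inner ℂ (x n) (x n) := by
    intro n
    have h1 := hD.coeFn_towerMap hH a (1 : dualQuotient H) n (hbox n)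
    rw [L2.inner_def, L2.inner_def]
    refine integral_congr_ae ?_
    filter_upwards [h1, Lp.coeFn_const 2 (D.measure.prod (haarQuotient H)) (1 : ℂ)] with p h2 h3
    rw [he, h3, hx]
    simp only [RCLike.inner_apply, h2, towerFun, Function.const_apply, map_one, mul_one]
    obtain ⟨k, hk⟩ := QuotientGroup.mk_surjective p.2
    rw [← hk, quotChar_mk]
    have e2 : ∀ k : K, ((1 : dualQuotient H) : PontryaginDual K) k = 1 := fun k => rfl
    simp only [e2, Circle.coe_one, map_one, mul_one]
    by_cases hs : pos n p.1 ∈ Set.Ico 0 (D.h n)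
    · simp [boxInd, Set.indicator_of_mem hs]
    · simp [boxInd, Set.indicator_of_notMem hs]
  have hee : inner ℂ e e = 1 := by
    rw [L2.inner_def]
    have : ∀ᵐ p ∂(D.measure.prod (haarQuotient H)), inner ℂ (e p) (e p) = (1 : ℂ) := by
      filter_upwards [Lp.coeFn_const 2 (D.measure.prod (haarQuotient H)) (1 : ℂ)] with p h3
      rw [he, h3]
      simp
    rw [integral_congr_ae this]
    simp
  have hdist : ∀ n, ‖x n - e‖ ^ 2 = 1 - D.weight n * D.h n := by
    intro n
    have h1 : ((‖x n - e‖ ^ 2 : ℝ) : ℂ) = inner ℂ (x n - e) (x n - e) := by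
      rw [inner_self_eq_norm_sq_to_K]
      push_cast
      rfl
    have h2 : inner ℂ (x n) e = inner ℂ (x n) (x n) := by
      rw [← inner_conj_symm, hcross, inner_conj_symm]
    rw [inner_sub_left, inner_sub_right, inner_sub_right, h2, hcross, hself, hee] at h1
    have h3 : ((‖x n - e‖ ^ 2 : ℝ) : ℂ) = ((1 - D.weight n * D.h n : ℝ) : ℂ) := by
      rw [h1]
      push_cast
      ring
    exact_mod_cast h3
  have hlim : Tendsto x atTop (𝓝 e) := by
    rw [tendsto_iff_norm_sub_tendsto_zero]
    have h1 : Tendsto (fun n => ‖x n - e‖ ^ 2) atTop (𝓝 0) := by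
      simp only [hdist]
      have := HR.weight.tendsto.const_sub 1
      rwa [sub_self] at this
    have h2 := (Real.continuous_sqrt.tendsto 0).comp h1
    rw [Real.sqrt_zero] at h2
    refine h2.congr fun n => ?_
    rw [Function.comp_apply, Real.sqrt_sq (norm_nonneg _)]
  exact (isClosed_towerSpan D _).mem_of_tendsto hlim
    (Eventually.of_forall fun n => hD.towerMap_mem hH a _ n (hbox n))

end CFData

lemma koopman_const {Y : Type*} [MeasurableSpace Y] {T : ℝ → Y → Y} {ν : Measure Y}
    [IsFiniteMeasure ν] (hT : IsFlow T ν) (t : ℝ) (c : ℂ) :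
    koopman hT t (Lp.const 2 ν c) = Lp.const 2 ν c := by
  refine Lp.ext ((coeFn_koopman hT t _).trans ?_)
  filter_upwards [(hT.measurePreserving (-t)).quasiMeasurePreserving.ae_eq_comp
    (Lp.coeFn_const 2 ν c), Lp.coeFn_const 2 ν c] with y h1 h2
  rw [h2]
  exact h1

lemma const_ne_zero {Y : Type*} [MeasurableSpace Y] {ν : Measure Y} [IsProbabilityMeasure ν] :
    Lp.const 2 ν (1 : ℂ) ≠ 0 := by
  intro h
  have h1 := Lp.coeFn_const 2 ν (1 : ℂ)
  rw [h] at h1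
  obtain ⟨y, h2, h3⟩ := (h1.and (Lp.coeFn_zero ℂ 2 ν)).exists
  rw [h3] at h2
  exact zero_ne_one h2

lemma mem_L2zero {Y : Type*} [MeasurableSpace Y] {ν : Measure Y} [IsFiniteMeasure ν]
    {f : Lp ℂ 2 ν} : f ∈ L2zero ν ↔ inner ℂ (Lp.const 2 ν (1 : ℂ)) f = 0 :=
  Submodule.mem_orthogonal_singleton_iff_inner_right

/-! ### Weak mixing -/

namespace IsConstruction

variable {K : Type*} [CommGroup K] [TopologicalSpace K] [IsTopologicalGroup K] [CompactSpace K]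
  [PolishSpace K] [MeasurableSpace K] [BorelSpace K]
  {v : K ≃ₜ* K} {ξ : Fin 2 → ℝ} {κ : ℕ → Fin 2 ⊕ periodicPoints v} {D : CFData} {a : ℕ → ℝ → K}
  {H : Subgroup K}

/-- Each component of an eigenvector with eigenvalue `s` is an eigenvector, so its spectral measure
is an atom at `s` unless it vanishes. By `eq_zero_of_atom` only `s = 0` and the trivial character
remain. There the representation is cyclic and contains the constants, to which the component is
orthogonal, so `eq_zero_of_invariant` applies. -/
theorem weaklyMixing (h : IsConstruction v ξ κ D a) (hξ : ∀ i, 0 < ξ i)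
    (hli : LinearIndependent ℚ ξ) (hκ : ∀ b, (κ ⁻¹' {b}).Infinite)
    (hdense : Dense (periodicPoints v)) (hH : IsClosed (H : Set K))
    [IsProbabilityMeasure (D.measure.prod (haarQuotient H))] :
    WeaklyMixing ((h.isFinite hξ).isFlow_extension hH a) := by
  intro s f hf0 hf
  have hD := h.isFinite hξ
  have hf' : ∀ t, koopman (hD.isFlow_extension hH a) t f = expi t s • f := hf
  have (χ : dualQuotient H) : (towerSpan D (D.towerMap a χ)).HasOrthogonalProjection := by
    have := (isClosed_towerSpan D (D.towerMap a χ)).completeSpace_coe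
    infer_instance
  have hproj : ∀ χ : dualQuotient H,
      (towerSpan D (D.towerMap a χ)).starProjection f = 0 := by
    intro χ
    have HR := hD.isRankOne hH a χ
    have hmem := Submodule.starProjection_apply_mem (towerSpan D (D.towerMap a χ)) f
    have heig := starProjection_eigenvector HR.rep
      (fun t x hx => HR.apply_mem_towerSpan hx t) hf'
    by_contra hne
    obtain ⟨hs0, hχ⟩ := h.eq_zero_of_atom hξ hli hκ hdense HR hmem
      (isSpectralMeasure_of_eigenvector heig) (s := s) (by
        simp only [Measure.smul_apply, Measure.dirac_apply_of_mem (Set.mem_singleton s),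
          smul_eq_mul, mul_one]
        have := norm_pos_iff.2 hne
        exact (ENNReal.ofReal_pos.2 (by positivity)).ne')
    have hχ1 : χ = 1 := Subtype.ext hχ
    subst hχ1
    have hcyc := h.towerSpan_eq_cyclicSpan hξ hli hκ hdense HR
    have hcm := hD.const_mem_towerSpan hH a
    refine hne (eq_zero_of_invariant (hcyc ▸ hmem) (hcyc ▸ hcm) (fun t => ?_)
      (fun t => koopman_const _ t 1) const_ne_zero ?_)
    · rw [heig, hs0, expi_zero_right, one_smul]
    · rw [← mem_L2zero.1 hf0, eq_comm, ← sub_eq_zero, ← inner_sub_right, ← inner_conj_symm,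
        Submodule.starProjection_inner_eq_zero _ _ hcm, map_zero]
  refine hD.eq_zero_of_forall_inner_towerMap hH a fun χ n g hg => ?_
  have h1 := Submodule.starProjection_inner_eq_zero (K := towerSpan D (D.towerMap a χ)) f _
    (hD.towerMap_mem hH a χ n hg)
  rwa [hproj χ, sub_zero] at h1

end IsConstruction

/-! ### The spectral multiplicities -/

lemma IsRankOne.map_boxInd_ne_zero {D : CFData} {w : ℕ → ℝ} {V : Type*} [NormedAddCommGroup V]
    [InnerProductSpace ℂ V] {U : ℝ → V →ₗᵢ[ℂ] V} {β : ℕ → ℝ → ℂ} {E : ℕ → (ℝ → ℂ) → V}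
    (H : IsRankOne D w U β E) (n : ℕ) {b b' : ℝ} (hb : 0 ≤ b) (hbb' : b < b') (hb' : b' ≤ D.h n) :
    E n (boxInd b b') ≠ 0 := by
  intro h0
  have h1 := H.norm_sq_map n (boxInd_mem_boxFun_of_le hb hb')
  have h2 : ∫ s, ‖boxInd b b' s‖ ^ 2 = b' - b := by
    have : ∀ s, ‖boxInd b b' s‖ ^ 2 = (Set.Ico b b').indicator (fun _ => (1 : ℝ)) s := by
      intro s
      unfold boxInd
      simp only [Set.indicator]
      split_ifs <;> simp
    simp_rw [this]
    rw [integral_indicator measurableSet_Ico, setIntegral_const, measureReal_def,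
      Real.volume_Ico, ENNReal.toReal_ofReal (by linarith)]
    simp
  rw [h0, h2, norm_zero] at h1
  have := mul_pos (H.weight.pos n) (sub_pos.2 hbb')
  norm_num at h1
  exact h1.elim (H.weight.pos n).ne' (sub_pos.2 hbb').ne'

/-- The cyclic space of a rank one representation has more than one dimension. -/
lemma IsRankOne.towerSpan_not_le_span_singleton {D : CFData} {w : ℕ → ℝ} {V : Type*}
    [NormedAddCommGroup V] [InnerProductSpace ℂ V] {U : ℝ → V →ₗᵢ[ℂ] V} {β : ℕ → ℝ → ℂ}
    {E : ℕ → (ℝ → ℂ) → V} (H : IsRankOne D w U β E) (e : V) : ¬ towerSpan D E ≤ ℂ ∙ e := by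
  intro hle
  have h1 : (1 : ℝ) ≤ D.h 0 := D.one_le_h 0
  obtain ⟨c, hc⟩ := Submodule.mem_span_singleton.1
    (hle (mem_towerSpan (D := D) (E := E) 0 (le_refl 0) (b := 1 / 2) (by norm_num) (by linarith)))
  obtain ⟨c', hc'⟩ := Submodule.mem_span_singleton.1
    (hle (mem_towerSpan (D := D) (E := E) 0 (a := 1 / 2) (b := 1) (by norm_num) (by norm_num) h1))
  have hx := H.map_boxInd_ne_zero 0 (le_refl 0) (b' := 1 / 2) (by norm_num) (by linarith)
  have hx' := H.map_boxInd_ne_zero 0 (b := 1 / 2) (b' := 1) (by norm_num) (by norm_num) h1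
  have hin := H.inner_map 0 (boxInd 0 (1 / 2)) (boxInd_mem_boxFun_of_le le_rfl (by linarith))
    (boxInd (1 / 2) 1) (boxInd_mem_boxFun_of_le (by norm_num) h1)
  have h0 : boxInner (boxInd 0 (1 / 2)) (boxInd (1 / 2) 1) = 0 := by
    have : ∀ s, conj (boxInd 0 (1 / 2) s) * boxInd (1 / 2) 1 s = 0 := by
      intro s
      unfold boxInd
      rcases lt_or_ge s (1 / 2) with hs | hs
      · rw [Set.indicator_of_notMem (s := Set.Ico (1 / 2 : ℝ) 1) (fun h => by linarith [h.1]),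
          mul_zero]
      · rw [Set.indicator_of_notMem (s := Set.Ico 0 (1 / 2 : ℝ)) (fun h => by linarith [h.2]),
          _root_.map_zero, zero_mul]
    simp only [boxInner, this, integral_zero]
  rw [h0, mul_zero, ← hc, ← hc', inner_smul_left, inner_smul_right] at hin
  rcases mul_eq_zero.1 hin with h | h
  · rw [(map_eq_zero (starRingEnd ℂ)).1 h, zero_smul] at hc
    exact hx hc.symm
  · rcases mul_eq_zero.1 h with h | h
    · rw [h, zero_smul] at hc'
      exact hx' hc'.symm
    · rw [inner_self_eq_zero.1 h, smul_zero] at hc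
      exact hx hc.symm

/-- The orbits of the dual automorphism on the dual of `K / H`. -/
def orbitSetoid {K : Type*} [CommGroup K] [TopologicalSpace K] [IsTopologicalGroup K]
    (v : K ≃ₜ* K) (H : Subgroup K) : Setoid (dualQuotient H) where
  r χ η := ∃ i : ℤ, (dualAut v ^ i) χ = (η : PontryaginDual K)
  iseqv :=
    { refl := fun χ => ⟨0, rfl⟩
      symm := by
        rintro χ η ⟨i, hi⟩
        exact ⟨-i, by rw [← hi, ← MulAut.mul_apply, ← zpow_add, neg_add_cancel]; rfl⟩
      trans := by
        rintro χ η θ ⟨i, hi⟩ ⟨j, hj⟩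
        exact ⟨j + i, by rw [zpow_add, MulAut.mul_apply, hi, hj]⟩ }

lemma encard_orbitSetoid {K : Type*} [CommGroup K] [TopologicalSpace K] [IsTopologicalGroup K]
    (v : K ≃ₜ* K) (H : Subgroup K) (χ : dualQuotient H) :
    {η | orbitSetoid v H χ η}.encard
      = (Set.range (fun i : ℤ => (dualAut v ^ i) χ) ∩ (dualQuotient H : Set _)).encard := by
  rw [← Subtype.val_injective.encard_image]
  congr 1
  ext η
  constructor
  · rintro ⟨η, ⟨i, hi⟩, rfl⟩
    exact ⟨⟨i, hi⟩, η.2⟩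
  · rintro ⟨⟨i, hi⟩, hη⟩
    exact ⟨⟨η, hη⟩, ⟨i, hi⟩, rfl⟩

/-- The trivial character is its own orbit and is the one excluded from `orbitCounts`; it accounts
for the additional value `1`. -/
lemma IsTriple.setOf_encard {K : Type*} [CommGroup K] [TopologicalSpace K] [IsTopologicalGroup K]
    {E : Set ℕ} {v : K ≃ₜ* K} {H : Subgroup K} (ht : IsTriple E H v) :
    {n | ∃ χ, n = {η | orbitSetoid v H χ η}.encard} = (fun n : ℕ => (n : ℕ∞)) '' (E ∪ {1}) := by
  have h1 : {η | orbitSetoid v H 1 η}.encard = 1 := by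
    rw [encard_orbitSetoid, Set.encard_eq_one]
    refine ⟨1, Set.eq_singleton_iff_unique_mem.2 ⟨⟨⟨0, rfl⟩, one_mem _⟩, ?_⟩⟩
    rintro _ ⟨⟨i, rfl⟩, -⟩
    exact map_one _
  rw [Set.image_union, Set.image_singleton, Nat.cast_one, ← ht.counts]
  ext n
  constructor
  · rintro ⟨χ, rfl⟩
    by_cases hχ : χ = 1
    · right
      rw [hχ, h1]
      rfl
    · left
      exact ⟨χ, χ.2, fun h => hχ (Subtype.ext h), encard_orbitSetoid v H χ⟩
  · rintro (⟨χ, hχ, -, rfl⟩ | rfl)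
    · exact ⟨⟨χ, hχ⟩, (encard_orbitSetoid v H ⟨χ, hχ⟩).symm⟩
    · exact ⟨1, h1.symm⟩

/-! ### The multiplicity set of the extension -/

namespace IsConstruction

variable {K : Type*} [CommGroup K] [TopologicalSpace K] [IsTopologicalGroup K] [CompactSpace K]
  [PolishSpace K] [MeasurableSpace K] [BorelSpace K]
  {v : K ≃ₜ* K} {ξ : Fin 2 → ℝ} {κ : ℕ → Fin 2 ⊕ periodicPoints v} {D : CFData} {a : ℕ → ℝ → K}

/-- Characters of `K` on the same orbit give rise to the same spectral type. -/
lemma exists_spectralTypes (h : IsConstruction v ξ κ D a) (hξ : ∀ i, 0 < ξ i)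
    (hli : LinearIndependent ℚ ξ) (hκ : ∀ b, (κ ⁻¹' {b}).Infinite)
    (hdense : Dense (periodicPoints v)) :
    ∃ τ : PontryaginDual K → Measure ℝ,
      (∀ χ (i : ℤ), τ ((dualAut v ^ i) χ) ≪ τ χ) ∧
      ∀ (H : Subgroup K) (hH : IsClosed (H : Set K)) (χ : dualQuotient H) (ρ : Measure ℝ),
        IsSpectralMeasure (koopman ((h.isFinite hξ).isFlow_extension hH a))
          (bottom (D.towerMap a χ)) ρ → ρ ≪ τ χ ∧ τ χ ≪ ρ := by
  have hD := h.isFinite hξ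
  -- Two characters of `K / H` on one orbit may be joined only through characters that are not
  -- trivial on `H`. So spectral types are attached to all characters of `K`, realized over the full
  -- extension by `K = K / ⊥`, and compared with those over `H` at the end.
  have hbot : IsClosed ((⊥ : Subgroup K) : Set K) := by
    rw [Subgroup.coe_bot]
    exact isClosed_singleton
  have hmem : ∀ χ : PontryaginDual K, χ ∈ dualQuotient (⊥ : Subgroup K) := fun χ k hk => by
    rw [Subgroup.mem_bot.1 hk, map_one]
  set ι : PontryaginDual K → dualQuotient (⊥ : Subgroup K) := fun χ => ⟨χ, hmem χ⟩ with hι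
  have HR := fun χ => hD.isRankOne hbot a (ι χ)
  have hcyc := fun χ => h.towerSpan_eq_cyclicSpan hξ hli hκ hdense (HR χ)
  have hb : ∀ (H : Subgroup K) (χ : dualQuotient H),
      bottom (D.towerMap a χ) ∈ towerSpan D (D.towerMap a χ) := fun H χ =>
    IsRankOne.mem_towerSpan 0 le_rfl zero_le_one (D.one_le_h 0)
  choose τ hτ using fun χ => (HR χ).exists_spectralMeasure (hb ⊥ (ι χ))
  have hstep : ∀ χ, τ (dualAut v χ) ≪ τ χ ∧ τ χ ≪ τ (dualAut v χ) := by
    intro χ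
    exact ⟨(HR χ).absolutelyContinuous_of_inner_eq (hcyc χ)
        (h.exists_inner_eq_of_dualAut (HR (dualAut v χ)) (HR χ)) (hτ χ) (hτ (dualAut v χ)),
      (HR (dualAut v χ)).absolutelyContinuous_of_inner_eq (hcyc (dualAut v χ))
        (h.exists_inner_eq_of_dualAut_symm (HR χ) (HR (dualAut v χ))) (hτ (dualAut v χ)) (hτ χ)⟩
  refine ⟨τ, fun χ i => ?_, fun H hH χ ρ hρ => ?_⟩
  · induction i using Int.induction_on with
    | zero => exact Measure.AbsolutelyContinuous.refl _
    | succ n ih =>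
      rw [add_comm, zpow_add, zpow_one, MulAut.mul_apply]
      exact (hstep _).1.trans ih
    | pred n ih =>
      refine Measure.AbsolutelyContinuous.trans (hstep _).2 ?_
      rw [← MulAut.mul_apply, ← zpow_one_add, add_sub_cancel]
      exact ih
  · have HR' := hD.isRankOne hH a χ
    exact ⟨(HR χ).absolutelyContinuous_of_inner_eq (hcyc χ)
        (exists_inner_eq_of_same HR' (HR χ)) (hτ χ) hρ,
      HR'.absolutelyContinuous_of_inner_eq (h.towerSpan_eq_cyclicSpan hξ hli hκ hdense HR')
        (exists_inner_eq_of_same (HR χ) HR') hρ (hτ χ)⟩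

variable {H : Subgroup K} {E : Set ℕ}

-- The cyclic vectors are the bottom vectors, except that the one of the trivial character is made
-- orthogonal to the constants. Equivalence of types within an orbit comes from
-- `exists_spectralTypes`, singularity of different orbits from different weak limits.
open Classical in
theorem hasMultiplicitySet (h : IsConstruction v ξ κ D a) (hξ : ∀ i, 0 < ξ i)
    (hli : LinearIndependent ℚ ξ) (hκ : ∀ b, (κ ⁻¹' {b}).Infinite) (ht : IsTriple E H v)
    (hsep : SeparatesOrbits H v) [IsProbabilityMeasure (D.measure.prod (haarQuotient H))] :
    HasMultiplicitySet (koopman ((h.isFinite hξ).isFlow_extension ht.isClosed a))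
      (L2zero (D.measure.prod (haarQuotient H))) ((fun n : ℕ => (n : ℕ∞)) '' (E ∪ {1})) := by
  have hD := h.isFinite hξ
  have hH := ht.isClosed
  have HR := hD.isRankOne hH a
  have hU := (HR 1).rep
  set U := koopman (hD.isFlow_extension hH a) with hUdef
  set e := Lp.const 2 (D.measure.prod (haarQuotient H)) (1 : ℂ) with he
  have hUe : ∀ t, U t e = e := fun t => koopman_const _ t 1
  have hee : inner ℂ e e ≠ 0 := inner_self_ne_zero.2 const_ne_zero
  have heT := hD.const_mem_towerSpan hH a
  have hcyc := fun χ => h.towerSpan_eq_cyclicSpan hξ hli hκ ht.dense (HR χ)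
  set b : dualQuotient H → Lp ℂ 2 (D.measure.prod (haarQuotient H)) := fun χ =>
    bottom (D.towerMap a χ) with hb
  have hbT : ∀ χ, b χ ∈ towerSpan D (D.towerMap a χ) := fun χ =>
    IsRankOne.mem_towerSpan 0 le_rfl zero_le_one (D.one_le_h 0)
  set c : ℂ := inner ℂ e (b 1) / inner ℂ e e with hc
  set w : dualQuotient H → Lp ℂ 2 (D.measure.prod (haarQuotient H)) := fun χ =>
    if χ = 1 then b 1 - c • e else b χ with hw
  have hw1 : w 1 = b 1 - c • e := if_pos rfl
  have hwχ : ∀ χ, χ ≠ 1 → w χ = b χ := fun χ hχ => if_neg hχ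
  have hwT : ∀ χ, w χ ∈ towerSpan D (D.towerMap a χ) := by
    intro χ
    by_cases hχ : χ = 1
    · subst hχ
      rw [hw1]
      exact Submodule.sub_mem _ (hbT 1) (Submodule.smul_mem _ _ heT)
    · rw [hwχ χ hχ]
      exact hbT χ
  have horth : ∀ χ η, χ ≠ η → ∀ x ∈ towerSpan D (D.towerMap a χ),
      ∀ y ∈ towerSpan D (D.towerMap a η), inner ℂ x y = 0 := fun χ η hne x hx y hy =>
    Submodule.inner_right_of_mem_orthogonal hx (hD.towerSpan_le_orthogonal hH a hne.symm hy)
  -- For `χ = 1`, vanishing would make the cyclic bottom vector a constant and its cyclic space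
  -- one-dimensional.
  have hw0 : ∀ χ, w χ ≠ 0 := by
    intro χ hχ0
    by_cases hχ : χ = 1
    · subst hχ
      rw [hw1, sub_eq_zero] at hχ0
      refine (HR 1).towerSpan_not_le_span_singleton e ?_
      rw [hcyc 1]
      refine Submodule.topologicalClosure_minimal _ ?_ (Submodule.closed_of_finiteDimensional _)
      rw [Submodule.span_le]
      rintro _ ⟨t, rfl⟩
      change U t (b 1) ∈ ℂ ∙ e
      rw [hχ0, map_smul, hUe]
      exact Submodule.smul_mem _ _ (Submodule.mem_span_singleton_self e)
    · rw [hwχ χ hχ] at hχ0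
      exact (HR χ).map_boxInd_ne_zero 0 le_rfl zero_lt_one (D.one_le_h 0) hχ0
  choose ρ hρ using fun χ => (HR χ).exists_spectralMeasure (hwT χ)
  obtain ⟨τ, hτ1, hτ2⟩ := h.exists_spectralTypes hξ hli hκ ht.dense
  have := countable_pontryaginDual K
  rw [← ht.setOf_encard]
  have hone : ∀ χ η, orbitSetoid v H χ η → (χ = 1 ↔ η = 1) := by
    rintro χ η ⟨i, hi⟩
    rw [← Subtype.coe_inj, ← Subtype.coe_inj, ← hi, Subgroup.coe_one, EmbeddingLike.map_eq_one_iff]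
  refine hasMultiplicitySet_of_family (w := w) (ρ := ρ) ?_ ?_ hρ ?_ ?_ ?_
  · exact fun χ η hne t => horth χ η hne _ (hwT χ) _ ((HR η).apply_mem_towerSpan (hwT η) t)
  · set Z := (Submodule.span ℂ (Set.range fun p : dualQuotient H × ℝ => U p.2 (w p.1)))
      |>.topologicalClosure with hZ
    have hZmem : ∀ χ t, U t (w χ) ∈ Z := fun χ t =>
      Submodule.le_topologicalClosure _ (Submodule.subset_span ⟨(χ, t), rfl⟩)
    have hZle : Z ≤ L2zero (D.measure.prod (haarQuotient H)) := by
      refine Submodule.topologicalClosure_minimal _ ?_ (Submodule.isClosed_orthogonal _)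
      rw [Submodule.span_le]
      rintro _ ⟨⟨χ, t⟩, rfl⟩
      rw [SetLike.mem_coe, mem_L2zero]
      change inner ℂ e (U t (w χ)) = 0
      rw [← hUe t, LinearIsometry.inner_map_map]
      by_cases hχ : χ = 1
      · subst hχ
        rw [hw1, inner_sub_right, inner_smul_right, hc, div_mul_cancel₀ _ hee, sub_self]
      · exact horth 1 χ (Ne.symm hχ) _ heT _ (hwT χ)
    have : Z.HasOrthogonalProjection := by
      have : CompleteSpace Z := (Submodule.isClosed_topologicalClosure _).completeSpace_coe
      infer_instance
    refine le_antisymm hZle fun f hf => ?_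
    set g := f - Z.starProjection f with hg
    have hg0 : inner ℂ e g = 0 := mem_L2zero.1
      (Submodule.sub_mem _ hf (hZle (Submodule.starProjection_apply_mem Z f)))
    have hgw : ∀ χ t, inner ℂ g (U t (w χ)) = 0 := fun χ t =>
      Submodule.starProjection_inner_eq_zero f _ (hZmem χ t)
    have hgb : ∀ χ t, inner ℂ g (U t (b χ)) = 0 := by
      intro χ t
      by_cases hχ : χ = 1
      · subst hχ
        have e1 : b 1 = w 1 + c • e := by rw [hw1, sub_add_cancel]
        rw [e1, map_add, inner_add_right, hgw, map_smul, hUe, inner_smul_right, ← inner_conj_symm,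
          hg0, map_zero, mul_zero, add_zero]
      · rw [← hwχ χ hχ]
        exact hgw χ t
    -- A vector orthogonal to the constants and to the cyclic spaces of all `w χ` is orthogonal to
    -- those of all bottom vectors, hence to all towers of all characters.
    have hgz : g = 0 := by
      refine hD.eq_zero_of_forall_inner_towerMap hH a fun χ n φ hφ => ?_
      have h1 : towerSpan D (D.towerMap a χ) ≤ (ℂ ∙ g)ᗮ := by
        rw [hcyc χ]
        refine Submodule.topologicalClosure_minimal _ ?_ (Submodule.isClosed_orthogonal _)
        rw [Submodule.span_le]
        rintro _ ⟨t, rfl⟩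
        exact Submodule.mem_orthogonal_singleton_iff_inner_right.2 (hgb χ t)
      exact Submodule.mem_orthogonal_singleton_iff_inner_right.1 (h1 (hD.towerMap_mem hH a χ n hφ))
    rw [sub_eq_zero.1 hgz]
    exact Submodule.starProjection_apply_mem Z f
  · intro χ hρ0
    have h1 := (hρ χ).2 0
    rw [hρ0, integral_zero_measure, hU.zero] at h1
    exact hw0 χ (inner_self_eq_zero.1 h1)
  · intro χ η hχη
    by_cases hχ : χ = 1
    · have hη := (hone χ η hχη).1 hχ
      rw [hχ, hη]
    · have hη : η ≠ 1 := fun h' => hχ ((hone χ η hχη).2 h')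
      have h1 := (hτ2 H hH χ (ρ χ) (by have := hρ χ; rwa [hwχ χ hχ] at this)).1
      have h2 := (hτ2 H hH η (ρ η) (by have := hρ η; rwa [hwχ η hη] at this)).2
      obtain ⟨i, hi⟩ := (orbitSetoid v H).symm' hχη
      have h3 := hτ1 η i
      rw [hi] at h3
      exact (h1.trans h3).trans h2
  · intro χ η hχη
    obtain ⟨p, hp, hne⟩ := hsep χ χ.2 η η.2 (fun i hi => hχη ⟨i, hi⟩)
    have := stepFilter_neBot (hκ (Sum.inr ⟨p, hp⟩))
    have := (hρ χ).1
    have := (hρ η).1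
    exact (h.hasWeakLimit_inr (HR χ) ⟨p, hp⟩ (hwT χ)).mutuallySingular
      (h.hasWeakLimit_inr (HR η) ⟨p, hp⟩ (hwT η)) hU hU (hρ χ) (hρ η)
      fun h' => hne ((starRingEnd ℂ).injective h')

end IsConstruction

/-! ### Existence of the construction -/

lemma exists_forall_infinite_fiber (B : Type*) [Countable B] [Nonempty B] :
    ∃ κ : ℕ → B, ∀ b, (κ ⁻¹' {b}).Infinite := by
  obtain ⟨f, hf⟩ := exists_surjective_nat B
  refine ⟨fun n => f (Nat.unpair n).1, fun b => ?_⟩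
  obtain ⟨k, rfl⟩ := hf b
  refine Set.infinite_of_injective_forall_mem (f := fun j : ℕ => Nat.pair k j) (fun i j hij => ?_)
    fun j => ?_
  · exact (Nat.pair_eq_pair.1 hij).2
  · simp

/-! ### Maps with prescribed increments -/

section Coefficients

variable {K : Type*} [CommGroup K] [TopologicalSpace K] (v : K ≃ₜ* K) (p : K)

/-- A map whose increments run through the orbit of a periodic point `p` of period `m`
in blocks of length `n`, and that is equivariant with respect to translation by `m n`. -/
def blockMap (m n j : ℕ) : K :=
  v^[j / (m * n)] (∏ i ∈ Finset.range (j % (m * n)), v^[(i + 1) / n] p)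

lemma blockMap_add {m n : ℕ} (hm : 0 < m) (hn : 0 < n) (j : ℕ) :
    blockMap v p m n (j + m * n) = v (blockMap v p m n j) := by
  rw [blockMap, blockMap, Nat.add_mod_right, Nat.add_div_right _ (Nat.mul_pos hm hn),
    Function.iterate_succ_apply']

/-- The condition `t + 1 < n` keeps both positions in block `s` of row `q`; the blocks have length
`n` and the rows `m * n`, and passing to the next row applies `v` once more, which explains the
exponent `q + s`. -/
lemma blockMap_succ {m n q s t : ℕ} (hs : s < m) (ht : t + 1 < n) :
    blockMap v p m n (q * (m * n) + (s * n + t) + 1)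
      = blockMap v p m n (q * (m * n) + (s * n + t)) * v^[q + s] p := by
  have hr : s * n + t + 1 < m * n := by
    have : (s + 1) * n ≤ m * n := Nat.mul_le_mul_right n hs
    nlinarith
  have hmn : 0 < m * n := by omega
  have h1 : ∀ r < m * n, (q * (m * n) + r) / (m * n) = q ∧ (q * (m * n) + r) % (m * n) = r := by
    intro r hr
    constructor
    · rw [add_comm, Nat.add_mul_div_right _ _ hmn, Nat.div_eq_of_lt hr, zero_add]
    · rw [add_comm, Nat.add_mul_mod_self_right, Nat.mod_eq_of_lt hr]
  have h2 : (s * n + t + 1) / n = s := by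
    rw [add_assoc, add_comm, Nat.add_mul_div_right _ _ (by omega), Nat.div_eq_of_lt ht, zero_add]
  rw [blockMap, blockMap, add_assoc (q * (m * n)), (h1 _ hr).1, (h1 _ hr).2,
    (h1 _ (by omega : s * n + t < m * n)).1, (h1 _ (by omega : s * n + t < m * n)).2,
    Finset.prod_range_succ, h2, iterate_map_mul, ← Function.iterate_add_apply]

variable {v p}

/-- The positions where the increment of `blockMap` equals `v^i(p)`. -/
lemma exists_increments {m n i : ℕ} (hm : m = Function.minimalPeriod v p) (hi : i < m) :
    ∃ B ⊆ Finset.range (n ^ 3 * m), B.card = n ^ 2 * (n - 1) ∧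
      ∀ j ∈ B, 1 ≤ j ∧ blockMap v p m n j = blockMap v p m n (j - 1) * v^[i] p := by
  have hm0 : 0 < m := by omega
  -- Modulo `m` this is `i - q`, so that `q + s q ≡ i`: in each of the `n²` rows it selects the
  -- block with increment `v^i(p)`, and `n - 1` of its positions are used.
  set s : ℕ → ℕ := fun q => (i + (m - 1) * q) % m with hs
  have hsm : ∀ q, s q < m := fun q => Nat.mod_lt _ hm0
  set F : ℕ × ℕ → ℕ := fun x => x.1 * (m * n) + (s x.1 * n + x.2) + 1 with hF
  have hrn : ∀ q t, t + 1 < n → s q * n + t + 1 < m * n := by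
    intro q t ht
    have : (s q + 1) * n ≤ m * n := Nat.mul_le_mul_right n (hsm q)
    nlinarith
  refine ⟨(Finset.range (n ^ 2) ×ˢ Finset.range (n - 1)).image F, ?_, ?_, ?_⟩
  · intro j hj
    obtain ⟨⟨q, t⟩, hqt, rfl⟩ := Finset.mem_image.1 hj
    obtain ⟨hq, ht⟩ := Finset.mem_product.1 hqt
    have hq' := Finset.mem_range.1 hq
    have ht' := Finset.mem_range.1 ht
    have h1 := hrn q t (by simp only at ht'; omega)
    have h2 : (q + 1) * (m * n) ≤ n ^ 2 * (m * n) := Nat.mul_le_mul_right _ hq'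
    have h3 : n ^ 2 * (m * n) = n ^ 3 * m := by ring
    simp only [hF, Finset.mem_range]
    nlinarith
  · rw [Finset.card_image_of_injOn, Finset.card_product, Finset.card_range, Finset.card_range]
    rintro ⟨q, t⟩ hqt ⟨q', t'⟩ hqt' heq
    have ht := Finset.mem_range.1 (Finset.mem_product.1 hqt).2
    have ht' := Finset.mem_range.1 (Finset.mem_product.1 hqt').2
    simp only at ht ht'
    simp only [hF] at heq
    have h1 := hrn q t (by omega)
    have h1' := hrn q' t' (by omega)
    have hmn : 0 < m * n := by omega
    have hqq : q = q' := by
      have e : (q * (m * n) + (s q * n + t)) / (m * n) = (q' * (m * n) + (s q' * n + t')) / (m * n) :=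
        congrArg (· / (m * n)) (Nat.succ_injective heq)
      rwa [add_comm, Nat.add_mul_div_right _ _ hmn, Nat.div_eq_of_lt (by omega), zero_add,
        add_comm, Nat.add_mul_div_right _ _ hmn, Nat.div_eq_of_lt (by omega), zero_add] at e
    subst hqq
    have : t = t' := by omega
    rw [this]
  · intro j hj
    obtain ⟨⟨q, t⟩, hqt, rfl⟩ := Finset.mem_image.1 hj
    have ht := Finset.mem_range.1 (Finset.mem_product.1 hqt).2
    simp only at ht
    refine ⟨Nat.succ_pos _, ?_⟩
    simp only [hF, Nat.add_sub_cancel]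
    rw [blockMap_succ v p (hsm q) (by omega), ← Function.iterate_mod_minimalPeriod_eq (f := v)
      (n := q + s q), ← hm]
    have h4 : (q + s q) % m = i := by
      obtain ⟨k, rfl⟩ : ∃ k, m = k + 1 := ⟨m - 1, by omega⟩
      rw [hs]
      simp only [Nat.add_sub_cancel, Nat.add_mod_mod]
      rw [show q + (i + k * q) = i + (k + 1) * q by ring, Nat.add_mul_mod_self_left,
        Nat.mod_eq_of_lt hi]
    rw [h4]

end Coefficients

/-! ### Recursive construction of the towers -/

section Existence

variable {K : Type*} [CommGroup K] [TopologicalSpace K] [IsTopologicalGroup K]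
  (v : K ≃ₜ* K) (ξ : Fin 2 → ℝ) (κ : ℕ → Fin 2 ⊕ periodicPoints v)

/-- The height of the next tower. -/
def nextHeight (n : ℕ) (h : ℝ) : Fin 2 ⊕ periodicPoints v → ℝ
  | Sum.inl i => 2 * n * h + n * ξ i
  | Sum.inr p => ((n ^ 3 * period v p : ℕ) : ℝ) * h + 1

/-- The positions of the copies of a tower in the next one. -/
def nextCopies (n : ℕ) (h : ℝ) : Fin 2 ⊕ periodicPoints v → Finset ℝ
  | Sum.inl i => (Finset.range n).image (fun j : ℕ => (j : ℝ) * h) ∪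
      (Finset.range n).image (fun j : ℕ => (j : ℝ) * (h + ξ i) + n * h)
  | Sum.inr p => (Finset.range (n ^ 3 * period v p)).image (fun j : ℕ => (j : ℝ) * h)

/-- The values of the cocycle. -/
def nextValue (n : ℕ) (h : ℝ) (c : ℝ) : Fin 2 ⊕ periodicPoints v → K
  | Sum.inl _ => 1
  | Sum.inr p => blockMap v p (period v p) n ⌊c / h⌋₊

/-- The heights of the towers. -/
def heights : ℕ → ℝ
  | 0 => 1
  | n + 1 => if n = 0 then 1 else nextHeight v ξ n (heights n) (κ (n + 1))

/-- The positions of the copies of the towers. -/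
def copySets : ℕ → Finset ℝ
  | 0 => {0}
  | n + 1 => if n = 0 then {0} else nextCopies v ξ n (heights v ξ κ n) (κ (n + 1))

variable {ξ}

lemma nextCopies_spec (hξ : ∀ i, 0 < ξ i) {n : ℕ} (hn : 1 ≤ n) {h : ℝ} (hh : 0 < h)
    (b : Fin 2 ⊕ periodicPoints v) : 0 ∈ nextCopies v ξ n h b ∧
      (∀ c ∈ nextCopies v ξ n h b, 0 ≤ c ∧ h + c ≤ nextHeight v ξ n h b) ∧
      ∀ c ∈ nextCopies v ξ n h b, ∀ c' ∈ nextCopies v ξ n h b, c < c' → h + c ≤ c' := by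
  have hlin : ∀ (i j : ℕ) (x : ℝ), 0 < x → (i : ℝ) * x < j * x → x + i * x ≤ j * x := by
    intro i j x hx hij
    have h1 : i < j := by exact_mod_cast lt_of_mul_lt_mul_right hij hx.le
    have h2 : ((i : ℝ) + 1) ≤ j := by exact_mod_cast h1
    nlinarith
  have hle : ∀ (i r : ℕ), i < r → (i : ℝ) + 1 ≤ r := fun i r h => by exact_mod_cast h
  rcases b with i | p
  · have hx := hξ i
    simp only [nextCopies, nextHeight]
    refine ⟨Finset.mem_union_left _ (Finset.mem_image.2 ⟨0, Finset.mem_range.2 hn, by simp⟩), ?_, ?_⟩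
    · intro c hc
      rcases Finset.mem_union.1 hc with hc | hc <;> obtain ⟨j, hj, rfl⟩ := Finset.mem_image.1 hc
      · have h1 := hle _ _ (Finset.mem_range.1 hj)
        exact ⟨by positivity, by nlinarith [mul_pos (lt_of_lt_of_le (by positivity) h1) hx]⟩
      · have h1 := hle _ _ (Finset.mem_range.1 hj)
        exact ⟨by positivity, by nlinarith⟩
    · intro c hc c' hc' hlt
      rcases Finset.mem_union.1 hc with hc | hc <;> obtain ⟨j, hj, rfl⟩ := Finset.mem_image.1 hc <;>
      rcases Finset.mem_union.1 hc' with hc' | hc' <;>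
      obtain ⟨j', hj', rfl⟩ := Finset.mem_image.1 hc' <;>
      have h1 := hle _ _ (Finset.mem_range.1 hj) <;>
      have h1' := hle _ _ (Finset.mem_range.1 hj')
      · exact hlin _ _ _ hh hlt
      · have : (0 : ℝ) ≤ j' * (h + ξ i) := by positivity
        nlinarith
      · have : (0 : ℝ) ≤ j * (h + ξ i) := by positivity
        nlinarith
      · have := hlin j j' (h + ξ i) (by positivity) (by linarith)
        linarith
  · have hp : 0 < period v p := IsConstruction.period_pos p
    simp only [nextCopies, nextHeight]
    refine ⟨Finset.mem_image.2 ⟨0, Finset.mem_range.2 (by positivity), by simp⟩, ?_, ?_⟩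
    · intro c hc
      obtain ⟨j, hj, rfl⟩ := Finset.mem_image.1 hc
      have h1 := hle _ _ (Finset.mem_range.1 hj)
      exact ⟨by positivity, by nlinarith⟩
    · intro c hc c' hc' hlt
      obtain ⟨j, hj, rfl⟩ := Finset.mem_image.1 hc
      obtain ⟨j', hj', rfl⟩ := Finset.mem_image.1 hc'
      exact hlin _ _ _ hh hlt

lemma heights_pos (hξ : ∀ i, 0 < ξ i) (n : ℕ) : 0 < heights v ξ κ n := by
  induction n with
  | zero => exact zero_lt_one
  | succ n ih =>
    rw [heights]
    split_ifs with h0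
    · exact zero_lt_one
    · have hs := nextCopies_spec v hξ (Nat.one_le_iff_ne_zero.2 h0) ih (κ (n + 1))
      linarith [(hs.2.1 0 hs.1).2]

/-- The first step is trivial, with `C_1 = {0}` and `h_1 = 1`. Afterwards the sets and heights are
dictated by `κ`, and the cocycle values are given by `blockMap`. -/
lemma exists_construction (hξ : ∀ i, 0 < ξ i) :
    ∃ (D : CFData) (a : ℕ → ℝ → K), IsConstruction v ξ κ D a := by
  have hspec := fun n (hn : n ≠ 0) => nextCopies_spec v hξ (Nat.one_le_iff_ne_zero.2 hn)
    (heights_pos v κ hξ n) (κ (n + 1))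
  let D : CFData :=
    { C := copySets v ξ κ
      h := heights v ξ κ
      h_zero := rfl
      zero_mem := fun n => by
        rw [copySets]
        split_ifs with h0
        · exact Finset.mem_singleton_self 0
        · exact (hspec n h0).1
      nonneg := fun n c hc => by
        rw [copySets] at hc
        split_ifs at hc with h0
        · rw [Finset.mem_singleton.1 hc]
        · exact ((hspec n h0).2.1 c hc).1
      add_le := fun n c hc => by
        rw [copySets] at hc
        rw [heights]
        split_ifs at hc ⊢ with h0
        · rw [Finset.mem_singleton.1 hc, h0, heights, add_zero]
        · exact ((hspec n h0).2.1 c hc).2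
      disjoint := fun n c hc c' hc' hne => by
        rw [SetLike.mem_coe, copySets] at hc hc'
        split_ifs at hc hc' with h0
        · exact absurd ((Finset.mem_singleton.1 hc).trans (Finset.mem_singleton.1 hc').symm) hne
        · rw [Function.onFun, Set.disjoint_left]
          rintro s ⟨h1, h2⟩ ⟨h3, h4⟩
          rcases lt_or_gt_of_ne hne with hlt | hlt
          · linarith [(hspec n h0).2.2 c hc c' hc' hlt]
          · linarith [(hspec n h0).2.2 c' hc' c hc hlt] }
  have hh : ∀ n, 0 < D.h n := heights_pos v κ hξ
  have hC : ∀ n, 1 ≤ n → D.C (n + 1) = nextCopies v ξ n (D.h n) (κ (n + 1)) := fun n hn => by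
    change copySets v ξ κ (n + 1) = _
    rw [copySets, if_neg (by omega)]
  have hH : ∀ n, 1 ≤ n → D.h (n + 1) = nextHeight v ξ n (D.h n) (κ (n + 1)) := fun n hn => by
    change heights v ξ κ (n + 1) = _
    rw [heights, if_neg (by omega)]
  -- The index `j` of the copy at `c = j h` is recovered inside `nextValue` as `⌊c / h⌋₊`.
  set a : ℕ → ℝ → K := fun k c => nextValue v (k - 1) (D.h (k - 1)) c (κ k) with ha
  have har : ∀ n p, κ (n + 1) = Sum.inr p → ∀ j : ℕ,
      a (n + 1) (j * D.h n) = blockMap v p (period v p) n j := by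
    intro n p hp j
    simp only [ha, hp, nextValue, Nat.add_sub_cancel]
    rw [mul_div_cancel_right₀ _ (hh n).ne', Nat.floor_natCast]
  have hCr : ∀ n, 1 ≤ n → ∀ p : periodicPoints v, κ (n + 1) = Sum.inr p →
      D.C (n + 1) = (Finset.range (n ^ 3 * period v p)).image (fun j : ℕ => (j : ℝ) * D.h n) := by
    intro n hn p hp
    rw [hC n hn, hp]
    rfl
  refine ⟨D, a, ⟨hCr, ?_, ?_, ?_, ?_, ?_, ?_⟩⟩
  · intro n hn p hp
    rw [hH n hn, hp]
    rfl
  · intro n hn p hp c hc _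
    rw [hCr n hn p hp] at hc
    obtain ⟨j, -, rfl⟩ := Finset.mem_image.1 hc
    have e : (j : ℝ) * D.h n + (period v p * n : ℕ) * D.h n
        = ((j + period v p * n : ℕ) : ℝ) * D.h n := by
      push_cast
      ring
    rw [e, har n p hp, har n p hp, blockMap_add v p (IsConstruction.period_pos p) hn]
  · intro n hn p hp i hi
    obtain ⟨B, hB1, hB2, hB3⟩ := exists_increments (v := v) (p := (p : K)) (n := n) rfl hi
    have hinj : Function.Injective fun j : ℕ => (j : ℝ) * D.h n := fun i j hij => by
      exact_mod_cast mul_right_cancel₀ (hh n).ne' hij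
    refine ⟨B.image fun j : ℕ => (j : ℝ) * D.h n, ?_, ?_, ?_⟩
    · rw [hCr n hn p hp]
      exact Finset.image_subset_image hB1
    · intro c hc
      obtain ⟨j, hj, rfl⟩ := Finset.mem_image.1 hc
      obtain ⟨hj1, hj2⟩ := hB3 j hj
      have e : (j : ℝ) * D.h n - D.h n = ((j - 1 : ℕ) : ℝ) * D.h n := by
        push_cast [hj1]
        ring
      have hjr : j < n ^ 3 * period v p := Finset.mem_range.1 (hB1 hj)
      refine ⟨?_, ?_⟩
      · simp only [e, hCr n hn p hp]
        exact Finset.mem_image_of_mem _ (Finset.mem_range.2 (by omega))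
      · simp only [e, har n p hp]
        exact hj2
    · rw [hCr n hn p hp, Finset.card_image_of_injective _ hinj, Finset.card_image_of_injective _ hinj,
        hB2, Finset.card_range]
      have hn0 : (0 : ℝ) < n := by exact_mod_cast hn
      have hm0 : (0 : ℝ) < period v p := by exact_mod_cast IsConstruction.period_pos p
      -- The frequency misses `1/m` by exactly `1/(n m)`, the share of the last position of each
      -- block.
      have e : ((n ^ 2 * (n - 1) : ℕ) : ℝ) / ((n ^ 3 * period v p : ℕ) : ℝ) - 1 / (period v p : ℝ)
          = -(1 / (n * period v p)) := by
        push_cast [hn]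
        field_simp
        ring
      rw [e, abs_neg, abs_of_pos (by positivity), div_lt_div_iff_of_pos_right (by positivity)]
      norm_num
  · intro n hn i hi
    rw [hC n hn, hi]
    rfl
  · intro n hn i hi
    rw [hH n hn, hi]
    rfl
  · intro n hn i hi c _
    simp only [ha, hi, nextValue]

end Existence

/-! ### Automorphisms with finite orbits on the dual group -/

section FiniteOrbits

variable {K : Type*} [CommGroup K] [TopologicalSpace K] [IsTopologicalGroup K]

lemma dualAut_zpow_apply (v : K ≃ₜ* K) (χ : PontryaginDual K) (i : ℤ) (a : K) :
    ((dualAut v ^ i) χ) a = χ (((v.toMulEquiv : MulAut K) ^ i) a) := by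
  induction i using Int.induction_on generalizing χ with
  | zero => rfl
  | succ n ih =>
    rw [zpow_add_one, add_comm, zpow_one_add, MulAut.mul_apply, ih]
    rfl
  | pred n ih =>
    rw [zpow_sub_one, sub_eq_neg_add, zpow_add, zpow_neg_one, MulAut.mul_apply, MulAut.mul_apply, ih]
    rfl

lemma coe_iterate_eq_zpow (v : K ≃ₜ* K) (n : ℕ) (a : K) :
    v^[n] a = ((v.toMulEquiv : MulAut K) ^ (n : ℤ)) a := by
  induction n generalizing a with
  | zero => rfl
  | succ n ih =>
    rw [Function.iterate_succ_apply, ih, Nat.cast_succ, zpow_add_one]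
    rfl

lemma sum_range_mul_of_periodic {f : ℕ → ℂ} {c : ℕ} (hf : Function.Periodic f c) (k : ℕ) :
    ∑ i ∈ Finset.range (k * c), f i = k * ∑ i ∈ Finset.range c, f i := by
  induction k with
  | zero => simp
  | succ k ih =>
    rw [Nat.succ_mul, Finset.sum_range_add, ih, Nat.cast_succ, add_mul, one_mul]
    congr 1
    refine Finset.sum_congr rfl fun i _ => ?_
    rw [add_comm]
    exact hf.nat_mul k i

/-- If `χ` is fixed by the `M`-th power of `v^`, then `l_χ(a)` is also the mean of `χ(v^i(a))` over
`0 ≤ i < M`. -/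
lemma sum_range_eq_mul_orbitMean {v : K ≃ₜ* K} {χ : PontryaginDual K} {a : K}
    (ha : a ∈ periodicPoints v) {M : ℕ} (hM : ∀ b, χ (v^[M] b) = χ b) :
    ∑ i ∈ Finset.range M, (χ (v^[i] a) : ℂ) = M * orbitMean v χ a := by
  have hm : 0 < period v a := Function.minimalPeriod_pos_of_mem_periodicPts ha
  have hm' : (period v a : ℂ) ≠ 0 := by exact_mod_cast hm.ne'
  have h1 : Function.Periodic (fun i => (χ (v^[i] a) : ℂ)) M := fun i => by
    change (χ (v^[i + M] a) : ℂ) = _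
    rw [add_comm, Function.iterate_add_apply, hM]
  have h2 : Function.Periodic (fun i => (χ (v^[i] a) : ℂ)) (period v a) := fun i => by
    change (χ (v^[i + period v a] a) : ℂ) = _
    rw [Function.iterate_add_apply]
    congr 3
    exact Function.iterate_minimalPeriod
  have h := sum_range_mul_of_periodic h1 (period v a)
  rw [mul_comm, sum_range_mul_of_periodic h2] at h
  rw [orbitMean, mul_left_comm, h, ← mul_assoc, inv_mul_cancel₀ hm', one_mul]

/-- Two finite families of characters with the same sum have a common member. -/
lemma exists_eq_of_sum_eq {G : Type*} [Monoid G] {M : ℕ} {χ η : ℕ → G →* ℂ}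
    (h : ∀ a, ∑ i ∈ Finset.range M, χ i a = ∑ i ∈ Finset.range M, η i a) (hM : 0 < M) :
    ∃ i, χ i = η 0 := by
  classical
  by_contra! hne
  -- By Dedekind's independence of characters both sums are determined by their coefficients; at `η
  -- 0` the coefficient is zero on one side and positive on the other.
  have hinj : Function.Injective (Finsupp.linearCombination ℂ
    (fun f => f : (G →* ℂ) → G → ℂ)) := linearIndependent_monoidHom G ℂ
  have heq : ∑ i ∈ Finset.range M, Finsupp.single (χ i) (1 : ℂ)
      = ∑ i ∈ Finset.range M, Finsupp.single (η i) (1 : ℂ) := by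
    apply hinj
    rw [map_sum, map_sum]
    funext a
    simpa [Finsupp.linearCombination_single] using h a
  have h0 := DFunLike.congr_fun heq (η 0)
  rw [Finsupp.finsetSum_apply, Finsupp.finsetSum_apply,
    Finset.sum_eq_zero fun i _ => Finsupp.single_eq_of_ne' (hne i)] at h0
  simp only [Finsupp.single_apply, Finset.sum_boole] at h0
  have hpos : 0 < (Finset.filter (fun i => η i = η 0) (Finset.range M)).card :=
    Finset.card_pos.2 ⟨0, by simpa using hM⟩
  exact hpos.ne' (by exact_mod_cast h0.symm)

/-- If the periodic points are dense and all orbits in the dual group are finite, then the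
functions `l_χ` separate the orbits. -/
lemma separatesOrbits_of_finite_orbits (H : Subgroup K) {v : K ≃ₜ* K}
    (hd : Dense (periodicPoints v))
    (hfin : ∀ χ : PontryaginDual K, ∃ n > 0, ∀ b, χ (v^[n] b) = χ b) : SeparatesOrbits H v := by
  intro χ _ η _ hne
  by_contra! hcon
  obtain ⟨m, hm, hχ⟩ := hfin χ
  obtain ⟨n, hn, hη⟩ := hfin η
  have hmul : ∀ (θ : PontryaginDual K) (m : ℕ), (∀ b, θ (v^[m] b) = θ b) →
      ∀ k b, θ (v^[m * k] b) = θ b := by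
    intro θ m hθ k
    induction k with
    | zero => exact fun b => rfl
    | succ k ih => exact fun b => by rw [Nat.mul_succ, add_comm, Function.iterate_add_apply, hθ, ih]
  have hχ' := hmul χ m hχ n
  have hη' := hmul η n hη m
  rw [mul_comm n m] at hη'
  let c : PontryaginDual K → ℕ → K →* ℂ := fun θ i =>
    Circle.coeHom.comp ((θ : K →ₜ* Circle).toMonoidHom.comp
      ((v.toMulEquiv : MulAut K) ^ (i : ℤ) : MulAut K).toMonoidHom)
  have hc : ∀ θ i a, c θ i a = (θ (v^[i] a) : ℂ) := fun θ i a => by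
    rw [coe_iterate_eq_zpow]
    rfl
  have hcont : ∀ θ : PontryaginDual K,
      Continuous fun a => ∑ i ∈ Finset.range (m * n), (θ (v^[i] a) : ℂ) := fun θ =>
    continuous_finsetSum _ fun i _ => continuous_subtype_val.comp
      ((map_continuous θ).comp ((map_continuous v).iterate i))
  -- Over the common period `m * n` of both characters, equality of `l_χ` and `l_η` says that the
  -- orbit sums agree at the periodic points, hence everywhere by density.
  have heq := Continuous.ext_on hd (hcont χ) (hcont η) fun a ha => by
    rw [sum_range_eq_mul_orbitMean ha hχ', sum_range_eq_mul_orbitMean ha hη', hcon a ha]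
  obtain ⟨i, hi⟩ := exists_eq_of_sum_eq (χ := c χ) (η := c η) (M := m * n) (fun a => by
    simpa only [hc] using congrFun heq a) (Nat.mul_pos hm hn)
  refine hne i (PontryaginDual.ext fun a => ?_)
  rw [dualAut_zpow_apply, ← coe_iterate_eq_zpow]
  have := DFunLike.congr_fun hi a
  rw [hc, hc] at this
  exact Circle.ext this

end FiniteOrbits

/-! ### Products of finite groups -/

section Pi

variable {ι : Type*} {G : ι → Type*} [∀ j, CommGroup (G j)]

/-- A continuous character of a product of topological groups depends on finitely many
coordinates. -/
lemma exists_finset_character_eq_one [∀ j, TopologicalSpace (G j)]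
    (χ : PontryaginDual (∀ j, G j)) :
    ∃ F : Finset ι, ∀ x : ∀ j, G j, (∀ j ∈ F, x j = 1) → χ x = 1 := by
  have hU : χ ⁻¹' Circle.centeredArc (Real.pi / 2) ∈ 𝓝 (1 : ∀ j, G j) := by
    refine (map_continuous χ).continuousAt.preimage_mem_nhds
      ((Circle.isOpen_centeredArc _).mem_nhds ?_)
    rw [_root_.map_one, Circle.mem_centeredArc (by linarith [Real.pi_pos])]
    simp [Real.pi_pos]
  rw [nhds_pi, Filter.mem_pi] at hU
  obtain ⟨I, hI, t, ht, hsub⟩ := hU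
  refine ⟨hI.toFinset, fun x hx => ?_⟩
  -- The circle has no small subgroups: the elements that are trivial on the chosen coordinates form
  -- a subgroup, which `χ` maps into a short arc.
  refine Circle.eq_one_of_forall_pow_mem_centeredArc_pi_div_two fun n _ => ?_
  rw [← _root_.map_pow]
  refine hsub fun j hj => ?_
  rw [Pi.pow_apply, hx j (hI.mem_toFinset.2 hj), one_pow]
  exact mem_of_mem_nhds (ht j)

lemma dense_finite_mulSupport [∀ j, TopologicalSpace (G j)] :
    Dense {x : ∀ j, G j | {j | x j ≠ 1}.Finite} := by
  classical
  intro x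
  rw [mem_closure_iff_nhds]
  intro U hU
  rw [nhds_pi, Filter.mem_pi] at hU
  obtain ⟨I, hI, t, ht, hsub⟩ := hU
  refine ⟨fun j => if j ∈ I then x j else 1, hsub fun j hj => ?_, ?_⟩
  · rw [if_pos hj]
    exact mem_of_mem_nhds (ht j)
  · refine hI.subset fun j hj => ?_
    by_contra h
    exact hj (if_neg h)

/-- The product of automorphisms of topological groups. -/
def piAut [∀ j, TopologicalSpace (G j)] [∀ j, DiscreteTopology (G j)] (c : ∀ j, MulAut (G j)) :
    (∀ j, G j) ≃ₜ* (∀ j, G j) where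
  __ := MulEquiv.piCongrRight fun j => (c j : G j ≃* G j)
  continuous_toFun := continuous_pi fun j => continuous_of_discreteTopology.comp (continuous_apply j)
  continuous_invFun := continuous_pi fun j =>
    continuous_of_discreteTopology.comp (continuous_apply j)

variable [∀ j, TopologicalSpace (G j)] [∀ j, DiscreteTopology (G j)] {c : ∀ j, MulAut (G j)}

lemma piAut_zpow_apply (i : ℤ) (x : ∀ j, G j) (j : ι) :
    (((piAut c).toMulEquiv : MulAut (∀ j, G j)) ^ i) x j = (c j ^ i) (x j) := by
  induction i using Int.induction_on generalizing x with
  | zero => rfl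
  | succ n ih =>
    rw [zpow_add_one, zpow_add_one, MulAut.mul_apply, MulAut.mul_apply, ih]
    rfl
  | pred n ih =>
    rw [zpow_sub_one, zpow_sub_one, MulAut.mul_apply, MulAut.mul_apply, ih]
    rfl

lemma piAut_iterate_apply (n : ℕ) (x : ∀ j, G j) (j : ι) :
    (piAut c)^[n] x j = (c j ^ n) (x j) := by
  rw [coe_iterate_eq_zpow, piAut_zpow_apply, zpow_natCast]

end Pi

open scoped Nat

section Pi

variable {ι : Type*} [DecidableEq ι] {G : ι → Type*} [∀ j, CommGroup (G j)]
  [∀ j, TopologicalSpace (G j)]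

lemma exists_finset_character_eq_prod (χ : PontryaginDual (∀ j, G j)) :
    ∃ F : Finset ι, ∀ x : ∀ j, G j, χ x = ∏ j ∈ F, χ (Pi.mulSingle j (x j)) := by
  obtain ⟨F, hF⟩ := exists_finset_character_eq_one χ
  refine ⟨F, fun x => ?_⟩
  rw [← _root_.map_prod, ← div_eq_one, ← map_div]
  refine hF _ fun j hj => ?_
  rw [Pi.div_apply, Finset.prod_apply, Finset.prod_eq_single j
    (fun k _ hk => Pi.mulSingle_eq_of_ne hk.symm _) (fun h => absurd hj h), Pi.mulSingle_eq_same,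
    div_self']

lemma character_ext_mulSingle {χ η : PontryaginDual (∀ j, G j)}
    (h : ∀ j x, χ (Pi.mulSingle j x) = η (Pi.mulSingle j x)) : χ = η := by
  obtain ⟨F, hF⟩ := exists_finset_character_eq_prod (χ / η)
  refine div_eq_one.1 (PontryaginDual.ext fun x => ?_)
  rw [hF]
  refine Finset.prod_eq_one fun j _ => ?_
  change χ _ / η _ = 1
  rw [h, div_self']

lemma piAut_zpow_mulSingle [∀ j, DiscreteTopology (G j)] (c : ∀ j, MulAut (G j)) (i : ℤ) (j : ι)
    (x : G j) :
    (((piAut c).toMulEquiv : MulAut (∀ j, G j)) ^ i) (Pi.mulSingle j x)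
      = Pi.mulSingle j ((c j ^ i) x) := by
  funext k
  rw [piAut_zpow_apply]
  by_cases hk : k = j
  · subst hk
    simp
  · simp [hk]

end Pi

/-! ### Free automorphisms -/

/-- The automorphism `z` has order `n` and the group generated by it acts freely on the nontrivial
elements. -/
structure IsFreeAut {A : Type*} [CommGroup A] (z : MulAut A) (n : ℕ) : Prop where
  pow_eq_one : z ^ n = 1
  dvd : ∀ (i : ℤ) (x : A), x ≠ 1 → (z ^ i) x = x → (n : ℤ) ∣ i

namespace IsFreeAut

variable {A : Type*} [CommGroup A] {z : MulAut A} {n : ℕ}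

lemma zpow_eq_of_dvd (h : IsFreeAut z n) {k l : ℤ} (hkl : (n : ℤ) ∣ k - l) : z ^ k = z ^ l := by
  obtain ⟨m, hm⟩ := hkl
  rw [eq_add_of_sub_eq hm, zpow_add, zpow_mul, zpow_natCast, h.pow_eq_one, one_zpow, one_mul]

/-- Composing a nontrivial homomorphism with two powers of `z` gives the same only if the
powers are the same. -/
lemma dvd_of_comp_eq [Finite A] {B : Type*} [CommGroup B] (h : IsFreeAut z n) {ψ : A →* B}
    {a : A} (ha : ψ a ≠ 1) {k l : ℤ} (hkl : ∀ x, ψ ((z ^ k) x) = ψ ((z ^ l) x)) :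
    (n : ℤ) ∣ k - l := by
  by_contra hn
  -- Unless `n ∣ k - l`, freeness makes this quotient injective, hence surjective on the finite
  -- group `A`. But `ψ` is trivial on its range.
  let f : A →* A := (z ^ k : MulAut A).toMonoidHom / (z ^ l : MulAut A).toMonoidHom
  have hf : ∀ x, f x = (z ^ k) x / (z ^ l) x := fun _ => rfl
  have hinj : Function.Injective f := by
    rw [injective_iff_map_eq_one]
    intro x hx
    by_contra hx1
    rw [hf, div_eq_one] at hx
    refine hn (h.dvd (k - l) x hx1 ?_)
    rw [sub_eq_neg_add, zpow_add, MulAut.mul_apply, hx, ← MulAut.mul_apply, ← zpow_add]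
    simp
  obtain ⟨x, rfl⟩ := Finite.surjective_of_injective hinj a
  rw [hf, map_div, hkl, div_self'] at ha
  exact ha rfl

end IsFreeAut

/-- The automorphism `(x, y) ↦ (z(x), z^{1+j}(y))`. -/
def twist {A : Type*} [CommGroup A] (z : MulAut A) (j : ℕ) : MulAut (A × A) :=
  MulEquiv.prodCongr z (z ^ (1 + j) : MulAut A)

lemma twist_zpow_apply {A : Type*} [CommGroup A] (z : MulAut A) (j : ℕ) (i : ℤ) (p : A × A) :
    (twist z j ^ i) p = ((z ^ i) p.1, (z ^ ((1 + j) * i)) p.2) := by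
  have h1 : ∀ p, twist z j p = (z p.1, (z ^ (1 + j : ℤ)) p.2) := fun p => by
    rw [← Nat.cast_one, ← Nat.cast_add, zpow_natCast]
    rfl
  have h2 : ∀ p, (twist z j)⁻¹ p = (z⁻¹ p.1, (z ^ (-(1 + j) : ℤ)) p.2) := fun p => by
    rw [zpow_neg, ← Nat.cast_one, ← Nat.cast_add, zpow_natCast]
    rfl
  induction i using Int.induction_on generalizing p with
  | zero => simp
  | succ n ih =>
    rw [zpow_add_one, zpow_add_one, MulAut.mul_apply, MulAut.mul_apply, h1, ih, mul_add_one,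
      zpow_add _ _ (1 + (j : ℤ)), MulAut.mul_apply]
  | pred n ih =>
    rw [zpow_sub_one, zpow_sub_one, MulAut.mul_apply, MulAut.mul_apply, h2, ih, mul_sub_one,
      sub_eq_add_neg _ (1 + (j : ℤ)), zpow_add _ _ (-(1 + (j : ℤ))), MulAut.mul_apply]

/-- The indices in question are the multiples of `d` modulo `d * J`. -/
lemma encard_range_inter {X : Type*} {f : ℤ → X} {B : Set X} {d J : ℕ} (hd : 0 < d)
    (hB : ∀ i, f i ∈ B ↔ (d : ℤ) ∣ i) (hf : ∀ i k, f i = f k ↔ ((d * J : ℕ) : ℤ) ∣ i - k)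
    (hJ : 0 < J) : (Set.range f ∩ B).encard = J := by
  have hd' : (d : ℤ) ≠ 0 := by exact_mod_cast hd.ne'
  have hinj : Function.Injective fun k : Fin J => f (d * (k : ℕ)) := by
    intro k l hkl
    have := (hf _ _).1 hkl
    rw [← mul_sub, Nat.cast_mul, mul_dvd_mul_iff_left hd'] at this
    have h0 := Int.eq_zero_of_abs_lt_dvd this (by
      rw [abs_lt]
      constructor <;> omega)
    exact Fin.ext (by omega)
  have hset : Set.range f ∩ B = Set.range fun k : Fin J => f (d * (k : ℕ)) := by
    ext x
    constructor
    · rintro ⟨⟨i, rfl⟩, hi⟩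
      obtain ⟨m, rfl⟩ := (hB i).1 hi
      have hJ' : (0 : ℤ) < J := by exact_mod_cast hJ
      refine ⟨⟨(m % J).toNat, ?_⟩, ?_⟩
      · have := Int.emod_lt_of_pos m hJ'
        omega
      · refine (hf _ _).2 ?_
        rw [Int.toNat_of_nonneg (Int.emod_nonneg _ hJ'.ne'), ← mul_sub, Nat.cast_mul]
        exact mul_dvd_mul_left _ (Int.mod_modEq m J).symm.dvd
    · rintro ⟨k, rfl⟩
      exact ⟨⟨_, rfl⟩, (hB _).2 (dvd_mul_right _ _)⟩
  rw [hset, ← Set.image_univ, hinj.encard_image, Set.encard_univ]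
  simp

/-! ### A triple with a prescribed set of orbit counts -/

section Twist

variable {E : Set ℕ} {M : E → Type*} [∀ j, CommGroup (M j)] {z : ∀ j, MulAut (M j)}

lemma twist_pow_eq_self_of_dvd (hz : ∀ j, IsFreeAut (z j) (j : ℕ)!) {j : E} {n : ℕ}
    (hn : (j : ℕ)! ∣ n) (x : M j × M j) : (twist (z j) j ^ n) x = x := by
  have hn' : (((j : ℕ)! : ℕ) : ℤ) ∣ (n : ℤ) := Int.natCast_dvd_natCast.2 hn
  rw [← zpow_natCast, twist_zpow_apply,
    (hz j).zpow_eq_of_dvd (k := n) (l := 0) (by simpa using hn'),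
    (hz j).zpow_eq_of_dvd (k := (1 + j) * n) (l := 0) (by simpa using hn'.mul_left _)]
  simp

/-- A fixed nontrivial element gives `j! ∣ n` or `j! ∣ (1 + j) n`, in either case `j! ≤ (1 + j) n`,
and the growth of factorials bounds `j`. -/
lemma le_of_twist_pow_eq_self (hz : ∀ j, IsFreeAut (z j) (j : ℕ)!) {j : E} {n : ℕ} (hn : 0 < n)
    {x : M j × M j} (hx : x ≠ 1) (h : (twist (z j) j ^ n) x = x) : (j : ℕ) ≤ 2 * n + 1 := by
  have hdvd : (j : ℕ)! ∣ (1 + j) * n := by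
    rw [← zpow_natCast, twist_zpow_apply] at h
    rw [← Int.natCast_dvd_natCast]
    push_cast
    by_cases h1 : x.1 = 1
    · exact (hz j).dvd _ _ (fun h2 => hx (Prod.ext h1 h2)) (congrArg Prod.snd h)
    · exact ((hz j).dvd _ _ h1 (congrArg Prod.fst h)).mul_left _
  have hle := Nat.le_of_dvd (by positivity) hdvd
  obtain hj | ⟨k, hk⟩ : (j : ℕ) = 0 ∨ ∃ k, (j : ℕ) = k + 1 := by
    cases (j : ℕ) with
    | zero => exact Or.inl rfl
    | succ k => exact Or.inr ⟨k, rfl⟩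
  · omega
  · rw [hk] at hle ⊢
    have : k ≤ k ! := Nat.self_le_factorial k
    rw [Nat.factorial_succ] at hle
    by_contra! hlt
    have h1 : 2 * n + 1 ≤ k ! := by omega
    nlinarith

variable [∀ j, TopologicalSpace (M j)] [∀ j, DiscreteTopology (M j)]

/-- A point fixed by the `n`-th iterate is trivial in all coordinates `j > 2n + 1`, and only
finitely many finite factors remain. -/
lemma countable_periodicPoints_piAut [∀ j, Finite (M j)] (hz : ∀ j, IsFreeAut (z j) (j : ℕ)!) :
    (periodicPoints (piAut fun j => twist (z j) j)).Countable := by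
  have hsub : periodicPoints (piAut fun j => twist (z j) j)
      ⊆ ⋃ n : ℕ, {x | ∀ j : E, n < (j : ℕ) → x j = 1} := by
    rintro x ⟨n, hn, hx⟩
    refine Set.mem_iUnion.2 ⟨2 * n + 1, fun j hj => ?_⟩
    by_contra h1
    refine hj.not_ge (le_of_twist_pow_eq_self hz hn h1 ?_)
    rw [← piAut_iterate_apply (c := fun j => twist (z j) j)]
    exact congrFun hx j
  refine (Set.countable_iUnion fun n => Set.Finite.countable ?_).mono hsub
  have : Finite {j : E // (j : ℕ) ≤ n} :=
    Finite.of_injective (fun j => (⟨j.1, Nat.lt_succ_of_le j.2⟩ : Fin (n + 1))) fun a b h =>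
      Subtype.ext (Subtype.ext (Fin.mk.inj h))
  refine Set.Finite.of_injOn (t := Set.univ)
    (f := fun (x : ∀ j, M j × M j) (j : {j : E // (j : ℕ) ≤ n}) => x j.1)
    (fun _ _ => Set.mem_univ _) ?_ Set.finite_univ
  intro x hx y hy hxy
  funext j
  by_cases hj : (j : ℕ) ≤ n
  · exact congrFun hxy ⟨j, hj⟩
  · rw [hx j (not_le.1 hj), hy j (not_le.1 hj)]

/-- Points with finitely many nontrivial coordinates are dense, and they are fixed by an iterate
whose exponent is the product of the factorials of these coordinates. -/
lemma dense_periodicPoints_piAut (hz : ∀ j, IsFreeAut (z j) (j : ℕ)!) :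
    Dense (periodicPoints (piAut fun j => twist (z j) j)) := by
  refine dense_finite_mulSupport.mono fun x (hx : Set.Finite _) => ?_
  refine ⟨∏ j ∈ hx.toFinset, (j : ℕ)!, Finset.prod_pos fun j _ => Nat.factorial_pos _, ?_⟩
  funext j
  rw [piAut_iterate_apply]
  by_cases hj : x j = 1
  · rw [hj, _root_.map_one]
  · exact twist_pow_eq_self_of_dvd hz
      (Finset.dvd_prod_of_mem (fun j : E => (j : ℕ)!) (hx.mem_toFinset.2 hj)) _

lemma exists_iterate_piAut_character_eq (hz : ∀ j, IsFreeAut (z j) (j : ℕ)!)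
    (χ : PontryaginDual (∀ j, M j × M j)) :
    ∃ n > 0, ∀ b, χ ((piAut fun j => twist (z j) j)^[n] b) = χ b := by
  obtain ⟨F, hF⟩ := exists_finset_character_eq_one χ
  refine ⟨∏ j ∈ F, (j : ℕ)!, Finset.prod_pos fun j _ => Nat.factorial_pos _, fun b => ?_⟩
  rw [← div_eq_one, ← map_div]
  refine hF _ fun j hj => ?_
  rw [Pi.div_apply, piAut_iterate_apply, twist_pow_eq_self_of_dvd hz
    (Finset.dvd_prod_of_mem (fun j : E => (j : ℕ)!) hj), div_self']

variable (M) in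
/-- The subgroup of all `x` with `x_j ∈ {(y, y⁻¹)}` for all `j`. -/
def antidiagonal : Subgroup (∀ j, M j × M j) where
  carrier := {x | ∀ j, (x j).1 * (x j).2 = 1}
  one_mem' := fun j => mul_one _
  mul_mem' := fun {x y} hx hy j => by
    change (x j).1 * (y j).1 * ((x j).2 * (y j).2) = 1
    rw [mul_mul_mul_comm, hx, hy, one_mul]
  inv_mem' := fun {x} hx j => by
    change (x j).1⁻¹ * (x j).2⁻¹ = 1
    rw [← mul_inv, hx, inv_one]

lemma isClosed_antidiagonal : IsClosed (antidiagonal M : Set (∀ j, M j × M j)) := by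
  have : (antidiagonal M : Set (∀ j, M j × M j)) = ⋂ j, {x | (x j).1 * (x j).2 = 1} := by
    ext x
    simp [antidiagonal]
  rw [this]
  refine isClosed_iInter fun j => ?_
  exact (isClosed_discrete {p : M j × M j | p.1 * p.2 = 1}).preimage
    (continuous_apply (A := fun j => M j × M j) j)

-- The character is trivial on the element `(y⁻¹, y)` of the antidiagonal, so on each factor it
-- depends only on the product of the two components.
open Classical in
lemma character_mulSingle_eq {χ : PontryaginDual (∀ j, M j × M j)}
    (hχ : χ ∈ dualQuotient (antidiagonal M)) (j : E) (x y : M j) :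
    χ (Pi.mulSingle j (x, y)) = χ (Pi.mulSingle j (x, 1)) * χ (Pi.mulSingle j (y, 1)) := by
  have h1 : χ (Pi.mulSingle j (y⁻¹, y)) = 1 := hχ _ fun k => by
    by_cases hk : k = j
    · subst hk
      simp
    · simp [hk]
  rw [← mul_one (_ * _), ← h1, ← _root_.map_mul, ← _root_.map_mul, ← Pi.mulSingle_mul,
    ← Pi.mulSingle_mul]
  simp

open Classical in
/-- The number of points of the orbit of a nontrivial character `χ` of `K/H` that are characters of
`K/H` is the maximum of the support of `χ`. -/
lemma exists_encard_orbit_eq [∀ j, Finite (M j)] (hE : ∀ n ∈ E, 0 < n)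
    (hz : ∀ j, IsFreeAut (z j) (j : ℕ)!) {χ : PontryaginDual (∀ j, M j × M j)}
    (hχ : χ ∈ dualQuotient (antidiagonal M)) (hχ1 : χ ≠ 1) :
    ∃ J : E, (∃ x, χ (Pi.mulSingle J (x, 1)) ≠ 1) ∧
      (Set.range (fun i : ℤ => (dualAut (piAut fun j => twist (z j) j) ^ i) χ) ∩
        (dualQuotient (antidiagonal M) : Set _)).encard = (J : ℕ) := by
  set θ : ℤ → PontryaginDual (∀ j, M j × M j) := fun i =>
    (dualAut (piAut fun j => twist (z j) j) ^ i) χ with hθ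
  have hθs : ∀ i j x y, θ i (Pi.mulSingle j (x, y)) = χ (Pi.mulSingle j ((z j ^ i) x, 1)) *
      χ (Pi.mulSingle j ((z j ^ ((1 + j) * i)) y, 1)) := by
    intro i j x y
    rw [hθ]
    change ((dualAut (piAut fun j => twist (z j) j) ^ i) χ) _ = _
    rw [dualAut_zpow_apply, piAut_zpow_mulSingle, twist_zpow_apply, character_mulSingle_eq hχ]
  let ψ : ∀ j, M j →* Circle := fun j => (χ : _ →ₜ* Circle).toMonoidHom.comp
    ((MonoidHom.mulSingle (fun j => M j × M j) j).comp (MonoidHom.inl (M j) (M j)))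
  have hψ : ∀ j x, ψ j x = χ (Pi.mulSingle j (x, 1)) := fun _ _ => rfl
  simp only [← hψ] at hθs ⊢
  set S : Set E := {j | ∃ x, ψ j x ≠ 1} with hS
  have hSfin : S.Finite := by
    obtain ⟨F, hF⟩ := exists_finset_character_eq_one χ
    refine F.finite_toSet.subset fun j hj => ?_
    obtain ⟨x, hx⟩ := hj
    by_contra hjF
    refine hx (hF _ fun k hk => Pi.mulSingle_eq_of_ne ?_ _)
    rintro rfl
    exact hjF hk
  have hSne : S.Nonempty := by
    by_contra hempty
    refine hχ1 (character_ext_mulSingle fun j p => ?_)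
    rw [character_mulSingle_eq hχ, ← hψ, ← hψ]
    have : ∀ x, ψ j x = 1 := fun x => by
      by_contra h
      exact hempty ⟨j, x, h⟩
    rw [this, this, one_mul]
    rfl
  obtain ⟨J, hJS, hJ⟩ := hSfin.exists_maximal hSne
  have hJle : ∀ j ∈ S, (j : ℕ) ≤ J := fun j hj => by
    rcases le_total (j : ℕ) J with h | h
    · exact h
    · exact hJ hj h
  have hJpos : 0 < (J : ℕ) := hE J J.2
  -- Writing `ψ j` for the restriction of `χ` to the first component of factor `j`, the `i`-th image
  -- restricts to `ψ j ∘ z^i` and `ψ j ∘ z^{(1+j)i}` on the two components. It is trivial on the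
  -- antidiagonal if and only if these agree, that is `j! ∣ j i`, or `(j-1)! ∣ i`, on the support.
  -- Factorials divide each other in order, so the maximal `J` decides both this and the period `J!
  -- = (J-1)! · J`.
  refine ⟨J, hJS, encard_range_inter (Nat.factorial_pos ((J : ℕ) - 1)) (fun i => ?_)
    (fun i k => ?_) hJpos⟩
  · have h1 : θ i ∈ dualQuotient (antidiagonal M) ↔
        ∀ j x, ψ j ((z j ^ i) x) = ψ j ((z j ^ ((1 + j) * i)) x) := by
      constructor
      · intro h j x
        have hx := hθs i j x x⁻¹
        rw [map_inv, map_inv, ← div_eq_mul_inv, eq_comm, h, div_eq_one] at hx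
        · exact hx
        · intro k
          by_cases hk : k = j
          · subst hk
            simp
          · simp [hk]
      · intro h a ha
        obtain ⟨F, hF⟩ := exists_finset_character_eq_prod (θ i)
        rw [hF]
        refine Finset.prod_eq_one fun j _ => ?_
        have haj : a j = ((a j).1, ((a j).1)⁻¹) :=
          Prod.ext rfl (eq_inv_of_mul_eq_one_right (ha j))
        rw [haj, hθs, h, ← _root_.map_mul, ← _root_.map_mul, mul_inv_cancel, _root_.map_one,
          _root_.map_one]
    rw [SetLike.mem_coe, h1]
    constructor
    · intro h
      obtain ⟨x, hx⟩ := hJS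
      have := (hz J).dvd_of_comp_eq hx (h J)
      rw [← Nat.mul_factorial_pred hJpos.ne'] at this
      have h2 : i - (1 + (J : ℕ)) * i = ((J : ℕ) : ℤ) * -i := by ring
      rw [h2, Nat.cast_mul, mul_dvd_mul_iff_left (by exact_mod_cast hJpos.ne'), dvd_neg] at this
      exact this
    · intro h j x
      by_cases hj : j ∈ S
      · congr 2
        refine (hz j).zpow_eq_of_dvd ?_
        have h2 : i - (1 + (j : ℕ)) * i = -(((j : ℕ) : ℤ) * i) := by ring
        rw [h2, dvd_neg, ← Nat.mul_factorial_pred (hE j j.2).ne', Nat.cast_mul]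
        refine mul_dvd_mul_left _ (dvd_trans (Int.natCast_dvd_natCast.2
          (Nat.factorial_dvd_factorial ?_)) h)
        have := hJle j hj
        omega
      · have : ∀ x, ψ j x = 1 := fun x => by
          by_contra h
          exact hj ⟨x, h⟩
        rw [this, this]
  · rw [mul_comm, Nat.mul_factorial_pred hJpos.ne']
    constructor
    · intro h
      obtain ⟨x, hx⟩ := hJS
      refine (hz J).dvd_of_comp_eq hx fun x => ?_
      have := DFunLike.congr_fun h (Pi.mulSingle J (x, 1))
      rw [hθs, hθs] at this
      simpa using this
    · intro h
      refine character_ext_mulSingle fun j p => ?_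
      rw [← Prod.mk.eta (p := p), hθs, hθs]
      by_cases hj : j ∈ S
      · have hd : (((j : ℕ)! : ℕ) : ℤ) ∣ i - k := dvd_trans (Int.natCast_dvd_natCast.2
          (Nat.factorial_dvd_factorial (hJle j hj))) h
        rw [(hz j).zpow_eq_of_dvd hd, (hz j).zpow_eq_of_dvd
          (k := (1 + (j : ℕ)) * i) (l := (1 + (j : ℕ)) * k)
          (by rw [← mul_sub]; exact hd.mul_left _)]
      · have : ∀ x, ψ j x = 1 := fun x => by
          by_contra h
          exact hj ⟨x, h⟩
        simp only [this]

lemma orbitCounts_piAut [∀ j, Finite (M j)] [∀ j, Nontrivial (M j)] (hE : ∀ n ∈ E, 0 < n)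
    (hz : ∀ j, IsFreeAut (z j) (j : ℕ)!) :
    orbitCounts (dualQuotient (antidiagonal M)) (dualAut (piAut fun j => twist (z j) j))
      = (fun n : ℕ => (n : ℕ∞)) '' E := by
  classical
  ext n
  constructor
  · rintro ⟨χ, hχ, hχ1, rfl⟩
    obtain ⟨J, -, h⟩ := exists_encard_orbit_eq hE hz hχ hχ1
    exact ⟨J, J.2, h.symm⟩
  · rintro ⟨j, hj, rfl⟩
    obtain ⟨g, hg⟩ := exists_ne (1 : M ⟨j, hj⟩)
    obtain ⟨ψ, hψ⟩ := exists_character_ne_one hg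
    -- A nontrivial character of the single factor `j`, composed with the product of the two
    -- components: it is trivial on the antidiagonal and supported at `j`, so it realizes the count
    -- `j`.
    let χ : PontryaginDual (∀ j, M j × M j) :=
      ContinuousMonoidHom.comp (A := ∀ j, M j × M j) (C := Circle) ψ
        ⟨⟨⟨fun x => (x ⟨j, hj⟩).1 * (x ⟨j, hj⟩).2, mul_one _⟩, fun x y => mul_mul_mul_comm _ _ _ _⟩,
          (continuous_mul (M := M ⟨j, hj⟩)).comp (continuous_apply (⟨j, hj⟩ : E))⟩
    have hχ : ∀ x, χ x = ψ ((x ⟨j, hj⟩).1 * (x ⟨j, hj⟩).2) := fun _ => rfl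
    have hmem : χ ∈ dualQuotient (antidiagonal M) := fun x hx => by
      rw [hχ, hx, _root_.map_one]
    have hne : χ ≠ 1 := by
      intro h
      have := DFunLike.congr_fun h
        (Pi.mulSingle (M := fun j => M j × M j) ⟨j, hj⟩ (g, 1))
      rw [hχ, Pi.mulSingle_eq_same, mul_one] at this
      exact hψ this
    obtain ⟨J, ⟨x, hx⟩, h⟩ := exists_encard_orbit_eq hE hz hmem hne
    refine ⟨χ, hmem, hne, ?_⟩
    rw [h]
    have : (⟨j, hj⟩ : E) = J := by
      by_contra hJ
      exact hx (by rw [hχ, Pi.mulSingle_eq_of_ne hJ]; simp)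
    rw [← this]

lemma isTriple_piAut [∀ j, Finite (M j)] [∀ j, Nontrivial (M j)] (hE : ∀ n ∈ E, 0 < n)
    (hz : ∀ j, IsFreeAut (z j) (j : ℕ)!) :
    IsTriple E (antidiagonal M) (piAut fun j => twist (z j) j) where
  isClosed := isClosed_antidiagonal
  counts := orbitCounts_piAut hE hz
  countable := countable_periodicPoints_piAut hz
  dense := dense_periodicPoints_piAut hz

end Twist

/-- There is a finite group with a free automorphism of any given order. -/
lemma exists_isFreeAut {n : ℕ} (hn : n ≠ 0) :
    ∃ (p : ℕ) (_ : Fact p.Prime) (z : MulAut (Multiplicative (ZMod p))), IsFreeAut z n := by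
  -- For a prime `p ≡ 1` modulo `n` the cyclic group of units of `ZMod p` has an element of order
  -- `n`. Multiplication by a unit other than `1` fixes only `0`, so the action is free.
  obtain ⟨p, hp, -, hpn⟩ := Nat.exists_prime_gt_modEq_one (k := n) 0 hn
  have : Fact p.Prime := ⟨hp⟩
  have hdvd : n ∣ Nat.card (ZMod p)ˣ := by
    rw [Nat.card_eq_fintype_card, ZMod.card_units]
    exact (Nat.modEq_iff_dvd' hp.one_le).1 hpn.symm
  obtain ⟨u, hu⟩ := IsCyclic.exists_ofOrder_eq_natCard (α := (ZMod p)ˣ)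
  obtain ⟨m, hm⟩ := hdvd
  have hpos : 0 < Nat.card (ZMod p)ˣ := Nat.card_pos
  have hw : orderOf (u ^ m) = n := by
    rw [orderOf_pow, hu, hm, Nat.gcd_mul_left_left, Nat.mul_div_cancel]
    exact Nat.pos_of_ne_zero fun h => by rw [hm, h, mul_zero] at hpos; exact hpos.false
  let f : (ZMod p)ˣ →* MulAut (Multiplicative (ZMod p)) :=
    (MulAutMultiplicative (ZMod p)).symm.toMonoidHom.comp AddAut.mulLeft
  have hf : ∀ w x, f w x = Multiplicative.ofAdd ((w : ZMod p) * x.toAdd) := fun _ _ => rfl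
  refine ⟨p, this, f (u ^ m), ?_, fun i x hx h => ?_⟩
  · rw [← _root_.map_pow, ← hw, pow_orderOf_eq_one, _root_.map_one]
  · rw [← hw, orderOf_dvd_iff_zpow_eq_one]
    rw [← map_zpow, hf] at h
    have hx0 : x.toAdd ≠ 0 := hx
    exact Units.ext (mul_right_cancel₀ hx0 ((congrArg Multiplicative.toAdd h).trans
      (one_mul _).symm))

end SpectralMult

/-! ### The main theorem -/

theorem theorem4p1 (E : Set ℕ) (hE : ∀ n ∈ E, 0 < n) :
    (∃ (K : Type) (_ : CommGroup K) (_ : TopologicalSpace K) (_ : IsTopologicalGroup K)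
        (_ : CompactSpace K) (_ : PolishSpace K) (H : Subgroup K) (v : K ≃ₜ* K),
        SpectralMult.IsTriple E H v ∧ SpectralMult.SeparatesOrbits H v) ∧
    ∀ (K : Type*) [CommGroup K] [TopologicalSpace K] [IsTopologicalGroup K]
      [CompactSpace K] [PolishSpace K] [MeasurableSpace K] [BorelSpace K]
      (H : Subgroup K) (v : K ≃ₜ* K), SpectralMult.IsTriple E H v →
      ∀ (ξ : Fin 2 → ℝ), (∀ i, 0 < ξ i) → LinearIndependent ℚ ξ →
      (∃ κ : ℕ → Fin 2 ⊕ SpectralMult.periodicPoints v, ∀ b, (κ ⁻¹' {b}).Infinite) ∧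
      ∀ (κ : ℕ → Fin 2 ⊕ SpectralMult.periodicPoints v), (∀ b, (κ ⁻¹' {b}).Infinite) →
      (∃ (D : SpectralMult.CFData) (a : ℕ → ℝ → K), SpectralMult.IsConstruction v ξ κ D a) ∧
      ∀ (D : SpectralMult.CFData) (a : ℕ → ℝ → K), SpectralMult.IsConstruction v ξ κ D a →
        ∃ (_ : IsProbabilityMeasure (D.measure.prod (SpectralMult.haarQuotient H)))
          (hT : SpectralMult.IsFlow (D.extension H a)
            (D.measure.prod (SpectralMult.haarQuotient H))),
          SpectralMult.WeaklyMixing hT ∧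
          (SpectralMult.SeparatesOrbits H v →
            SpectralMult.HasMultiplicitySet (SpectralMult.koopman hT)
              (SpectralMult.L2zero (D.measure.prod (SpectralMult.haarQuotient H)))
              ((fun n : ℕ => (n : ℕ∞)) '' (E ∪ {1}))) := by
  constructor
  · choose p hp z hz using fun j : E => SpectralMult.exists_isFreeAut (Nat.factorial_ne_zero j)
    have : ∀ j, IsTopologicalGroup (Multiplicative (ZMod (p j))) := fun j => inferInstance
    exact ⟨∀ j : E, Multiplicative (ZMod (p j)) × Multiplicative (ZMod (p j)), inferInstance,
      inferInstance, inferInstance, inferInstance, inferInstance,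
      SpectralMult.antidiagonal fun j : E => Multiplicative (ZMod (p j)),
      SpectralMult.piAut fun j => SpectralMult.twist (z j) j, SpectralMult.isTriple_piAut hE hz,
      SpectralMult.separatesOrbits_of_finite_orbits _ (SpectralMult.dense_periodicPoints_piAut hz)
        (SpectralMult.exists_iterate_piAut_character_eq hz)⟩
  · intro K _ _ _ _ _ _ _ H v ht ξ hξ hli
    have : Countable (SpectralMult.periodicPoints v) := ht.countable.to_subtype
    refine ⟨SpectralMult.exists_forall_infinite_fiber _, fun κ hκ =>
      ⟨SpectralMult.exists_construction v κ hξ, fun D a h => ?_⟩⟩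
    have hD := h.isFinite hξ
    have := hD.isProbabilityMeasure
    have := SpectralMult.isProbabilityMeasure_haarQuotient H
    exact ⟨inferInstance, hD.isFlow_extension ht.isClosed a,
      h.weaklyMixing hξ hli hκ ht.dense ht.isClosed,
      fun hsep => h.hasMultiplicitySet hξ hli hκ ht hsep⟩

end
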